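/- Let $P\ge 1$ and let $$u_0(x)=\sum_{p=1}^P\left(\frac{c_p}{x-z_p}+\frac{c_p^*}{x-z_p^*}\right),\qquad u_0\in L^1(\mathbb R),$$ where $\mathrm{Im}\,z_p>0$ and $\mathrm{Re}\,z_1<\dots<\mathrm{Re}\,z_P$. Assume that $u_0$ is a negative rational Klaus--Shaw potential ($u_0<0$ on $\mathbb R$, and there is $x_{\mathrm c}\in\mathbb R$ such that $u_0$ is strictly monotone on $(-\infty,x_{\mathrm c})$ and on $(x_{\mathrm c},\infty)$), and that every $c_p$ is positive imaginary. Put $$h(z;\lambda)=\lambda z+f(z),\qquad f(z)=\sum_{p=1}^P\Big[c_p\big(\mathrm{Log}(i(z-z_p))+\tfrac{\pi i}{2}\big)+c_p^*\big(\mathrm{Log}(-i(z-z_p^*))-\tfrac{\pi i}{2}\big)\Big]$$ (principal logarithms), so that $h'=\lambda+u_0$ and $\mathrm{Re}\{-ih\}$ is single-valued. For $\epsilon>0$ and $\lambda<0$ let $$A_{mp}(\lambda)=\int_{C_m}\frac{e^{-ih(z;\lambda)/\epsilon}}{z-z_p}\,dz,\qquad b_m(\lambda)=-\lambda\int_{C_m}e^{-ih(z;\lambda)/\epsilon}\,dz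 ,$$ where $C_m$ lies in the domain of analyticity of $f$ (the plane cut vertically upwards from each $z_p$ and downwards from each $z_p^*$) and comes from $i\infty$ to the left of $\mathrm{Re}\,z=\mathrm{Re}\,z_1$; if $ic_m/\epsilon$ is a negative integer it terminates at $z_m$, and otherwise it returns to $i\infty$ to the right of $\mathrm{Re}\,z=\mathrm{Re}\,z_m$ and (if $m<P$) to the left of $\mathrm{Re}\,z=\mathrm{Re}\,z_{m+1}$. For $\lambda>0$ let $\mathbf A^>(\lambda),\mathbf b^>(\lambda)$ be the boundary values, from the upper half $\lambda$-plane, of the analytic continuations of $\mathbf A,\mathbf b$ to $\mathbb C\setminus[0,\infty)$. Let $\lambda>0$ be such that the critical points of $h(\cdot;\lambda)$ in the open upper half-plane are all simple and correspond to distinct nonzero values of $\mathrm{Re}\{-ih(z;\lambda)\}$, and such that $h(\cdot;\lambda)$ has no real critical point of multiplicity greater than two. Then for all $\epsilon>0$ the boundary values $\mathbf A^>(\lambda)$, $\mathbf b^>(\lambda)$ exist, and there are piecewise smooth contours $W_1,\dots,W_P$ in $\mathbb C\setminus\{z_p,z_p^*\}_{p=1}^P$, each end of which is one of the points $z_p$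 or $-i\infty$ (to the left of $\mathrm{Re}\,z=\mathrm{Re}\,z_1$), branches of $h(\cdot;\lambda)$ continued analytically along each $W_m$ (contours and branches independent of $\epsilon$), and, for every $\epsilon>0$, a matrix $\mathbf N=\mathbf N(\epsilon)\in\mathbb C^{P\times P}$, such that with absolutely convergent integrals $$(\mathbf N\mathbf A^>(\lambda))_{mp}=\int_{W_m}\frac{e^{-ih(z;\lambda)/\epsilon}}{z-z_p}\,dz,\qquad (\mathbf N\mathbf b^>(\lambda))_m=-\lambda\int_{W_m}e^{-ih(z;\lambda)/\epsilon}\,dz ,$$ and the modified system $\mathbf N\mathbf A^>(\lambda)\mathbf v=\mathbf N\mathbf b^>(\lambda)$ is suitable: (i) each $W_m$ passes through exactly one critical point $x_m$ of $h(\cdot;\lambda)$, it does so once, and $\mathrm{Re}\{-ih(z;\lambda)\}$ attains its strict maximum along $W_m$ there; (ii) $x_1,\dots,x_P$ are distinct; (iii) $\mathbf N$ is invertible. -/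

import Mathlib

open Filter Topology MeasureTheory
open scoped ComplexConjugate

noncomputable section

namespace BenjaminOno

/-- A real rational potential `u₀(x) = ∑ₚ cₚ / (x - zₚ) + c.c.` in `L¹(ℝ)`, with nonzero `cₚ` and
poles `zₚ` in the open upper half-plane whose real parts are distinct and increase with `p`. -/
structure RationalPotential (P : ℕ) where
  c : Fin P → ℂ
  z : Fin P → ℂ
  c_ne_zero : ∀ p, c p ≠ 0
  z_im_pos : ∀ p, 0 < (z p).im
  z_re_strictMono : StrictMono fun p => (z p).re
  integrable : Integrable fun x : ℝ =>
    ∑ p, (c p / ((x : ℂ) - z p) + conj (c p) / ((x : ℂ) - conj (z p)))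

namespace RationalPotential

variable {P : ℕ} (u : RationalPotential P)

/-- The rational function `u₀` on the complex plane. -/
def toFun (w : ℂ) : ℂ :=
  ∑ p, (u.c p / (w - u.z p) + conj (u.c p) / (w - conj (u.z p)))

/-- The potential `u₀` on the real line, where it is real-valued. -/
def onReal (x : ℝ) : ℝ := (u.toFun (x : ℂ)).re

/-- Klaus–Shaw condition: `u₀` is strictly monotone on each side of some real point. -/
def IsKlausShaw : Prop :=
  ∃ xc : ℝ,
    (StrictMonoOn u.onReal (Set.Iio xc) ∨ StrictAntiOn u.onReal (Set.Iio xc)) ∧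
    (StrictMonoOn u.onReal (Set.Ioi xc) ∨ StrictAntiOn u.onReal (Set.Ioi xc))

/-- `w` is one of the singularities `zₚ`, `zₚ*`. -/
def IsPole (w : ℂ) : Prop := ∃ p, w = u.z p ∨ w = conj (u.z p)

/-- The antiderivative `f` of `u₀`, with principal logarithms; the branch cuts are the vertical
rays going up from the `zₚ` and down from the `zₚ*`. The second summand is the analytic
extension of the complex conjugate (for real argument) of the first. -/
def f (w : ℂ) : ℂ :=
  ∑ p, (u.c p * (Complex.log (Complex.I * (w - u.z p)) + Real.pi * Complex.I / 2) +
    conj (u.c p) * (Complex.log (-Complex.I * (w - conj (u.z p))) - Real.pi * Complex.I / 2))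

/-- The exponent function `h(w; lam) = lam w + f(w)`. -/
def h (lam : ℝ) (w : ℂ) : ℂ := lam * w + u.f w

/-- `Re(-i h)`. It is independent of the branch of `h` when all `cₚ` are purely imaginary. -/
def R (lam : ℝ) (w : ℂ) : ℝ := (-Complex.I * u.h lam w).re

/-- Critical points of `h(·; lam)`: the points where `h' = lam + u₀` vanishes. -/
def IsCritical (lam : ℝ) (w : ℂ) : Prop := ¬ u.IsPole w ∧ (lam : ℂ) + u.toFun w = 0

/-! ### The linear system for negative spectral parameter -/

/-- A real abscissa to the left of all poles. -/
def leftAbscissa : ℝ := if hP : 0 < P then (u.z ⟨0, hP⟩).re - 1 else 0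

/-- A real abscissa to the right of the `m`-th pole and to the left of the next one, if any. -/
def gapAbscissa (m : Fin P) : ℝ :=
  if hm : m.val + 1 < P then ((u.z m).re + (u.z ⟨m.val + 1, hm⟩).re) / 2 else (u.z m).re + 1

/-- The exceptional case: `i cₘ / ε` is a negative integer. -/
def IsExceptional (ε : ℝ) (m : Fin P) : Prop :=
  ∃ n : ℕ, 0 < n ∧ Complex.I * u.c m / ε = -(n : ℂ)

/-- Integral of `g` along the upward vertical ray from the real point `a` to `a + i∞`. -/
def rayIntegral (g : ℂ → ℂ) (a : ℝ) : ℂ :=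
  ∫ y in Set.Ioi (0 : ℝ), g (a + y * Complex.I) * Complex.I

open scoped Classical in
/-- Integral of `g` along the contour `Cₘ`, which lies in the domain of analyticity of `f`.
In the general case `Cₘ` comes from `i∞` to the left of all poles, down to the real axis, along
it, and returns to `i∞` between the `m`-th pole and the next one; in the exceptional case it
starts in the same way but terminates at `zₘ`, which is approached vertically from below.
By Cauchy's theorem the values used below depend only on these end-points. -/
def integralC (ε : ℝ) (m : Fin P) (g : ℂ → ℂ) : ℂ :=
  if u.IsExceptional ε m then
    -rayIntegral g u.leftAbscissa
      + (∫ x in u.leftAbscissa..(u.z m).re, g x)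
      + ∫ y in (0 : ℝ)..(u.z m).im, g ((u.z m).re + y * Complex.I) * Complex.I
  else
    -rayIntegral g u.leftAbscissa
      + (∫ x in u.leftAbscissa..u.gapAbscissa m, g x)
      + rayIntegral g (u.gapAbscissa m)

/-- Matrix entry `Aₘₚ(μ)`, for `μ < 0`. -/
def entryA (ε : ℝ) (m p : Fin P) (μ : ℝ) : ℂ :=
  u.integralC ε m fun w => Complex.exp (-Complex.I * u.h μ w / ε) / (w - u.z p)

/-- Right-hand side `bₘ(μ)`, for `μ < 0`. -/
def entryB (ε : ℝ) (m : Fin P) (μ : ℝ) : ℂ :=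
  -μ * u.integralC ε m fun w => Complex.exp (-Complex.I * u.h μ w / ε)

end RationalPotential

/-- `a` is the boundary value at `lam`, taken from the upper half-plane, of the analytic
continuation to `ℂ ∖ [0, ∞)` of the function `F` given on the negative half-line. -/
def IsUpperBoundaryValue (F : ℝ → ℂ) (lam : ℝ) (a : ℂ) : Prop :=
  ∃ G : ℂ → ℂ,
    DifferentiableOn ℂ G {μ : ℂ | ¬ (μ.im = 0 ∧ 0 ≤ μ.re)} ∧
    (∀ μ : ℝ, μ < 0 → G (μ : ℂ) = F μ) ∧
    Tendsto G (𝓝[{μ : ℂ | 0 < μ.im}] (lam : ℂ)) (𝓝 a)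

/-- A piecewise continuously differentiable regular curve, parametrized by the real line. -/
def IsPiecewiseC1 (γ : ℝ → ℂ) : Prop :=
  Continuous γ ∧ ∃ S : Finset ℝ,
    (∀ t, t ∉ S → ContDiffAt ℝ 1 γ t ∧ deriv γ t ≠ 0) ∧
    ∀ t ∈ S, (∃ d : ℂ, d ≠ 0 ∧ Tendsto (deriv γ) (𝓝[<] t) (𝓝 d)) ∧
      ∃ d : ℂ, d ≠ 0 ∧ Tendsto (deriv γ) (𝓝[>] t) (𝓝 d)

namespace RationalPotential

variable {P : ℕ} (u : RationalPotential P)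

/-- `(A, b)` are the coefficients `(A^>(lam), b^>(lam))` of the linear system for `lam > 0`:
entry by entry the boundary values, from the upper half-plane, of the continuations of `A`, `b`. -/
def IsJostSystem (ε lam : ℝ) (A : Matrix (Fin P) (Fin P) ℂ) (b : Fin P → ℂ) : Prop :=
  (∀ m p, IsUpperBoundaryValue (u.entryA ε m p) lam (A m p)) ∧
  ∀ m, IsUpperBoundaryValue (u.entryB ε m) lam (b m)

/-- The curve `γ` runs, along the filter `l`, into one of the points `zₚ`. -/
def EndsAtPole (γ : ℝ → ℂ) (l : Filter ℝ) : Prop := ∃ p, Tendsto γ l (𝓝 (u.z p))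

/-- The curve `γ` runs, along the filter `l`, to `-i∞` in a vertical strip to the left of all
poles. -/
def EndsAtNegIInfty (γ : ℝ → ℂ) (l : Filter ℝ) : Prop :=
  Tendsto (fun t => (γ t).im) l atBot ∧
  ∃ a₁ a₂ : ℝ, (∀ p, a₂ < (u.z p).re) ∧ ∀ᶠ t in l, a₁ ≤ (γ t).re ∧ (γ t).re ≤ a₂

/-- Admissible contours: piecewise smooth, avoiding the singularities, each end being one of the
`zₚ` or `-i∞`. -/
structure IsContour (γ : ℝ → ℂ) : Prop where
  piecewise : IsPiecewiseC1 γ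
  avoids : ∀ t, ¬ u.IsPole (γ t)
  start : u.EndsAtPole γ atBot ∨ u.EndsAtNegIInfty γ atBot
  finish : u.EndsAtPole γ atTop ∨ u.EndsAtNegIInfty γ atTop

/-- `H` is a branch of the multivalued function `h(·; lam)` continued analytically along `γ`:
all the logarithms are chosen continuously along `γ`. -/
def IsBranchAlong (lam : ℝ) (γ H : ℝ → ℂ) : Prop :=
  ∃ L L' : Fin P → ℝ → ℂ,
    (∀ p, Continuous (L p) ∧ ∀ t, Complex.exp (L p t) = Complex.I * (γ t - u.z p)) ∧
    (∀ p, Continuous (L' p) ∧ ∀ t, Complex.exp (L' p t) = -Complex.I * (γ t - conj (u.z p))) ∧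
    ∀ t, H t = lam * γ t +
      ∑ p, (u.c p * (L p t + Real.pi * Complex.I / 2) +
        conj (u.c p) * (L' p t - Real.pi * Complex.I / 2))

/-- The curve `γ` passes exactly once through `x`, which is a critical point of `h(·; lam)` and the
only one on `γ`, and `Re(-ih)` is maximized along `γ` at `x` and only there. -/
def PassesMaximally (lam : ℝ) (γ : ℝ → ℂ) (x : ℂ) : Prop :=
  u.IsCritical lam x ∧ ∃ t₀, γ t₀ = x ∧
    ∀ t, t ≠ t₀ → ¬ u.IsCritical lam (γ t) ∧ u.R lam (γ t) < u.R lam x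

/-- The integrand of the modified matrix, in terms of the parameter of the contour. -/
def integrandA (ε : ℝ) (γ H : ℝ → ℂ) (p : Fin P) (t : ℝ) : ℂ :=
  Complex.exp (-Complex.I * H t / ε) / (γ t - u.z p) * deriv γ t

/-- The integrand of the modified right-hand side, in terms of the parameter of the contour. -/
def integrandB (ε : ℝ) (γ H : ℝ → ℂ) (t : ℝ) : ℂ :=
  Complex.exp (-Complex.I * H t / ε) * deriv γ t

/-- For the value `ε` of the dispersion parameter, left multiplication by `N` turns the system
`A^> v = b^>` into a system of the same form, in which the `m`-th row has (absolutely convergent)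
integrals over `Wₘ`, of the branch of the integrand given by `Hₘ`. -/
def IsModifiedSystem (ε lam : ℝ) (N : Matrix (Fin P) (Fin P) ℂ) (W H : Fin P → ℝ → ℂ) : Prop :=
  ∃ (A : Matrix (Fin P) (Fin P) ℂ) (b : Fin P → ℂ), u.IsJostSystem ε lam A b ∧
    (∀ m p, Integrable (u.integrandA ε (W m) (H m) p) ∧
      (N * A) m p = ∫ t, u.integrandA ε (W m) (H m) p t) ∧
    ∀ m, Integrable (integrandB ε (W m) (H m)) ∧
      N.mulVec b m = -(lam : ℂ) * ∫ t, integrandB ε (W m) (H m) t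

/-- Suitability of the system modified by the matrices `N ε` and having the contours `Wₘ`: the
contours and the branches of `h` do not depend on `ε`; (i) each `Wₘ` passes through exactly one
critical point of `h`, where `Re(-ih)` is maximized along `Wₘ`; (ii) different contours have
different critical points; (iii) the matrices `N ε` are invertible. -/
structure IsSuitable (lam : ℝ) (N : ℝ → Matrix (Fin P) (Fin P) ℂ) (W H : Fin P → ℝ → ℂ) :
    Prop where
  contour : ∀ m, u.IsContour (W m)
  branch : ∀ m, u.IsBranchAlong lam (W m) (H m)
  modified : ∀ ε : ℝ, 0 < ε → u.IsModifiedSystem ε lam (N ε) W H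
  critical : ∃ x : Fin P → ℂ, Function.Injective x ∧ ∀ m, u.PassesMaximally lam (W m) (x m)
  invertible : ∀ ε : ℝ, 0 < ε → IsUnit (N ε).det

end RationalPotential

end BenjaminOno

end

/-! Fix `lam > 0`. For each contour, the integral of `g e^{-ih/ε}` is a linear functional of a test
function `g`, which may have simple poles at the `zₚ`. The choices `g = 1/(w - zₚ)` and `g = 1` give
the entries of the linear system. It therefore suffices to relate the `P` functionals given by the
continued contours `Cₘ` (the loops) to `P` functionals given by descent contours through critical
points, by an invertible matrix.

Landscape. Since `cₚ = iγₚ` with `γₚ > 0`, `R = Re(-ih)` is single-valued. It vanishes on the real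
axis, tends to `-∞` at each `zₚ` (a well), and has no local minimum. The nodes are the critical
points in the open upper half-plane, together with the leftmost real critical point if there is one.
From each node two curves descend, each ending in a well or at `-i∞`. The key fact is
`IsPosImag.reach`: minimising `R` over the points that cannot be joined to a well or to `-i∞` would
produce a local minimum. Klaus–Shaw makes `u₀` quasiconvex, which fixes the sign of `h'` at a double
real zero and makes `{lam + u₀ ≤ 0}` an interval.

Spanning. A functional lies in the span of finitely many others as soon as it vanishes on their
common kernel. So let all integrals over node contours of some `g` vanish. Then `(y e^{-ih/ε})' = g
e^{-ih/ε}` has a solution `y` that is analytic at the wells and recessive at `-i∞`, built by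
sweeping through the sublevel sets `{R < c}` of the upper half-plane (`Setting.exists_isSol`). For
very negative `c` the sublevel set consists of small pieces around the wells, where the local
analytic solution is unique because the exponent `-γₚ/ε` of the homogeneous equation is negative.
Raising `c` past a critical point joins two sectors, and the vanishing integral says that the
solutions in them agree. At `c = 0` the sublevel set meets the axis along the interval `{lam + u₀ ≤
0}`; there `y` must match the solution recessive at `-i∞`. One contour, through the left end of the
interval, gives the match there, and connectedness spreads it. With `y` available up to a large
height, every loop integral telescopes to zero (`loop_eq_zero`).

Counting. The numerator of `h'` is a real polynomial of degree at most `2P`, so there are at most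
`P` nodes (`card_isNode_le`). The loop functionals are linearly independent
(`linearIndependent_loop`): on `g = e^{κw}` with `κ → ∞`, the `m`-th loop is not bounded by `e^{κx}`
for `x` slightly less than `Re zₘ`, while the preceding loops are. This uses that the monodromy
around `zₘ` is nontrivial, or that the loop ends at `zₘ`. Hence there are exactly `P` nodes, and the
coefficient matrix is invertible.

Boundary values. As the spectral parameter goes from the negative axis through the upper half-plane
to `lam`, the ends of `Cₘ` turn from `i∞` through `-∞` to `-i∞` on the left of the poles, by
Cauchy's theorem in quadrants. The end that was to the right of `zₘ` is first carried back above all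
poles, which multiplies the tail by a monodromy factor. This identifies `A^>` and `b^>` with loop
integrals (`isUpperBoundaryValue_loop`). -/

namespace BenjaminOno.RationalPotential

/-! ### The function `R`, its wells and its sublevel sets -/

variable {P : ℕ} (u : RationalPotential P)

/-- The residues of `u₀` at the `zₚ` are positive imaginary. -/
def IsPosImag : Prop := ∀ p, (u.c p).re = 0 ∧ 0 < (u.c p).im

/-- The imaginary part of the residue at `zₚ`. -/
def gam (p : Fin P) : ℝ := (u.c p).im

variable {u}

lemma IsPosImag.c_eq (hc : u.IsPosImag) (p : Fin P) : u.c p = Complex.I * u.gam p := by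
  apply Complex.ext <;> simp [gam, (hc p).1]

lemma IsPosImag.gam_pos (hc : u.IsPosImag) (p : Fin P) : 0 < u.gam p := (hc p).2

lemma IsPosImag.conj_c_eq (hc : u.IsPosImag) (p : Fin P) :
    conj (u.c p) = -(Complex.I * u.gam p) := by
  rw [hc.c_eq]; simp

/-- Since `-i cₚ = γₚ` is real, only the moduli of the arguments of the logarithms contribute. This
shows that `R` does not depend on branches and has a well at each `zₚ`. -/
lemma IsPosImag.R_eq (hc : u.IsPosImag) (lam : ℝ) (w : ℂ) :
    u.R lam w = lam * w.im +
      ∑ p, u.gam p * (Real.log ‖w - u.z p‖ - Real.log ‖w - conj (u.z p)‖) := by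
  have h1 : -Complex.I * u.h lam w = -Complex.I * (lam * w) +
      ∑ p, ((u.gam p : ℂ) * (Complex.log (Complex.I * (w - u.z p)) + Real.pi * Complex.I / 2) -
        u.gam p * (Complex.log (-Complex.I * (w - conj (u.z p))) - Real.pi * Complex.I / 2)) := by
    simp only [h, f, mul_add, Finset.mul_sum]
    congr 1
    refine Finset.sum_congr rfl fun p _ => ?_
    rw [hc.conj_c_eq, hc.c_eq]
    ring_nf
    simp only [Complex.I_sq, show Complex.I ^ 3 = -Complex.I by
      rw [pow_succ, Complex.I_sq]; ring]
    ring
  rw [R, h1, Complex.add_re, Complex.re_sum]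
  congr 1
  · simp
  · refine Finset.sum_congr rfl fun p _ => ?_
    simp only [Complex.sub_re, Complex.re_ofReal_mul, Complex.add_re, Complex.log_re, norm_mul,
      norm_neg, Complex.norm_I, one_mul]
    simp
    ring

lemma norm_ofReal_sub_conj (x : ℝ) (z : ℂ) : ‖(x : ℂ) - conj z‖ = ‖(x : ℂ) - z‖ := by
  rw [← Complex.norm_conj ((x : ℂ) - z)]; simp

/-- A real point is equidistant from `zₚ` and its conjugate, so the logarithms cancel. This is why
the level `0` plays a special role later. -/
lemma IsPosImag.R_ofReal (hc : u.IsPosImag) (lam x : ℝ) : u.R lam (x : ℂ) = 0 := by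
  rw [hc.R_eq]
  simp [norm_ofReal_sub_conj]

lemma toFun_conj (w : ℂ) : u.toFun (conj w) = conj (u.toFun w) := by
  simp only [toFun, map_sum, map_add, map_div₀, map_sub, Complex.conj_conj]
  exact Finset.sum_congr rfl fun p _ => add_comm _ _

lemma toFun_ofReal (x : ℝ) : u.toFun (x : ℂ) = (u.onReal x : ℂ) := by
  rw [onReal]
  exact (Complex.conj_eq_iff_re.1 (by rw [← toFun_conj, Complex.conj_ofReal])).symm

lemma isPole_conj {w : ℂ} : u.IsPole (conj w) ↔ u.IsPole w := by
  simp only [IsPole]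
  refine exists_congr fun p => ?_
  rw [(starRingEnd ℂ).injective.eq_iff, or_comm]
  exact or_congr Iff.rfl ⟨fun h => by rw [← h, Complex.conj_conj], fun h => by
    rw [h, Complex.conj_conj]⟩

lemma finite_isPole : {w | u.IsPole w}.Finite := by
  have : {w | u.IsPole w} ⊆ Set.range u.z ∪ Set.range (fun p => conj (u.z p)) := by
    rintro w ⟨p, rfl | rfl⟩
    · exact Or.inl ⟨p, rfl⟩
    · exact Or.inr ⟨p, rfl⟩
  exact ((Set.finite_range _).union (Set.finite_range _)).subset this

lemma isOpen_not_isPole : IsOpen {w | ¬ u.IsPole w} := finite_isPole.isClosed.isOpen_compl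

lemma not_isPole_ofReal (x : ℝ) : ¬ u.IsPole (x : ℂ) := by
  rintro ⟨p, h | h⟩ <;> have h1 := congrArg Complex.im h <;> have h2 := u.z_im_pos p <;>
    simp only [Complex.ofReal_im, Complex.conj_im] at h1 <;> linarith

lemma sub_ne_zero_of_not_isPole {w : ℂ} (hw : ¬ u.IsPole w) (p : Fin P) :
    w - u.z p ≠ 0 ∧ w - conj (u.z p) ≠ 0 :=
  ⟨fun h => hw ⟨p, Or.inl (sub_eq_zero.1 h)⟩, fun h => hw ⟨p, Or.inr (sub_eq_zero.1 h)⟩⟩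

lemma isPole_iff_of_im_pos {w : ℂ} (hw : 0 < w.im) : u.IsPole w ↔ ∃ p, w = u.z p := by
  refine exists_congr fun p => or_iff_left fun h => ?_
  have := u.z_im_pos p
  rw [h] at hw
  simp at hw
  linarith

lemma analyticAt_toFun {w : ℂ} (hw : ¬ u.IsPole w) : AnalyticAt ℂ u.toFun w := by
  unfold toFun
  apply Finset.analyticAt_fun_sum
  intro p _
  obtain ⟨h1, h2⟩ := sub_ne_zero_of_not_isPole hw p
  have h3 : ∀ z : ℂ, AnalyticAt ℂ (fun w => w - z) w := fun z => analyticAt_id.sub analyticAt_const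
  exact (analyticAt_const.div (h3 _) h1).add (analyticAt_const.div (h3 _) h2)

lemma eventually_not_isPole {w : ℂ} (hw : ¬ u.IsPole w) : ∀ᶠ w' in 𝓝 w, ¬ u.IsPole w' :=
  isOpen_not_isPole.mem_nhds hw

/-- Dividing by the value at the centre `q` puts the argument in the unit disc around `1`, where the
principal logarithm is analytic wherever the global cuts may run. -/
lemma hasDerivAt_log_div {q z w : ℂ} (hq : q - z ≠ 0) (hw : ‖w - q‖ < ‖q - z‖) :
    w - z ≠ 0 ∧ HasDerivAt (fun w => Complex.log ((w - z) / (q - z))) (1 / (w - z)) w := by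
  have hwz : w - z ≠ 0 := by
    intro h
    rw [sub_eq_zero.1 h, norm_sub_rev] at hw
    exact lt_irrefl _ hw
  refine ⟨hwz, ?_⟩
  have hs : (w - z) / (q - z) ∈ Complex.slitPlane := by
    apply Complex.mem_slitPlane_of_norm_lt_one (z := (w - q) / (q - z)) ?_ |> fun h => ?_
    · rw [norm_div, div_lt_one (norm_pos_iff.2 hq)]; exact hw
    · convert! h using 1
      field_simp
      ring
  have h1 : HasDerivAt (fun w => (w - z) / (q - z)) (1 / (q - z)) w :=
    ((hasDerivAt_id w).sub_const z).div_const _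
  convert! h1.clog hs using 1
  field_simp

/-- A local analytic function with real part `R` and derivative `-i h'`. -/
lemma IsPosImag.exists_local (hc : u.IsPosImag) (lam : ℝ) {q : ℂ} (hq : ¬ u.IsPole q) :
    ∃ r > 0, ∃ F : ℂ → ℂ, ∀ w ∈ Metric.ball q r, ¬ u.IsPole w ∧
      HasDerivAt F (-Complex.I * (lam + u.toFun w)) w ∧ (F w).re = u.R lam w := by
  have hev : ∀ᶠ w in 𝓝 q, ∀ p, ‖w - q‖ < ‖q - u.z p‖ ∧ ‖w - q‖ < ‖q - conj (u.z p)‖ := by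
    rw [eventually_all]
    intro p
    obtain ⟨h1, h2⟩ := sub_ne_zero_of_not_isPole hq p
    have ht : Tendsto (fun w => ‖w - q‖) (𝓝 q) (𝓝 0) := by
      have : ContinuousAt (fun w => ‖w - q‖) q := by fun_prop
      simpa [ContinuousAt] using this
    exact (ht.eventually_lt_const (norm_pos_iff.2 h1)).and
      (ht.eventually_lt_const (norm_pos_iff.2 h2))
  obtain ⟨r, hr, hball⟩ := Metric.eventually_nhds_iff_ball.1 (hev.and (eventually_not_isPole hq))
  refine ⟨r, hr, fun w => -Complex.I * (lam * w) + ∑ p, (u.gam p : ℂ) *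
    ((Complex.log ((w - u.z p) / (q - u.z p)) + Real.log ‖q - u.z p‖) -
      (Complex.log ((w - conj (u.z p)) / (q - conj (u.z p))) + Real.log ‖q - conj (u.z p)‖)),
    fun w hw => ⟨(hball w hw).2, ?_, ?_⟩⟩
  · have hsum : HasDerivAt (fun w => ∑ p, (u.gam p : ℂ) *
      ((Complex.log ((w - u.z p) / (q - u.z p)) + Real.log ‖q - u.z p‖) -
      (Complex.log ((w - conj (u.z p)) / (q - conj (u.z p))) + Real.log ‖q - conj (u.z p)‖)))
      (∑ p, (u.gam p : ℂ) * (1 / (w - u.z p) - 1 / (w - conj (u.z p)))) w := by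
      apply HasDerivAt.fun_sum
      intro p _
      obtain ⟨h1, h2⟩ := sub_ne_zero_of_not_isPole hq p
      obtain ⟨h3, h4⟩ := (hball w hw).1 p
      exact (((hasDerivAt_log_div h1 h3).2.add_const _).sub
        ((hasDerivAt_log_div h2 h4).2.add_const _)).const_mul _
    have hlin : HasDerivAt (fun w : ℂ => -Complex.I * (lam * w)) (-Complex.I * (lam * 1)) w :=
      ((hasDerivAt_id w).const_mul _).const_mul _
    convert! hlin.add hsum using 1
    rw [mul_add, mul_one, toFun, Finset.mul_sum]
    congr 1
    refine Finset.sum_congr rfl fun p _ => ?_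
    rw [hc.conj_c_eq, hc.c_eq]
    linear_combination (-(u.gam p : ℂ) / (w - u.z p) + (u.gam p : ℂ) / (w - conj (u.z p))) *
      Complex.I_sq
  · rw [hc.R_eq, Complex.add_re, Complex.re_sum]
    congr 1
    · simp
    · refine Finset.sum_congr rfl fun p _ => ?_
      obtain ⟨h1, h2⟩ := sub_ne_zero_of_not_isPole hq p
      obtain ⟨h3, h4⟩ := sub_ne_zero_of_not_isPole (hball w hw).2 p
      simp only [Complex.re_ofReal_mul, Complex.sub_re, Complex.add_re, Complex.ofReal_re,
        Complex.log_re, norm_div]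
      rw [Real.log_div (norm_ne_zero_iff.2 h3) (norm_ne_zero_iff.2 h1),
        Real.log_div (norm_ne_zero_iff.2 h4) (norm_ne_zero_iff.2 h2)]
      ring

lemma IsPosImag.continuousAt_R (hc : u.IsPosImag) (lam : ℝ) {q : ℂ} (hq : ¬ u.IsPole q) :
    ContinuousAt (u.R lam) q := by
  obtain ⟨r, hr, F, hF⟩ := hc.exists_local lam hq
  have h1 : ContinuousAt (fun w => (F w).re) q :=
    Complex.continuous_re.continuousAt.comp (hF q (Metric.mem_ball_self hr)).2.1.continuousAt
  refine h1.congr ?_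
  filter_upwards [Metric.ball_mem_nhds q hr] with w hw using (hF w hw).2.2

lemma IsPosImag.hasDerivAt_R_vertical (hc : u.IsPosImag) (lam x y : ℝ)
    (hq : ¬ u.IsPole (x + y * Complex.I)) :
    HasDerivAt (fun t : ℝ => u.R lam (x + t * Complex.I))
      (lam + (u.toFun (x + y * Complex.I)).re) y := by
  obtain ⟨r, hr, F, hF⟩ := hc.exists_local lam hq
  have hl : HasDerivAt (fun t : ℝ => (x : ℂ) + t * Complex.I) Complex.I y := by
    simpa using ((Complex.ofRealCLM.hasDerivAt (x := y)).mul_const Complex.I).const_add (x : ℂ)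
  have h1 := (hF _ (Metric.mem_ball_self hr)).2.1.comp y hl
  have h2 : HasDerivAt (fun t : ℝ => (F (x + t * Complex.I)).re)
      ((-Complex.I * (lam + u.toFun (x + y * Complex.I)) * Complex.I).re) y :=
    (Complex.reCLM.hasFDerivAt.comp_hasDerivAt y h1)
  have h3 : (-Complex.I * (lam + u.toFun (x + y * Complex.I)) * Complex.I) =
      lam + u.toFun (x + y * Complex.I) := by
    linear_combination (-(lam + u.toFun (x + y * Complex.I))) * Complex.I_sq
  rw [h3, Complex.add_re, Complex.ofReal_re] at h2
  refine h2.congr_of_eventuallyEq ?_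
  have : ∀ᶠ t : ℝ in 𝓝 y, (x : ℂ) + t * Complex.I ∈ Metric.ball (x + y * Complex.I) r :=
    hl.continuousAt.eventually_mem (Metric.ball_mem_nhds _ hr)
  filter_upwards [this] with t ht using (hF _ ht).2.2.symm

/-- `R` increases along an upward vertical segment on which `Re h' > 0`. -/
lemma IsPosImag.R_lt_R_vertical (hc : u.IsPosImag) (lam x : ℝ) {y₁ y₂ : ℝ} (hy : y₁ < y₂)
    (h : ∀ y ∈ Set.Icc y₁ y₂, ¬ u.IsPole (x + y * Complex.I) ∧
      0 < lam + (u.toFun (x + y * Complex.I)).re) :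
    u.R lam (x + y₁ * Complex.I) < u.R lam (x + y₂ * Complex.I) := by
  have hm : StrictMonoOn (fun t : ℝ => u.R lam (x + t * Complex.I)) (Set.Icc y₁ y₂) := by
    apply strictMonoOn_of_deriv_pos (convex_Icc _ _)
    · intro y hy
      exact (hc.hasDerivAt_R_vertical lam x y (h y hy).1).continuousAt.continuousWithinAt
    · intro y hy
      rw [interior_Icc] at hy
      rw [(hc.hasDerivAt_R_vertical lam x y (h y (Set.Ioo_subset_Icc_self hy)).1).deriv]
      exact (h y (Set.Ioo_subset_Icc_self hy)).2
  exact hm (Set.left_mem_Icc.2 hy.le) (Set.right_mem_Icc.2 hy.le) hy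

lemma tendsto_toFun_cocompact : Tendsto u.toFun (cocompact ℂ) (𝓝 0) := by
  have h1 : ∀ c z : ℂ, Tendsto (fun w => c / (w - z)) (cocompact ℂ) (𝓝 0) := by
    intro c z
    have h2 : Tendsto (fun w : ℂ => w - z) (cocompact ℂ) (cocompact ℂ) :=
      (Homeomorph.subRight z).isClosedEmbedding.tendsto_cocompact
    have h3 : Tendsto (fun w : ℂ => w⁻¹) (cocompact ℂ) (𝓝 0) := by
      rw [← Metric.cobounded_eq_cocompact]; exact tendsto_inv₀_cobounded
    simpa [div_eq_mul_inv] using (h3.comp h2).const_mul c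
  have : Tendsto u.toFun (cocompact ℂ) (𝓝 (∑ _p : Fin P, ((0 : ℂ) + 0))) :=
    tendsto_finsetSum _ fun p _ => (h1 _ _).add (h1 _ _)
  simpa using this

variable (u) in
/-- Outside the disc of radius `ρ` there are no poles and `u₀` is small. -/
def IsFarRadius (lam ρ : ℝ) : Prop :=
  0 < ρ ∧ ∀ w : ℂ, ρ ≤ ‖w‖ → ¬ u.IsPole w ∧ 0 < lam + (u.toFun w).re

lemma exists_isFarRadius {lam : ℝ} (hlam : 0 < lam) : ∃ ρ, u.IsFarRadius lam ρ := by
  have h1 : ∀ᶠ w in cocompact ℂ, ¬ u.IsPole w :=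
    finite_isPole.isCompact.compl_mem_cocompact
  have h2 : ∀ᶠ w in cocompact ℂ, ‖u.toFun w‖ < lam :=
    (tendsto_zero_iff_norm_tendsto_zero.1 tendsto_toFun_cocompact).eventually_lt_const hlam
  have h3 := h1.and h2
  rw [← Metric.cobounded_eq_cocompact] at h3
  obtain ⟨ρ, hρ0, hρ⟩ := ((hasBasis_cobounded_norm (E := ℂ)).eventually_iff.1 h3)
  refine ⟨max ρ 1, by positivity, fun w hw => ?_⟩
  obtain ⟨h4, h5⟩ := hρ (show w ∈ {x | ρ ≤ ‖x‖} from (le_max_left _ _).trans hw)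
  refine ⟨h4, ?_⟩
  have := (abs_lt.1 ((Complex.abs_re_le_norm _).trans_lt h5)).1
  linarith

lemma IsFarRadius.of_re {lam ρ : ℝ} (h : u.IsFarRadius lam ρ) {w : ℂ} (hw : ρ ≤ |w.re|) :
    ¬ u.IsPole w ∧ 0 < lam + (u.toFun w).re :=
  h.2 w (hw.trans (Complex.abs_re_le_norm w))

lemma norm_sub_conj_le (w z : ℂ) : ‖w - conj z‖ ≤ ‖w - z‖ + 2 * |z.im| := by
  have h1 : w - conj z = (w - z) + (z - conj z) := by ring
  have h2 : ‖z - conj z‖ = 2 * |z.im| := by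
    rw [Complex.sub_conj]; simp
  rw [h1, ← h2]; exact norm_add_le _ _

lemma norm_sub_le_conj (w z : ℂ) : ‖w - z‖ ≤ ‖w - conj z‖ + 2 * |z.im| := by
  simpa using norm_sub_conj_le w (conj z)

lemma log_sub_log_le {x y b r : ℝ} (hr : 0 < r) (hx : r ≤ x) (hb : 0 ≤ b)
    (hxy : y ≤ x + b) (hy : 0 < y) : Real.log y - Real.log x ≤ Real.log (1 + b / r) := by
  have hx0 : 0 < x := hr.trans_le hx
  rw [← Real.log_div hy.ne' hx0.ne']
  apply Real.log_le_log (by positivity)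
  rw [div_le_iff₀ hx0, add_mul, one_mul]
  have : b ≤ b / r * x := by
    rw [div_mul_eq_mul_div, le_div_iff₀ hr]
    exact mul_le_mul_of_nonneg_left hx hb
  linarith

/-- The distances to `zₚ` and to its conjugate differ by at most `2 Im zₚ`, so at distance `r` from
the wells the logarithmic part of `R` is bounded below. -/
lemma IsPosImag.le_R (hc : u.IsPosImag) (lam : ℝ) {r : ℝ} (hr : 0 < r) {w : ℂ}
    (hw : ¬ u.IsPole w) (h : ∀ p, r ≤ ‖w - u.z p‖) :
    lam * w.im - ∑ p, u.gam p * Real.log (1 + 2 * |(u.z p).im| / r) ≤ u.R lam w := by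
  rw [hc.R_eq, sub_eq_add_neg, ← Finset.sum_neg_distrib]
  gcongr with p
  rw [← mul_neg]
  apply mul_le_mul_of_nonneg_left _ (hc.gam_pos p).le
  have := log_sub_log_le hr (h p) (b := 2 * |(u.z p).im|) (by positivity)
    (norm_sub_conj_le w (u.z p)) (norm_pos_iff.2 (sub_ne_zero_of_not_isPole hw p).2)
  linarith

lemma IsPosImag.R_le (hc : u.IsPosImag) (lam : ℝ) {r : ℝ} (hr : 0 < r) {w : ℂ}
    (hw : ¬ u.IsPole w) (h : ∀ p, r ≤ ‖w - conj (u.z p)‖) :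
    u.R lam w ≤ lam * w.im + ∑ p, u.gam p * Real.log (1 + 2 * |(u.z p).im| / r) := by
  rw [hc.R_eq]
  gcongr with p
  · exact (hc.gam_pos p).le
  · exact log_sub_log_le hr (h p) (b := 2 * |(u.z p).im|) (by positivity)
      (norm_sub_le_conj w (u.z p)) (norm_pos_iff.2 (sub_ne_zero_of_not_isPole hw p).1)

/-- High up the linear term `lam * im` dominates, so sublevel sets of `R` are bounded above. -/
lemma IsPosImag.exists_im_bound (hc : u.IsPosImag) {lam : ℝ} (hlam : 0 < lam) (c : ℝ) :
    ∃ Y, ∀ w : ℂ, Y ≤ w.im → ¬ u.IsPole w ∧ c ≤ u.R lam w := by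
  obtain ⟨M, hM⟩ := (Set.finite_range fun p => (u.z p).im).bddAbove
  have hM' : ∀ p, (u.z p).im ≤ M := fun p => hM ⟨p, rfl⟩
  refine ⟨max (max M 0 + 1) ((c + ∑ p, u.gam p * Real.log (1 + 2 * |(u.z p).im| / 1)) / lam),
    fun w hw => ?_⟩
  have h1 := (le_max_left _ _).trans hw
  have h2 := (le_max_right _ _).trans hw
  have hd : ∀ p, 1 ≤ ‖w - u.z p‖ := fun p => by
    refine le_trans ?_ ((le_abs_self _).trans (Complex.abs_im_le_norm (w - u.z p)))
    rw [Complex.sub_im]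
    have := hM' p
    have := le_max_left M 0
    linarith
  have hnp : ¬ u.IsPole w := by
    rw [isPole_iff_of_im_pos (by have := le_max_right M 0; linarith)]
    rintro ⟨p, rfl⟩
    have := hd p
    simp at this
    linarith
  refine ⟨hnp, ?_⟩
  have h3 := hc.le_R lam one_pos hnp hd
  rw [div_le_iff₀ hlam] at h2
  linarith

/-- A point of the upper half-plane at which `R` is very negative is close to some `zₚ`. -/
lemma IsPosImag.exists_near_well (hc : u.IsPosImag) {lam : ℝ} (hlam : 0 < lam) {r : ℝ}
    (hr : 0 < r) : ∃ c < 0, ∀ w : ℂ, 0 < w.im → u.R lam w < c → ∃ p, ‖w - u.z p‖ < r := by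
  refine ⟨min (-1) (-∑ p, u.gam p * Real.log (1 + 2 * |(u.z p).im| / r)),
    (min_le_left _ _).trans_lt (by norm_num), fun w hw hR => ?_⟩
  by_contra! hd
  have hnp : ¬ u.IsPole w := by
    rw [isPole_iff_of_im_pos hw]
    rintro ⟨p, rfl⟩
    have := hd p
    simp at this
    linarith
  have h1 := hc.le_R lam hr hnp hd
  have h2 := hR.trans_le (min_le_right _ _)
  have h3 : 0 < lam * w.im := by positivity
  linarith

lemma tendsto_norm_sub_well (z : ℂ) : Tendsto (fun w => ‖w - z‖) (𝓝[≠] z) (𝓝[>] 0) := by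
  apply tendsto_nhdsWithin_iff.2 ⟨?_, ?_⟩
  · have : ContinuousAt (fun w => ‖w - z‖) z := by fun_prop
    have h := this.tendsto
    simp only [sub_self, norm_zero] at h
    exact h.mono_left nhdsWithin_le_nhds
  · filter_upwards [self_mem_nhdsWithin] with w hw
    exact norm_pos_iff.2 (sub_ne_zero.2 hw)

lemma z_ne_conj (p q : Fin P) : u.z p ≠ conj (u.z q) := by
  intro h
  have h1 := congrArg Complex.im h
  have := u.z_im_pos p
  have := u.z_im_pos q
  simp at h1
  linarith

lemma z_injective : Function.Injective u.z := fun p q h =>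
  u.z_re_strictMono.injective (by simp [h])

lemma eventually_not_isPole_punctured (p : ℂ) : ∀ᶠ w in 𝓝[≠] p, ¬ u.IsPole w := by
  have := finite_isPole (u := u)
  have h := (this.subset (Set.inter_subset_left : {w | u.IsPole w} ∩ {p}ᶜ ⊆ _)).isClosed
  have h2 := h.isOpen_compl.mem_nhds (x := p) (by simp)
  filter_upwards [mem_nhdsWithin_of_mem_nhds h2, self_mem_nhdsWithin] with w hw hw' hp
  exact hw ⟨hp, hw'⟩

/-- Near `zₚ`, `R = γₚ log |w - zₚ| + O(1)`. -/
lemma IsPosImag.R_sub_log_near (hc : u.IsPosImag) (lam : ℝ) (p : Fin P) :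
    ∃ C, ∀ᶠ w in 𝓝 (u.z p), u.R lam w ≤ u.gam p * Real.log ‖w - u.z p‖ + C := by
  have hcont : ContinuousAt (fun w => lam * w.im - u.gam p * Real.log ‖w - conj (u.z p)‖ +
      ∑ q ∈ Finset.univ.erase p,
        u.gam q * (Real.log ‖w - u.z q‖ - Real.log ‖w - conj (u.z q)‖)) (u.z p) := by
    have hl : ∀ z, u.z p ≠ z → ContinuousAt (fun w => Real.log ‖w - z‖) (u.z p) := fun z hz =>
      ContinuousAt.log (by fun_prop) (norm_ne_zero_iff.2 (sub_ne_zero.2 hz))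
    have h1 : ContinuousAt (fun w => ∑ q ∈ Finset.univ.erase p,
        u.gam q * (Real.log ‖w - u.z q‖ - Real.log ‖w - conj (u.z q)‖)) (u.z p) := by
      apply tendsto_finsetSum
      intro q hq
      exact ((hl _ fun h => Finset.ne_of_mem_erase hq (z_injective h).symm).sub
        (hl _ (z_ne_conj p q))).const_mul _
    have h2 : ContinuousAt (fun w : ℂ => lam * w.im) (u.z p) :=
      (Complex.continuous_im.continuousAt).const_mul _
    exact (h2.sub ((hl _ (z_ne_conj p p)).const_mul _)).add h1
  obtain ⟨C, hC⟩ := exists_gt ((fun w => lam * w.im - u.gam p * Real.log ‖w - conj (u.z p)‖ +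
      ∑ q ∈ Finset.univ.erase p,
        u.gam q * (Real.log ‖w - u.z q‖ - Real.log ‖w - conj (u.z q)‖)) (u.z p))
  refine ⟨C, (hcont.tendsto.eventually_lt_const hC).mono fun w hw => ?_⟩
  rw [hc.R_eq, ← Finset.add_sum_erase _ _ (Finset.mem_univ p), mul_sub]
  linarith

lemma IsPosImag.tendsto_R_well (hc : u.IsPosImag) (lam : ℝ) (p : Fin P) :
    Tendsto (u.R lam) (𝓝[≠] (u.z p)) atBot := by
  obtain ⟨C, hC⟩ := hc.R_sub_log_near lam p
  refine tendsto_atBot_mono' _ (mem_nhdsWithin_of_mem_nhds hC) ?_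
  apply tendsto_atBot_add_const_right
  exact (Real.tendsto_log_nhdsGT_zero.comp (tendsto_norm_sub_well _)).const_mul_atBot
    (hc.gam_pos p)

/-- The residue is nonzero and all other terms stay bounded. Critical points have `u₀ = -lam`, so
this keeps them away from the wells. -/
lemma tendsto_norm_toFun_well (p : Fin P) :
    Tendsto (fun w => ‖u.toFun w‖) (𝓝[≠] (u.z p)) atTop := by
  set G : ℂ → ℂ := fun w => conj (u.c p) / (w - conj (u.z p)) +
    ∑ q ∈ Finset.univ.erase p, (u.c q / (w - u.z q) + conj (u.c q) / (w - conj (u.z q))) with hG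
  have hcont : ContinuousAt G (u.z p) := by
    have hl : ∀ c z, u.z p ≠ z → ContinuousAt (fun w => c / (w - z)) (u.z p) := fun c z hz =>
      ContinuousAt.div (by fun_prop) (by fun_prop) (sub_ne_zero.2 hz)
    refine (hl _ _ (z_ne_conj p p)).add ?_
    apply tendsto_finsetSum
    intro q hq
    exact (hl _ _ fun h => Finset.ne_of_mem_erase hq (z_injective h).symm).add
        (hl _ _ (z_ne_conj p q))
  have h1 : Tendsto (fun w => ‖u.c p / (w - u.z p)‖) (𝓝[≠] (u.z p)) atTop := by
    simp only [norm_mul, norm_inv, div_eq_mul_inv]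
    exact ((tendsto_inv_nhdsGT_zero).comp (tendsto_norm_sub_well _)).const_mul_atTop
      (norm_pos_iff.2 (u.c_ne_zero p))
  have h2 : Tendsto (fun w => -‖G w‖) (𝓝[≠] (u.z p)) (𝓝 (-‖G (u.z p)‖)) :=
    hcont.norm.neg.tendsto.mono_left nhdsWithin_le_nhds
  refine tendsto_atTop_mono (fun w => ?_) (h1.atTop_add h2)
  have : u.toFun w = u.c p / (w - u.z p) + G w := by
    rw [toFun, ← Finset.add_sum_erase _ _ (Finset.mem_univ p), hG, add_assoc]
  rw [this]
  have := norm_sub_le_norm_add (u.c p / (w - u.z p)) (G w)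
  linarith

/-- The punctured neighbourhoods of `zₚ`. -/
lemma IsPosImag.eventually_well (hc : u.IsPosImag) (lam : ℝ) (p : Fin P) (c : ℝ) :
    ∀ᶠ w in 𝓝[≠] (u.z p), ¬ u.IsPole w ∧ u.R lam w < c ∧ ¬ u.IsCritical lam w ∧ 0 < w.im := by
  have h0 : ∀ᶠ w in 𝓝 (u.z p), 0 < w.im :=
    (isOpen_lt continuous_const Complex.continuous_im).mem_nhds (u.z_im_pos p)
  filter_upwards [eventually_not_isPole_punctured (u := u) (u.z p),
    (hc.tendsto_R_well lam p).eventually_lt_atBot c,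
    (tendsto_norm_toFun_well p).eventually_gt_atTop |lam|, mem_nhdsWithin_of_mem_nhds h0]
    with w h1 h2 h3 h4
  refine ⟨h1, h2, fun h => ?_, h4⟩
  have : u.toFun w = -(lam : ℂ) := by linear_combination h.2
  rw [this] at h3
  simp at h3

variable (u) in
/-- The sublevel set of `R` in the upper half-plane, with the `zₚ` included. -/
def sub (lam c : ℝ) : Set ℂ := {w | 0 < w.im ∧ (u.IsPole w ∨ u.R lam w < c)}

/-- At the wells openness comes from `R → -∞`, whatever junk value `R` takes at `zₚ` itself. -/
lemma IsPosImag.isOpen_sub (hc : u.IsPosImag) (lam c : ℝ) : IsOpen (u.sub lam c) := by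
  rw [isOpen_iff_mem_nhds]
  rintro w ⟨hw, h⟩
  have h0 : ∀ᶠ w' in 𝓝 w, 0 < w'.im :=
    (isOpen_lt continuous_const Complex.continuous_im).mem_nhds hw
  by_cases hp : u.IsPole w
  · obtain ⟨p, rfl⟩ := (isPole_iff_of_im_pos hw).1 hp
    have := eventually_nhdsWithin_iff.1 (hc.eventually_well lam p c)
    filter_upwards [this, h0] with w' h1 h2
    refine ⟨h2, ?_⟩
    by_cases h3 : w' = u.z p
    · rw [h3]; exact Or.inl hp
    · exact Or.inr (h1 h3).2.1
  · filter_upwards [h0, (hc.continuousAt_R lam hp).eventually_lt_const (h.resolve_left hp)]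
      with w' h1 h2 using ⟨h1, Or.inr h2⟩

lemma sub_mono {lam c c' : ℝ} (h : c ≤ c') : u.sub lam c ⊆ u.sub lam c' :=
  fun _ hw => ⟨hw.1, hw.2.imp_right fun h1 => h1.trans_le h⟩

/-! ### Counting the critical points -/

open Polynomial in
variable (u) in
/-- The numerator of `h'`. -/
noncomputable def critPoly (lam : ℝ) : ℂ[X] :=
  C (lam : ℂ) * ∏ p, ((X - C (u.z p)) * (X - C (conj (u.z p)))) +
    ∑ p, (C (u.c p) * (X - C (conj (u.z p))) + C (conj (u.c p)) * (X - C (u.z p))) *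
      ∏ q ∈ Finset.univ.erase p, ((X - C (u.z q)) * (X - C (conj (u.z q))))

lemma critPoly_eval (lam : ℝ) {w : ℂ} (hw : ¬ u.IsPole w) :
    (u.critPoly lam).eval w =
      (∏ p, ((w - u.z p) * (w - conj (u.z p)))) * (lam + u.toFun w) := by
  simp only [critPoly, Polynomial.eval_add, Polynomial.eval_mul, Polynomial.eval_C,
    Polynomial.eval_prod, Polynomial.eval_sub, Polynomial.eval_X, Polynomial.eval_finsetSum]
  rw [mul_add, mul_comm (lam : ℂ), toFun, Finset.mul_sum]
  congr 1
  refine Finset.sum_congr rfl fun p _ => ?_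
  obtain ⟨h1, h2⟩ := sub_ne_zero_of_not_isPole hw p
  rw [← Finset.mul_prod_erase _ _ (Finset.mem_univ p)]
  field_simp

open Polynomial in
lemma natDegree_critPoly_le (lam : ℝ) : (u.critPoly lam).natDegree ≤ 2 * P := by
  have h1 : ∀ p, ((X - C (u.z p)) * (X - C (conj (u.z p)))).natDegree ≤ 2 := fun p => by
    compute_degree
  have h2 : ∀ s : Finset (Fin P),
      (∏ q ∈ s, ((X - C (u.z q)) * (X - C (conj (u.z q))))).natDegree ≤ 2 * s.card := fun s => by
    refine (natDegree_prod_le _ _).trans ?_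
    refine (Finset.sum_le_card_nsmul _ _ 2 fun p _ => h1 p).trans ?_
    rw [smul_eq_mul, mul_comm]
  refine natDegree_add_le_of_degree_le ?_ ?_
  · refine (natDegree_C_mul_le _ _).trans ((h2 _).trans ?_)
    simp
  · refine natDegree_sum_le_of_forall_le _ _ fun p _ => ?_
    refine (natDegree_mul_le_of_le (m := 1) (n := 2 * (P - 1)) ?_ ?_).trans ?_
    · compute_degree
    · refine (h2 _).trans ?_
      simp [Finset.card_erase_of_mem]
    · have := p.pos
      omega

/-- At a far real point there is no pole and `Re h' > 0`, so the numerator does not vanish there. -/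
lemma critPoly_ne_zero {lam : ℝ} (hlam : 0 < lam) : u.critPoly lam ≠ 0 := by
  intro h
  obtain ⟨ρ, h0, hρ⟩ := exists_isFarRadius (u := u) hlam
  obtain ⟨h1, h2⟩ := hρ (ρ : ℂ) (by simp [abs_of_pos h0])
  have h3 := critPoly_eval lam h1
  rw [h, Polynomial.eval_zero, eq_comm, mul_eq_zero, Finset.prod_eq_zero_iff] at h3
  rcases h3 with ⟨p, _, hp⟩ | h3
  · rcases mul_eq_zero.1 hp with hp | hp
    · exact (sub_ne_zero_of_not_isPole h1 p).1 hp
    · exact (sub_ne_zero_of_not_isPole h1 p).2 hp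
  · have := congrArg Complex.re h3
    simp at this
    linarith

lemma IsCritical.isRoot {lam : ℝ} {w : ℂ} (h : u.IsCritical lam w) :
    (u.critPoly lam).IsRoot w := by
  rw [Polynomial.IsRoot, critPoly_eval lam h.1, h.2, mul_zero]

lemma finite_isCritical {lam : ℝ} (hlam : 0 < lam) : {w | u.IsCritical lam w}.Finite := by
  refine (u.critPoly lam).roots.toFinset.finite_toSet.subset fun w hw => ?_
  rw [Finset.mem_coe, Multiset.mem_toFinset, Polynomial.mem_roots (critPoly_ne_zero hlam)]
  exact IsCritical.isRoot hw

lemma card_critical_le {lam : ℝ} (hlam : 0 < lam) (T : Finset ℂ)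
    (hT : ∀ w ∈ T, u.IsCritical lam w) : T.card ≤ 2 * P := by
  have h1 : T ⊆ (u.critPoly lam).roots.toFinset := fun w hw => by
    rw [Multiset.mem_toFinset, Polynomial.mem_roots (critPoly_ne_zero hlam)]
    exact IsCritical.isRoot (hT w hw)
  exact (Finset.card_le_card h1).trans ((Multiset.toFinset_card_le _).trans
    ((Polynomial.card_roots' _).trans (natDegree_critPoly_le lam)))

lemma IsCritical.conj {lam : ℝ} {w : ℂ} (h : u.IsCritical lam w) :
    u.IsCritical lam (conj w) := by
  refine ⟨fun h1 => h.1 (isPole_conj.1 h1), ?_⟩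
  rw [toFun_conj]
  have := congrArg (starRingEnd ℂ) h.2
  simpa using this

/-- The critical points in the upper half-plane, plus one more if there is a real one, are at most
`P` in number. -/
lemma card_upper_critical_le {lam : ℝ} (hlam : 0 < lam) (S : Finset ℂ)
    (hS : ∀ w ∈ S, u.IsCritical lam w ∧ 0 < w.im) :
    S.card ≤ P ∧ ((∃ x : ℝ, u.IsCritical lam x) → S.card + 1 ≤ P) := by
  classical
  have hdisj : Disjoint S (S.image (starRingEnd ℂ)) := by
    rw [Finset.disjoint_left]
    intro w hw hw'
    obtain ⟨v, hv, rfl⟩ := Finset.mem_image.1 hw'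
    have h1 := (hS _ hw).2
    have h2 := (hS _ hv).2
    simp at h1
    linarith
  have hcard : (S ∪ S.image (starRingEnd ℂ)).card = 2 * S.card := by
    rw [Finset.card_union_of_disjoint hdisj,
      Finset.card_image_of_injective _ (starRingEnd ℂ).injective]
    ring
  have hcrit : ∀ w ∈ S ∪ S.image (starRingEnd ℂ), u.IsCritical lam w ∧ w.im ≠ 0 := by
    intro w hw
    rcases Finset.mem_union.1 hw with hw | hw
    · exact ⟨(hS w hw).1, (hS w hw).2.ne'⟩
    · obtain ⟨v, hv, rfl⟩ := Finset.mem_image.1 hw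
      exact ⟨(hS v hv).1.conj, by simpa using (hS v hv).2.ne'⟩
  constructor
  · have := card_critical_le hlam _ fun w hw => (hcrit w hw).1
    omega
  -- A real critical point is its own conjugate, so it raises the count `2 |S|` only by one; parity
  -- of the bound `2P` then gives `|S| + 1 ≤ P`.
  · rintro ⟨x, hx⟩
    have hx' : (x : ℂ) ∉ S ∪ S.image (starRingEnd ℂ) := fun h => (hcrit _ h).2 (by simp)
    have := card_critical_le hlam (insert (x : ℂ) (S ∪ S.image (starRingEnd ℂ))) fun w hw => by
      rcases Finset.mem_insert.1 hw with rfl | hw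
      · exact hx
      · exact (hcrit w hw).1
    rw [Finset.card_insert_of_notMem hx'] at this
    omega

end BenjaminOno.RationalPotential

/-! ### Local normal form of `R` at a point -/

namespace BenjaminOno

/-- A local coordinate in which an analytic function is a monomial. -/
lemma exists_chart {F G : ℂ → ℂ} {q a : ℂ} {n : ℕ} (hn : n ≠ 0) (hG : AnalyticAt ℂ G q)
    (hG1 : G q = 1) (hF : ∀ᶠ w in 𝓝 q, F w = F q + a * ((w - q) ^ n * G w)) :
    ∃ φ : ℂ → ℂ, φ q = 0 ∧ HasDerivAt φ 1 q ∧ ∀ N ∈ 𝓝 q, ∃ O ⊆ N, IsOpen O ∧ q ∈ O ∧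
      (∀ w ∈ O, F w = F q + a * φ w ^ n) ∧
      ∀ C : Set ℂ, IsOpen C → Convex ℝ C →
        IsOpen (O ∩ φ ⁻¹' C) ∧ IsPreconnected (O ∩ φ ⁻¹' C) := by
  -- An `n`-th root of the factor `G`, which is `1` at `q` and so stays off the cut; then `φ ^ n =
  -- (w - q) ^ n * G`, and `φ' = 1` at `q` makes `φ` a coordinate.
  set φ : ℂ → ℂ := fun w => (w - q) * G w ^ ((n : ℂ)⁻¹) with hφ
  have hslit : G q ∈ Complex.slitPlane := by rw [hG1]; exact Complex.one_mem_slitPlane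
  have hroot : AnalyticAt ℂ (fun w => G w ^ ((n : ℂ)⁻¹)) q := hG.cpow analyticAt_const hslit
  have hsub : AnalyticAt ℂ (fun w => w - q) q := analyticAt_id.sub analyticAt_const
  have hφa : AnalyticAt ℂ φ q := hsub.mul hroot
  have hφ0 : φ q = 0 := by simp [hφ]
  have hφd : HasDerivAt φ 1 q := by
    have := ((hasDerivAt_id q).sub_const q).mul hroot.differentiableAt.hasDerivAt
    convert! this using 1
    simp [hG1]
  have hstrict : HasStrictDerivAt φ 1 q := by
    have := hφa.hasStrictDerivAt
    rwa [hφd.deriv] at this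
  set e := (hstrict.hasStrictFDerivAt_equiv one_ne_zero).toOpenPartialHomeomorph φ with he
  have hecoe : (e : ℂ → ℂ) = φ :=
    (hstrict.hasStrictFDerivAt_equiv one_ne_zero).toOpenPartialHomeomorph_coe
  have hes : q ∈ e.source :=
    (hstrict.hasStrictFDerivAt_equiv one_ne_zero).mem_toOpenPartialHomeomorph_source
  refine ⟨φ, hφ0, hφd, fun N hN => ?_⟩
  have h1 : ∀ᶠ w in 𝓝 q, F w = F q + a * φ w ^ n := by
    filter_upwards [hF] with w hw
    rw [hw, hφ]
    simp only [mul_pow, Complex.cpow_nat_inv_pow _ hn]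
  obtain ⟨N', hN', hN'o, hqN'⟩ := mem_nhds_iff.1 (inter_mem hN h1)
  set e' := e.restrOpen N' hN'o with he'
  have hqe' : q ∈ e'.source := by
    rw [he', OpenPartialHomeomorph.restrOpen_source]; exact ⟨hes, hqN'⟩
  have he'coe : (e' : ℂ → ℂ) = φ := by rw [← hecoe]; rfl
  have h0 : (0 : ℂ) ∈ e'.target := by
    have := e'.map_source hqe'
    rwa [he'coe, hφ0] at this
  obtain ⟨ρ, hρ, hball⟩ := Metric.isOpen_iff.1 e'.open_target 0 h0
  -- Preimages of convex sets are images under the inverse chart of convex subsets of a disc, hence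
  -- connected.
  have himg : ∀ C : Set ℂ, e'.source ∩ φ ⁻¹' (Metric.ball 0 ρ ∩ C) =
      e'.symm '' (Metric.ball 0 ρ ∩ C) := by
    intro C
    rw [← he'coe]
    exact (e'.toPartialEquiv.symm_image_eq_source_inter_preimage
      (Set.inter_subset_left.trans hball)).symm
  have hopen : ∀ C : Set ℂ, IsOpen C → IsOpen (e'.source ∩ φ ⁻¹' (Metric.ball 0 ρ ∩ C)) := by
    intro C hC
    rw [← he'coe]
    exact e'.isOpen_inter_preimage (Metric.isOpen_ball.inter hC)
  have hO : ∀ w ∈ e'.source ∩ φ ⁻¹' (Metric.ball 0 ρ), w ∈ N' := by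
    rintro w ⟨hw, -⟩
    rw [he', OpenPartialHomeomorph.restrOpen_source] at hw
    exact hw.2
  refine ⟨e'.source ∩ φ ⁻¹' (Metric.ball 0 ρ), fun w hw => (hN' (hO w hw)).1, ?_, ?_, ?_, ?_⟩
  · simpa using hopen Set.univ isOpen_univ
  · exact ⟨hqe', by simp [hφ0, hρ]⟩
  · exact fun w hw => (hN' (hO w hw)).2
  · intro C hC hCc
    rw [Set.inter_assoc, ← Set.preimage_inter]
    refine ⟨hopen C hC, ?_⟩
    rw [himg]
    refine (((convex_ball (0 : ℂ) ρ).inter hCc).isPreconnected).image _ ?_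
    exact e'.continuousOn_symm.mono (Set.inter_subset_left.trans hball)

/-- Since `φ q = 0` and `φ' = 1`, the quotient `φ (q + tω) / t` tends to `ω`, and cones are
invariant under positive scaling. Directions at `q` can thus be read off in the chart. -/
lemma eventually_chart_mem_cone {φ : ℂ → ℂ} {q ω : ℂ} {C : Set ℂ} (h0 : φ q = 0)
    (hφ : HasDerivAt φ 1 q) (hC : IsOpen C) (hcone : ∀ t : ℝ, 0 < t → ∀ z ∈ C, (t : ℂ) * z ∈ C)
    (hω : ω ∈ C) : ∀ᶠ t : ℝ in 𝓝[>] 0, φ (q + t * ω) ∈ C := by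
  have hl : HasDerivAt (fun t : ℝ => q + t * ω) ω 0 := by
    simpa using ((Complex.ofRealCLM.hasDerivAt (x := 0)).mul_const ω).const_add q
  have h1 : HasDerivAt (fun t : ℝ => φ (q + t * ω)) ω 0 := by
    have h2 : HasDerivAt φ 1 (q + ((0 : ℝ) : ℂ) * ω) := by simpa using hφ
    convert! h2.comp (0 : ℝ) hl using 1
    simp
  have h2 := h1.tendsto_slope_zero_right
  simp only [zero_add, Complex.ofReal_zero, zero_mul, add_zero, h0, sub_zero] at h2
  filter_upwards [h2.eventually_mem (hC.mem_nhds hω), self_mem_nhdsWithin] with t ht ht0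
  have h3 := hcone t ht0 _ ht
  rw [Complex.real_smul, ← mul_assoc] at h3
  have : (t : ℂ) ≠ 0 := by exact_mod_cast (ne_of_gt ht0)
  rwa [Complex.ofReal_inv, mul_inv_cancel₀ this, one_mul] at h3

/-- Integration of the local order of vanishing. -/
lemma exists_local_power {F f g : ℂ → ℂ} {q : ℂ} {k : ℕ} (hF : AnalyticAt ℂ F q)
    (hd : ∀ᶠ w in 𝓝 q, HasDerivAt F (-Complex.I * f w) w) (hg : AnalyticAt ℂ g q) (hg0 : g q ≠ 0)
    (hf : ∀ᶠ w in 𝓝 q, f w = (w - q) ^ k * g w) :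
    ∃ G : ℂ → ℂ, AnalyticAt ℂ G q ∧ G q = 1 ∧ ∀ᶠ w in 𝓝 q,
      F w = F q + (-Complex.I * g q / (k + 1)) * ((w - q) ^ (k + 1) * G w) := by
  have hF0 : AnalyticAt ℂ (fun w => F w - F q) q := hF.sub analyticAt_const
  have hder : ∀ᶠ w in 𝓝 q, deriv F w = (w - q) ^ k • (-Complex.I * g w) := by
    filter_upwards [hd, hf] with w h1 h2
    rw [h1.deriv, h2, smul_eq_mul]; ring
  -- A locally constant `F` would force `g` to vanish on a punctured neighbourhood, and by
  -- continuity at `q`.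
  have hne : ¬ ∀ᶠ w in 𝓝 q, F w - F q = 0 := by
    intro h
    have h1 : ∀ᶠ w in 𝓝 q, deriv F w = 0 := by
      filter_upwards [eventually_eventually_nhds.2 h] with w hw
      have : F =ᶠ[𝓝 w] fun _ => F q := hw.mono fun v hv => by linear_combination hv
      rw [this.deriv_eq]; simp
    have h2 : ∀ᶠ w in 𝓝[≠] q, g w = 0 := by
      filter_upwards [mem_nhdsWithin_of_mem_nhds h1, mem_nhdsWithin_of_mem_nhds hder,
        self_mem_nhdsWithin] with w h3 h4 h5
      rw [h3] at h4
      have := pow_ne_zero k (sub_ne_zero.2 h5)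
      simpa [this] using h4.symm
    have h3 : Tendsto g (𝓝[≠] q) (𝓝 (g q)) := hg.continuousAt.tendsto.mono_left nhdsWithin_le_nhds
    exact hg0 (tendsto_nhds_unique h3 ((tendsto_congr' h2).2 tendsto_const_nhds))
  obtain ⟨n, G, hG, hG0, hGe⟩ := hF0.exists_eventuallyEq_pow_smul_nonzero_iff.2 hne
  have hn : n ≠ 0 := by
    rintro rfl
    have := hGe.self_of_nhds
    simp at this
    exact hG0 this.symm
  obtain ⟨m, rfl⟩ : ∃ m, n = m + 1 := Nat.exists_eq_succ_of_ne_zero hn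
  have hder2 : ∀ᶠ w in 𝓝 q, deriv F w = (w - q) ^ m • ((m + 1) * G w + (w - q) * deriv G w) := by
    filter_upwards [eventually_eventually_nhds.2 hGe, hG.eventually_analyticAt] with w h1 h2
    have h3 : F =ᶠ[𝓝 w] fun v => F q + (v - q) ^ (m + 1) * G v :=
      h1.mono fun v hv => by rw [smul_eq_mul] at hv; linear_combination hv
    rw [h3.deriv_eq]
    have h4 : HasDerivAt (fun v => F q + (v - q) ^ (m + 1) * G v)
        ((((m + 1 : ℕ) : ℂ) * (w - q) ^ m * 1) * G w + (w - q) ^ (m + 1) * deriv G w) w :=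
      ((((hasDerivAt_id w).sub_const q).pow (m + 1)).mul
        h2.differentiableAt.hasDerivAt).const_add _
    rw [h4.deriv, smul_eq_mul]
    push_cast
    ring
  have hsub : AnalyticAt ℂ (fun w => w - q) q := analyticAt_id.sub analyticAt_const
  have hA : AnalyticAt ℂ (fun w => (m + 1) * G w + (w - q) * deriv G w) q :=
    (analyticAt_const.mul hG).add (hsub.mul hG.deriv)
  have hA0 : (fun w => (m + 1) * G w + (w - q) * deriv G w) q ≠ 0 := by
    have : ((m : ℂ) + 1) ≠ 0 := by exact_mod_cast Nat.succ_ne_zero m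
    simp [hG0, this]
  have hB : AnalyticAt ℂ (fun w => -Complex.I * g w) q := analyticAt_const.mul hg
  -- The order of vanishing of `F'`, computed from the factorisation of `F - F q` and from the
  -- hypothesis, must be the same.
  have hmk : m = k := AnalyticAt.unique_eventuallyEq_pow_smul_nonzero (f := deriv F)
    ⟨_, hA, hA0, hder2⟩ ⟨_, hB, by simp [hg0], hder⟩
  subst hmk
  have hval : ((m : ℂ) + 1) * G q = -Complex.I * g q := by
    have h1 : ∀ᶠ w in 𝓝[≠] q, (m + 1) * G w + (w - q) * deriv G w = -Complex.I * g w := by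
      filter_upwards [mem_nhdsWithin_of_mem_nhds hder2, mem_nhdsWithin_of_mem_nhds hder,
        self_mem_nhdsWithin] with w h3 h4 h5
      rw [h3] at h4
      exact mul_left_cancel₀ (pow_ne_zero m (sub_ne_zero.2 h5)) h4
    have h2 := hA.continuousAt.tendsto.mono_left (nhdsWithin_le_nhds (s := {q}ᶜ))
    have h3 := hB.continuousAt.tendsto.mono_left (nhdsWithin_le_nhds (s := {q}ᶜ))
    have := tendsto_nhds_unique (h2.congr' h1) h3
    simpa using this
  have hm1 : ((m : ℂ) + 1) ≠ 0 := by exact_mod_cast Nat.succ_ne_zero m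
  refine ⟨fun w => G w / G q, hG.div analyticAt_const hG0, div_self hG0, ?_⟩
  filter_upwards [hGe] with w hw
  rw [smul_eq_mul] at hw
  rw [← hval]
  field_simp
  linear_combination hw

lemma exists_dslope {f : ℂ → ℂ} {q : ℂ} (hf : AnalyticAt ℂ f q) (h0 : f q = 0) :
    ∃ g, AnalyticAt ℂ g q ∧ g q = deriv f q ∧ ∀ w, f w = (w - q) * g w := by
  obtain ⟨p, hp⟩ := hf
  refine ⟨dslope f q, ⟨_, hp.has_fpower_series_dslope_fslope⟩, dslope_same _ _, fun w => ?_⟩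
  have := sub_smul_dslope f q w
  rw [h0, sub_zero, smul_eq_mul] at this
  exact this.symm

lemma exists_dslope_two {f : ℂ → ℂ} {q : ℂ} (hf : AnalyticAt ℂ f q) (h0 : f q = 0)
    (h1 : deriv f q = 0) :
    ∃ g, AnalyticAt ℂ g q ∧ g q = iteratedDeriv 2 f q / 2 ∧ ∀ w, f w = (w - q) ^ 2 * g w := by
  obtain ⟨g, hg, hg0, hfg⟩ := exists_dslope hf h0
  obtain ⟨k, hk, hk0, hgk⟩ := exists_dslope hg (hg0.trans h1)
  have hfk : ∀ w, f w = (w - q) ^ 2 * k w := fun w => by rw [hfg, hgk]; ring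
  refine ⟨k, hk, ?_, hfk⟩
  have hd : ∀ᶠ w in 𝓝 q, deriv f w = (w - q) * (2 * k w + (w - q) * deriv k w) := by
    filter_upwards [hk.eventually_analyticAt] with w hw
    have h4 : HasDerivAt (fun v => (v - q) ^ 2 * k v)
        ((((2 : ℕ) : ℂ) * (w - q) ^ 1 * 1) * k w + (w - q) ^ 2 * deriv k w) w :=
      (((hasDerivAt_id w).sub_const q).pow 2).mul hw.differentiableAt.hasDerivAt
    rw [funext hfk, h4.deriv]
    push_cast
    ring
  have hsub : AnalyticAt ℂ (fun w => w - q) q := analyticAt_id.sub analyticAt_const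
  have hA : AnalyticAt ℂ (fun w => 2 * k w + (w - q) * deriv k w) q :=
    (analyticAt_const.mul hk).add (hsub.mul hk.deriv)
  have h5 : HasDerivAt (fun w => (w - q) * (2 * k w + (w - q) * deriv k w))
      (1 * (2 * k q + (q - q) * deriv k q) + (q - q) * deriv (fun w => 2 * k w +
        (w - q) * deriv k w) q) q :=
    ((hasDerivAt_id q).sub_const q).mul hA.differentiableAt.hasDerivAt
  have : iteratedDeriv 2 f q = 2 * k q := by
    rw [iteratedDeriv_succ, iteratedDeriv_one, EventuallyEq.deriv_eq hd, h5.deriv]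
    simp
  rw [this]; ring

/-- Intermediate value theorem for the imaginary part. It is applied to sectors of `{R < 0}`, which
cannot meet the real axis because `R = 0` there. -/
lemma im_neg_of_isPreconnected {S : Set ℂ} (hS : IsPreconnected S) (h0 : ∀ w ∈ S, w.im ≠ 0)
    {v : ℂ} (hv : v ∈ S) (hv0 : v.im < 0) : ∀ w ∈ S, w.im < 0 := by
  intro w hw
  by_contra! h
  have himg := (hS.image _ Complex.continuous_im.continuousOn).ordConnected
  obtain ⟨z, hz, hz0⟩ := himg.out (Set.mem_image_of_mem _ hv) (Set.mem_image_of_mem _ hw)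
    ⟨hv0.le, h⟩
  exact h0 z hz hz0

lemma im_pos_of_isPreconnected {S : Set ℂ} (hS : IsPreconnected S) (h0 : ∀ w ∈ S, w.im ≠ 0)
    {v : ℂ} (hv : v ∈ S) (hv0 : 0 < v.im) : ∀ w ∈ S, 0 < w.im := by
  intro w hw
  by_contra! h
  have himg := (hS.image _ Complex.continuous_im.continuousOn).ordConnected
  obtain ⟨z, hz, hz0⟩ := himg.out (Set.mem_image_of_mem _ hw) (Set.mem_image_of_mem _ hv)
    ⟨h, hv0.le⟩
  exact h0 z hz hz0

/-- The value of `h'` to leading order at `q`. -/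
structure LocalOrder {P : ℕ} (u : RationalPotential P) (lam : ℝ) (q : ℂ) (k : ℕ) (α : ℂ) : Prop where
  not_isPole : ¬ u.IsPole q
  ne_zero : α ≠ 0
  exists_factor : ∃ g : ℂ → ℂ, AnalyticAt ℂ g q ∧ g q = α ∧
    ∀ᶠ w in 𝓝 q, (lam : ℂ) + u.toFun w = (w - q) ^ k * g w

namespace RationalPotential

variable {P : ℕ} {u : RationalPotential P} {lam : ℝ}

lemma analyticAt_hder {q : ℂ} (hq : ¬ u.IsPole q) :
    AnalyticAt ℂ (fun w => (lam : ℂ) + u.toFun w) q :=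
  analyticAt_const.add (analyticAt_toFun hq)

/-- There are finitely many critical points, so `h'` does not vanish identically near `q` and has
finite order. -/
lemma exists_localOrder (hlam : 0 < lam) {q : ℂ} (hq : ¬ u.IsPole q) :
    ∃ k α, LocalOrder u lam q k α := by
  have hne : ¬ ∀ᶠ w in 𝓝 q, (lam : ℂ) + u.toFun w = 0 := by
    intro h
    have h1 : ∀ᶠ w in 𝓝[≠] q, w ∈ {w | u.IsCritical lam w} := by
      filter_upwards [mem_nhdsWithin_of_mem_nhds h,
        mem_nhdsWithin_of_mem_nhds (eventually_not_isPole hq)] with w h1 h2 using ⟨h2, h1⟩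
    have h2 : ∀ᶠ w in 𝓝[≠] q, w ∉ {w | u.IsCritical lam w} := by
      have h := ((finite_isCritical (u := u) hlam).subset
        (Set.inter_subset_left : {w | u.IsCritical lam w} ∩ {q}ᶜ ⊆ _)).isClosed
      filter_upwards [mem_nhdsWithin_of_mem_nhds (h.isOpen_compl.mem_nhds (x := q) (by simp)),
        self_mem_nhdsWithin] with w hw hw' hp
      exact hw ⟨hp, hw'⟩
    obtain ⟨w, hw1, hw2⟩ := (h1.and h2).exists
    exact hw2 hw1
  obtain ⟨k, g, hg, hg0, hge⟩ := (analyticAt_hder (lam := lam) hq).exists_eventuallyEq_pow_smul_nonzero_iff.2 hne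
  exact ⟨k, g q, hq, hg0, g, hg, rfl, hge⟩

lemma localOrder_of_not_isCritical {q : ℂ} (hq : ¬ u.IsPole q) (hcr : ¬ u.IsCritical lam q) :
    LocalOrder u lam q 0 (lam + u.toFun q) :=
  ⟨hq, fun h => hcr ⟨hq, h⟩, _, analyticAt_hder hq, rfl, by simp⟩

lemma deriv_hder (q : ℂ) : deriv (fun w => (lam : ℂ) + u.toFun w) q = deriv u.toFun q := by
  rw [deriv_const_add]

lemma IsCritical.localOrder_one {q : ℂ} (hcr : u.IsCritical lam q) (hd : deriv u.toFun q ≠ 0) :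
    LocalOrder u lam q 1 (deriv u.toFun q) := by
  obtain ⟨g, hg, hg0, hge⟩ := exists_dslope (analyticAt_hder (lam := lam) hcr.1) hcr.2
  rw [deriv_hder] at hg0
  exact ⟨hcr.1, hd, g, hg, hg0, Eventually.of_forall fun w => by simpa using hge w⟩

lemma IsCritical.localOrder_two {q : ℂ} (hcr : u.IsCritical lam q) (hd : deriv u.toFun q = 0)
    (hd2 : iteratedDeriv 2 u.toFun q ≠ 0) :
    LocalOrder u lam q 2 (iteratedDeriv 2 u.toFun q / 2) := by
  obtain ⟨g, hg, hg0, hge⟩ := exists_dslope_two (analyticAt_hder (lam := lam) hcr.1) hcr.2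
    ((deriv_hder q).trans hd)
  have : iteratedDeriv 2 (fun w => (lam : ℂ) + u.toFun w) q = iteratedDeriv 2 u.toFun q := by
    rw [iteratedDeriv_succ' (n := 1), iteratedDeriv_succ' (n := 1) (f := u.toFun)]
    congr 1
    exact funext fun w => deriv_hder w
  rw [this] at hg0
  exact ⟨hcr.1, by simp [hd2], g, hg, hg0, Eventually.of_forall fun w => by simpa using hge w⟩

/-- The local structure of `R` at a point where `h'` vanishes to order `k`. -/
lemma _root_.BenjaminOno.LocalOrder.exists_chart (hc : u.IsPosImag) {q : ℂ} {k : ℕ} {α : ℂ}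
    (h : LocalOrder u lam q k α) :
    ∃ φ : ℂ → ℂ, φ q = 0 ∧ HasDerivAt φ 1 q ∧ ∀ N ∈ 𝓝 q, ∃ O ⊆ N, IsOpen O ∧ q ∈ O ∧
      (∀ w ∈ O, ¬ u.IsPole w ∧
        u.R lam w = u.R lam q + ((-Complex.I * α / (k + 1)) * φ w ^ (k + 1)).re) ∧
      ∀ C : Set ℂ, IsOpen C → Convex ℝ C →
        IsOpen (O ∩ φ ⁻¹' C) ∧ IsPreconnected (O ∩ φ ⁻¹' C) := by
  obtain ⟨hq, hα, g, hg, rfl, hge⟩ := h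
  obtain ⟨r, hr, F, hF⟩ := hc.exists_local lam hq
  have hFa : AnalyticAt ℂ F q := by
    refine DifferentiableOn.analyticAt (s := Metric.ball q r) (fun w hw =>
      (hF w hw).2.1.differentiableAt.differentiableWithinAt) (Metric.ball_mem_nhds q hr)
  have hFd : ∀ᶠ w in 𝓝 q, HasDerivAt F (-Complex.I * (lam + u.toFun w)) w := by
    filter_upwards [Metric.ball_mem_nhds q hr] with w hw using (hF w hw).2.1
  obtain ⟨G, hG, hG1, hGe⟩ := exists_local_power hFa hFd hg hα hge
  obtain ⟨φ, h0, hd, hN⟩ := BenjaminOno.exists_chart k.succ_ne_zero hG hG1 hGe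
  refine ⟨φ, h0, hd, fun N hNq => ?_⟩
  obtain ⟨O, hON, hOo, hqO, hOF, hC⟩ := hN (N ∩ Metric.ball q r)
    (inter_mem hNq (Metric.ball_mem_nhds q hr))
  refine ⟨O, hON.trans Set.inter_subset_left, hOo, hqO, fun w hw => ?_, hC⟩
  have h1 := hF w (hON hw).2
  have h2 := hF q (Metric.mem_ball_self hr)
  refine ⟨h1.1, ?_⟩
  rw [← h1.2.2, ← h2.2.2, hOF w hw, Complex.add_re]

/-- The directions in which the leading term has negative real part form an open cone, and the chart
maps rays to curves tangent to them. -/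
lemma _root_.BenjaminOno.LocalOrder.eventually_R_lt (hc : u.IsPosImag) {q : ℂ} {k : ℕ} {α : ℂ}
    (h : LocalOrder u lam q k α) {ω : ℂ}
    (hω : ((-Complex.I * α / (k + 1)) * ω ^ (k + 1)).re < 0) :
    ∀ᶠ t : ℝ in 𝓝[>] 0, u.R lam (q + t * ω) < u.R lam q := by
  obtain ⟨φ, h0, hd, hN⟩ := h.exists_chart hc
  obtain ⟨O, -, hOo, hqO, hOF, -⟩ := hN Set.univ univ_mem
  set C : Set ℂ := {z | ((-Complex.I * α / (k + 1)) * z ^ (k + 1)).re < 0} with hC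
  have hCo : IsOpen C := isOpen_lt (by fun_prop) continuous_const
  have hcone : ∀ t : ℝ, 0 < t → ∀ z ∈ C, (t : ℂ) * z ∈ C := by
    intro t ht z hz
    have : (-Complex.I * α / (k + 1)) * ((t : ℂ) * z) ^ (k + 1) =
        ((t ^ (k + 1) : ℝ) : ℂ) * ((-Complex.I * α / (k + 1)) * z ^ (k + 1)) := by
      push_cast; ring
    simp only [hC, Set.mem_ofPred_eq] at hz ⊢
    rw [this, Complex.re_ofReal_mul]
    exact mul_neg_of_pos_of_neg (by positivity) hz
  have hO : ∀ᶠ t : ℝ in 𝓝[>] 0, q + t * ω ∈ O := by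
    have : ContinuousAt (fun t : ℝ => q + t * ω) 0 := by fun_prop
    refine (this.eventually_mem (hOo.mem_nhds (by simpa using hqO))).filter_mono nhdsWithin_le_nhds
  filter_upwards [eventually_chart_mem_cone h0 hd hCo hcone hω, hO] with t h1 h2
  rw [(hOF _ h2).2]
  have : ((-Complex.I * α / (k + 1)) * φ (q + t * ω) ^ (k + 1)).re < 0 := h1
  linarith

/-- `R` has no local minima. -/
lemma IsPosImag.exists_R_lt (hc : u.IsPosImag) (hlam : 0 < lam) {q : ℂ} (hq : ¬ u.IsPole q) {N : Set ℂ}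
    (hN : N ∈ 𝓝 q) : ∃ w ∈ N, u.R lam w < u.R lam q := by
  obtain ⟨k, α, h⟩ := exists_localOrder hlam hq
  have hk : ((k : ℂ) + 1) ≠ 0 := by exact_mod_cast k.succ_ne_zero
  have ha : -Complex.I * α / (k + 1) ≠ 0 := by simp [h.ne_zero, hk]
  -- A direction in which the leading term equals `-1`.
  obtain ⟨ω, hω⟩ := IsAlgClosed.exists_pow_nat_eq (-(-Complex.I * α / (k + 1))⁻¹) k.succ_pos
  have hlt := h.eventually_R_lt hc (ω := ω) (by rw [hω, mul_neg, mul_inv_cancel₀ ha]; simp)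
  have hmem : ∀ᶠ t : ℝ in 𝓝[>] 0, q + t * ω ∈ N := by
    have : ContinuousAt (fun t : ℝ => q + t * ω) 0 := by fun_prop
    exact (this.eventually_mem (by simpa using hN)).filter_mono nhdsWithin_le_nhds
  obtain ⟨t, h1, h2⟩ := (hlt.and hmem).exists
  exact ⟨_, h2, h1⟩

end RationalPotential

end BenjaminOno

/-! ### Sectors of descent of `R` -/

namespace BenjaminOno

/-- An open convex cone in the plane, the intersection of two half-planes. -/
def wedge (a b c d : ℝ) : Set ℂ := {z | 0 < a * z.re + b * z.im ∧ 0 < c * z.re + d * z.im}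

lemma isOpen_wedge (a b c d : ℝ) : IsOpen (wedge a b c d) := by
  have h : ∀ a b : ℝ, IsOpen {z : ℂ | 0 < a * z.re + b * z.im} := fun a b =>
    isOpen_lt continuous_const (by fun_prop)
  exact (h a b).inter (h c d)

lemma convex_wedge (a b c d : ℝ) : Convex ℝ (wedge a b c d) := by
  intro z hz w hw s t hs ht hst
  simp only [wedge, Set.mem_ofPred_eq, Complex.add_re, Complex.add_im, Complex.real_smul,
    Complex.re_ofReal_mul, Complex.im_ofReal_mul] at *
  have key : ∀ x y : ℝ, 0 < x → 0 < y → 0 < s * x + t * y := fun x y hx hy => by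
    rcases hs.eq_or_lt with rfl | hs
    · rw [zero_add] at hst; subst hst; simpa using hy
    · have : 0 ≤ t * y := by positivity
      have : 0 < s * x := by positivity
      linarith
  exact ⟨by have := key _ _ hz.1 hw.1; linarith, by have := key _ _ hz.2 hw.2; linarith⟩

lemma wedge_cone (a b c d : ℝ) : ∀ t : ℝ, 0 < t → ∀ z ∈ wedge a b c d,
    (t : ℂ) * z ∈ wedge a b c d := by
  intro t ht z hz
  simp only [wedge, Set.mem_ofPred_eq, Complex.re_ofReal_mul, Complex.im_ofReal_mul] at *
  exact ⟨by have := mul_pos ht hz.1; linarith, by have := mul_pos ht hz.2; linarith⟩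

namespace RationalPotential

variable {P : ℕ} {u : RationalPotential P} {lam : ℝ}

/-- In the chart `R - R q` is real-linear, so `{R < R q}` is a half-plane, written as a wedge with
two equal sides. -/
lemma exists_sector_regular (hc : u.IsPosImag) {q : ℂ} (hq : ¬ u.IsPole q)
    (hcr : ¬ u.IsCritical lam q) {N : Set ℂ} (hN : N ∈ 𝓝 q) :
    ∃ r > 0, ∃ S, IsOpen S ∧ IsPreconnected S ∧
      (∀ w ∈ S, w ∈ N ∧ ¬ u.IsPole w ∧ u.R lam w < u.R lam q) ∧
      ∀ w ∈ Metric.ball q r, u.R lam w < u.R lam q → w ∈ S := by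
  have h := localOrder_of_not_isCritical (lam := lam) hq hcr
  obtain ⟨φ, -, -, hφ⟩ := h.exists_chart hc
  obtain ⟨O, hON, hOo, hqO, hOR, hC⟩ := hφ N hN
  set a : ℂ := -Complex.I * (lam + u.toFun q) / ((0 : ℕ) + 1) with ha
  set C := wedge (-a.re) a.im (-a.re) a.im with hCdef
  have hmem : ∀ z, z ∈ C ↔ (a * z ^ (0 + 1)).re < 0 := by
    intro z
    simp only [hCdef, wedge, Set.mem_ofPred_eq, and_self, zero_add, pow_one, Complex.mul_re]
    constructor <;> intro h <;> linarith
  obtain ⟨hSo, hSp⟩ := hC C (isOpen_wedge _ _ _ _) (convex_wedge _ _ _ _)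
  obtain ⟨r, hr, hrO⟩ := Metric.isOpen_iff.1 hOo q hqO
  refine ⟨r, hr, _, hSo, hSp, fun w hw => ⟨hON hw.1, (hOR w hw.1).1, ?_⟩, fun w hw hlt =>
    ⟨hrO hw, ?_⟩⟩
  · rw [(hOR w hw.1).2]
    have := (hmem _).1 hw.2
    linarith
  · rw [(hOR w (hrO hw)).2] at hlt
    exact (hmem _).2 (by linarith)

/-- In the chart `R - R q` is the real part of a nondegenerate square, so `{R < R q}` consists of
two opposite right-angled wedges. The direction `v` is chosen before the neighbourhood `N`, so that
one pair of curves serves for all `N`. -/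
lemma exists_sectors_simple (hc : u.IsPosImag) {q : ℂ} (hcr : u.IsCritical lam q)
    (hd : deriv u.toFun q ≠ 0) :
    ∃ v : ℂ, v ≠ 0 ∧ ∀ N ∈ 𝓝 q, ∃ r > 0, ∃ S₁ S₂, IsOpen S₁ ∧ IsPreconnected S₁ ∧
      IsOpen S₂ ∧ IsPreconnected S₂ ∧
      (∀ w ∈ S₁ ∪ S₂, w ∈ N ∧ ¬ u.IsPole w ∧ u.R lam w < u.R lam q) ∧
      (∀ w ∈ Metric.ball q r, u.R lam w < u.R lam q → w ∈ S₁ ∪ S₂) ∧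
      ∀ᶠ t : ℝ in 𝓝[>] 0, q + t * v ∈ S₁ ∧ q - t * v ∈ S₂ := by
  have h := hcr.localOrder_one hd
  obtain ⟨φ, hφ0, hφd, hφ⟩ := h.exists_chart hc
  set a : ℂ := -Complex.I * deriv u.toFun q / ((1 : ℕ) + 1) with ha
  have ha0 : a ≠ 0 := by
    simp only [ha, ne_eq, div_eq_zero_iff, mul_eq_zero, hd, or_false, neg_eq_zero,
      Complex.I_ne_zero, false_or]
    norm_num
  -- With `b² = a`, the condition is `Re (bz)² < 0`, that is, `Im (bz) - Re (bz)` and `Im (bz) + Re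
  -- (bz)` have the same sign. The coefficients of the wedges are those of these two forms.
  obtain ⟨b, hb⟩ := IsAlgClosed.exists_pow_nat_eq a two_pos
  have hb0 : b ≠ 0 := by rintro rfl; exact ha0 (by rw [← hb]; simp)
  set C₁ := wedge (b.im - b.re) (b.re + b.im) (b.im + b.re) (b.re - b.im) with hC₁
  set C₂ := wedge (-(b.im - b.re)) (-(b.re + b.im)) (-(b.im + b.re)) (-(b.re - b.im)) with hC₂
  have hre : ∀ z : ℂ, (a * z ^ (1 + 1)).re =
      -(((b.im - b.re) * z.re + (b.re + b.im) * z.im) *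
        ((b.im + b.re) * z.re + (b.re - b.im) * z.im)) := by
    intro z
    have : a * z ^ (1 + 1) = (b * z) * (b * z) := by rw [← hb]; ring
    rw [this]
    simp only [Complex.mul_re, Complex.mul_im]
    ring
  have hmem : ∀ z, z ∈ C₁ ∪ C₂ ↔ (a * z ^ (1 + 1)).re < 0 := by
    intro z
    rw [hre]
    simp only [hC₁, hC₂, wedge, Set.mem_union, Set.mem_ofPred_eq]
    rw [neg_lt_zero, mul_pos_iff]
    refine or_congr Iff.rfl (and_congr ?_ ?_) <;> constructor <;> intro h <;> linarith
  -- The axis of the wedge: `b v = i`, where the square is `-1`.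
  refine ⟨Complex.I / b, div_ne_zero Complex.I_ne_zero hb0, fun N hN => ?_⟩
  obtain ⟨O, hON, hOo, hqO, hOR, hC⟩ := hφ N hN
  obtain ⟨hSo₁, hSp₁⟩ := hC C₁ (isOpen_wedge _ _ _ _) (convex_wedge _ _ _ _)
  obtain ⟨hSo₂, hSp₂⟩ := hC C₂ (isOpen_wedge _ _ _ _) (convex_wedge _ _ _ _)
  obtain ⟨r, hr, hrO⟩ := Metric.isOpen_iff.1 hOo q hqO
  refine ⟨r, hr, _, _, hSo₁, hSp₁, hSo₂, hSp₂, fun w hw => ?_, fun w hw hlt => ?_, ?_⟩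
  · rw [← Set.inter_union_distrib_left, ← Set.preimage_union] at hw
    refine ⟨hON hw.1, (hOR w hw.1).1, ?_⟩
    rw [(hOR w hw.1).2]
    have := (hmem _).1 hw.2
    linarith
  · rw [← Set.inter_union_distrib_left, ← Set.preimage_union]
    refine ⟨hrO hw, (hmem _).2 ?_⟩
    rw [(hOR w (hrO hw)).2] at hlt
    linarith
  · have hbI : b * (Complex.I / b) = Complex.I := by field_simp
    have him : b.re * (Complex.I / b).im + b.im * (Complex.I / b).re = 1 := by
      have := congrArg Complex.im hbI
      rwa [Complex.mul_im, Complex.I_im] at this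
    have hre' : b.re * (Complex.I / b).re - b.im * (Complex.I / b).im = 0 := by
      have := congrArg Complex.re hbI
      rwa [Complex.mul_re, Complex.I_re] at this
    have hv₁ : Complex.I / b ∈ C₁ := by
      constructor <;> linarith
    have hv₂ : -(Complex.I / b) ∈ C₂ := by
      constructor <;> simp only [Complex.neg_re, Complex.neg_im] <;> linarith
    have hO : ∀ ω : ℂ, ∀ᶠ t : ℝ in 𝓝[>] 0, q + t * ω ∈ O := fun ω => by
      have : ContinuousAt (fun t : ℝ => q + t * ω) 0 := by fun_prop
      exact (this.eventually_mem (hOo.mem_nhds (by simpa using hqO))).filter_mono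
        nhdsWithin_le_nhds
    filter_upwards [hO (Complex.I / b), hO (-(Complex.I / b)),
      eventually_chart_mem_cone hφ0 hφd (isOpen_wedge _ _ _ _) (wedge_cone _ _ _ _) hv₁,
      eventually_chart_mem_cone hφ0 hφd (isOpen_wedge _ _ _ _) (wedge_cone _ _ _ _) hv₂]
      with t h1 h2 h3 h4
    refine ⟨⟨h1, h3⟩, ?_⟩
    rw [show q - t * (Complex.I / b) = q + t * (-(Complex.I / b)) by ring]
    exact ⟨h2, h4⟩

/-- The sign conditions satisfied by `h'` at its real zeros, where it vanishes to order `k` and to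
leading order is `r (w - q) ^ k`. -/
def RealSign (k : ℕ) (r : ℝ) : Prop := (k = 1 ∧ r ≠ 0) ∨ (k = 2 ∧ 0 < r)

/-- In the chart `{R < 0}` is a union of wedges. Each is connected and misses the real axis, so it
lies in the half-plane of the sample direction `ωᵢ`. With one sample above and the others below the
axis, the upper part of `{R < 0}` is a single connected sector. -/
lemma exists_sector_real_aux (hc : u.IsPosImag) {q : ℝ} {k : ℕ} {α : ℂ}
    (h : LocalOrder u lam q k α) {a₀ b₀ c₀ d₀ a₁ b₁ c₁ d₁ a₂ b₂ c₂ d₂ : ℝ} {ω₀ ω₁ ω₂ : ℂ}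
    (hω₀ : ω₀ ∈ wedge a₀ b₀ c₀ d₀) (hω₁ : ω₁ ∈ wedge a₁ b₁ c₁ d₁) (hω₂ : ω₂ ∈ wedge a₂ b₂ c₂ d₂)
    (h₀ : 0 < ω₀.im) (h₁ : ω₁.im < 0) (h₂ : ω₂.im < 0)
    (hmem : ∀ z, z ∈ wedge a₀ b₀ c₀ d₀ ∪ (wedge a₁ b₁ c₁ d₁ ∪ wedge a₂ b₂ c₂ d₂) ↔
      ((-Complex.I * α / (k + 1)) * z ^ (k + 1)).re < 0) {N : Set ℂ} (hN : N ∈ 𝓝 (q : ℂ)) :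
    ∃ r > 0, ∃ S, IsOpen S ∧ IsPreconnected S ∧
      (∀ w ∈ S, w ∈ N ∧ ¬ u.IsPole w ∧ u.R lam w < 0 ∧ 0 < w.im) ∧
      (∀ w ∈ Metric.ball (q : ℂ) r, u.R lam w < 0 → 0 < w.im → w ∈ S) ∧ (q : ℂ) ∈ closure S := by
  obtain ⟨φ, hφ0, hφd, hφ⟩ := h.exists_chart hc
  obtain ⟨O, hON, hOo, hqO, hOR, hC⟩ := hφ N hN
  obtain ⟨r, hr, hrO⟩ := Metric.isOpen_iff.1 hOo q hqO
  have hR : ∀ w ∈ O, u.R lam w < 0 ↔ φ w ∈ wedge a₀ b₀ c₀ d₀ ∪ (wedge a₁ b₁ c₁ d₁ ∪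
      wedge a₂ b₂ c₂ d₂) := fun w hw => by
    rw [hmem, (hOR w hw).2, hc.R_ofReal, zero_add]
  have hO : ∀ ω : ℂ, Tendsto (fun t : ℝ => (q : ℂ) + t * ω) (𝓝[>] 0) (𝓝 (q : ℂ)) := fun ω => by
    have : ContinuousAt (fun t : ℝ => (q : ℂ) + t * ω) 0 := by fun_prop
    have := this.tendsto
    simp only [Complex.ofReal_zero, zero_mul, add_zero] at this
    exact this.mono_left nhdsWithin_le_nhds
  have him : ∀ S : Set ℂ, (∀ w ∈ S, u.R lam w < 0) → ∀ w ∈ S, w.im ≠ 0 := fun S hS w hw h0 => by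
    have := hS w hw
    rw [show w = ((w.re : ℝ) : ℂ) from Complex.ext rfl (by simpa using h0), hc.R_ofReal] at this
    exact lt_irrefl _ this
  have hpt : ∀ {a b c d : ℝ} {ω : ℂ}, ω ∈ wedge a b c d → ∀ᶠ t : ℝ in 𝓝[>] 0,
      0 < t ∧ (q : ℂ) + t * ω ∈ O ∩ φ ⁻¹' wedge a b c d := fun hω => by
    filter_upwards [(hO _).eventually_mem (hOo.mem_nhds hqO), self_mem_nhdsWithin,
      eventually_chart_mem_cone hφ0 hφd (isOpen_wedge _ _ _ _) (wedge_cone _ _ _ _) hω]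
      with t h1 h2 h3 using ⟨h2, h1, h3⟩
  have hlow : ∀ {a b c d : ℝ} {ω : ℂ}, ω ∈ wedge a b c d → ω.im < 0 →
      (∀ w ∈ O ∩ φ ⁻¹' wedge a b c d, u.R lam w < 0) →
      ∀ w ∈ O ∩ φ ⁻¹' wedge a b c d, w.im < 0 := fun hω hω0 hneg => by
    obtain ⟨t, ht, h1⟩ := (hpt hω).exists
    exact im_neg_of_isPreconnected (hC _ (isOpen_wedge _ _ _ _) (convex_wedge _ _ _ _)).2
      (him _ hneg) h1 (by simpa using mul_neg_of_pos_of_neg ht hω0)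
  obtain ⟨hSo, hSp⟩ := hC _ (isOpen_wedge a₀ b₀ c₀ d₀) (convex_wedge a₀ b₀ c₀ d₀)
  have hneg₀ : ∀ w ∈ O ∩ φ ⁻¹' wedge a₀ b₀ c₀ d₀, u.R lam w < 0 := fun w hw =>
    (hR w hw.1).2 (Or.inl hw.2)
  refine ⟨r, hr, _, hSo, hSp, fun w hw => ⟨hON hw.1, (hOR w hw.1).1, hneg₀ w hw, ?_⟩,
    fun w hw hlt hw0 => ⟨hrO hw, ?_⟩, ?_⟩
  · obtain ⟨t, ht, h1⟩ := (hpt hω₀).exists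
    exact im_pos_of_isPreconnected hSp (him _ hneg₀) h1 (by simpa using mul_pos ht h₀) w hw
  · rcases (hR w (hrO hw)).1 hlt with h3 | h3 | h3
    · exact h3
    · exact absurd (hlow hω₁ h₁ (fun v hv => (hR v hv.1).2 (Or.inr (Or.inl hv.2))) w
        ⟨hrO hw, h3⟩) hw0.not_gt
    · exact absurd (hlow hω₂ h₂ (fun v hv => (hR v hv.1).2 (Or.inr (Or.inr hv.2))) w
        ⟨hrO hw, h3⟩) hw0.not_gt
  · exact mem_closure_of_tendsto (hO ω₀) ((hpt hω₀).mono fun t ht => ht.2)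

/-- For a simple zero `R` behaves like `r xy`, negative in two opposite quadrants (the lower one is
passed twice to the auxiliary lemma). For a double zero it behaves like `(r/3) y (3x² - y²)`; with
`r > 0` only one of its three negative sectors of opening `π/3` lies above the axis, whereas `r < 0`
would give two. -/
lemma exists_sector_real (hc : u.IsPosImag) {q : ℝ} {k : ℕ} {r : ℝ} (hs : RealSign k r)
    (h : LocalOrder u lam q k r) {N : Set ℂ} (hN : N ∈ 𝓝 (q : ℂ)) :
    ∃ ρ > 0, ∃ S, IsOpen S ∧ IsPreconnected S ∧
      (∀ w ∈ S, w ∈ N ∧ ¬ u.IsPole w ∧ u.R lam w < 0 ∧ 0 < w.im) ∧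
      (∀ w ∈ Metric.ball (q : ℂ) ρ, u.R lam w < 0 → 0 < w.im → w ∈ S) ∧ (q : ℂ) ∈ closure S := by
  rcases hs with ⟨rfl, hr⟩ | ⟨rfl, hr⟩
  · have hre : ∀ z : ℂ, ((-Complex.I * r / ((1 : ℕ) + 1)) * z ^ (1 + 1)).re = r * (z.re * z.im) := by
      intro z
      have : (-Complex.I * r / ((1 : ℕ) + 1)) * z ^ (1 + 1) = ((r / 2 : ℝ) : ℂ) *
        (-Complex.I * (z * z)) := by push_cast; ring
      rw [this, Complex.re_ofReal_mul]
      simp only [Complex.mul_re, Complex.mul_im, Complex.neg_re, Complex.neg_im, Complex.I_re,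
        Complex.I_im]
      ring
    rcases hr.lt_or_gt with hr | hr
    · refine exists_sector_real_aux hc h (a₀ := 1) (b₀ := 0) (c₀ := 0) (d₀ := 1) (a₁ := -1)
        (b₁ := 0) (c₁ := 0) (d₁ := -1) (a₂ := -1) (b₂ := 0) (c₂ := 0) (d₂ := -1)
        (ω₀ := ⟨1, 1⟩) (ω₁ := ⟨-1, -1⟩) (ω₂ := ⟨-1, -1⟩) ?_ ?_ ?_ ?_ ?_ ?_ ?_ hN
      pick_goal 7
      · intro z
        rw [hre]
        simp only [wedge, Set.mem_union, Set.mem_ofPred_eq, one_mul, zero_mul, add_zero, zero_add,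
          neg_mul, Left.neg_pos_iff, or_self]
        constructor
        · rintro (h | h)
          · nlinarith [mul_pos h.1 h.2]
          · nlinarith [mul_pos_of_neg_of_neg h.1 h.2]
        · intro h
          have : 0 < z.re * z.im := by nlinarith
          rcases mul_pos_iff.1 this with h | h
          · left; exact h
          · right; exact h
      all_goals norm_num [wedge]
    · refine exists_sector_real_aux hc h (a₀ := -1) (b₀ := 0) (c₀ := 0) (d₀ := 1) (a₁ := 1)
        (b₁ := 0) (c₁ := 0) (d₁ := -1) (a₂ := 1) (b₂ := 0) (c₂ := 0) (d₂ := -1)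
        (ω₀ := ⟨-1, 1⟩) (ω₁ := ⟨1, -1⟩) (ω₂ := ⟨1, -1⟩) ?_ ?_ ?_ ?_ ?_ ?_ ?_ hN
      pick_goal 7
      · intro z
        rw [hre]
        simp only [wedge, Set.mem_union, Set.mem_ofPred_eq, one_mul, zero_mul, add_zero, zero_add,
          neg_mul, Left.neg_pos_iff, or_self]
        constructor
        · rintro (h | h)
          · nlinarith [mul_pos_of_neg_of_neg h.1 (neg_neg_of_pos h.2)]
          · nlinarith [mul_pos h.1 (neg_pos.2 h.2)]
        · intro h
          have : z.re * z.im < 0 := by nlinarith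
          rcases mul_neg_iff.1 this with h | h
          · right; exact h
          · left; exact h
      all_goals norm_num [wedge]
  · have hre : ∀ z : ℂ, ((-Complex.I * r / ((2 : ℕ) + 1)) * z ^ (2 + 1)).re =
        r / 3 * (z.im * (3 * z.re ^ 2 - z.im ^ 2)) := by
      intro z
      have : (-Complex.I * r / ((2 : ℕ) + 1)) * z ^ (2 + 1) = ((r / 3 : ℝ) : ℂ) *
        (-Complex.I * (z * z * z)) := by push_cast; ring
      rw [this, Complex.re_ofReal_mul]
      simp only [Complex.mul_re, Complex.mul_im, Complex.neg_re, Complex.neg_im, Complex.I_re,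
        Complex.I_im]
      ring
    have hs0 : 0 < √(3 : ℝ) := by positivity
    have hs3 : √(3 : ℝ) * √3 = 3 := Real.mul_self_sqrt (by norm_num)
    refine exists_sector_real_aux hc h (a₀ := √3) (b₀ := 1) (c₀ := -√3) (d₀ := 1) (a₁ := -√3)
        (b₁ := 1) (c₁ := 0) (d₁ := -1) (a₂ := √3) (b₂ := 1) (c₂ := 0) (d₂ := -1)
        (ω₀ := ⟨0, 1⟩) (ω₁ := ⟨-2, -1⟩) (ω₂ := ⟨2, -1⟩) ?_ ?_ ?_ ?_ ?_ ?_ ?_ hN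
    pick_goal 7
    · intro z
      rw [hre]
      simp only [wedge, Set.mem_union, Set.mem_ofPred_eq, one_mul, zero_mul, zero_add,
        neg_mul, Left.neg_pos_iff]
      have hfac : z.im * (3 * z.re ^ 2 - z.im ^ 2) =
          -(z.im * ((√3 * z.re + z.im) * (-(√3 * z.re) + z.im))) := by
        linear_combination (-(z.im * z.re ^ 2)) * hs3
      rw [hfac]
      set A := √3 * z.re with hA
      have hr3 : 0 < r / 3 := by positivity
      have hiff : r / 3 * -(z.im * ((A + z.im) * (-A + z.im))) < 0 ↔
          0 < z.im * ((A + z.im) * (-A + z.im)) := by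
        constructor <;> intro h <;> nlinarith
      rw [hiff]
      constructor
      · rintro (h | h | h)
        · have : 0 < z.im := by linarith [h.1, h.2]
          exact mul_pos this (mul_pos h.1 h.2)
        · exact mul_pos_of_neg_of_neg h.2 (mul_neg_of_neg_of_pos (by linarith [h.1, h.2]) h.1)
        · exact mul_pos_of_neg_of_neg h.2 (mul_neg_of_pos_of_neg h.1 (by linarith [h.1, h.2]))
      · intro h
        rcases mul_pos_iff.1 h with ⟨h1, h2⟩ | ⟨h1, h2⟩
        · left
          rcases mul_pos_iff.1 h2 with h3 | h3
          · exact h3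
          · linarith [h3.1, h3.2]
        · right
          rcases mul_neg_iff.1 h2 with h3 | h3
          · right; exact ⟨h3.1, h1⟩
          · left; exact ⟨h3.2, h1⟩
    all_goals norm_num [wedge]
    · nlinarith
    · nlinarith

end RationalPotential

end BenjaminOno

/-! ### The real axis and the Klaus–Shaw condition -/

namespace BenjaminOno.RationalPotential

variable {P : ℕ} {u : RationalPotential P} {lam : ℝ}

lemma isCritical_ofReal_iff {x : ℝ} : u.IsCritical lam x ↔ lam + u.onReal x = 0 := by
  rw [IsCritical, toFun_ofReal]
  constructor
  · rintro ⟨-, h⟩; exact_mod_cast h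
  · exact fun h => ⟨not_isPole_ofReal x, by exact_mod_cast h⟩

lemma continuous_onReal : Continuous u.onReal := by
  rw [continuous_iff_continuousAt]
  intro x
  have := (analyticAt_toFun (not_isPole_ofReal (u := u) x)).continuousAt
  exact Complex.continuous_re.continuousAt.comp
    (ContinuousAt.comp (f := fun x : ℝ => (x : ℂ)) this Complex.continuous_ofReal.continuousAt)

lemma tendsto_onReal_cocompact : Tendsto u.onReal (cocompact ℝ) (𝓝 0) := by
  have h1 : Tendsto (fun x : ℝ => (x : ℂ)) (cocompact ℝ) (cocompact ℂ) :=
    Complex.isometry_ofReal.isClosedEmbedding.tendsto_cocompact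
  have h2 := (Complex.continuous_re.tendsto 0).comp (tendsto_toFun_cocompact (u := u) |>.comp h1)
  rw [Complex.zero_re] at h2
  exact h2

/-- A negative Klaus–Shaw potential is strictly quasiconvex. -/
lemma IsKlausShaw.lt_max (hKS : u.IsKlausShaw) (hneg : ∀ x, u.onReal x < 0) {x y z : ℝ}
    (hxy : x < y) (hyz : y < z) : u.onReal y < max (u.onReal x) (u.onReal z) := by
  obtain ⟨xc, hl, hr⟩ := hKS
  have hbot : Tendsto u.onReal atBot (𝓝 0) := tendsto_onReal_cocompact.mono_left atBot_le_cocompact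
  have htop : Tendsto u.onReal atTop (𝓝 0) := tendsto_onReal_cocompact.mono_left atTop_le_cocompact
  have hl' : StrictAntiOn u.onReal (Set.Iio xc) := by
    refine hl.resolve_left fun h => ?_
    -- If `u₀` increased on the left, it would lie above its limit `0` at `-∞`, contradicting
    -- negativity; the right side is symmetric.
    have : (0 : ℝ) ≤ u.onReal (xc - 1) := by
      refine le_of_tendsto hbot ?_
      filter_upwards [eventually_lt_atBot (xc - 1)] with t ht
      exact (h (by simp; linarith) (by simp) ht).le
    exact absurd (hneg (xc - 1)) this.not_gt
  have hr' : StrictMonoOn u.onReal (Set.Ioi xc) := by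
    refine hr.resolve_right fun h => ?_
    have : (0 : ℝ) ≤ u.onReal (xc + 1) := by
      refine le_of_tendsto htop ?_
      filter_upwards [eventually_gt_atTop (xc + 1)] with t ht
      exact (h (by simp) (by simp; linarith) ht).le
    exact absurd (hneg (xc + 1)) this.not_gt
  rcases lt_trichotomy y xc with h | rfl | h
  · exact lt_max_of_lt_left (hl' (hxy.trans h) h hxy)
  -- At the turning point itself only the one-sided limit is available, so the comparison goes
  -- through a midpoint.
  · have hm : (x + y) / 2 < y := by linarith
    refine lt_max_of_lt_left (lt_of_le_of_lt ?_ (hl' hxy hm (by linarith : x < (x + y) / 2)))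
    have ht : Tendsto u.onReal (𝓝[<] y) (𝓝 (u.onReal y)) :=
      continuous_onReal.continuousAt.tendsto.mono_left nhdsWithin_le_nhds
    refine le_of_tendsto ht ?_
    filter_upwards [Ioo_mem_nhdsLT hm] with t ht
    exact (hl' hm ht.2 ht.1).le
  · exact lt_max_of_lt_right (hr' h (h.trans hyz) hyz)

/-- Sublevel sets of a quasiconvex function are intervals. Along this interval `{R < 0}` touches the
axis from above, and its connectedness is the reason why one real node is enough. -/
lemma IsKlausShaw.ordConnected (hKS : u.IsKlausShaw) (hneg : ∀ x, u.onReal x < 0) (lam : ℝ) :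
    {x | lam + u.onReal x ≤ 0}.OrdConnected := by
  refine ⟨fun x hx z hz y hy => ?_⟩
  rcases hy.1.eq_or_lt with rfl | h1
  · exact hx
  rcases hy.2.eq_or_lt with rfl | h2
  · exact hz
  have := hKS.lt_max hneg h1 h2
  have h3 : max (u.onReal x) (u.onReal z) ≤ -lam := max_le
    (by have : lam + u.onReal x ≤ 0 := hx; linarith)
    (by have : lam + u.onReal z ≤ 0 := hz; linarith)
  show lam + u.onReal y ≤ 0
  linarith

lemma deriv_toFun_conj (w : ℂ) : deriv u.toFun (conj w) = conj (deriv u.toFun w) := by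
  have h : u.toFun = conj ∘ u.toFun ∘ conj := by
    funext v; simp [toFun_conj]
  have := congrFun (deriv_conj_conj (f := u.toFun)) (conj w)
  rw [← h] at this
  simpa using this

lemma deriv_toFun_ofReal (x : ℝ) : ∃ r : ℝ, deriv u.toFun (x : ℂ) = r := by
  have := deriv_toFun_conj (u := u) (x : ℂ)
  rw [Complex.conj_ofReal] at this
  exact ⟨_, (Complex.conj_eq_iff_re.1 this.symm).symm⟩

lemma iteratedDeriv_two_toFun_ofReal (x : ℝ) :
    ∃ r : ℝ, iteratedDeriv 2 u.toFun (x : ℂ) = r := by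
  have h : deriv u.toFun = conj ∘ deriv u.toFun ∘ conj := by
    funext v; simp [deriv_toFun_conj]
  have := congrFun (deriv_conj_conj (f := deriv u.toFun)) (x : ℂ)
  rw [← h, Function.comp_apply, Function.comp_apply, Complex.conj_ofReal] at this
  rw [iteratedDeriv_succ, iteratedDeriv_one]
  exact ⟨_, (Complex.conj_eq_iff_re.1 this.symm).symm⟩

/-- The sign of `h'` on the real axis near one of its zeros. -/
lemma _root_.BenjaminOno.LocalOrder.exists_real_factor {q : ℝ} {k : ℕ} {r : ℝ}
    (h : LocalOrder u lam q k r) : ∃ g : ℝ → ℝ, Tendsto g (𝓝 q) (𝓝 r) ∧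
      ∀ᶠ x in 𝓝 q, lam + u.onReal x = (x - q) ^ k * g x := by
  obtain ⟨-, -, g, hg, hgq, hge⟩ := h
  have hcoe : Tendsto (fun x : ℝ => (x : ℂ)) (𝓝 q) (𝓝 (q : ℂ)) :=
    Complex.continuous_ofReal.tendsto q
  refine ⟨fun x => (g x).re, ?_, ?_⟩
  · have := ((Complex.continuous_re.tendsto _).comp hg.continuousAt).comp hcoe
    rw [hgq] at this
    exact this
  · filter_upwards [hcoe.eventually hge] with x hx
    have := congrArg Complex.re hx
    rw [toFun_ofReal, Complex.add_re, Complex.ofReal_re, Complex.ofReal_re,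
      ← Complex.ofReal_sub, ← Complex.ofReal_pow, Complex.re_ofReal_mul] at this
    exact this

/-- A double zero of `h'` with negative leading coefficient would be a strict local maximum of `u₀`,
which quasiconvexity forbids. Reality of the coefficients comes from the symmetry of `u₀` under
conjugation. -/
lemma exists_realSign (hKS : u.IsKlausShaw) (hneg : ∀ x, u.onReal x < 0)
    (hreal : ∀ x : ℝ, u.IsCritical lam (x : ℂ) → deriv u.toFun (x : ℂ) = 0 →
      iteratedDeriv 2 u.toFun (x : ℂ) ≠ 0) {q : ℝ} (hq : u.IsCritical lam q) :
    ∃ k r, RealSign k r ∧ LocalOrder u lam q k r := by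
  obtain ⟨r, hr⟩ := deriv_toFun_ofReal (u := u) q
  by_cases hr0 : r = 0
  · obtain ⟨s, hs⟩ := iteratedDeriv_two_toFun_ofReal (u := u) q
    have hd0 : deriv u.toFun q = 0 := by rw [hr, hr0]; simp
    have hL := hq.localOrder_two hd0 (hreal q hq hd0)
    have hs0 : s ≠ 0 := fun h => hreal q hq hd0 (by rw [hs, h]; simp)
    rw [hs, show (s : ℂ) / 2 = ((s / 2 : ℝ) : ℂ) by push_cast; rfl] at hL
    refine ⟨2, s / 2, Or.inr ⟨rfl, ?_⟩, hL⟩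
    by_contra! hneg'
    have hlt : s / 2 < 0 := lt_of_le_of_ne hneg' (by simpa using hs0)
    obtain ⟨g, hg, hge⟩ := hL.exists_real_factor
    obtain ⟨δ, hδ, hball⟩ := Metric.eventually_nhds_iff.1 (hge.and (hg.eventually_lt_const hlt))
    have hval : lam + u.onReal q = 0 := isCritical_ofReal_iff.1 hq
    have key : ∀ x, x ≠ q → |x - q| < δ → u.onReal x < u.onReal q := fun x hx hd => by
      obtain ⟨h1, h2⟩ := hball (y := x) (by rwa [Real.dist_eq])
      have h3 : 0 < (x - q) ^ 2 := by have := sub_ne_zero.2 hx; positivity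
      nlinarith
    have h1 := key (q - δ / 2) (by linarith) (by rw [abs_lt]; constructor <;> linarith)
    have h2 := key (q + δ / 2) (by linarith) (by rw [abs_lt]; constructor <;> linarith)
    exact absurd (hKS.lt_max hneg (x := q - δ / 2) (y := q) (z := q + δ / 2) (by linarith)
      (by linarith)) (max_lt h1 h2).not_gt
  · have hd : deriv u.toFun q ≠ 0 := by rw [hr]; exact_mod_cast hr0
    have hL := hq.localOrder_one hd
    rw [hr] at hL
    exact ⟨1, r, Or.inl ⟨rfl, hr0⟩, hL⟩

variable (u lam) in
/-- `q` is the leftmost real critical point. -/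
def IsLeftCritical (q : ℝ) : Prop := u.IsCritical lam q ∧ ∀ x < q, 0 < lam + u.onReal x

lemma exists_isLeftCritical (hlam : 0 < lam) {x : ℝ} (hx : lam + u.onReal x ≤ 0) :
    ∃ q ≤ x, u.IsLeftCritical lam q := by
  have hbot : Tendsto (fun x => lam + u.onReal x) atBot (𝓝 (lam + 0)) :=
    (tendsto_onReal_cocompact.mono_left atBot_le_cocompact).const_add lam
  have hcont : Continuous fun x => lam + u.onReal x := continuous_const.add continuous_onReal
  set S : Set ℝ := {x | lam + u.onReal x ≤ 0} with hS
  have hSc : IsClosed S := isClosed_le hcont continuous_const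
  have hSb : BddBelow S := by
    obtain ⟨a, ha⟩ := eventually_atBot.1 (hbot.eventually_const_lt (show 0 < lam + 0 by simpa))
    refine ⟨a, fun t ht => ?_⟩
    by_contra! h
    exact absurd ht (not_le.2 (ha t h.le))
  have hmem : sInf S ∈ S := hSc.csInf_mem ⟨x, hx⟩ hSb
  have hlt : ∀ t < sInf S, 0 < lam + u.onReal t := fun t ht => by
    by_contra! h
    exact absurd (csInf_le hSb h) ht.not_ge
  refine ⟨sInf S, csInf_le hSb hx, isCritical_ofReal_iff.2 (le_antisymm hmem ?_), hlt⟩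
  have ht : Tendsto (fun x => lam + u.onReal x) (𝓝[<] (sInf S)) (𝓝 (lam + u.onReal (sInf S))) :=
    hcont.continuousAt.tendsto.mono_left nhdsWithin_le_nhds
  exact ge_of_tendsto ht (by filter_upwards [self_mem_nhdsWithin] with t ht using (hlt t ht).le)

/-- To the left of `q` the function `h'` is positive, so a simple zero has negative slope. -/
lemma IsLeftCritical.sign {q : ℝ} (hq : u.IsLeftCritical lam q) {k : ℕ} {r : ℝ}
    (hs : RealSign k r) (h : LocalOrder u lam q k r) : (k = 1 ∧ r < 0) ∨ (k = 2 ∧ 0 < r) := by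
  refine hs.imp_left fun ⟨hk, hr⟩ => ⟨hk, ?_⟩
  subst hk
  by_contra! hr'
  have hpos : 0 < r := lt_of_le_of_ne hr' hr.symm
  obtain ⟨g, hg, hge⟩ := h.exists_real_factor
  have h1 := (hge.and (hg.eventually_const_lt hpos)).filter_mono (nhdsWithin_le_nhds (s := Set.Iio q))
  obtain ⟨x, ⟨hx1, hx2⟩, hx3⟩ := (h1.and self_mem_nhdsWithin).exists
  have := hq.2 x hx3
  rw [hx1, pow_one] at this
  have h4 : x - q < 0 := sub_neg.2 hx3
  nlinarith

/-- `Re h' > 0` in a wedge to the lower left of the leftmost real critical point. -/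
lemma IsLeftCritical.exists_wedge {q : ℝ} (hq : u.IsLeftCritical lam q) {k : ℕ} {r : ℝ}
    (hs : RealSign k r) (h : LocalOrder u lam q k r) :
    ∃ τ > 0, ∀ x y : ℝ, 0 < x → x ≤ τ → 0 ≤ y → y ≤ x / 2 →
      ¬ u.IsPole (((q - x : ℝ) : ℂ) + (-y : ℝ) * Complex.I) ∧
      0 < lam + (u.toFun (((q - x : ℝ) : ℂ) + (-y : ℝ) * Complex.I)).re := by
  have hsign := hq.sign hs h
  obtain ⟨-, hr0, g, hg, hgq, hge⟩ := h
  have hr : 0 < |r| / 4 := by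
    have : r ≠ 0 := by exact_mod_cast hr0
    positivity
  -- With relative error `1/4` and slope at most `1/2`, the main term wins in both orders: `1 > 3/8`
  -- for `k = 1` and `3/4 > 5/16` for `k = 2`, in units of `|r| x ^ k`.
  have hgt : ∀ᶠ w in 𝓝 (q : ℂ), ‖g w - r‖ < |r| / 4 := by
    have h1 : Tendsto (fun w => ‖g w - r‖) (𝓝 (q : ℂ)) (𝓝 0) := by
      have := (hg.continuousAt.sub (continuousAt_const (y := (r : ℂ)))).norm.tendsto
      simpa [hgq] using this
    exact h1.eventually_lt_const hr
  obtain ⟨δ, hδ, hball⟩ := Metric.eventually_nhds_iff.1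
    (hge.and (hgt.and (eventually_not_isPole (not_isPole_ofReal (u := u) q))))
  refine ⟨δ / 2, by positivity, fun x y hx hxδ hy hyx => ?_⟩
  set s : ℂ := ⟨-x, -y⟩ with hsdef
  have hw : ((q - x : ℝ) : ℂ) + (-y : ℝ) * Complex.I = q + s := by
    apply Complex.ext <;> simp [hsdef, sub_eq_add_neg]
  have hsn : ‖s‖ ^ 2 = x ^ 2 + y ^ 2 := by
    rw [Complex.sq_norm, Complex.normSq_apply]; simp [hsdef]; ring
  have hsn1 : ‖s‖ ≤ 3 / 2 * x := by
    apply le_of_sq_le_sq _ (by positivity)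
    rw [hsn]; nlinarith
  rw [hw]
  obtain ⟨h1, h2, h3⟩ := hball (y := (q : ℂ) + s) (by
    rw [dist_eq_norm, add_sub_cancel_left]; linarith)
  refine ⟨h3, ?_⟩
  have hre : lam + (u.toFun (q + s)).re = (s ^ k * g (q + s)).re := by
    have := congrArg Complex.re h1
    rw [add_sub_cancel_left] at this
    rw [← this]; simp
  rw [hre]
  have hdec : s ^ k * g (q + s) = r * s ^ k + s ^ k * (g (q + s) - r) := by ring
  have herr : |(s ^ k * (g (q + s) - r)).re| ≤ ‖s‖ ^ k * (|r| / 4) := by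
    refine (Complex.abs_re_le_norm _).trans ?_
    rw [norm_mul, norm_pow]
    gcongr
  rw [hdec, Complex.add_re, Complex.re_ofReal_mul]
  have herr' := (abs_le.1 herr).1
  rcases hsign with ⟨rfl, hr⟩ | ⟨rfl, hr⟩
  · rw [abs_of_neg hr] at herr'
    simp only [pow_one] at herr' ⊢
    have : s.re = -x := rfl
    rw [this]
    nlinarith
  · rw [abs_of_pos hr, hsn] at herr'
    have : (s ^ 2).re = x ^ 2 - y ^ 2 := by rw [sq, Complex.mul_re]; simp [hsdef]; ring
    rw [this]
    have hy2 : y ^ 2 ≤ x ^ 2 / 4 := by nlinarith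
    have hx2 : 0 < x ^ 2 := by positivity
    nlinarith

/-- The direction `1 + 2i` serves both cases: it lies in the first quadrant, where `r xy < 0`, and
has slope `2 > √3`, so that `3x² - y² < 0`. -/
lemma IsLeftCritical.eventually_R_neg (hc : u.IsPosImag) {q : ℝ} (hq : u.IsLeftCritical lam q)
    {k : ℕ} {r : ℝ} (hs : RealSign k r) (h : LocalOrder u lam q k r) :
    ∀ᶠ t : ℝ in 𝓝[>] 0, u.R lam (q + t * ⟨1, 2⟩) < 0 := by
  have hsign := hq.sign hs h
  refine (h.eventually_R_lt hc (ω := ⟨1, 2⟩) ?_).mono fun t ht => by rwa [hc.R_ofReal] at ht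
  rcases hsign with ⟨rfl, hr⟩ | ⟨rfl, hr⟩
  · have : (-Complex.I * r / ((1 : ℕ) + 1)) * (⟨1, 2⟩ : ℂ) ^ (1 + 1) = ((r / 2 : ℝ) : ℂ) *
        (-Complex.I * (⟨1, 2⟩ * ⟨1, 2⟩)) := by push_cast; ring
    rw [this, Complex.re_ofReal_mul]
    simp [Complex.mul_re, Complex.mul_im]
    linarith
  · have : (-Complex.I * r / ((2 : ℕ) + 1)) * (⟨1, 2⟩ : ℂ) ^ (2 + 1) = ((r / 3 : ℝ) : ℂ) *
        (-Complex.I * (⟨1, 2⟩ * ⟨1, 2⟩ * ⟨1, 2⟩)) := by push_cast; ring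
    rw [this, Complex.re_ofReal_mul]
    simp [Complex.mul_re, Complex.mul_im]
    linarith

end BenjaminOno.RationalPotential

/-! ### Descent to a well or to `-i∞` -/

namespace BenjaminOno.RationalPotential

variable {P : ℕ} {u : RationalPotential P} {lam : ℝ}

variable (u) in
/-- `w` is connected within `M`, along segments, to one of the `zₚ` or to `-i∞`. -/
inductive Reach (M : Set ℂ) : ℂ → Prop
  | well {w : ℂ} (k : Fin P) (hne : w ≠ u.z k)
      (h : ∀ s : ℝ, 0 < s → s ≤ 1 → u.z k + s * (w - u.z k) ∈ M) : Reach M w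
  | down {w : ℂ} (hre : w.re ≤ u.leftAbscissa) (h : ∀ s : ℝ, 0 ≤ s → w - s * Complex.I ∈ M) :
      Reach M w
  | step {w w' : ℂ} (h : segment ℝ w w' ⊆ M) (hne : w ≠ w') (hr : Reach M w') : Reach M w

lemma Reach.mono {M M' : Set ℂ} (hM : M ⊆ M') {w : ℂ} (hw : Reach u M w) : Reach u M' w := by
  induction hw with
  | well k hne h => exact Reach.well k hne fun s h1 h2 => hM (h s h1 h2)
  | down hre h => exact Reach.down hre fun s h1 => hM (h s h1)
  | step h hne _ ih => exact Reach.step (h.trans hM) hne ih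

variable (u) in
/-- The part of `{R < c}` in which the contours run; `-i∞` is accessible if `c` is positive. -/
def region (lam c ρ : ℝ) : Set ℂ :=
  {w | ¬ u.IsPole w ∧ ¬ u.IsCritical lam w ∧ u.R lam w < c ∧ (0 < w.im ∨ (0 < c ∧ w.re < -ρ))}

lemma leftAbscissa_lt (p : Fin P) : u.leftAbscissa < (u.z p).re := by
  have hP : 0 < P := p.pos
  rw [leftAbscissa, dif_pos hP]
  have : (u.z ⟨0, hP⟩).re ≤ (u.z p).re := u.z_re_strictMono.monotone (Nat.zero_le _)
  linarith

lemma IsFarRadius.mono {ρ ρ' : ℝ} (h : u.IsFarRadius lam ρ) (hρ : ρ ≤ ρ') :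
    u.IsFarRadius lam ρ' :=
  ⟨h.1.trans_le hρ, fun w hw => h.2 w (hρ.trans hw)⟩

lemma IsFarRadius.not_isCritical {ρ : ℝ} (h : u.IsFarRadius lam ρ) {w : ℂ} (hw : ρ ≤ |w.re|) :
    ¬ u.IsCritical lam w := fun hcr => by
  have h1 := (h.of_re hw).2
  have := congrArg Complex.re hcr.2
  rw [Complex.add_re, Complex.ofReal_re, Complex.zero_re] at this
  linarith

lemma IsPosImag.R_lt_R_far (hc : u.IsPosImag) {ρ : ℝ} (h : u.IsFarRadius lam ρ) {x y₁ y₂ : ℝ}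
    (hx : ρ ≤ |x|) (hy : y₁ < y₂) :
    u.R lam (x + y₁ * Complex.I) < u.R lam (x + y₂ * Complex.I) :=
  hc.R_lt_R_vertical lam x hy fun y _ => h.of_re (by simpa using hx)

lemma IsPosImag.R_pos_far (hc : u.IsPosImag) {ρ : ℝ} (h : u.IsFarRadius lam ρ) {w : ℂ}
    (hx : ρ ≤ |w.re|) (hy : 0 < w.im) : 0 < u.R lam w := by
  have := hc.R_lt_R_far h hx hy
  rwa [Complex.re_add_im, Complex.ofReal_zero, zero_mul, add_zero, hc.R_ofReal] at this

/-- A low strip above the real axis in which `R < c` and which has no critical points. -/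
lemma IsPosImag.exists_low_strip (hc : u.IsPosImag) (hlam : 0 < lam) {c : ℝ} (h0 : 0 < c) (ρ : ℝ) :
    ∃ η > 0, ∀ w : ℂ, |w.re| ≤ ρ → 0 < w.im → w.im ≤ η →
      ¬ u.IsPole w ∧ ¬ u.IsCritical lam w ∧ u.R lam w < c := by
  have hloc : ∀ x ∈ Set.Icc (-ρ) ρ, ∀ᶠ p : ℝ × ℝ in 𝓝 0 ×ˢ 𝓝 x, 0 < p.1 →
      ¬ u.IsPole (p.2 + p.1 * Complex.I) ∧ ¬ u.IsCritical lam (p.2 + p.1 * Complex.I) ∧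
      u.R lam (p.2 + p.1 * Complex.I) < c := by
    intro x _
    have hcont : Tendsto (fun p : ℝ × ℝ => (p.2 : ℂ) + p.1 * Complex.I) (𝓝 0 ×ˢ 𝓝 x)
        (𝓝 (x : ℂ)) := by
      rw [← nhds_prod_eq]
      have : ContinuousAt (fun p : ℝ × ℝ => (p.2 : ℂ) + p.1 * Complex.I) (0, x) := by fun_prop
      simpa [ContinuousAt] using this
    have h1 := hcont.eventually (eventually_not_isPole (not_isPole_ofReal (u := u) x))
    have h2 := hcont.eventually ((hc.continuousAt_R lam (not_isPole_ofReal (u := u) x)).eventually_lt_const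
      (by rwa [hc.R_ofReal]))
    have hfin : {w | u.IsCritical lam w ∧ w ≠ x}.Finite := (finite_isCritical hlam).subset fun _ h => h.1
    have h3 := hcont.eventually (hfin.isClosed.isOpen_compl.mem_nhds (x := (x : ℂ)) (by simp))
    filter_upwards [h1, h2, h3] with p h1 h2 h3 hp
    refine ⟨h1, fun hcr => h3 ⟨hcr, fun he => ?_⟩, h2⟩
    have := congrArg Complex.im he
    simp at this
    linarith
  -- Compactness of the real interval turns the local statements at points of the axis, where `R = 0
  -- < c`, into a strip of uniform height.
  have hall := isCompact_Icc.eventually_forall_of_forall_eventually (x₀ := (0 : ℝ)) (K := Set.Icc (-ρ) ρ)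
    (P := fun y x => 0 < y → ¬ u.IsPole (x + y * Complex.I) ∧ ¬ u.IsCritical lam (x + y * Complex.I) ∧
      u.R lam (x + y * Complex.I) < c) (by
      intro x hx
      have := hloc x hx
      rwa [← nhds_prod_eq] at this)
  obtain ⟨δ, hδ, hball⟩ := Metric.eventually_nhds_iff.1 hall
  refine ⟨δ / 2, by positivity, fun w hre him himη => ?_⟩
  have := hball (y := w.im) (by rw [dist_zero_right, Real.norm_eq_abs, abs_of_pos him]; linarith)
    w.re (abs_le.1 hre) him
  rwa [Complex.re_add_im] at this

lemma segment_vertical {x y₁ y₂ : ℝ} {w : ℂ}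
    (hw : w ∈ segment ℝ ((x : ℂ) + y₁ * Complex.I) (x + y₂ * Complex.I)) (h : y₁ ≤ y₂) :
    ∃ y, y₁ ≤ y ∧ y ≤ y₂ ∧ w = x + y * Complex.I := by
  rw [segment_eq_image_lineMap] at hw
  obtain ⟨t, ⟨h0, h1⟩, rfl⟩ := hw
  refine ⟨y₁ + t * (y₂ - y₁), by nlinarith, by nlinarith, ?_⟩
  simp [AffineMap.lineMap_apply]
  ring

lemma segment_horizontal {x₁ x₂ y : ℝ} {w : ℂ}
    (hw : w ∈ segment ℝ ((x₁ : ℂ) + y * Complex.I) (x₂ + y * Complex.I)) (h : x₁ ≤ x₂) :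
    ∃ x, x₁ ≤ x ∧ x ≤ x₂ ∧ w = x + y * Complex.I := by
  rw [segment_eq_image_lineMap] at hw
  obtain ⟨t, ⟨h0, h1⟩, rfl⟩ := hw
  refine ⟨x₁ + t * (x₂ - x₁), by nlinarith, by nlinarith, ?_⟩
  simp [AffineMap.lineMap_apply]
  ring

section Regions
variable {ρ c : ℝ}

/-- Far to the left `Re h' > 0`, so moving straight down decreases `R` and meets no critical point.
-/
lemma IsPosImag.reach_far_left (hc : u.IsPosImag) (h : u.IsFarRadius lam ρ)
    (hρ : -ρ ≤ u.leftAbscissa) (h0 : 0 < c) {w : ℂ} (hw : w.re < -ρ) (hR : u.R lam w < c) :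
    Reach u (u.region lam c ρ) w := by
  have hab : ρ ≤ |w.re| := by rw [le_abs]; right; linarith
  refine Reach.down (hw.le.trans hρ) fun s hs => ?_
  have hre : (w - s * Complex.I).re = w.re := by simp
  refine ⟨(h.of_re (by rwa [hre])).1, h.not_isCritical (by rwa [hre]), ?_,
    Or.inr ⟨h0, by rwa [hre]⟩⟩
  rcases hs.eq_or_lt with rfl | hs
  · simpa using hR
  · have := hc.R_lt_R_far h hab (show w.im - s < w.im by linarith)
    rw [Complex.re_add_im] at this
    have h2 : w - s * Complex.I = w.re + ((w.im - s : ℝ) : ℂ) * Complex.I := by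
      apply Complex.ext <;> simp
    rw [h2]; linarith

/-- Within a strip just above the axis, where `R < c`, one can travel horizontally to abscissa `-(ρ
+ 1)` and then go down. This passage needs `c > 0`. -/
lemma IsPosImag.reach_low_strip (hc : u.IsPosImag) (h : u.IsFarRadius lam ρ)
    (hρ : -ρ ≤ u.leftAbscissa) (h0 : 0 < c) {η : ℝ}
    (hstrip : ∀ w : ℂ, |w.re| ≤ ρ + 1 → 0 < w.im → w.im ≤ η →
      ¬ u.IsPole w ∧ ¬ u.IsCritical lam w ∧ u.R lam w < c) {w : ℂ} (hw0 : 0 < w.im)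
    (hwη : w.im ≤ η) (hre : |w.re| ≤ ρ + 1) : Reach u (u.region lam c ρ) w := by
  have hρ0 := h.1
  rcases lt_or_ge w.re (-ρ) with hlt | hge
  · exact hc.reach_far_left h hρ h0 hlt (hstrip w hre hw0 hwη).2.2
  have hl : |(((-(ρ + 1) : ℝ) : ℂ) + w.im * Complex.I).re| ≤ ρ + 1 := by
    simp only [Complex.add_re, Complex.ofReal_re, Complex.mul_re, Complex.I_re, mul_zero,
      Complex.ofReal_im, Complex.I_im, mul_one, sub_self, add_zero]
    rw [abs_neg, abs_of_pos (by linarith)]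
  refine Reach.step (w' := ((-(ρ + 1) : ℝ) : ℂ) + w.im * Complex.I) ?_ ?_
    (hc.reach_far_left h hρ h0 (by simp) (hstrip _ hl (by simpa using hw0) (by simpa using hwη)).2.2)
  · intro v hv
    rw [segment_symm, ← Complex.re_add_im w] at hv
    simp only [Complex.add_im, Complex.ofReal_im, Complex.mul_im, Complex.ofReal_re, Complex.I_im,
      mul_one, Complex.I_re, mul_zero, add_zero, zero_add] at hv
    obtain ⟨x, hx1, hx2, rfl⟩ := segment_horizontal hv (by linarith)
    have hx : |((x : ℂ) + w.im * Complex.I).re| ≤ ρ + 1 := by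
      simp only [Complex.add_re, Complex.ofReal_re, Complex.mul_re, Complex.I_re, mul_zero,
        Complex.ofReal_im, Complex.I_im, mul_one, sub_self, add_zero]
      exact abs_le.2 ⟨by linarith, hx2.trans (abs_le.1 hre).2⟩
    obtain ⟨h1, h2, h3⟩ := hstrip _ hx (by simpa using hw0) (by simpa using hwη)
    exact ⟨h1, h2, h3, Or.inl (by simpa using hw0)⟩
  · intro he
    have := congrArg Complex.re he
    simp at this
    linarith

/-- Points with `R < c` that are far out reach `-i∞`. -/
lemma IsPosImag.reach_far (hc : u.IsPosImag) (hlam : 0 < lam) (h : u.IsFarRadius lam ρ)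
    (hρ : -ρ ≤ u.leftAbscissa) {w : ℂ} (hw0 : 0 < w.im) (hre : ρ < |w.re|)
    (hR : u.R lam w < c) : Reach u (u.region lam c ρ) w := by
  have h0 : 0 < c := (hc.R_pos_far h hre.le hw0).trans hR
  rcases lt_abs.1 hre with hlt | hlt
  swap
  · exact hc.reach_far_left h hρ h0 (by linarith) hR
  -- A point far to the right descends vertically into a low strip; the radius is enlarged so that
  -- the strip reaches back from there to the far left.
  have h' := h.mono (show ρ ≤ max (ρ + 1) |w.re| by linarith [le_max_left (ρ + 1) |w.re|])
  have hsub : u.region lam c (max (ρ + 1) |w.re|) ⊆ u.region lam c ρ := fun v hv =>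
    ⟨hv.1, hv.2.1, hv.2.2.1, hv.2.2.2.imp_right fun h =>
      ⟨h.1, by linarith [h.2, le_max_left (ρ + 1) |w.re|]⟩⟩
  refine Reach.mono hsub ?_
  set ρ' := max (ρ + 1) |w.re| with hρ'
  have hρρ' : ρ + 1 ≤ ρ' := le_max_left _ _
  have hwρ' : |w.re| ≤ ρ' := le_max_right _ _
  obtain ⟨η, hη, hstrip⟩ := hc.exists_low_strip hlam h0 (ρ' + 1)
  rcases le_or_gt w.im η with hle | hgt
  · exact hc.reach_low_strip h' (by linarith) h0 hstrip hw0 hle (by linarith)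
  · have hw' : Reach u (u.region lam c ρ') (w.re + η * Complex.I) := by
      refine hc.reach_low_strip h' (by linarith) h0 hstrip ?_ ?_ ?_ <;> simp
      · exact hη
      · linarith
    refine Reach.step ?_ ?_ hw'
    · intro v hv
      rw [segment_symm] at hv
      nth_rewrite 2 [← Complex.re_add_im w] at hv
      obtain ⟨y, hy1, hy2, rfl⟩ := segment_vertical hv hgt.le
      have hab : ρ ≤ |((w.re : ℂ) + y * Complex.I).re| := by simpa using hre.le
      refine ⟨(h.of_re hab).1, h.not_isCritical hab, ?_, Or.inl (by simp; linarith)⟩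
      rcases hy2.eq_or_lt with rfl | hy2
      · rwa [Complex.re_add_im]
      · have := hc.R_lt_R_far h hre.le hy2
        rw [Complex.re_add_im] at this
        linarith
    · intro he
      have := congrArg Complex.im he
      simp at this
      linarith

/-- A small punctured disc around `zₚ` lies in the region and is star-shaped towards `zₚ`. -/
lemma IsPosImag.reach_well (hc : u.IsPosImag) (lam c ρ : ℝ) (p : Fin P) :
    ∀ᶠ w in 𝓝[≠] (u.z p), Reach u (u.region lam c ρ) w := by
  obtain ⟨r, hr, hball⟩ := Metric.eventually_nhds_iff_ball.1
    (eventually_nhdsWithin_iff.1 (hc.eventually_well lam p c))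
  rw [eventually_nhdsWithin_iff]
  filter_upwards [Metric.ball_mem_nhds _ hr] with w hw hne
  refine Reach.well p hne fun s hs0 hs1 => ?_
  have hne' : u.z p + s * (w - u.z p) ≠ u.z p := by
    have : (s : ℂ) ≠ 0 := by exact_mod_cast hs0.ne'
    simp [this, sub_ne_zero.2 hne]
  obtain ⟨h1, h2, h3, h4⟩ := hball (u.z p + s * (w - u.z p)) (by
    rw [Metric.mem_ball, dist_eq_norm] at hw
    rw [Metric.mem_ball, dist_eq_norm, add_sub_cancel_left, norm_mul, Complex.norm_real, Real.norm_eq_abs,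
      abs_of_pos hs0]
    have := norm_nonneg (w - u.z p)
    nlinarith) hne'
  exact ⟨h1, h3, h2, Or.inl h4⟩

/-- Two points of a punctured disc are connected by at most two segments. -/
lemma exists_segments_punctured {q w w' : ℂ} {r : ℝ} (hw : w ∈ Metric.ball q r) (hwq : w ≠ q)
    (hw' : w' ∈ Metric.ball q r) (hwq' : w' ≠ q) :
    ∃ s, segment ℝ w s ⊆ Metric.ball q r \ {q} ∧ segment ℝ s w' ⊆ Metric.ball q r \ {q} := by
  have hsub : ∀ a ∈ Metric.ball q r, ∀ b ∈ Metric.ball q r, segment ℝ a b ⊆ Metric.ball q r :=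
    fun a ha b hb => (convex_ball q r).segment_subset ha hb
  by_cases hq : q ∈ segment ℝ w w'
  · obtain ⟨a, b, ha, hb, hab, he⟩ := hq
    set v := w - q with hv
    have hv0 : v ≠ 0 := sub_ne_zero.2 hwq
    -- When the centre lies on the segment, `w` and `w'` are on opposite rays from `q`; the detour
    -- goes through `w` turned by a right angle about `q`.
    have hs : q + Complex.I * v ∈ Metric.ball q r := by
      rw [Metric.mem_ball, dist_eq_norm] at hw ⊢
      simpa using hw
    have hb0 : b ≠ 0 := by
      rintro rfl
      have : a = 1 := by linarith
      subst this
      exact hwq (by simpa using he)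
    have hw'v : w' = q - (a / b : ℝ) * v := by
      have hb0' : (b : ℂ) ≠ 0 := by exact_mod_cast hb0
      have hab' : (a : ℂ) + b = 1 := by exact_mod_cast hab
      simp only [Complex.real_smul] at he
      rw [hv]; push_cast
      field_simp
      linear_combination he - q * hab'
    have hk : 0 < a / b := by
      refine lt_of_le_of_ne (div_nonneg ha hb) fun h0 => hwq' ?_
      rw [hw'v, ← h0]; simp
    refine ⟨q + Complex.I * v, fun x hx => ⟨hsub _ hw _ hs hx, ?_⟩,
      fun x hx => ⟨hsub _ hs _ hw' hx, ?_⟩⟩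
    · rintro rfl
      obtain ⟨α, β, hα, hβ, hαβ, hx⟩ := hx
      have hαβ' : (α : ℂ) + β = 1 := by exact_mod_cast hαβ
      simp only [Complex.real_smul] at hx
      have : ((α : ℂ) + β * Complex.I) * v = 0 := by
        rw [hv] at hx ⊢; linear_combination hx - x * hαβ'
      rcases mul_eq_zero.1 this with h | h
      · have h1 := congrArg Complex.re h
        have h2 := congrArg Complex.im h
        simp at h1 h2
        linarith
      · exact hv0 h
    · rintro rfl
      rw [hw'v] at hx
      obtain ⟨α, β, hα, hβ, hαβ, hx⟩ := hx
      have hαβ' : (α : ℂ) + β = 1 := by exact_mod_cast hαβ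
      simp only [Complex.real_smul] at hx
      have : ((α : ℂ) * Complex.I - β * (a / b : ℝ)) * v = 0 := by
        linear_combination hx - x * hαβ'
      rcases mul_eq_zero.1 this with h | h
      · have h1 := congrArg Complex.re h
        have h2 := congrArg Complex.im h
        rw [← Complex.ofReal_mul] at h1 h2
        simp at h1 h2
        rcases h1 with h1 | h1 | h1
        · linarith
        · exact hk.ne' (by simp [h1])
        · exact hb0 h1
      · exact hv0 h
  · refine ⟨w', fun x hx => ⟨hsub _ hw _ hw' hx, ?_⟩, fun x hx => ?_⟩
    · rintro rfl; exact hq hx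
    · rw [segment_same, Set.mem_singleton_iff] at hx
      subst hx
      exact ⟨hw', hwq'⟩

/-- Within `{R < c}`, every noncritical point of the upper half-plane is connected to one of the
`zₚ` or to `-i∞`. -/
theorem IsPosImag.reach (hc : u.IsPosImag) (hlam : 0 < lam) (h : u.IsFarRadius lam ρ)
    (hρ : -ρ ≤ u.leftAbscissa) {w₀ : ℂ} (hw₀ : w₀ ∈ u.region lam c ρ) (him₀ : 0 < w₀.im) :
    Reach u (u.region lam c ρ) w₀ := by
  by_contra hnr
  -- The unreachable points not higher than `w₀`. The proof minimises `R` over the closure of this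
  -- bounded set and contradicts the absence of local minima.
  set Z : Set ℂ := {w | w ∈ u.region lam c ρ ∧ 0 < w.im ∧ ¬ Reach u (u.region lam c ρ) w ∧
    u.R lam w ≤ u.R lam w₀} with hZ
  have hw₀Z : w₀ ∈ Z := ⟨hw₀, him₀, hnr, le_rfl⟩
  obtain ⟨Y, hY⟩ := hc.exists_im_bound hlam c
  have hZre : ∀ w ∈ Z, |w.re| ≤ ρ := fun w hw => by
    by_contra! hlt
    exact hw.2.2.1 (hc.reach_far hlam h hρ hw.2.1 hlt hw.1.2.2.1)
  have hZim : ∀ w ∈ Z, w.im ≤ Y := fun w hw => by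
    by_contra! hlt
    exact absurd hw.1.2.2.1 (hY w hlt.le).2.not_gt
  have hbdd : Bornology.IsBounded Z := by
    refine (Metric.isBounded_closedBall (x := (0 : ℂ)) (r := ρ + Y)).subset fun w hw => ?_
    rw [mem_closedBall_zero_iff]
    refine (Complex.norm_le_abs_re_add_abs_im w).trans ?_
    rw [abs_of_pos hw.2.1]
    linarith [hZre w hw, hZim w hw]
  have hcl : IsCompact (closure Z) := hbdd.isCompact_closure
  have him : ∀ w ∈ closure Z, 0 ≤ w.im := fun w hw =>
    closure_minimal (fun v (hv : v ∈ Z) => hv.2.1.le)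
      (isClosed_le continuous_const Complex.continuous_im) hw
  -- Unreachable points cannot accumulate at a well, because a punctured neighbourhood of it is
  -- reachable; so `R` is continuous on the closure.
  have hnp : ∀ w ∈ closure Z, ¬ u.IsPole w := by
    intro w hw hp
    rcases (him w hw).eq_or_lt with h0 | h0
    · have : w = (w.re : ℂ) := by apply Complex.ext <;> simp [h0.symm]
      exact not_isPole_ofReal _ (this ▸ hp)
    · obtain ⟨p, rfl⟩ := (isPole_iff_of_im_pos h0).1 hp
      obtain ⟨v, hvZ, hv⟩ := (mem_closure_iff_frequently.1 hw).and_eventually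
        (eventually_nhdsWithin_iff.1 (hc.reach_well lam c ρ p)) |>.exists
      exact hvZ.2.2.1 (hv fun he => hvZ.1.1 ⟨p, Or.inl he⟩)
  have hcont : ContinuousOn (u.R lam) (closure Z) := fun w hw =>
    (hc.continuousAt_R lam (hnp w hw)).continuousWithinAt
  obtain ⟨q, hq, hmin⟩ := hcl.exists_isMinOn ⟨w₀, subset_closure hw₀Z⟩ hcont
  have hmin' : ∀ w ∈ Z, u.R lam q ≤ u.R lam w := fun w hw => hmin (subset_closure hw)
  have hqc : u.R lam q < c := (hmin' _ hw₀Z).trans_lt hw₀.2.2.1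
  -- A minimum on the axis would have `0 = R q < c`, but then low strips above the axis are
  -- reachable.
  have himq : 0 < q.im := by
    refine lt_of_le_of_ne (him q hq) fun h0 => ?_
    have hqe : q = (q.re : ℂ) := by apply Complex.ext <;> simp [h0.symm]
    rw [hqe, hc.R_ofReal] at hqc
    obtain ⟨η, hη, hstrip⟩ := hc.exists_low_strip hlam hqc (ρ + 1)
    have hev : ∀ᶠ v in 𝓝 q, v.im < η :=
      (isOpen_lt Complex.continuous_im continuous_const).mem_nhds (show q.im < η by linarith)
    obtain ⟨v, hvZ, hv⟩ := (mem_closure_iff_frequently.1 hq).and_eventually hev |>.exists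
    exact hvZ.2.2.1 (hc.reach_low_strip h hρ hqc hstrip hvZ.2.1 hv.le
      (by linarith [hZre v hvZ]))
  have hfin : {w | u.IsCritical lam w ∧ w ≠ q}.Finite := (finite_isCritical hlam).subset fun _ h => h.1
  have himev : ∀ᶠ w in 𝓝 q, 0 < w.im :=
    (isOpen_lt continuous_const Complex.continuous_im).mem_nhds himq
  have hev : ∀ᶠ w in 𝓝 q, ¬ u.IsPole w ∧ u.R lam w < c ∧ 0 < w.im ∧
      w ∉ {w | u.IsCritical lam w ∧ w ≠ q} :=
    (eventually_not_isPole (hnp q hq)).and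
      (((hc.continuousAt_R lam (hnp q hq)).eventually_lt_const hqc).and
      (himev.and (hfin.isClosed.isOpen_compl.mem_nhds (by simp))))
  obtain ⟨r, hr, hball⟩ := Metric.eventually_nhds_iff_ball.1 hev
  have hsub : Metric.ball q r \ {q} ⊆ u.region lam c ρ := fun w hw => by
    obtain ⟨h1, h2, h3, h4⟩ := hball w hw.1
    exact ⟨h1, fun hcr => h4 ⟨hcr, hw.2⟩, h2, Or.inl h3⟩
  -- A point below the minimum must be reachable; every other point of the punctured disc can be
  -- joined to it inside the region.
  obtain ⟨w', hw'b, hw'R⟩ := hc.exists_R_lt hlam (hnp q hq) (Metric.ball_mem_nhds q hr)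
  have hw'q : w' ≠ q := by rintro rfl; exact lt_irrefl _ hw'R
  have hw'r : Reach u (u.region lam c ρ) w' := by
    by_contra hn
    exact absurd (hmin' w' ⟨hsub ⟨hw'b, hw'q⟩, (hball w' hw'b).2.2.1, hn,
      (hw'R.le.trans (hmin' _ hw₀Z))⟩) hw'R.not_ge
  have key : ∀ w ∈ Metric.ball q r, w ≠ q → Reach u (u.region lam c ρ) w := by
    intro w hw hwq
    obtain ⟨s, hs1, hs2⟩ := exists_segments_punctured hw hwq hw'b hw'q
    have hs : Reach u (u.region lam c ρ) s := by
      by_cases he : s = w'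
      · rwa [he]
      · exact Reach.step (hs2.trans hsub) he hw'r
    by_cases he : w = s
    · rwa [he]
    · exact Reach.step (hs1.trans hsub) he hs
  obtain ⟨w, hwZ, hwb⟩ := (mem_closure_iff_frequently.1 hq).and_eventually
    (Metric.ball_mem_nhds q hr) |>.exists
  -- If `q` itself belongs to `Z` it is not critical, and the segment from `q` to `w'` lies in the
  -- region.
  by_cases hwq : w = q
  · subst hwq
    have hseg : segment ℝ w w' ⊆ u.region lam c ρ := by
      intro v hv
      by_cases hvw : v = w
      · rw [hvw]; exact hwZ.1
      · exact hsub ⟨(convex_ball w r).segment_subset (Metric.mem_ball_self hr) hw'b hv, hvw⟩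
    exact hwZ.2.2.1 (Reach.step hseg (Ne.symm hw'q) hw'r)
  · exact hwZ.2.2.1 (key w hwb hwq)

end Regions

end BenjaminOno.RationalPotential

namespace BenjaminOno.RationalPotential

variable {P : ℕ} {u : RationalPotential P} {lam : ℝ}

/-! ### Branches along curves -/

/-- The line is simply connected, so a map to the punctured plane lifts through the exponential. -/
lemma exists_continuous_log {g : ℝ → ℂ} (hg : Continuous g) (h0 : ∀ t, g t ≠ 0) :
    ∃ L : ℝ → ℂ, Continuous L ∧ ∀ t, Complex.exp (L t) = g t := by
  have hcs : ContractibleSpace (Set.univ : Set ℝ) :=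
    convex_univ.contractibleSpace Set.univ_nonempty
  obtain ⟨L, hL, he⟩ := Complex.exists_continuousOn_eqOn_exp_comp (U := (Set.univ : Set ℝ))
    (inferInstanceAs (SimplyConnectedSpace (Set.univ : Set ℝ))) isOpen_univ hg.continuousOn (by
      rintro ⟨t, -, ht⟩; exact h0 t ht)
  exact ⟨L, continuousOn_univ.1 hL, fun t => he (Set.mem_univ t)⟩

lemma exists_isBranchAlong {γ : ℝ → ℂ} (hγ : Continuous γ) (hp : ∀ t, ¬ u.IsPole (γ t)) :
    ∃ H, u.IsBranchAlong lam γ H := by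
  have h1 : ∀ p, ∃ L : ℝ → ℂ, Continuous L ∧ ∀ t, Complex.exp (L t) = Complex.I * (γ t - u.z p) :=
    fun p => exists_continuous_log (by fun_prop) fun t =>
      mul_ne_zero Complex.I_ne_zero (sub_ne_zero_of_not_isPole (hp t) p).1
  have h2 : ∀ p, ∃ L : ℝ → ℂ, Continuous L ∧
      ∀ t, Complex.exp (L t) = -Complex.I * (γ t - conj (u.z p)) :=
    fun p => exists_continuous_log (by fun_prop) fun t =>
      mul_ne_zero (neg_ne_zero.2 Complex.I_ne_zero) (sub_ne_zero_of_not_isPole (hp t) p).2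
  choose L hL using h1
  choose L' hL' using h2
  exact ⟨_, L, L', hL, hL', fun _ => rfl⟩

/-- While the increment of `L` is smaller than `π`, it is the principal logarithm of its own
exponential. -/
lemma eventually_eq_log_add {γ L : ℝ → ℂ} {t₀ : ℝ} {z a : ℂ} (ha : a ≠ 0) (hL : ContinuousAt L t₀)
    (he : ∀ t, Complex.exp (L t) = a * (γ t - z)) :
    ∀ᶠ t in 𝓝 t₀, L t = L t₀ + Complex.log ((γ t - z) / (γ t₀ - z)) := by
  have h1 : ∀ᶠ t in 𝓝 t₀, ‖L t - L t₀‖ < Real.pi := by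
    have h2 : ContinuousAt (fun t => ‖L t - L t₀‖) t₀ := (hL.sub continuousAt_const).norm
    have h3 : ‖L t₀ - L t₀‖ < Real.pi := by simpa using Real.pi_pos
    exact h2.eventually_lt_const h3
  filter_upwards [h1] with t ht
  have h2 : (γ t - z) / (γ t₀ - z) = Complex.exp (L t - L t₀) := by
    rw [Complex.exp_sub, he, he, mul_div_mul_left _ _ ha]
  have h3 := (Complex.abs_im_le_norm (L t - L t₀)).trans_lt ht
  rw [h2, Complex.log_exp (abs_lt.1 h3).1 (abs_lt.1 h3).2.le]
  ring

/-- Locally a branch along a curve is the composition of the curve with an analytic branch, so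
derivatives of `H` come from the chain rule. -/
lemma IsBranchAlong.exists_local {γ H : ℝ → ℂ} (hb : u.IsBranchAlong lam γ H) {t₀ : ℝ}
    (hp : ¬ u.IsPole (γ t₀)) :
    ∃ K : ℂ → ℂ, ∃ r > 0, (∀ w ∈ Metric.ball (γ t₀) r, HasDerivAt K (lam + u.toFun w) w) ∧
      ∀ᶠ t in 𝓝 t₀, H t = K (γ t) := by
  obtain ⟨L, L', hL, hL', hH⟩ := hb
  have hev : ∀ᶠ w in 𝓝 (γ t₀), ∀ p, ‖w - γ t₀‖ < ‖γ t₀ - u.z p‖ ∧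
      ‖w - γ t₀‖ < ‖γ t₀ - conj (u.z p)‖ := by
    rw [eventually_all]
    intro p
    have hc : ContinuousAt (fun w => ‖w - γ t₀‖) (γ t₀) := by fun_prop
    obtain ⟨h1, h2⟩ := sub_ne_zero_of_not_isPole hp p
    exact (hc.eventually_lt_const (by simpa using h1)).and
      (hc.eventually_lt_const (by simpa using h2))
  obtain ⟨r, hr, hball⟩ := Metric.eventually_nhds_iff_ball.1 hev
  refine ⟨fun w => lam * w + ∑ p, (u.c p * ((L p t₀ +
      Complex.log ((w - u.z p) / (γ t₀ - u.z p))) + Real.pi * Complex.I / 2) +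
      conj (u.c p) * ((L' p t₀ + Complex.log ((w - conj (u.z p)) / (γ t₀ - conj (u.z p)))) -
        Real.pi * Complex.I / 2)), r, hr, fun w hw => ?_, ?_⟩
  · rw [toFun]
    refine HasDerivAt.add (by simpa using (hasDerivAt_id w).const_mul (lam : ℂ)) ?_
    refine HasDerivAt.fun_sum fun p _ => ?_
    obtain ⟨h1, h2⟩ := sub_ne_zero_of_not_isPole hp p
    have h3 := (hasDerivAt_log_div h1 (hball w hw p).1).2
    have h4 := (hasDerivAt_log_div h2 (hball w hw p).2).2
    convert! (((h3.const_add (L p t₀)).add_const (Real.pi * Complex.I / 2)).const_mul (u.c p)).add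
      (((h4.const_add (L' p t₀)).sub_const (Real.pi * Complex.I / 2)).const_mul (conj (u.c p)))
      using 1 <;> simp [div_eq_mul_inv]
  · have h1 : ∀ᶠ t in 𝓝 t₀, ∀ p,
        L p t = L p t₀ + Complex.log ((γ t - u.z p) / (γ t₀ - u.z p)) ∧
        L' p t = L' p t₀ + Complex.log ((γ t - conj (u.z p)) / (γ t₀ - conj (u.z p))) := by
      rw [eventually_all]
      intro p
      exact (eventually_eq_log_add Complex.I_ne_zero (hL p).1.continuousAt (hL p).2).and
        (eventually_eq_log_add (neg_ne_zero.2 Complex.I_ne_zero) (hL' p).1.continuousAt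
          (hL' p).2)
    filter_upwards [h1] with t ht
    rw [hH]
    congr 1
    refine Finset.sum_congr rfl fun p _ => ?_
    rw [(ht p).1, (ht p).2]

/-- Different logarithms differ by imaginary constants, which real `γₚ` keep imaginary in `-ih`. -/
lemma IsBranchAlong.re_eq (hc : u.IsPosImag) {γ H : ℝ → ℂ} (hb : u.IsBranchAlong lam γ H) (t : ℝ) :
    (-Complex.I * H t).re = u.R lam (γ t) := by
  obtain ⟨L, L', hL, hL', hH⟩ := hb
  have h1 : -Complex.I * H t = -Complex.I * (lam * γ t) +
      ∑ p, ((u.gam p : ℂ) * (L p t + Real.pi * Complex.I / 2) -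
        u.gam p * (L' p t - Real.pi * Complex.I / 2)) := by
    rw [hH, mul_add, Finset.mul_sum]
    congr 1
    refine Finset.sum_congr rfl fun p _ => ?_
    rw [hc.conj_c_eq, hc.c_eq]
    linear_combination (-(u.gam p : ℂ) * (L p t + Real.pi * Complex.I / 2) +
        u.gam p * (L' p t - Real.pi * Complex.I / 2)) * Complex.I_sq
  have hlog : ∀ {l v : ℂ}, Complex.exp l = v → l.re = Real.log ‖v‖ := fun {l v} h => by
    rw [← h, Complex.norm_exp, Real.log_exp]
  rw [h1, hc.R_eq, Complex.add_re, Complex.re_sum]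
  congr 1
  · simp
  · refine Finset.sum_congr rfl fun p _ => ?_
    have h3 := hlog ((hL p).2 t)
    have h4 := hlog ((hL' p).2 t)
    simp only [norm_mul, norm_neg, Complex.norm_I, one_mul] at h3 h4
    simp only [Complex.sub_re, Complex.re_ofReal_mul, Complex.add_re, h3, h4]
    simp
    ring

/-- The exponential factor along a curve with a branch `H` of `h`. -/
noncomputable def _root_.BenjaminOno.expAlong (ε : ℝ) (H : ℝ → ℂ) (t : ℝ) : ℂ :=
  Complex.exp (-Complex.I * H t / ε)

lemma norm_expAlong (hc : u.IsPosImag) {γ H : ℝ → ℂ} (hb : u.IsBranchAlong lam γ H)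
    (ε : ℝ) (t : ℝ) : ‖expAlong ε H t‖ = Real.exp (u.R lam (γ t) / ε) := by
  rw [expAlong, Complex.norm_exp, Complex.div_ofReal_re, hb.re_eq hc]

lemma IsBranchAlong.continuous {γ H : ℝ → ℂ} (hb : u.IsBranchAlong lam γ H) (hγ : Continuous γ) :
    Continuous H := by
  obtain ⟨L, L', hL, hL', hH⟩ := hb
  rw [show H = _ from funext hH]
  have h1 := fun p => (hL p).1
  have h2 := fun p => (hL' p).1
  fun_prop

lemma continuous_expAlong {γ H : ℝ → ℂ} (hb : u.IsBranchAlong lam γ H) (hγ : Continuous γ)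
    (ε : ℝ) : Continuous (expAlong ε H) := by
  have := hb.continuous hγ
  unfold expAlong
  fun_prop

lemma hasDerivAt_expAlong {γ H : ℝ → ℂ} (hb : u.IsBranchAlong lam γ H) (ε : ℝ) {t : ℝ} {d : ℂ}
    (hp : ¬ u.IsPole (γ t)) (hd : HasDerivAt γ d t) :
    HasDerivAt (expAlong ε H)
      (expAlong ε H t * (-Complex.I * ((lam + u.toFun (γ t)) * d) / ε)) t := by
  obtain ⟨K, r, hr, hK, hKe⟩ := hb.exists_local hp
  have h1 : HasDerivAt (fun t => K (γ t)) ((lam + u.toFun (γ t)) * d) t :=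
    (hK _ (Metric.mem_ball_self hr)).comp t hd
  have h2 : HasDerivAt H ((lam + u.toFun (γ t)) * d) t := h1.congr_of_eventuallyEq hKe
  exact ((h2.const_mul (-Complex.I)).div_const (ε : ℂ)).cexp

end BenjaminOno.RationalPotential

namespace BenjaminOno.RationalPotential

variable {P : ℕ} {u : RationalPotential P} {lam : ℝ}

/-! ### Curves -/

variable (u) in
/-- A piecewise `C¹` curve on `[0, ∞)` that starts at `p`, runs in `M`, and ends at one of the
`zₚ` or at `-i∞`. -/
structure Half (M : Set ℂ) (p : ℂ) (γ : ℝ → ℂ) : Prop where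
  zero : γ 0 = p
  cont : Continuous γ
  mem : ∀ t, 0 < t → γ t ∈ M
  smooth : ∃ (S : Finset ℝ) (C : ℝ), ∀ t, 0 < t → t ∉ S →
    ContDiffAt ℝ 1 γ t ∧ deriv γ t ≠ 0 ∧ ‖deriv γ t‖ ≤ C
  right : ∀ t, 0 ≤ t → ∃ d : ℂ, d ≠ 0 ∧ Tendsto (deriv γ) (𝓝[>] t) (𝓝 d)
  left : ∀ t, 0 < t → ∃ d : ℂ, d ≠ 0 ∧ Tendsto (deriv γ) (𝓝[<] t) (𝓝 d)
  ends : ∃ T ≥ 0, (∃ (k : Fin P) (v : ℂ), v ≠ 0 ∧ ∀ t ≥ T, γ t = u.z k + Real.exp (-t) * v) ∨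
    ∃ b : ℂ, b.re ≤ u.leftAbscissa ∧ ∀ t ≥ T, γ t = b - t * Complex.I

lemma hasDerivAt_exp_curve (z v : ℂ) (t : ℝ) :
    HasDerivAt (fun t : ℝ => z + Real.exp (-t) * v) (-(Real.exp (-t) * v)) t := by
  have h1 : HasDerivAt (fun t : ℝ => Real.exp (-t)) (-Real.exp (-t)) t := by
    simpa using (hasDerivAt_neg t).exp
  have := ((h1.ofReal_comp).mul_const v).const_add z
  simpa using this

lemma hasDerivAt_line (b v : ℂ) (t : ℝ) : HasDerivAt (fun t : ℝ => b + t * v) v t := by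
  simpa using ((Complex.ofRealCLM.hasDerivAt (x := t)).mul_const v).const_add b

/-- The segment is parametrised by `e^{-t}`, so that the well is reached only as `t → ∞` and the
curve avoids it at finite times. -/
lemma half_well {M : Set ℂ} {w : ℂ} (k : Fin P) (hne : w ≠ u.z k)
    (h : ∀ s : ℝ, 0 < s → s ≤ 1 → u.z k + s * (w - u.z k) ∈ M) :
    ∃ γ, u.Half M w γ := by
  have hv : w - u.z k ≠ 0 := sub_ne_zero.2 hne
  have hd : deriv (fun t : ℝ => u.z k + Real.exp (-t) * (w - u.z k)) =
      fun t => -(Real.exp (-t) * (w - u.z k)) :=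
    funext fun t => (hasDerivAt_exp_curve _ _ t).deriv
  have hne : ∀ t : ℝ, -((Real.exp (-t) : ℂ) * (w - u.z k)) ≠ 0 := fun t =>
    neg_ne_zero.2 (mul_ne_zero (by exact_mod_cast (Real.exp_pos _).ne') hv)
  have hcd : Continuous fun t : ℝ => -((Real.exp (-t) : ℂ) * (w - u.z k)) := by fun_prop
  refine ⟨fun t => u.z k + Real.exp (-t) * (w - u.z k), by simp, by fun_prop,
    fun t ht => h _ (Real.exp_pos _) (Real.exp_le_one_iff.2 (by linarith)),
    ⟨∅, ‖w - u.z k‖, fun t ht _ => ⟨?_, ?_, ?_⟩⟩, fun t ht => ⟨_, hne t, ?_⟩,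
    fun t ht => ⟨_, hne t, ?_⟩, 0, le_rfl, Or.inl ⟨k, _, hv, fun _ _ => rfl⟩⟩
  · have : ContDiff ℝ 1 fun t : ℝ => u.z k + Real.exp (-t) * (w - u.z k) := by
      have h1 : ContDiff ℝ 1 fun t : ℝ => Real.exp (-t) := by fun_prop
      exact contDiff_const.add ((Complex.ofRealCLM.contDiff.comp h1).mul contDiff_const)
    exact this.contDiffAt
  · rw [hd]; exact hne t
  · rw [hd]
    simp only [norm_neg, norm_mul, Complex.norm_real, Real.norm_eq_abs, Real.abs_exp]
    exact mul_le_of_le_one_left (norm_nonneg _) (Real.exp_le_one_iff.2 (by linarith))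
  · rw [hd]; exact (hcd.tendsto t).mono_left nhdsWithin_le_nhds
  · rw [hd]; exact (hcd.tendsto t).mono_left nhdsWithin_le_nhds

lemma half_down {M : Set ℂ} {w : ℂ} (hre : w.re ≤ u.leftAbscissa)
    (h : ∀ s : ℝ, 0 ≤ s → w - s * Complex.I ∈ M) : ∃ γ, u.Half M w γ := by
  have hfun : (fun t : ℝ => w - t * Complex.I) = fun t : ℝ => w + t * (-Complex.I) := by
    funext t; ring
  have hd : deriv (fun t : ℝ => w - t * Complex.I) = fun _ => -Complex.I := by
    rw [hfun]; exact funext fun t => (hasDerivAt_line _ _ t).deriv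
  refine ⟨fun t => w - t * Complex.I, by simp, by fun_prop, fun t ht => h t ht.le,
    ⟨∅, 1, fun t ht _ => ⟨?_, ?_, ?_⟩⟩, fun t ht => ⟨-Complex.I, by simp, ?_⟩,
    fun t ht => ⟨-Complex.I, by simp, ?_⟩, 0, le_rfl, Or.inr ⟨w, hre, fun _ _ => rfl⟩⟩
  · have : ContDiff ℝ 1 fun t : ℝ => w - t * Complex.I :=
      contDiff_const.sub (Complex.ofRealCLM.contDiff.mul contDiff_const)
    exact this.contDiffAt
  · rw [hd]; simp
  · rw [hd]; simp
  · rw [hd]; exact tendsto_const_nhds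
  · rw [hd]; exact tendsto_const_nhds

/-- Prepending a segment. -/
lemma Half.cons {M M' : Set ℂ} (hM : M ⊆ M') {w w' : ℂ} {γ : ℝ → ℂ} (hγ : u.Half M w' γ)
    (hne : w ≠ w') (hseg : ∀ s : ℝ, 0 < s → s ≤ 1 → w + s * (w' - w) ∈ M') :
    ∃ γ', u.Half M' w γ' ∧ ∀ t ≤ 1, γ' t = w + t * (w' - w) := by
  obtain ⟨hz, hcont, hmem, ⟨S, C, hS⟩, hr, hl, T, hT, hend⟩ := hγ
  set γ' : ℝ → ℂ := fun t => if t ≤ 1 then w + t * (w' - w) else γ (t - 1) with hγ'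
  have hlt : ∀ t < 1, γ' =ᶠ[𝓝 t] fun t => w + t * (w' - w) := fun t ht => by
    filter_upwards [eventually_lt_nhds ht] with s hs
    simp [hγ', hs.le]
  have hgt : ∀ t > 1, γ' =ᶠ[𝓝 t] fun t => γ (t - 1) := fun t ht => by
    filter_upwards [eventually_gt_nhds ht] with s hs
    simp [hγ', hs.not_ge]
  have hdlt : ∀ t < 1, deriv γ' t = w' - w := fun t ht => by
    rw [(hlt t ht).deriv_eq, (hasDerivAt_line _ _ t).deriv]
  have hdgt : ∀ t > 1, deriv γ' t = deriv γ (t - 1) := fun t ht => by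
    rw [(hgt t ht).deriv_eq, deriv_comp_sub_const]
  have hne' : w' - w ≠ 0 := sub_ne_zero.2 hne.symm
  have hshr : ∀ t : ℝ, Tendsto (fun s => s - 1) (𝓝[>] t) (𝓝[>] (t - 1)) := fun t => by
    apply tendsto_nhdsWithin_iff.2 ⟨?_, ?_⟩
    · exact ((continuous_id.sub continuous_const).tendsto t).mono_left nhdsWithin_le_nhds
    · filter_upwards [self_mem_nhdsWithin] with s (hs : t < s)
      show t - 1 < s - 1
      linarith
  have hshl : ∀ t : ℝ, Tendsto (fun s => s - 1) (𝓝[<] t) (𝓝[<] (t - 1)) := fun t => by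
    apply tendsto_nhdsWithin_iff.2 ⟨?_, ?_⟩
    · exact ((continuous_id.sub continuous_const).tendsto t).mono_left nhdsWithin_le_nhds
    · filter_upwards [self_mem_nhdsWithin] with s (hs : s < t)
      show s - 1 < t - 1
      linarith
  refine ⟨γ', ⟨by simp [hγ'], ?_, ?_, ⟨insert 1 (S.image (· + 1)), max C ‖w' - w‖, ?_⟩, ?_, ?_,
    T + 1, by linarith, ?_⟩, fun t ht => by simp [hγ', ht]⟩
  · refine Continuous.if_le (by fun_prop) (by fun_prop) continuous_id continuous_const ?_
    rintro t rfl
    simp [hz]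
  · intro t ht
    by_cases h1 : t ≤ 1
    · simpa [hγ', h1] using hseg t ht h1
    · simpa [hγ', h1] using hM (hmem (t - 1) (by linarith [not_le.1 h1]))
  · intro t ht htS
    simp only [Finset.mem_insert, Finset.mem_image, not_or, not_exists, not_and] at htS
    rcases lt_or_gt_of_ne htS.1 with h1 | h1
    · rw [hdlt t h1]
      refine ⟨ContDiffAt.congr_of_eventuallyEq ?_ (hlt t h1), hne', le_max_right _ _⟩
      have : ContDiff ℝ 1 fun t : ℝ => w + t * (w' - w) :=
        contDiff_const.add (Complex.ofRealCLM.contDiff.mul contDiff_const)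
      exact this.contDiffAt
    · rw [hdgt t h1]
      obtain ⟨h2, h3, h4⟩ := hS (t - 1) (by linarith) fun h => htS.2 _ h (by ring)
      refine ⟨ContDiffAt.congr_of_eventuallyEq ?_ (hgt t h1), h3, h4.trans (le_max_left _ _)⟩
      exact ContDiffAt.comp (f := fun t : ℝ => t - 1) t h2 (contDiff_id.sub contDiff_const).contDiffAt
  · intro t ht
    rcases lt_or_ge t 1 with h1 | h1
    · refine ⟨_, hne', tendsto_const_nhds.congr' ?_⟩
      filter_upwards [mem_nhdsWithin_of_mem_nhds (eventually_lt_nhds h1)] with s hs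
        using (hdlt s hs).symm
    · obtain ⟨d, hd, hd'⟩ := hr (t - 1) (by linarith)
      refine ⟨d, hd, (hd'.comp (hshr t)).congr' ?_⟩
      filter_upwards [self_mem_nhdsWithin] with s (hs : t < s)
        using (hdgt s (lt_of_le_of_lt h1 hs)).symm
  · intro t ht
    rcases le_or_gt t 1 with h1 | h1
    · refine ⟨_, hne', tendsto_const_nhds.congr' ?_⟩
      filter_upwards [self_mem_nhdsWithin] with s (hs : s < t)
        using (hdlt s (lt_of_lt_of_le hs h1)).symm
    · obtain ⟨d, hd, hd'⟩ := hl (t - 1) (by linarith)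
      refine ⟨d, hd, (hd'.comp (hshl t)).congr' ?_⟩
      filter_upwards [mem_nhdsWithin_of_mem_nhds (eventually_gt_nhds h1)] with s hs
        using (hdgt s hs).symm
  · have hval : ∀ t ≥ T + 1, γ' t = γ (t - 1) := fun t ht => by
      rcases (show 1 ≤ t by linarith).eq_or_lt with rfl | h1
      · simp [hγ', hz]
      · simp [hγ', h1.not_ge]
    rcases hend with ⟨k, v, hv, he⟩ | ⟨b, hb, he⟩
    -- The factor `e`, like the shift by `i` in the other case, compensates for the delay by one
    -- unit of time.
    · refine Or.inl ⟨k, Real.exp 1 * v, mul_ne_zero (by exact_mod_cast (Real.exp_pos _).ne') hv,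
        fun t ht => ?_⟩
      rw [hval t ht, he _ (by linarith), show -(t - 1) = -t + 1 by ring, Real.exp_add]
      push_cast; ring
    · refine Or.inr ⟨b + Complex.I, by simpa using hb, fun t ht => ?_⟩
      rw [hval t ht, he _ (by linarith)]
      push_cast; ring

lemma add_mul_mem_segment (w w' : ℂ) {s : ℝ} (h0 : 0 ≤ s) (h1 : s ≤ 1) :
    w + s * (w' - w) ∈ segment ℝ w w' := by
  rw [segment_eq_image']
  exact ⟨s, ⟨h0, h1⟩, by simp⟩

lemma Reach.exists_half {M : Set ℂ} {w : ℂ} (h : u.Reach M w) : ∃ γ, u.Half M w γ := by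
  induction h with
  | well k hne h => exact half_well k hne h
  | down hre h => exact half_down hre h
  | step h hne _ ih =>
    obtain ⟨γ, hγ⟩ := ih
    obtain ⟨γ', hγ', -⟩ := hγ.cons subset_rfl hne fun s h0 h1 =>
      h (add_mul_mem_segment _ _ h0.le h1)
    exact ⟨γ', hγ'⟩

lemma Half.mono {M M' : Set ℂ} (hM : M ⊆ M') {w : ℂ} {γ : ℝ → ℂ} (h : u.Half M w γ) :
    u.Half M' w γ :=
  { h with mem := fun t ht => hM (h.mem t ht) }

/-- The curve consisting of `γ₁` and the reverse of `γ₂`. -/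
noncomputable def glue (γ₁ γ₂ : ℝ → ℂ) (t : ℝ) : ℂ := if 0 ≤ t then γ₁ t else γ₂ (-t)

lemma deriv_glue_pos (γ₁ γ₂ : ℝ → ℂ) {t : ℝ} (ht : 0 < t) :
    glue γ₁ γ₂ =ᶠ[𝓝 t] γ₁ ∧ deriv (glue γ₁ γ₂) t = deriv γ₁ t := by
  have h : glue γ₁ γ₂ =ᶠ[𝓝 t] γ₁ := by
    filter_upwards [eventually_gt_nhds ht] with s hs
    simp [glue, hs.le]
  exact ⟨h, h.deriv_eq⟩

lemma deriv_glue_neg (γ₁ γ₂ : ℝ → ℂ) {t : ℝ} (ht : t < 0) :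
    glue γ₁ γ₂ =ᶠ[𝓝 t] (fun t => γ₂ (-t)) ∧ deriv (glue γ₁ γ₂) t = -deriv γ₂ (-t) := by
  have h : glue γ₁ γ₂ =ᶠ[𝓝 t] fun t => γ₂ (-t) := by
    filter_upwards [eventually_lt_nhds ht] with s hs
    simp [glue, hs.not_ge]
  exact ⟨h, by rw [h.deriv_eq, deriv_comp_neg]⟩

lemma tendsto_neg_nhdsGT (t : ℝ) : Tendsto (fun s : ℝ => -s) (𝓝[>] t) (𝓝[<] (-t)) := by
  apply tendsto_nhdsWithin_iff.2 ⟨?_, ?_⟩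
  · exact (continuous_neg.tendsto t).mono_left nhdsWithin_le_nhds
  · filter_upwards [self_mem_nhdsWithin] with s (hs : t < s)
    exact neg_lt_neg hs

lemma tendsto_neg_nhdsLT (t : ℝ) : Tendsto (fun s : ℝ => -s) (𝓝[<] t) (𝓝[>] (-t)) := by
  apply tendsto_nhdsWithin_iff.2 ⟨?_, ?_⟩
  · exact (continuous_neg.tendsto t).mono_left nhdsWithin_le_nhds
  · filter_upwards [self_mem_nhdsWithin] with s (hs : s < t)
    exact neg_lt_neg hs

section Glue
variable {M : Set ℂ} {p : ℂ} {γ₁ γ₂ : ℝ → ℂ}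

lemma Half.continuous_glue (h₁ : u.Half M p γ₁) (h₂ : u.Half M p γ₂) :
    Continuous (glue γ₁ γ₂) := by
  refine Continuous.if_le h₁.cont (h₂.cont.comp continuous_neg) continuous_const continuous_id ?_
  rintro t rfl
  simp [h₁.zero, h₂.zero]

lemma Half.smooth_glue (h₁ : u.Half M p γ₁) (h₂ : u.Half M p γ₂) :
    ∃ (S : Finset ℝ) (C : ℝ), ∀ t, t ∉ S → ContDiffAt ℝ 1 (glue γ₁ γ₂) t ∧
      deriv (glue γ₁ γ₂) t ≠ 0 ∧ ‖deriv (glue γ₁ γ₂) t‖ ≤ C := by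
  obtain ⟨S₁, C₁, hS₁⟩ := h₁.smooth
  obtain ⟨S₂, C₂, hS₂⟩ := h₂.smooth
  refine ⟨insert 0 (S₁ ∪ S₂.image (fun t => -t)), max C₁ C₂, fun t ht => ?_⟩
  simp only [Finset.mem_insert, Finset.mem_union, Finset.mem_image, not_or, not_exists,
    not_and] at ht
  rcases lt_or_gt_of_ne ht.1 with h | h
  · obtain ⟨h3, h4⟩ := deriv_glue_neg γ₁ γ₂ h
    obtain ⟨h5, h6, h7⟩ := hS₂ (-t) (by linarith) fun h => ht.2.2 _ h (by ring)
    rw [h4]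
    refine ⟨ContDiffAt.congr_of_eventuallyEq ?_ h3, neg_ne_zero.2 h6,
      by rw [norm_neg]; exact h7.trans (le_max_right _ _)⟩
    exact ContDiffAt.comp (f := fun t : ℝ => -t) t h5 contDiff_neg.contDiffAt
  · obtain ⟨h3, h4⟩ := deriv_glue_pos γ₁ γ₂ h
    obtain ⟨h5, h6, h7⟩ := hS₁ t h ht.2.1
    rw [h4]
    exact ⟨h5.congr_of_eventuallyEq h3, h6, h7.trans (le_max_left _ _)⟩

lemma Half.isPiecewiseC1_glue (h₁ : u.Half M p γ₁) (h₂ : u.Half M p γ₂) :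
    IsPiecewiseC1 (glue γ₁ γ₂) := by
  obtain ⟨S, C, hS⟩ := h₁.smooth_glue h₂
  have hpos : ∀ t, 0 < t → ∀ᶠ s in 𝓝 t, deriv (glue γ₁ γ₂) s = deriv γ₁ s := fun t ht =>
    (eventually_gt_nhds ht).mono fun s hs => (deriv_glue_pos γ₁ γ₂ hs).2
  have hneg : ∀ t, t < 0 → ∀ᶠ s in 𝓝 t, deriv (glue γ₁ γ₂) s = -deriv γ₂ (-s) := fun t ht =>
    (eventually_lt_nhds ht).mono fun s hs => (deriv_glue_neg γ₁ γ₂ hs).2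
  refine ⟨h₁.continuous_glue h₂, S, fun t ht => ⟨(hS t ht).1, (hS t ht).2.1⟩, fun t _ => ⟨?_, ?_⟩⟩
  · rcases le_or_gt t 0 with h | h
    · obtain ⟨d, hd, hd'⟩ := h₂.right (-t) (by linarith)
      refine ⟨-d, neg_ne_zero.2 hd, ((hd'.comp (tendsto_neg_nhdsLT t)).neg).congr' ?_⟩
      filter_upwards [self_mem_nhdsWithin] with s (hs : s < t)
        using (deriv_glue_neg γ₁ γ₂ (hs.trans_le h)).2.symm
    · obtain ⟨d, hd, hd'⟩ := h₁.left t h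
      refine ⟨d, hd, hd'.congr' ?_⟩
      filter_upwards [mem_nhdsWithin_of_mem_nhds (hpos t h)] with s hs using hs.symm
  · rcases le_or_gt 0 t with h | h
    · obtain ⟨d, hd, hd'⟩ := h₁.right t h
      refine ⟨d, hd, hd'.congr' ?_⟩
      filter_upwards [self_mem_nhdsWithin] with s (hs : t < s)
        using (deriv_glue_pos γ₁ γ₂ (h.trans_lt hs)).2.symm
    · obtain ⟨d, hd, hd'⟩ := h₂.left (-t) (by linarith)
      refine ⟨-d, neg_ne_zero.2 hd, ((hd'.comp (tendsto_neg_nhdsGT t)).neg).congr' ?_⟩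
      filter_upwards [mem_nhdsWithin_of_mem_nhds (hneg t h)] with s hs using hs.symm

lemma Half.ends_atTop {γ : ℝ → ℂ} (h : u.Half M p γ) :
    u.EndsAtPole γ atTop ∨ u.EndsAtNegIInfty γ atTop := by
  obtain ⟨T, -, ⟨k, v, -, he⟩ | ⟨b, hb, he⟩⟩ := h.ends
  · refine Or.inl ⟨k, ?_⟩
    have h1 : Tendsto (fun t : ℝ => u.z k + (Real.exp (-t) : ℂ) * v) atTop
        (𝓝 (u.z k + ((0 : ℝ) : ℂ) * v)) :=
      (((Complex.continuous_ofReal.tendsto _).comp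
        (Real.tendsto_exp_atBot.comp tendsto_neg_atTop_atBot)).mul_const v).const_add _
    simp only [Complex.ofReal_zero, zero_mul, add_zero] at h1
    exact h1.congr' ((eventually_ge_atTop T).mono fun t ht => (he t ht).symm)
  · refine Or.inr ⟨?_, b.re, u.leftAbscissa, leftAbscissa_lt, ?_⟩
    · have h1 : Tendsto (fun t : ℝ => b.im + -t) atTop atBot :=
        tendsto_atBot_add_const_left _ _ tendsto_neg_atTop_atBot
      refine h1.congr' ((eventually_ge_atTop T).mono fun t ht => ?_)
      simp [he t ht, sub_eq_add_neg]
    · filter_upwards [eventually_ge_atTop T] with t ht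
      rw [he t ht]; simp [hb]

lemma Half.isContour_glue (h₁ : u.Half M p γ₁) (h₂ : u.Half M p γ₂) (hM : ∀ w ∈ M, ¬ u.IsPole w)
    (hp : ¬ u.IsPole p) : u.IsContour (glue γ₁ γ₂) := by
  refine ⟨h₁.isPiecewiseC1_glue h₂, fun t => ?_, ?_, ?_⟩
  · rcases lt_trichotomy t 0 with h | rfl | h
    · rw [(deriv_glue_neg γ₁ γ₂ h).1.self_of_nhds]
      exact hM _ (h₂.mem _ (by linarith))
    · simpa [glue, h₁.zero] using hp
    · rw [(deriv_glue_pos γ₁ γ₂ h).1.self_of_nhds]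
      exact hM _ (h₁.mem _ h)
  · have hev : ∀ᶠ t : ℝ in atBot, γ₂ (-t) = glue γ₁ γ₂ t :=
      (eventually_lt_atBot 0).mono fun t ht => (deriv_glue_neg γ₁ γ₂ ht).1.self_of_nhds.symm
    refine h₂.ends_atTop.imp ?_ ?_
    · rintro ⟨k, hk⟩
      exact ⟨k, (hk.comp tendsto_neg_atBot_atTop).congr' hev⟩
    · rintro ⟨hi, a₁, a₂, ha, hre⟩
      refine ⟨(hi.comp tendsto_neg_atBot_atTop).congr' (hev.mono fun t ht => ?_), a₁, a₂, ha, ?_⟩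
      · exact congrArg Complex.im ht
      · filter_upwards [hev, tendsto_neg_atBot_atTop.eventually hre] with t h1 h2
        rwa [h1] at h2
  · have hev : ∀ᶠ t : ℝ in atTop, γ₁ t = glue γ₁ γ₂ t :=
      (eventually_gt_atTop 0).mono fun t ht => (deriv_glue_pos γ₁ γ₂ ht).1.self_of_nhds.symm
    refine h₁.ends_atTop.imp ?_ ?_
    · rintro ⟨k, hk⟩
      exact ⟨k, hk.congr' hev⟩
    · rintro ⟨hi, a₁, a₂, ha, hre⟩
      refine ⟨hi.congr' (hev.mono fun t ht => congrArg Complex.im ht), a₁, a₂, ha, ?_⟩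
      filter_upwards [hev, hre] with t h1 h2
      rwa [h1] at h2

lemma Half.passesMaximally_glue (h₁ : u.Half M p γ₁) (h₂ : u.Half M p γ₂)
    (hM : ∀ w ∈ M, ¬ u.IsCritical lam w ∧ u.R lam w < u.R lam p) (hp : u.IsCritical lam p) :
    u.PassesMaximally lam (glue γ₁ γ₂) p := by
  refine ⟨hp, 0, by simp [glue, h₁.zero], fun t ht => ?_⟩
  rcases lt_or_gt_of_ne ht with h | h
  · rw [(deriv_glue_neg γ₁ γ₂ h).1.self_of_nhds]
    exact hM _ (h₂.mem _ (by linarith))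
  · rw [(deriv_glue_pos γ₁ γ₂ h).1.self_of_nhds]
    exact hM _ (h₁.mem _ h)

end Glue

end BenjaminOno.RationalPotential

namespace BenjaminOno.RationalPotential

variable {P : ℕ} {u : RationalPotential P} {lam : ℝ}

/-! ### Integrals along the curves -/

variable (u) in
/-- The functions `g` for which the integrals of `g e^{-ih/ε}` are considered. -/
structure IsTest (g : ℂ → ℂ) : Prop where
  diff : ∀ w, (∀ p, w ≠ u.z p) → DifferentiableAt ℂ g w
  well : ∀ p, ∃ C, ∀ᶠ w in 𝓝[≠] (u.z p), ‖w - u.z p‖ * ‖g w‖ ≤ C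
  left : ∃ C, ∀ w : ℂ, w.im ≤ 0 → w.re ≤ u.leftAbscissa → ‖g w‖ ≤ C

lemma ne_z_of_not_isPole {w : ℂ} (hw : ¬ u.IsPole w) (p : Fin P) : w ≠ u.z p :=
  fun h => hw ⟨p, Or.inl h⟩

lemma IsTest.analyticAt {g : ℂ → ℂ} (hg : u.IsTest g) {w : ℂ} (hw : ∀ p, w ≠ u.z p) :
    AnalyticAt ℂ g w := by
  have hfin : (Set.range u.z).Finite := Set.finite_range _
  have hd : DifferentiableOn ℂ g (Set.range u.z)ᶜ := fun w hw =>
    (hg.diff w fun p h => hw ⟨p, h.symm⟩).differentiableWithinAt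
  exact hd.analyticAt (hfin.isClosed.isOpen_compl.mem_nhds (by rintro ⟨p, hp⟩; exact hw p hp.symm))

lemma leftAbscissa_add_one_le (p : Fin P) : u.leftAbscissa + 1 ≤ (u.z p).re := by
  have hP : 0 < P := p.pos
  rw [leftAbscissa, dif_pos hP]
  have : (u.z ⟨0, hP⟩).re ≤ (u.z p).re := u.z_re_strictMono.monotone (Nat.zero_le _)
  linarith

variable (u) in
/-- A bound for `R - lam * im` to the left of all poles. -/
noncomputable def leftBound : ℝ := ∑ p, u.gam p * Real.log (1 + 2 * |(u.z p).im| / 1)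

lemma IsPosImag.R_le_left (hc : u.IsPosImag) (lam : ℝ) {w : ℂ} (hw : w.re ≤ u.leftAbscissa)
    (hp : ¬ u.IsPole w) : u.R lam w ≤ lam * w.im + u.leftBound := by
  refine hc.R_le lam one_pos hp fun p => ?_
  refine le_trans ?_ ((neg_le_abs _).trans (Complex.abs_re_le_norm (w - conj (u.z p))))
  rw [Complex.sub_re, Complex.conj_re]
  linarith [leftAbscissa_add_one_le (u := u) p]

variable (u) in
/-- `E` is a branch of `e^{-ih/ε}` along `γ` on `[0, ∞)`. -/
structure IsExp (lam ε : ℝ) (γ E : ℝ → ℂ) : Prop where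
  cont : Continuous E
  norm : ∀ t, 0 < t → ‖E t‖ = Real.exp (u.R lam (γ t) / ε)
  deriv : ∀ t d, 0 < t → HasDerivAt γ d t →
    HasDerivAt E (E t * (-Complex.I * ((lam + u.toFun (γ t)) * d) / ε)) t

section
variable {M : Set ℂ} {p : ℂ} {γ E : ℝ → ℂ} {ε : ℝ}

/-- At a well `R = γₖ log |w - zₖ| + O(1)` and the distance is proportional to `e^{-t}`; towards
`-i∞` one has `R ≤ lam Im w + O(1)`. Either way the exponential decays exponentially in `t`. -/
lemma Half.norm_exp_le (hc : u.IsPosImag) (hlam : 0 < lam) (hε : 0 < ε) (h : u.Half M p γ)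
    (hM : ∀ w ∈ M, ¬ u.IsPole w) (hE : u.IsExp lam ε γ E) :
    ∃ C, ∃ κ > 0, ∀ᶠ t in atTop, ‖E t‖ ≤ C * Real.exp (-κ * t) := by
  obtain ⟨T, hT, ⟨k, v, hv, he⟩ | ⟨b, hb, he⟩⟩ := h.ends
  · obtain ⟨C, hC⟩ := hc.R_sub_log_near lam k
    have ht : Tendsto γ atTop (𝓝 (u.z k)) := by
      have h1 : Tendsto (fun t : ℝ => u.z k + (Real.exp (-t) : ℂ) * v) atTop
          (𝓝 (u.z k + ((0 : ℝ) : ℂ) * v)) :=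
        (((Complex.continuous_ofReal.tendsto _).comp
          (Real.tendsto_exp_atBot.comp tendsto_neg_atTop_atBot)).mul_const v).const_add _
      simp only [Complex.ofReal_zero, zero_mul, add_zero] at h1
      exact h1.congr' ((eventually_ge_atTop T).mono fun t ht => (he t ht).symm)
    refine ⟨Real.exp ((u.gam k * Real.log ‖v‖ + C) / ε), u.gam k / ε,
      div_pos (hc.gam_pos k) hε, ?_⟩
    filter_upwards [ht.eventually hC, eventually_ge_atTop T, eventually_gt_atTop 0] with t h1 h2 h3
    rw [hE.norm t h3, ← Real.exp_add, Real.exp_le_exp, div_eq_mul_inv, div_eq_mul_inv,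
      div_eq_mul_inv]
    have h4 : ‖γ t - u.z k‖ = Real.exp (-t) * ‖v‖ := by
      rw [he t h2, add_sub_cancel_left, norm_mul, Complex.norm_real, Real.norm_eq_abs, Real.abs_exp]
    rw [h4, Real.log_mul (Real.exp_pos _).ne' (norm_ne_zero_iff.2 hv), Real.log_exp] at h1
    have h5 : 0 < ε⁻¹ := inv_pos.2 hε
    nlinarith
  · refine ⟨Real.exp ((lam * b.im + u.leftBound) / ε), lam / ε, div_pos hlam hε, ?_⟩
    filter_upwards [eventually_ge_atTop T, eventually_gt_atTop 0] with t h2 h3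
    have him : (γ t).im = b.im - t := by rw [he t h2]; simp
    have hR := hc.R_le_left lam (w := γ t) (by rw [he t h2]; simpa using hb) (hM _ (h.mem t h3))
    rw [hE.norm t h3, ← Real.exp_add, Real.exp_le_exp, div_eq_mul_inv, div_eq_mul_inv,
      div_eq_mul_inv]
    rw [him] at hR
    have h5 : 0 < ε⁻¹ := inv_pos.2 hε
    nlinarith

/-- In the parametrisation by `e^{-t}` the speed equals the distance to the well, which compensates
a simple pole of `g`. -/
lemma Half.norm_test_le (h : u.Half M p γ) {g : ℂ → ℂ} (hg : u.IsTest g) :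
    ∃ C, ∀ᶠ t in atTop, ‖g (γ t)‖ * ‖deriv γ t‖ ≤ C := by
  obtain ⟨T, hT, ⟨k, v, hv, he⟩ | ⟨b, hb, he⟩⟩ := h.ends
  · obtain ⟨C, hC⟩ := hg.well k
    have hne : ∀ t ≥ T, γ t ≠ u.z k := fun t ht => by
      rw [he t ht]
      simpa using hv
    have ht : Tendsto γ atTop (𝓝[≠] (u.z k)) := by
      have h1 : Tendsto (fun t : ℝ => u.z k + (Real.exp (-t) : ℂ) * v) atTop
          (𝓝 (u.z k + ((0 : ℝ) : ℂ) * v)) :=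
        (((Complex.continuous_ofReal.tendsto _).comp
          (Real.tendsto_exp_atBot.comp tendsto_neg_atTop_atBot)).mul_const v).const_add _
      simp only [Complex.ofReal_zero, zero_mul, add_zero] at h1
      exact tendsto_nhdsWithin_iff.2
        ⟨h1.congr' ((eventually_ge_atTop T).mono fun t ht => (he t ht).symm),
          (eventually_ge_atTop T).mono hne⟩
    refine ⟨C, ?_⟩
    filter_upwards [ht.eventually hC, eventually_gt_atTop T] with t h1 h2
    have hd : deriv γ t = -(Real.exp (-t) * v) := by
      have : γ =ᶠ[𝓝 t] fun t : ℝ => u.z k + Real.exp (-t) * v :=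
        (eventually_gt_nhds h2).mono fun s hs => he s hs.le
      rw [this.deriv_eq, (hasDerivAt_exp_curve _ _ t).deriv]
    have : ‖deriv γ t‖ = ‖γ t - u.z k‖ := by rw [hd, he t h2.le, norm_neg, add_sub_cancel_left]
    rw [this, mul_comm]; exact h1
  · obtain ⟨C, hC⟩ := hg.left
    refine ⟨C, ?_⟩
    filter_upwards [eventually_gt_atTop T, eventually_ge_atTop b.im] with t h2 h3
    have hd : deriv γ t = -Complex.I := by
      have : γ =ᶠ[𝓝 t] fun t : ℝ => b + t * (-Complex.I) :=
        (eventually_gt_nhds h2).mono fun s hs => by rw [he s hs.le]; ring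
      rw [this.deriv_eq, (hasDerivAt_line _ _ t).deriv]
    rw [hd, norm_neg, Complex.norm_I, mul_one]
    apply hC <;> rw [he t h2.le]
    · simpa using h3
    · simpa using hb

lemma Half.continuousOn_test (h : u.Half M p γ) {g : ℂ → ℂ} (hg : u.IsTest g)
    (hp : ¬ u.IsPole p) (hM : ∀ w ∈ M, ¬ u.IsPole w) :
    ContinuousOn (fun t => g (γ t)) (Set.Ici 0) := by
  intro t (ht : 0 ≤ t)
  have hnp : ¬ u.IsPole (γ t) := by
    rcases ht.eq_or_lt with rfl | ht
    · rwa [h.zero]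
    · exact hM _ (h.mem t ht)
  exact (ContinuousAt.comp (hg.diff _ (ne_z_of_not_isPole hnp)).continuousAt
    h.cont.continuousAt).continuousWithinAt

lemma Half.integrableOn (hc : u.IsPosImag) (hlam : 0 < lam) (hε : 0 < ε) (h : u.Half M p γ)
    (hp : ¬ u.IsPole p) (hM : ∀ w ∈ M, ¬ u.IsPole w) (hE : u.IsExp lam ε γ E)
    {g : ℂ → ℂ} (hg : u.IsTest g) :
    IntegrableOn (fun t => g (γ t) * E t * deriv γ t) (Set.Ioi 0) := by
  obtain ⟨C₁, κ, hκ, h1⟩ := h.norm_exp_le hc hlam hε hM hE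
  obtain ⟨C₂, h2⟩ := h.norm_test_le hg
  obtain ⟨T, hT⟩ := eventually_atTop.1 ((h1.and h2).and (eventually_gt_atTop 0))
  have hT0 : 0 < T := (hT T le_rfl).2
  have hcont : ContinuousOn (fun t => g (γ t) * E t) (Set.Ici 0) :=
    (h.continuousOn_test hg hp hM).mul hE.cont.continuousOn
  have hmeas : AEStronglyMeasurable (fun t => g (γ t) * E t * deriv γ t)
      (volume.restrict (Set.Ioi 0)) :=
    ((hcont.mono Set.Ioi_subset_Ici_self).aestronglyMeasurable measurableSet_Ioi).mul
      (measurable_deriv γ).aestronglyMeasurable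
  rw [← Set.Ioc_union_Ioi_eq_Ioi hT0.le]
  apply IntegrableOn.union
  · obtain ⟨S, C₃, hS⟩ := h.smooth
    obtain ⟨C₄, hC₄⟩ := isCompact_Icc.exists_bound_of_continuousOn
      (hcont.mono (show Set.Icc 0 T ⊆ Set.Ici 0 from Set.Icc_subset_Ici_self))
    have hconst : IntegrableOn (fun _ : ℝ => C₄ * C₃) (Set.Ioc 0 T) := integrableOn_const (by simp)
    refine hconst.mono' (hmeas.mono_measure
      (Measure.restrict_mono Set.Ioc_subset_Ioi_self le_rfl)) ?_
    rw [ae_restrict_iff' measurableSet_Ioc]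
    have hSn : ∀ᵐ t : ℝ, t ∉ (S : Set ℝ) := S.finite_toSet.countable.ae_notMem _
    filter_upwards [hSn] with t htS ht
    rw [norm_mul]
    exact mul_le_mul (hC₄ t ⟨ht.1.le, ht.2⟩) (hS t ht.1 htS).2.2 (norm_nonneg _)
      ((norm_nonneg _).trans (hC₄ t ⟨ht.1.le, ht.2⟩))
  · have hint : IntegrableOn (fun t => C₂ * (C₁ * Real.exp (-κ * t))) (Set.Ioi T) :=
      ((exp_neg_integrableOn_Ioi T hκ).const_mul C₁).const_mul C₂
    refine hint.mono' (hmeas.mono_measure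
      (Measure.restrict_mono (Set.Ioi_subset_Ioi hT0.le) le_rfl)) ?_
    rw [ae_restrict_iff' measurableSet_Ioi]
    refine Eventually.of_forall fun t (ht : T < t) => ?_
    obtain ⟨⟨h3, h4⟩, -⟩ := hT t ht.le
    have h5 : 0 ≤ C₂ := le_trans (by positivity) h4
    calc ‖g (γ t) * E t * deriv γ t‖ = ‖g (γ t)‖ * ‖deriv γ t‖ * ‖E t‖ := by
          rw [norm_mul, norm_mul]; ring
      _ ≤ _ := mul_le_mul h4 h3 (norm_nonneg _) h5

/-- The fundamental theorem of calculus along the curve, for a solution `y` of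
`(y e^{-ih/ε})' = g e^{-ih/ε}`. -/
lemma Half.integral_eq (hc : u.IsPosImag) (hlam : 0 < lam) (hε : 0 < ε) (h : u.Half M p γ)
    (hp : ¬ u.IsPole p) (hM : ∀ w ∈ M, ¬ u.IsPole w) (hE : u.IsExp lam ε γ E)
    {g : ℂ → ℂ} (hg : u.IsTest g) {y : ℂ → ℂ}
    (hy : ∀ t, 0 < t → HasDerivAt y (g (γ t) + Complex.I / ε * (lam + u.toFun (γ t)) * y (γ t)) (γ t))
    {ℓ : ℂ} (h0 : Tendsto (fun t => y (γ t) * E t) (𝓝[>] 0) (𝓝 ℓ))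
    (hinf : Tendsto (fun t => y (γ t) * E t) atTop (𝓝 0)) :
    ∫ t in Set.Ioi (0 : ℝ), g (γ t) * E t * deriv γ t = -ℓ := by
  have hint := h.integrableOn hc hlam hε hp hM hE hg
  obtain ⟨S, C₃, hS⟩ := h.smooth
  -- No regularity of `y` at the starting point is assumed; the one-sided limit `ℓ` supplies the
  -- boundary value.
  set F : ℝ → ℂ := Function.update (fun t => y (γ t) * E t) 0 ℓ with hF
  have hFt : ∀ t, 0 < t → F t = y (γ t) * E t := fun t ht => by
    rw [hF, Function.update_of_ne ht.ne']
  have hFe : ∀ t, 0 < t → F =ᶠ[𝓝 t] fun t => y (γ t) * E t := fun t ht =>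
    (eventually_gt_nhds ht).mono hFt
  have hFTC : ∀ b > 0, ∫ t in (0 : ℝ)..b, g (γ t) * E t * deriv γ t = F b - F 0 := by
    intro b hb
    apply integral_eq_of_hasDerivAt_off_countable_of_le F _ hb.le S.finite_toSet.countable
    · intro t ht
      rcases ht.1.eq_or_lt with rfl | h1
      · have : ContinuousWithinAt F (Set.Ici 0) 0 := by
          rw [hF, continuousWithinAt_update_same]
          rwa [show Set.Ici (0 : ℝ) \ {0} = Set.Ioi 0 by ext; simp [lt_iff_le_and_ne, eq_comm]]
        exact this.mono Set.Icc_subset_Ici_self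
      · refine ((ContinuousAt.mul ?_ hE.cont.continuousAt).congr (hFe t h1).symm).continuousWithinAt
        exact ContinuousAt.comp (hy t h1).continuousAt h.cont.continuousAt
    · rintro t ⟨⟨h1, h2⟩, h3⟩
      have hd := ((hS t h1 h3).1.differentiableAt (by simp)).hasDerivAt
      refine HasDerivAt.congr_of_eventuallyEq ?_ (hFe t h1)
      convert! ((hy t h1).comp t hd).mul (hE.deriv t _ h1 hd) using 1
      simp only [Function.comp_apply]
      ring
    · rw [intervalIntegrable_iff_integrableOn_Ioc_of_le hb.le]
      exact hint.mono_set Set.Ioc_subset_Ioi_self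
  have hl := intervalIntegral_tendsto_integral_Ioi 0 hint tendsto_id
  have hr : Tendsto (fun b => F b - F 0) atTop (𝓝 (0 - ℓ)) := by
    have : F 0 = ℓ := by rw [hF, Function.update_self]
    rw [this]
    exact (hinf.congr' ((eventually_gt_atTop 0).mono fun t ht => (hFt t ht).symm)).sub_const ℓ
  rw [zero_sub] at hr
  exact tendsto_nhds_unique hl (hr.congr' ((eventually_gt_atTop 0).mono fun b hb =>
    (hFTC b hb).symm))

end

end BenjaminOno.RationalPotential

namespace BenjaminOno.RationalPotential

variable {P : ℕ} {u : RationalPotential P} {lam : ℝ} {ρ : ℝ}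

/-! ### Contours through the critical points -/

lemma eventually_not_isCritical (hlam : 0 < lam) (q : ℂ) :
    ∀ᶠ w in 𝓝 q, w ≠ q → ¬ u.IsCritical lam w := by
  have hfin : {w | u.IsCritical lam w ∧ w ≠ q}.Finite :=
    (finite_isCritical hlam).subset fun _ h => h.1
  filter_upwards [hfin.isClosed.isOpen_compl.mem_nhds (x := q) (by simp)] with w hw hne hcr
    using hw ⟨hcr, hne⟩

lemma eventually_im_pos {q : ℂ} (hq : 0 < q.im) : ∀ᶠ w in 𝓝 q, 0 < w.im :=
  (isOpen_lt continuous_const Complex.continuous_im).mem_nhds hq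

lemma exists_forall_mem_Ioc {p : ℝ → Prop} (h : ∀ᶠ t in 𝓝[>] 0, p t) :
    ∃ s > 0, ∀ t, 0 < t → t ≤ s → p t := by
  obtain ⟨s, hs, hsub⟩ := (nhdsGT_basis_Ioc (0 : ℝ)).eventually_iff.1 h
  exact ⟨s, hs, fun t h0 h1 => hsub ⟨h0, h1⟩⟩

/-- A short segment in a direction of descent, continued by the curve that `IsPosImag.reach`
provides from its end. -/
lemma IsPosImag.exists_half_of_direction (hc : u.IsPosImag) (hlam : 0 < lam)
    (h : u.IsFarRadius lam ρ) (hρ : -ρ ≤ u.leftAbscissa) {q v : ℂ} {c : ℝ} (hv : v ≠ 0)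
    (hev : ∀ᶠ t : ℝ in 𝓝[>] 0, q + t * v ∈ u.region lam c ρ ∧ 0 < (q + t * v).im) :
    ∃ s₀ > (0 : ℝ), ∀ s : ℝ, 0 < s → s ≤ s₀ → ∃ γ, u.Half (u.region lam c ρ) q γ ∧
      ∀ t ≤ 1, γ t = q + t * (s * v) := by
  obtain ⟨s₀, hs₀, hs⟩ := exists_forall_mem_Ioc hev
  refine ⟨s₀, hs₀, fun s hs0 hs1 => ?_⟩
  obtain ⟨h1, h2⟩ := hs s hs0 hs1
  obtain ⟨γ, hγ⟩ := (hc.reach hlam h hρ h1 h2).exists_half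
  have hne : q ≠ q + s * v := by
    have : (s : ℂ) ≠ 0 := by exact_mod_cast hs0.ne'
    simp [this, hv]
  obtain ⟨γ', hγ', he⟩ := hγ.cons subset_rfl hne fun t ht0 ht1 => by
    have := (hs (t * s) (by positivity) (by nlinarith)).1
    convert! this using 1
    push_cast; ring
  exact ⟨γ', hγ', fun t ht => by rw [he t ht]; ring⟩

/-- The two halves leave along `v` and `-v`, hence through opposite sectors, and they are straight
near `q`. So they start in the sectors attached to every neighbourhood `N`. -/
theorem IsPosImag.exists_halves_upper (hc : u.IsPosImag) (hlam : 0 < lam)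
    (h : u.IsFarRadius lam ρ) (hρ : -ρ ≤ u.leftAbscissa) {q : ℂ} (him : 0 < q.im)
    (hcr : u.IsCritical lam q) (hd : deriv u.toFun q ≠ 0) :
    ∃ γ₁ γ₂, u.Half (u.region lam (u.R lam q) ρ) q γ₁ ∧ u.Half (u.region lam (u.R lam q) ρ) q γ₂ ∧
      ∀ N ∈ 𝓝 q, ∃ r > 0, ∃ S₁ S₂ : Set ℂ, IsOpen S₁ ∧ IsPreconnected S₁ ∧
        IsOpen S₂ ∧ IsPreconnected S₂ ∧
        (∀ w ∈ S₁ ∪ S₂, w ∈ N ∧ ¬ u.IsPole w ∧ u.R lam w < u.R lam q) ∧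
        (∀ w ∈ Metric.ball q r, u.R lam w < u.R lam q → w ∈ S₁ ∪ S₂) ∧
        (∀ᶠ t in 𝓝[>] 0, γ₁ t ∈ S₁) ∧ ∀ᶠ t in 𝓝[>] 0, γ₂ t ∈ S₂ := by
  obtain ⟨v, hv, hN⟩ := exists_sectors_simple hc hcr hd
  have hmem : {w | 0 < w.im ∧ (w ≠ q → ¬ u.IsCritical lam w)} ∈ 𝓝 q :=
    (eventually_im_pos him).and (eventually_not_isCritical hlam q)
  obtain ⟨r, hr, S₁, S₂, -, -, -, -, h1, -, h3⟩ := hN _ hmem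
  have hreg : ∀ w, (w ∈ {w | 0 < w.im ∧ (w ≠ q → ¬ u.IsCritical lam w)} ∧
      ¬ u.IsPole w ∧ u.R lam w < u.R lam q) →
      w ∈ u.region lam (u.R lam q) ρ ∧ 0 < w.im := fun w hw => by
    have hne : w ≠ q := by rintro rfl; exact lt_irrefl _ hw.2.2
    exact ⟨⟨hw.2.1, hw.1.2 hne, hw.2.2, Or.inl hw.1.1⟩, hw.1.1⟩
  obtain ⟨s₁, hs₁, H₁⟩ := hc.exists_half_of_direction hlam h hρ hv
    (h3.mono fun t ht => hreg _ (h1 _ (Or.inl ht.1)))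
  obtain ⟨s₂, hs₂, H₂⟩ := hc.exists_half_of_direction hlam h hρ (neg_ne_zero.2 hv)
    (h3.mono fun t ht => hreg _ (by
      have := h1 _ (Or.inr ht.2)
      rwa [sub_eq_add_neg, ← mul_neg] at this))
  obtain ⟨γ₁, hγ₁, e₁⟩ := H₁ s₁ hs₁ le_rfl
  obtain ⟨γ₂, hγ₂, e₂⟩ := H₂ s₂ hs₂ le_rfl
  refine ⟨γ₁, γ₂, hγ₁, hγ₂, fun N hNq => ?_⟩
  obtain ⟨r, hr, S₁, S₂, k1, k2, k3, k5, k6, k7, k4⟩ := hN N hNq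
  have hscale : ∀ s : ℝ, 0 < s → Tendsto (fun t : ℝ => t * s) (𝓝[>] 0) (𝓝[>] 0) := fun s hs => by
    apply tendsto_nhdsWithin_iff.2 ⟨?_, ?_⟩
    · have : Tendsto (fun t : ℝ => t * s) (𝓝 0) (𝓝 (0 * s)) := tendsto_id.mul_const s
      rw [zero_mul] at this
      exact this.mono_left nhdsWithin_le_nhds
    · filter_upwards [self_mem_nhdsWithin] with t (ht : 0 < t)
      exact mul_pos ht hs
  have hle : ∀ᶠ t : ℝ in 𝓝[>] 0, t ≤ 1 := by
    filter_upwards [Ioc_mem_nhdsGT one_pos] with t ht using ht.2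
  refine ⟨r, hr, S₁, S₂, k1, k2, k3, k5, k6, k7, ?_, ?_⟩
  · filter_upwards [hle, (hscale s₁ hs₁).eventually k4] with t ht ht'
    rw [e₁ t ht, ← mul_assoc, ← Complex.ofReal_mul]
    exact ht'.1
  · filter_upwards [hle, (hscale s₂ hs₂).eventually k4] with t ht ht'
    rw [e₂ t ht, ← mul_assoc, ← Complex.ofReal_mul, mul_neg, ← sub_eq_add_neg]
    exact ht'.2

variable (u) in
/-- The domain consisting of a strip around the real axis, a left and a right half-plane. -/
def dom (ρ : ℝ) : Set ℂ :=
  {w | (∀ p, |w.im| < (u.z p).im) ∨ w.re < u.leftAbscissa + 1 ∨ ρ < w.re}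

variable (u) in
/-- A part of `{R < 0}` in the lower half-plane. -/
def lowRegion (lam ρ : ℝ) : Set ℂ :=
  {w | ¬ u.IsPole w ∧ ¬ u.IsCritical lam w ∧ u.R lam w < 0 ∧ w.im < 0 ∧ w ∈ u.dom ρ}

lemma not_isCritical_of_re_pos {w : ℂ} (h : 0 < lam + (u.toFun w).re) : ¬ u.IsCritical lam w :=
  fun hcr => by
    have := congrArg Complex.re hcr.2
    rw [Complex.add_re, Complex.ofReal_re, Complex.zero_re] at this
    linarith

/-- `R` vanishes on the axis and increases upwards where `Re h' > 0`, so it is negative below. -/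
lemma IsPosImag.mem_lowRegion (hc : u.IsPosImag) {x y : ℝ} (hy : y < 0)
    (hd : (x : ℂ) + y * Complex.I ∈ u.dom ρ)
    (h : ∀ s ∈ Set.Icc y 0, ¬ u.IsPole (x + s * Complex.I) ∧
      0 < lam + (u.toFun (x + s * Complex.I)).re) :
    (x : ℂ) + y * Complex.I ∈ u.lowRegion lam ρ := by
  have h1 := h y ⟨le_rfl, hy.le⟩
  have h2 := hc.R_lt_R_vertical lam x hy h
  rw [Complex.ofReal_zero, zero_mul, add_zero, hc.R_ofReal] at h2
  exact ⟨h1.1, not_isCritical_of_re_pos h1.2, h2, by simpa using hy, hd⟩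

/-- `Re h' > 0` in a thin strip below a compact interval to the left of the leftmost real critical
point. -/
lemma IsLeftCritical.exists_strip {q : ℝ} (hq : u.IsLeftCritical lam q) {a b : ℝ} (hb : b < q) :
    ∃ η > (0 : ℝ), ∀ x ∈ Set.Icc a b, ∀ y ∈ Set.Icc (-η) 0, ¬ u.IsPole (x + y * Complex.I) ∧
      0 < lam + (u.toFun (x + y * Complex.I)).re := by
  have hall := isCompact_Icc.eventually_forall_of_forall_eventually (x₀ := (0 : ℝ))
    (K := Set.Icc a b)
    (P := fun y x => ¬ u.IsPole (x + y * Complex.I) ∧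
      0 < lam + (u.toFun (x + y * Complex.I)).re) (by
      intro x hx
      have hcont : Tendsto (fun p : ℝ × ℝ => (p.2 : ℂ) + p.1 * Complex.I) (𝓝 (0, x))
          (𝓝 (x : ℂ)) := by
        have : ContinuousAt (fun p : ℝ × ℝ => (p.2 : ℂ) + p.1 * Complex.I) (0, x) := by fun_prop
        simpa [ContinuousAt] using this
      have hnp := not_isPole_ofReal (u := u) x
      refine (hcont.eventually (eventually_not_isPole hnp)).and ?_
      have h1 : ContinuousAt (fun w => lam + (u.toFun w).re) (x : ℂ) :=
        continuousAt_const.add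
          (Complex.continuous_re.continuousAt.comp (analyticAt_toFun hnp).continuousAt)
      exact hcont.eventually (h1.eventually_const_lt (hq.2 x (hx.2.trans_lt hb))))
  obtain ⟨δ, hδ, hball⟩ := Metric.eventually_nhds_iff.1 hall
  refine ⟨δ / 2, by positivity, fun x hx y hy => hball ?_ x hx⟩
  rw [dist_zero_right, Real.norm_eq_abs, abs_lt]
  constructor <;> linarith [hy.1, hy.2]

/-- One half rises in direction `1 + 2i` inside `{R < 0}`. The other descends to the left inside the
wedge where `Re h' > 0`, runs left in a thin strip below the axis, which is possible because `h' >
0` to the left of `q`, and then goes down to `-i∞`. -/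
theorem IsPosImag.exists_halves_real (hc : u.IsPosImag) (hlam : 0 < lam)
    (h : u.IsFarRadius lam ρ) (hρ : -ρ ≤ u.leftAbscissa) {q : ℝ} (hq : u.IsLeftCritical lam q)
    {k : ℕ} {r : ℝ} (hs : RealSign k r) (hL : LocalOrder u lam q k r) :
    ∃ γ₁ γ₂, u.Half (u.region lam 0 ρ) q γ₁ ∧ u.Half (u.lowRegion lam ρ) q γ₂ := by
  have hev : ∀ᶠ t : ℝ in 𝓝[>] 0, (q : ℂ) + t * (⟨1, 2⟩ : ℂ) ∈ u.region lam 0 ρ ∧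
      0 < ((q : ℂ) + t * (⟨1, 2⟩ : ℂ)).im := by
    have hcont : Tendsto (fun t : ℝ => (q : ℂ) + t * (⟨1, 2⟩ : ℂ)) (𝓝[>] 0) (𝓝 (q : ℂ)) := by
      have : ContinuousAt (fun t : ℝ => (q : ℂ) + t * (⟨1, 2⟩ : ℂ)) 0 := by fun_prop
      have := this.tendsto
      simp only [Complex.ofReal_zero, zero_mul, add_zero] at this
      exact this.mono_left nhdsWithin_le_nhds
    filter_upwards [hq.eventually_R_neg hc hs hL, self_mem_nhdsWithin,
      hcont.eventually (eventually_not_isPole (not_isPole_ofReal (u := u) q)),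
      hcont.eventually (eventually_not_isCritical hlam (q : ℂ))] with t h1 (h2 : 0 < t) h3 h4
    have him : 0 < ((q : ℂ) + t * (⟨1, 2⟩ : ℂ)).im := by simp [h2]
    refine ⟨⟨h3, h4 fun he => ?_, h1, Or.inl him⟩, him⟩
    rw [he] at him
    simp at him
  obtain ⟨s₀, hs₀, H⟩ := hc.exists_half_of_direction hlam h hρ
    (show (⟨1, 2⟩ : ℂ) ≠ 0 by simp [Complex.ext_iff]) hev
  obtain ⟨γ₁, hγ₁, -⟩ := H s₀ hs₀ le_rfl
  obtain ⟨τ, hτ, hw⟩ := hq.exists_wedge hs hL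
  have hqρ : -ρ < q := by
    by_contra! hle
    exact h.not_isCritical (w := (q : ℂ)) (by
      rw [Complex.ofReal_re, le_abs]; right; linarith) hq.1
  obtain ⟨m, hm, hmz⟩ : ∃ m > 0, ∀ p, m < (u.z p).im := by
    have : ∀ᶠ m : ℝ in 𝓝[>] 0, ∀ p, m < (u.z p).im :=
      eventually_all.2 fun p => mem_nhdsWithin_of_mem_nhds (eventually_lt_nhds (u.z_im_pos p))
    obtain ⟨m, h1, h2⟩ := (this.and self_mem_nhdsWithin).exists
    exact ⟨m, h2, h1⟩
  -- The first segment ends at `q - 2t₀ - i t₀`: slope `1/2`, within the wedge of width `τ` and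
  -- above all lower poles.
  obtain ⟨t₀, ht₀, ht₁, ht₂, ht₃⟩ : ∃ t₀ > 0, 2 * t₀ ≤ τ ∧ t₀ ≤ 1 / 2 ∧ t₀ ≤ m :=
    ⟨min (min (τ / 2) (1 / 2)) m, by positivity,
      by linarith [min_le_left (τ / 2) (1 / 2), min_le_left (min (τ / 2) (1 / 2)) m],
      (min_le_left _ _).trans (min_le_right _ _), min_le_right _ _⟩
  have hdom : ∀ x y : ℝ, y < 0 → -t₀ ≤ y → (x : ℂ) + y * Complex.I ∈ u.dom ρ :=
    fun x y h1 h2 => Or.inl fun p => by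
      simp only [Complex.add_im, Complex.ofReal_im, Complex.mul_im, Complex.I_im, mul_one,
        Complex.I_re, mul_zero, Complex.ofReal_re, add_zero, zero_add]
      rw [abs_of_neg h1]; linarith [hmz p]
  obtain ⟨η₀, hη₀, hstrip⟩ := hq.exists_strip (a := -ρ - 1) (b := q - 2 * t₀) (by linarith)
  obtain ⟨η, hη, hη₁, hη₂⟩ : ∃ η > 0, η ≤ η₀ ∧ η < t₀ :=
    ⟨min η₀ (t₀ / 2), by positivity, min_le_left _ _, by linarith [min_le_right η₀ (t₀ / 2)]⟩
  have hwedge : ∀ t y : ℝ, 0 < t → t ≤ t₀ → y < 0 → -t ≤ y →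
      ((q - 2 * t : ℝ) : ℂ) + y * Complex.I ∈ u.lowRegion lam ρ := by
    intro t y h1 h2 h3 h4
    refine hc.mem_lowRegion h3 (hdom _ _ h3 (by linarith)) fun s hs => ?_
    have := hw (2 * t) (-s) (by linarith) (by linarith) (by linarith [hs.2])
      (by linarith [hs.1])
    rwa [neg_neg] at this
  have hhor : ∀ x ∈ Set.Icc (-ρ - 1) (q - 2 * t₀),
      ((x : ℝ) : ℂ) + ((-η : ℝ) : ℂ) * Complex.I ∈ u.lowRegion lam ρ := fun x hx =>
    hc.mem_lowRegion (by linarith) (hdom _ _ (by linarith) (by linarith)) fun s hs => hstrip x hx s ⟨by linarith [hs.1], hs.2⟩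
  -- The path is assembled from its far end: the ray down, then the horizontal part at depth `η <
  -- t₀`, then the vertical part inside the wedge.
  have r1 : u.Reach (u.lowRegion lam ρ) (((-ρ - 1 : ℝ) : ℂ) + ((-η : ℝ) : ℂ) * Complex.I) := by
    refine Reach.down (by simp; linarith) fun s hs => ?_
    have : ((-ρ - 1 : ℝ) : ℂ) + ((-η : ℝ) : ℂ) * Complex.I - s * Complex.I =
        ((-ρ - 1 : ℝ) : ℂ) + ((-η - s : ℝ) : ℂ) * Complex.I := by push_cast; ring
    rw [this]
    refine hc.mem_lowRegion (by linarith) (Or.inr (Or.inl (by simp; linarith)))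
      fun y hy => h.of_re ?_
    have : (((-ρ - 1 : ℝ) : ℂ) + (y : ℂ) * Complex.I).re = -ρ - 1 := by simp
    rw [this, le_abs]; right; linarith
  have r2 : u.Reach (u.lowRegion lam ρ) (((q - 2 * t₀ : ℝ) : ℂ) + ((-η : ℝ) : ℂ) * Complex.I) := by
    refine Reach.step (fun v hv => ?_) (fun he => ?_) r1
    · rw [segment_symm] at hv
      obtain ⟨x, hx1, hx2, rfl⟩ := segment_horizontal hv (by linarith)
      exact hhor x ⟨hx1, hx2⟩
    · have := congrArg Complex.re he
      simp at this
      linarith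
  have r3 : u.Reach (u.lowRegion lam ρ) (((q - 2 * t₀ : ℝ) : ℂ) + ((-t₀ : ℝ) : ℂ) * Complex.I) := by
    refine Reach.step (fun v hv => ?_) (fun he => ?_) r2
    · obtain ⟨y, hy1, hy2, rfl⟩ := segment_vertical hv (by linarith)
      exact hwedge t₀ y ht₀ le_rfl (by linarith) hy1
    · have := congrArg Complex.im he
      simp at this
      linarith
  obtain ⟨γ, hγ⟩ := r3.exists_half
  obtain ⟨γ₂, hγ₂, -⟩ := hγ.cons (w := (q : ℂ)) subset_rfl (fun he => by
    have := congrArg Complex.im he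
    simp at this
    linarith) (fun s h0 h1 => by
      have := hwedge (s * t₀) (-(s * t₀)) (by positivity) (by nlinarith)
        (by have : 0 < s * t₀ := by positivity
            linarith) le_rfl
      convert! this using 1
      push_cast; ring)
  exact ⟨γ₁, γ₂, hγ₁, hγ₂⟩

end BenjaminOno.RationalPotential

namespace BenjaminOno.RationalPotential

variable {P : ℕ} {u : RationalPotential P} {lam ε : ℝ} {g : ℂ → ℂ}

/-! ### Solutions of `(y e^{-ih/ε})' = g e^{-ih/ε}` -/

/-- The Poincaré lemma for the form `f dz`, whose closedness is the complex linearity of `f'`. -/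
lemma _root_.Convex.exists_primitive {U : Set ℂ} (hU : Convex ℝ U) (hUo : IsOpen U) {f : ℂ → ℂ}
    (hf : ∀ w ∈ U, DifferentiableAt ℂ f w) : ∃ F : ℂ → ℂ, ∀ w ∈ U, HasDerivAt F (f w) w := by
  set ω : ℂ → ℂ →L[ℂ] ℂ := fun z => (ContinuousLinearMap.toSpanSingleton ℂ (f z)) with hω
  have hd : ∀ w ∈ U, HasFDerivAt ω
      (((ContinuousLinearMap.toSpanSingletonCLE (𝕜 := ℂ) (E := ℂ)).toContinuousLinearMap.restrictScalars ℝ).comp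
        ((fderiv ℂ f w).restrictScalars ℝ)) w := fun w hw => by
    have h1 := (hf w hw).hasFDerivAt.restrictScalars ℝ
    exact (((ContinuousLinearMap.toSpanSingletonCLE (𝕜 := ℂ)
      (E := ℂ)).toContinuousLinearMap.restrictScalars ℝ).hasFDerivAt (x := f w)).comp w h1
  obtain ⟨F, hF⟩ := hU.exists_forall_hasFDerivAt_of_fderiv_symmetric hUo (ω := ω)
    (fun w hw => (hd w hw).differentiableAt.differentiableWithinAt) (by
      intro a ha x y
      rw [(hd a ha).fderiv]
      change y • fderiv ℂ f a x = x • fderiv ℂ f a y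
      rw [← mul_one x, ← mul_one y, ← smul_eq_mul x, ← smul_eq_mul y, map_smul, map_smul]
      simp only [smul_eq_mul]; ring)
  refine ⟨F, fun w hw => ?_⟩
  have := (hF w hw).hasDerivAt
  simpa [hω] using this

variable (u) in
/-- `y` is an analytic solution near `w` of `y' = g + (i/ε) h' y`, except for this equation at the
singularities. -/
def SolAt (lam ε : ℝ) (g y : ℂ → ℂ) (w : ℂ) : Prop :=
  AnalyticAt ℂ y w ∧ ∀ᶠ w' in 𝓝 w, ¬ u.IsPole w' →
    deriv y w' = g w' + Complex.I / ε * (lam + u.toFun w') * y w'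

lemma SolAt.eventually {y : ℂ → ℂ} {w : ℂ} (h : u.SolAt lam ε g y w) :
    ∀ᶠ w' in 𝓝 w, u.SolAt lam ε g y w' :=
  h.1.eventually_analyticAt.and (eventually_eventually_nhds.2 h.2)

lemma SolAt.congr {y y' : ℂ → ℂ} {w : ℂ} (h : u.SolAt lam ε g y w) (he : y =ᶠ[𝓝 w] y') :
    u.SolAt lam ε g y' w := by
  refine ⟨h.1.congr he, ?_⟩
  filter_upwards [h.2, eventually_eventually_nhds.2 he] with v h1 h2 h3
  rw [← Filter.EventuallyEq.deriv_eq h2, h1 h3, h2.self_of_nhds]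

lemma SolAt.hasDerivAt {y : ℂ → ℂ} {w : ℂ} (h : u.SolAt lam ε g y w) (hp : ¬ u.IsPole w) :
    HasDerivAt y (g w + Complex.I / ε * (lam + u.toFun w) * y w) w := by
  rw [← h.2.self_of_nhds hp]
  exact h.1.differentiableAt.hasDerivAt

variable (u) in
/-- An exponential `E` together with a primitive `Φ` of `g E`. -/
structure Frame (lam ε : ℝ) (g : ℂ → ℂ) (U : Set ℂ) (E Φ : ℂ → ℂ) : Prop where
  isOpen : IsOpen U
  not_isPole : ∀ w ∈ U, ¬ u.IsPole w
  ne_zero : ∀ w ∈ U, E w ≠ 0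
  deriv_exp : ∀ w ∈ U, HasDerivAt E (E w * (-Complex.I * (lam + u.toFun w) / ε)) w
  deriv_prim : ∀ w ∈ U, HasDerivAt Φ (g w * E w) w

section
variable {U S : Set ℂ} {E Φ y y₁ y₂ : ℂ → ℂ}

lemma Frame.solAt (h : u.Frame lam ε g U E Φ) (a : ℂ) {w : ℂ}
    (hw : w ∈ U) : u.SolAt lam ε g (fun w => (Φ w + a) / E w) w := by
  have hd : ∀ v ∈ U, HasDerivAt (fun w => (Φ w + a) / E w)
      (g v + Complex.I / ε * (lam + u.toFun v) * ((Φ v + a) / E v)) v := fun v hv => by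
    have hne := h.ne_zero v hv
    convert! ((h.deriv_prim v hv).add_const a).div (h.deriv_exp v hv) hne using 1
    field_simp
    ring
  refine ⟨?_, ?_⟩
  · exact DifferentiableOn.analyticAt (s := U)
      (fun v hv => (hd v hv).differentiableAt.differentiableWithinAt) (h.isOpen.mem_nhds hw)
  · filter_upwards [h.isOpen.mem_nhds hw] with v hv _ using (hd v hv).deriv

/-- `(yE - Φ)' = 0`: on a connected set a solution is determined by a single constant. All matching
arguments below compare such constants. -/
lemma Frame.exists_const (h : u.Frame lam ε g U E Φ) (hS : IsOpen S) (hSc : IsPreconnected S)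
    (hSU : S ⊆ U) (hy : ∀ w ∈ S, u.SolAt lam ε g y w) :
    ∃ a, ∀ w ∈ S, y w = (Φ w + a) / E w := by
  have hd : ∀ w ∈ S, HasDerivAt (fun w => y w * E w - Φ w) 0 w := fun w hw => by
    convert! (((hy w hw).hasDerivAt (h.not_isPole w (hSU hw))).mul
      (h.deriv_exp w (hSU hw))).sub (h.deriv_prim w (hSU hw)) using 1
    ring
  obtain ⟨a, ha⟩ := hS.exists_is_const_of_deriv_eq_zero hSc
    (fun w hw => (hd w hw).differentiableAt.differentiableWithinAt)
    (fun w hw => (hd w hw).deriv)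
  refine ⟨a, fun w hw => ?_⟩
  rw [eq_div_iff (h.ne_zero w (hSU hw)), ← ha w hw]
  ring

lemma exists_frame_of_exp (hg : u.IsTest g) (hU : Convex ℝ U) (hUo : IsOpen U)
    (hp : ∀ w ∈ U, ¬ u.IsPole w) (h0 : ∀ w ∈ U, E w ≠ 0)
    (hE : ∀ w ∈ U, HasDerivAt E (E w * (-Complex.I * (lam + u.toFun w) / ε)) w) :
    ∃ Φ, u.Frame lam ε g U E Φ := by
  obtain ⟨Φ, hΦ⟩ := hU.exists_primitive hUo (f := fun w => g w * E w) fun w hw =>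
    (hg.diff w (ne_z_of_not_isPole (hp w hw))).mul (hE w hw).differentiableAt
  exact ⟨Φ, hUo, hp, h0, hE, hΦ⟩

/-- A primitive of `-ih'` has real part `R` up to a real constant, which is absorbed to make the
modulus exact. -/
lemma IsPosImag.exists_exp (hc : u.IsPosImag) (lam ε : ℝ) (hU : Convex ℝ U) (hUo : IsOpen U)
    (hp : ∀ w ∈ U, ¬ u.IsPole w) :
    ∃ E : ℂ → ℂ, (∀ w ∈ U, ‖E w‖ = Real.exp (u.R lam w / ε)) ∧
      ∀ w ∈ U, HasDerivAt E (E w * (-Complex.I * (lam + u.toFun w) / ε)) w := by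
  obtain ⟨K, hK⟩ := hU.exists_primitive hUo (f := fun w => -Complex.I * (lam + u.toFun w))
    fun w hw => ((analyticAt_toFun (hp w hw)).differentiableAt.const_add _).const_mul _
  have hd : ∀ w ∈ U, HasFDerivAt (fun w => u.R lam w - (K w).re) (0 : ℂ →L[ℝ] ℝ) w := by
    intro w hw
    obtain ⟨r, hr, F, hF⟩ := hc.exists_local lam (hp w hw)
    have h1 : HasDerivAt (fun w => F w - K w) 0 w := by
      convert! (hF w (Metric.mem_ball_self hr)).2.1.sub (hK w hw) using 1
      rw [sub_self]
    have h2 := h1.hasFDerivAt.restrictScalars ℝ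
    have h3 := (Complex.reCLM.hasFDerivAt (x := F w - K w)).comp w h2
    have h4 : HasFDerivAt (fun w => (F w - K w).re) (0 : ℂ →L[ℝ] ℝ) w := by
      convert! h3 using 1
      ext <;> simp
    refine h4.congr_of_eventuallyEq ?_
    filter_upwards [Metric.ball_mem_nhds w hr] with v hv
    rw [Complex.sub_re, (hF v hv).2.2]
  obtain ⟨b, hb⟩ : ∃ b : ℝ, ∀ w ∈ U, u.R lam w - (K w).re = b := by
    obtain ⟨b, hb⟩ := hUo.exists_is_const_of_fderiv_eq_zero hU.isPreconnected
      (fun w hw => (hd w hw).differentiableAt.differentiableWithinAt)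
      (fun w hw => (hd w hw).fderiv)
    exact ⟨b, hb⟩
  refine ⟨fun w => Complex.exp ((K w + b) / ε), fun w hw => ?_, fun w hw => ?_⟩
  · rw [Complex.norm_exp, Complex.div_ofReal_re, Complex.add_re, Complex.ofReal_re, ← hb w hw]
    congr 2; ring
  · exact (((hK w hw).add_const (b : ℂ)).div_const (ε : ℂ)).cexp

lemma IsPosImag.exists_frame (hc : u.IsPosImag) (hg : u.IsTest g) (lam ε : ℝ) (hU : Convex ℝ U)
    (hUo : IsOpen U) (hp : ∀ w ∈ U, ¬ u.IsPole w) :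
    ∃ E Φ, u.Frame lam ε g U E Φ ∧ ∀ w ∈ U, ‖E w‖ = Real.exp (u.R lam w / ε) := by
  obtain ⟨E, hE, hE'⟩ := hc.exists_exp lam ε hU hUo hp
  obtain ⟨Φ, hΦ⟩ := exists_frame_of_exp hg hU hUo hp
    (fun w hw => norm_ne_zero_iff.1 (by rw [hE w hw]; exact (Real.exp_pos _).ne')) hE'
  exact ⟨E, Φ, hΦ, hE⟩

lemma Frame.eq_of_eq (h : u.Frame lam ε g U E Φ) (hS : IsOpen S) (hSc : IsPreconnected S)
    (hSU : S ⊆ U) (h₁ : ∀ w ∈ S, u.SolAt lam ε g y₁ w) (h₂ : ∀ w ∈ S, u.SolAt lam ε g y₂ w)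
    {p : ℂ} (hp : p ∈ S) (he : y₁ p = y₂ p) : ∀ w ∈ S, y₁ w = y₂ w := by
  obtain ⟨a, ha⟩ := h.exists_const hS hSc hSU h₁
  obtain ⟨b, hb⟩ := h.exists_const hS hSc hSU h₂
  have hab : a = b := by
    rw [ha p hp, hb p hp] at he
    have := h.ne_zero p (hSU hp)
    field_simp at he
    exact add_left_cancel he
  intro w hw
  rw [ha w hw, hb w hw, hab]

/-- Solutions that agree at one point agree near it. -/
lemma SolAt.eventuallyEq (hc : u.IsPosImag) (hg : u.IsTest g) {p : ℂ} (hp : ¬ u.IsPole p)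
    (h₁ : u.SolAt lam ε g y₁ p) (h₂ : u.SolAt lam ε g y₂ p) (he : y₁ p = y₂ p) :
    y₁ =ᶠ[𝓝 p] y₂ := by
  obtain ⟨r, hr, hball⟩ := Metric.eventually_nhds_iff_ball.1
    ((eventually_not_isPole hp).and (h₁.eventually.and h₂.eventually))
  obtain ⟨E, Φ, hF, -⟩ := hc.exists_frame hg lam ε (convex_ball p r) Metric.isOpen_ball
    fun w hw => (hball w hw).1
  filter_upwards [Metric.ball_mem_nhds p hr] with w hw
  exact hF.eq_of_eq Metric.isOpen_ball (convex_ball p r).isPreconnected subset_rfl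
    (fun w hw => (hball w hw).2.1) (fun w hw => (hball w hw).2.2) (Metric.mem_ball_self hr) he w hw

/-- Solutions that agree near one point of a connected set agree near all of it. -/
lemma eventuallyEq_of_isPreconnected (hc : u.IsPosImag) (hg : u.IsTest g) (hS : IsPreconnected S)
    (h₁ : ∀ w ∈ S, u.SolAt lam ε g y₁ w) (h₂ : ∀ w ∈ S, u.SolAt lam ε g y₂ w)
    {p : ℂ} (hp : p ∈ S) (he : y₁ =ᶠ[𝓝 p] y₂) {w : ℂ} (hw : w ∈ S) (hwp : ¬ u.IsPole w) :
    y₁ =ᶠ[𝓝 w] y₂ :=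
  (h₁ w hw).eventuallyEq hc hg hwp (h₂ w hw) (AnalyticOnNhd.eqOn_of_preconnected_of_eventuallyEq
    (fun w hw => (h₁ w hw).1) (fun w hw => (h₂ w hw).1) hS hp he hw)

/-- Existence and uniqueness in a convex set without singularities. -/
lemma IsPosImag.exists_solAt (hc : u.IsPosImag) (hg : u.IsTest g) (lam ε : ℝ) (hU : Convex ℝ U)
    (hUo : IsOpen U) (hp : ∀ w ∈ U, ¬ u.IsPole w) {p : ℂ} (hpU : p ∈ U) (b : ℂ) :
    ∃ y, y p = b ∧ ∀ w ∈ U, u.SolAt lam ε g y w := by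
  obtain ⟨E, Φ, hF, -⟩ := hc.exists_frame hg lam ε hU hUo hp
  refine ⟨fun w => (Φ w + (b * E p - Φ p)) / E w, ?_, fun w hw => hF.solAt _ hw⟩
  have := hF.ne_zero p hpU
  field_simp
  ring

end

end BenjaminOno.RationalPotential

namespace BenjaminOno.RationalPotential

variable {P : ℕ} {u : RationalPotential P} {lam ε : ℝ} {g : ℂ → ℂ}

/-! ### Solutions at the wells -/

/-- The analytic solution at a regular singular point. -/
lemma exists_frobenius {G : ℂ → ℂ} {z : ℂ} (hG : AnalyticAt ℂ G z) {a : ℝ} (ha : 0 < a) :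
    ∃ Y, AnalyticAt ℂ Y z ∧ ∀ᶠ w in 𝓝 z, (w - z) * deriv Y w = G w - a * Y w := by
  obtain ⟨r, hr, hball⟩ := Metric.eventually_nhds_iff_ball.1 hG.eventually_analyticAt
  set ρ := r / 2 with hρ
  have hρ0 : 0 < ρ := by positivity
  have hcb : Metric.closedBall z ρ ⊆ Metric.ball z r :=
    Metric.closedBall_subset_ball (by rw [hρ]; linarith)
  have hGc : ContinuousOn G (Metric.closedBall z ρ) := fun w hw =>
    (hball w (hcb hw)).continuousAt.continuousWithinAt
  have hG'c : ContinuousOn (deriv G) (Metric.closedBall z ρ) := fun w hw =>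
    (hball w (hcb hw)).deriv.continuousAt.continuousWithinAt
  obtain ⟨M, hM⟩ := (isCompact_closedBall z ρ).exists_bound_of_continuousOn hG'c
  have hseg : ∀ w ∈ Metric.closedBall z ρ, ∀ t ∈ Set.Icc (0 : ℝ) 1,
      z + t * (w - z) ∈ Metric.closedBall z ρ := fun w hw t ht => by
    rw [Metric.mem_closedBall, dist_eq_norm] at hw ⊢
    rw [add_sub_cancel_left, norm_mul, Complex.norm_real, Real.norm_eq_abs, abs_of_nonneg ht.1]
    nlinarith [norm_nonneg (w - z), ht.2]
  have hcomp : ∀ (F : ℂ → ℂ), ContinuousOn F (Metric.closedBall z ρ) →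
      ∀ w ∈ Metric.closedBall z ρ, ContinuousOn (fun t : ℝ => F (z + t * (w - z)))
        (Set.uIcc 0 1) := fun F hF w hw => by
    rw [Set.uIcc_of_le zero_le_one]
    exact hF.comp (by fun_prop) fun t ht => hseg w hw t ht
  have hpow : IntervalIntegrable (fun t : ℝ => ((t ^ (a - 1) : ℝ) : ℂ)) volume 0 1 := by
    have := intervalIntegral.intervalIntegrable_rpow' (r := a - 1) (a := 0) (b := 1) (by linarith)
    exact ⟨this.1.ofReal, this.2.ofReal⟩
  -- The solution is `Y w = ∫₀¹ t^{a-1} G(z + t(w - z)) dt`, convergent since `a > 0`.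
  set F : ℂ → ℝ → ℂ := fun w t => ((t ^ (a - 1) : ℝ) : ℂ) * G (z + t * (w - z)) with hF
  set F' : ℂ → ℝ → ℂ := fun w t => ((t ^ (a - 1) : ℝ) : ℂ) * (deriv G (z + t * (w - z)) * t)
    with hF'
  have hFi : ∀ w ∈ Metric.closedBall z ρ, IntervalIntegrable (F w) volume 0 1 := fun w hw =>
    hpow.mul_continuousOn (hcomp G hGc w hw)
  have hF'i : ∀ w ∈ Metric.closedBall z ρ, IntervalIntegrable (F' w) volume 0 1 := fun w hw =>
    hpow.mul_continuousOn ((hcomp _ hG'c w hw).mul Complex.continuous_ofReal.continuousOn)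
  have hder : ∀ w ∈ Metric.ball z ρ,
      HasDerivAt (fun w => ∫ t in (0 : ℝ)..1, F w t) (∫ t in (0 : ℝ)..1, F' w t) w := by
    intro w hw
    refine (intervalIntegral.hasDerivAt_integral_of_dominated_loc_of_deriv_le
      (bound := fun t => t ^ (a - 1) * M) (s := Metric.ball z ρ)
      (Metric.isOpen_ball.mem_nhds hw) ?_ (hFi w (Metric.ball_subset_closedBall hw)) ?_ ?_ ?_ ?_).2
    · filter_upwards [Metric.isOpen_ball.mem_nhds hw] with v hv
      exact (hFi v (Metric.ball_subset_closedBall hv)).aestronglyMeasurable_restrict_uIoc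
    · exact (hF'i w (Metric.ball_subset_closedBall hw)).aestronglyMeasurable_restrict_uIoc
    · refine Eventually.of_forall fun t ht v hv => ?_
      rw [Set.uIoc_of_le zero_le_one] at ht
      rw [hF', norm_mul, Complex.norm_real, Real.norm_eq_abs,
        abs_of_nonneg (Real.rpow_nonneg ht.1.le _), norm_mul, Complex.norm_real,
        Real.norm_eq_abs, abs_of_pos ht.1]
      refine mul_le_mul_of_nonneg_left ?_ (Real.rpow_nonneg ht.1.le _)
      have := hM _ (hseg v (Metric.ball_subset_closedBall hv) t ⟨ht.1.le, ht.2⟩)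
      nlinarith [norm_nonneg (deriv G (z + t * (v - z))), ht.2]
    · exact (intervalIntegral.intervalIntegrable_rpow' (by linarith)).mul_const M
    · refine Eventually.of_forall fun t ht v hv => ?_
      rw [Set.uIoc_of_le zero_le_one] at ht
      have h1 : HasDerivAt (fun v => z + t * (v - z)) (t : ℂ) v := by
        simpa using (((hasDerivAt_id v).sub_const z).const_mul (t : ℂ)).const_add z
      have h2 := (hball _ (hcb (hseg v (Metric.ball_subset_closedBall hv) t
        ⟨ht.1.le, ht.2⟩))).differentiableAt.hasDerivAt
      exact (h2.comp v h1).const_mul _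
  refine ⟨fun w => ∫ t in (0 : ℝ)..1, F w t, DifferentiableOn.analyticAt (s := Metric.ball z ρ)
    (fun w hw => (hder w hw).differentiableAt.differentiableWithinAt)
    (Metric.ball_mem_nhds z hρ0), ?_⟩
  filter_upwards [Metric.ball_mem_nhds z hρ0] with w hw
  have hw' := Metric.ball_subset_closedBall hw
  rw [(hder w hw).deriv]
  -- Integrating the derivative of `t^a G(z + t(w - z))` over `[0, 1]` gives `G w = a Y w + (w - z)
  -- Y' w`.
  have hFTC := intervalIntegral.integral_eq_sub_of_hasDerivAt_of_le (zero_le_one (α := ℝ))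
    (f := fun t : ℝ => ((t ^ a : ℝ) : ℂ) * G (z + t * (w - z)))
    (f' := fun t => a * F w t + (w - z) * F' w t) ?_ ?_ ?_
  · rw [intervalIntegral.integral_add ((hFi w hw').const_mul _) ((hF'i w hw').const_mul _),
      intervalIntegral.integral_const_mul, intervalIntegral.integral_const_mul] at hFTC
    simp only [Complex.ofReal_one, Real.one_rpow, one_mul, add_sub_cancel, Real.zero_rpow ha.ne',
      Complex.ofReal_zero, zero_mul, sub_zero] at hFTC
    linear_combination hFTC
  · have := hcomp G hGc w hw'
    rw [Set.uIcc_of_le zero_le_one] at this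
    refine ContinuousOn.mul ?_ this
    exact Complex.continuous_ofReal.comp_continuousOn
      (Real.continuous_rpow_const ha.le).continuousOn
  · intro t ht
    have h1 : HasDerivAt (fun t : ℝ => z + t * (w - z)) (w - z) t := hasDerivAt_line _ _ _
    have h2 := (hball _ (hcb (hseg w hw' t ⟨ht.1.le, ht.2.le⟩))).differentiableAt.hasDerivAt
    have h3 := (Real.hasDerivAt_rpow_const (p := a) (Or.inl ht.1.ne')).ofReal_comp
    convert! h3.mul (h2.comp t h1) using 1
    have h4 : t ^ a = t ^ (a - 1) * t := by
      rw [← Real.rpow_add_one ht.1.ne', sub_add_cancel]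
    simp only [hF, hF', h4, Function.comp_apply]
    push_cast
    ring
  · exact ((hFi w hw').const_mul _).add ((hF'i w hw').const_mul _)

/-- The coefficient of the differential equation has a simple pole with residue `-γₚ/ε` at `zₚ`. -/
lemma IsPosImag.exists_coeff (hc : u.IsPosImag) (lam ε : ℝ) (p : Fin P) :
    ∃ V : ℂ → ℂ, AnalyticAt ℂ V (u.z p) ∧ ∀ w, w ≠ u.z p →
      (w - u.z p) * (Complex.I / ε * (lam + u.toFun w)) =
        -((u.gam p / ε : ℝ) : ℂ) + (w - u.z p) * V w := by
  refine ⟨fun w => Complex.I / ε * (lam + (conj (u.c p) / (w - conj (u.z p)) +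
    ∑ q ∈ Finset.univ.erase p, (u.c q / (w - u.z q) + conj (u.c q) / (w - conj (u.z q))))),
    ?_, fun w hw => ?_⟩
  · have hl : ∀ c z, u.z p ≠ z → AnalyticAt ℂ (fun w => c / (w - z)) (u.z p) := fun c z hz =>
      analyticAt_const.div (analyticAt_id.sub analyticAt_const) (sub_ne_zero.2 hz)
    refine analyticAt_const.mul (analyticAt_const.add ((hl _ _ (z_ne_conj p p)).add ?_))
    refine Finset.analyticAt_fun_sum _ fun q hq => ?_
    exact (hl _ _ fun h => Finset.ne_of_mem_erase hq (z_injective h).symm).add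
        (hl _ _ (z_ne_conj p q))
  · rw [toFun, ← Finset.add_sum_erase _ _ (Finset.mem_univ p)]
    have h1 : (w - u.z p) * (u.c p / (w - u.z p)) = u.c p := by
      field_simp [sub_ne_zero.2 hw]
    rw [hc.c_eq] at h1 ⊢
    push_cast
    linear_combination Complex.I / ε * h1 + (u.gam p / ε : ℂ) * Complex.I_sq

/-- The integrating factor `B = exp (-∫ V)` removes the regular part `V` of the coefficient. What
remains is an equation `(w - z) Y' = G - aY` with `a = γₚ/ε > 0`. -/
theorem IsPosImag.exists_solAt_well (hc : u.IsPosImag) (hg : u.IsTest g) (lam : ℝ) (hε : 0 < ε)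
    (p : Fin P) : ∃ y, u.SolAt lam ε g y (u.z p) := by
  obtain ⟨V, hV, hVe⟩ := hc.exists_coeff lam ε p
  set z := u.z p with hz
  obtain ⟨r₁, hr₁, hVb⟩ := Metric.eventually_nhds_iff_ball.1 hV.eventually_analyticAt
  obtain ⟨K, hK⟩ := (convex_ball z r₁).exists_primitive Metric.isOpen_ball (f := V)
    fun w hw => (hVb w hw).differentiableAt
  set B : ℂ → ℂ := fun w => Complex.exp (-K w) with hB
  have hBd : ∀ w ∈ Metric.ball z r₁, HasDerivAt B (-V w * B w) w := fun w hw => by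
    convert! (hK w hw).neg.cexp using 1
    simp only [hB, Pi.neg_apply]
    ring
  have hBa : AnalyticAt ℂ B z := DifferentiableOn.analyticAt (s := Metric.ball z r₁)
    (fun w hw => (hBd w hw).differentiableAt.differentiableWithinAt) (Metric.ball_mem_nhds z hr₁)
  -- A test function has at most a simple pole, so `(w - z) g` has a removable singularity.
  obtain ⟨G₀, hG₀, hG₀e⟩ : ∃ G₀, AnalyticAt ℂ G₀ z ∧ ∀ᶠ w in 𝓝[≠] z, G₀ w = (w - z) * g w := by
    obtain ⟨C, hC⟩ := hg.well p
    have hnp := eventually_not_isPole_punctured (u := u) z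
    obtain ⟨r, hr, hb⟩ := Metric.eventually_nhds_iff_ball.1
      (eventually_nhdsWithin_iff.1 (hC.and hnp))
    have hd := Complex.differentiableOn_update_limUnder_of_bddAbove
      (f := fun w => (w - z) * g w) (Metric.ball_mem_nhds z hr)
      (fun w hw => ((differentiableAt_id.sub_const z).mul
        (hg.diff w (ne_z_of_not_isPole (hb w hw.1 hw.2).2))).differentiableWithinAt)
      ⟨C, by
        rintro _ ⟨w, hw, rfl⟩
        simpa using (hb w hw.1 hw.2).1⟩
    refine ⟨_, hd.analyticAt (Metric.ball_mem_nhds z hr), ?_⟩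
    filter_upwards [self_mem_nhdsWithin] with w hw
    exact Function.update_of_ne hw _ _
  obtain ⟨Y, hY, hYe⟩ := exists_frobenius (hG₀.mul hBa) (div_pos (hc.gam_pos p) hε)
  refine ⟨fun w => Y w / B w, hY.div hBa (Complex.exp_ne_zero _), ?_⟩
  rw [eventually_nhdsWithin_iff] at hG₀e
  filter_upwards [hYe, hG₀e, Metric.ball_mem_nhds z hr₁, hY.eventually_analyticAt]
    with w h1 h2 h3 h4 hnp
  have hwz : w ≠ z := ne_z_of_not_isPole hnp p
  have hwz' : w - z ≠ 0 := sub_ne_zero.2 hwz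
  have hB0 : B w ≠ 0 := Complex.exp_ne_zero _
  have hd := (h4.differentiableAt.hasDerivAt.div (hBd w h3) hB0).deriv
  have hd' : deriv (fun w => Y w / B w) w = (deriv Y w * B w - Y w * (-V w * B w)) / B w ^ 2 := hd
  rw [hd']
  have h5 := h2 hwz
  have h6 := hVe w hwz
  rw [Pi.mul_apply, h5] at h1
  apply mul_left_cancel₀ hwz'
  have h7 : (w - z) * (g w + Complex.I / ε * (lam + u.toFun w) * (Y w / B w)) =
      (w - z) * g w + ((w - z) * (Complex.I / ε * (lam + u.toFun w))) * (Y w / B w) := by ring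
  rw [h7, h6]
  have h8 : (w - z) * ((deriv Y w * B w - Y w * (-V w * B w)) / B w ^ 2) =
      ((w - z) * deriv Y w) / B w + (w - z) * V w * (Y w / B w) := by
    field_simp
    ring
  rw [h8, h1]
  field_simp
  ring

/-- Homogeneous solutions behave like `(w - zₚ)^{-γₚ/ε}`, so a nonzero analytic difference of
solutions would have the negative order `-γₚ/ε`. -/
theorem IsPosImag.eventuallyEq_well (hc : u.IsPosImag) (hε : 0 < ε) {p : Fin P} {y₁ y₂ : ℂ → ℂ}
    (h₁ : u.SolAt lam ε g y₁ (u.z p)) (h₂ : u.SolAt lam ε g y₂ (u.z p)) :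
    y₁ =ᶠ[𝓝 (u.z p)] y₂ := by
  obtain ⟨V, hV, hVe⟩ := hc.exists_coeff lam ε p
  set z := u.z p with hz
  set d : ℂ → ℂ := fun w => y₁ w - y₂ w with hd
  have hda : AnalyticAt ℂ d z := h₁.1.sub h₂.1
  have hde : ∀ᶠ w in 𝓝[≠] z, (w - z) * deriv d w =
      (-((u.gam p / ε : ℝ) : ℂ) + (w - z) * V w) * d w := by
    filter_upwards [mem_nhdsWithin_of_mem_nhds h₁.2, mem_nhdsWithin_of_mem_nhds h₂.2,
      eventually_not_isPole_punctured (u := u) z, self_mem_nhdsWithin,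
      mem_nhdsWithin_of_mem_nhds h₁.1.eventually_analyticAt,
      mem_nhdsWithin_of_mem_nhds h₂.1.eventually_analyticAt] with w e1 e2 e3 e4 e5 e6
    have : deriv d w = deriv y₁ w - deriv y₂ w :=
      deriv_fun_sub e5.differentiableAt e6.differentiableAt
    rw [this, e1 e3, e2 e3, ← hVe w e4]
    simp only [hd]; ring
  by_contra hne
  have hne' : ¬ ∀ᶠ w in 𝓝 z, d w = 0 := fun h => hne (h.mono fun w hw => sub_eq_zero.1 hw)
  obtain ⟨n, k, hk, hk0, hke⟩ := hda.exists_eventuallyEq_pow_smul_nonzero_iff.2 hne'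
  have hdk : ∀ᶠ w in 𝓝 z, (w - z) * deriv d w = (w - z) ^ n * (n * k w + (w - z) * deriv k w) := by
    filter_upwards [eventually_eventually_nhds.2 hke, hk.eventually_analyticAt] with w e1 e2
    have e3 : d =ᶠ[𝓝 w] fun w => (w - z) ^ n * k w := e1.mono fun v hv => by rw [hv, smul_eq_mul]
    have e4 := (((hasDerivAt_id w).sub_const z).pow n).mul e2.differentiableAt.hasDerivAt
    have e5 : deriv d w = _ := e3.deriv_eq.trans e4.deriv
    rw [e5]
    rcases n with _ | n
    · simp
    · simp [pow_succ]; ring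
  have hlim : ∀ᶠ w in 𝓝[≠] z, n * k w + (w - z) * deriv k w =
      (-((u.gam p / ε : ℝ) : ℂ) + (w - z) * V w) * k w := by
    filter_upwards [hde, mem_nhdsWithin_of_mem_nhds hdk, mem_nhdsWithin_of_mem_nhds hke,
      self_mem_nhdsWithin] with w e1 e2 e3 e4
    have hpow : (w - z) ^ n ≠ 0 := pow_ne_zero _ (sub_ne_zero.2 e4)
    apply mul_left_cancel₀ hpow
    rw [← e2, e1, e3, smul_eq_mul]; ring
  have hc1 : ContinuousAt (fun w => n * k w + (w - z) * deriv k w) z :=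
    (continuousAt_const.mul hk.continuousAt).add
      ((continuousAt_id.sub continuousAt_const).mul hk.deriv.continuousAt)
  have hc2 : ContinuousAt (fun w => (-((u.gam p / ε : ℝ) : ℂ) + (w - z) * V w) * k w) z :=
    (continuousAt_const.add ((continuousAt_id.sub continuousAt_const).mul
      hV.continuousAt)).mul hk.continuousAt
  have heq := tendsto_nhds_unique ((hc2.tendsto.mono_left nhdsWithin_le_nhds).congr'
    (hlim.mono fun w hw => hw.symm)) (hc1.tendsto.mono_left nhdsWithin_le_nhds)
  simp only [sub_self, zero_mul, add_zero] at heq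
  have h3 : ((n : ℂ) + ((u.gam p / ε : ℝ) : ℂ)) * k z = 0 := by linear_combination -heq
  rcases mul_eq_zero.1 h3 with h | h
  · have h4 : (n : ℝ) + u.gam p / ε = 0 := by exact_mod_cast h
    have h5 := div_pos (hc.gam_pos p) hε
    have h6 : (0 : ℝ) ≤ n := Nat.cast_nonneg n
    linarith
  · exact hk0 h

end BenjaminOno.RationalPotential

namespace BenjaminOno.RationalPotential

variable {P : ℕ} {u : RationalPotential P} {lam ε ρ : ℝ} {g : ℂ → ℂ}

/-! ### The solution that is recessive at `-i∞` -/

variable (u) in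
def strip : Set ℂ := {w | ∀ p, |w.im| < (u.z p).im}

lemma isOpen_strip : IsOpen u.strip := by
  have : u.strip = ⋂ p, {w : ℂ | |w.im| < (u.z p).im} := by ext; simp [strip]
  rw [this]
  exact isOpen_iInter_of_finite fun p => isOpen_lt (by fun_prop) continuous_const

lemma convex_strip : Convex ℝ u.strip := by
  have : u.strip = ⋂ p, Complex.im ⁻¹' (Set.Ioo (-(u.z p).im) (u.z p).im) := by
    ext; simp [strip, abs_lt]
  rw [this]
  exact convex_iInter fun p => (convex_Ioo _ _).linear_preimage Complex.imLm

lemma ofReal_mem_strip (x : ℝ) : (x : ℂ) ∈ u.strip := fun p => by simpa using u.z_im_pos p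

lemma not_isPole_of_mem_strip {w : ℂ} (hw : w ∈ u.strip) : ¬ u.IsPole w := by
  rintro ⟨p, rfl | rfl⟩ <;> have := hw p <;> simp [abs_of_pos (u.z_im_pos p)] at this

lemma not_isPole_of_re_lt {w : ℂ} (hw : w.re < u.leftAbscissa + 1) : ¬ u.IsPole w := by
  rintro ⟨p, rfl | rfl⟩
  · linarith [leftAbscissa_add_one_le (u := u) p]
  · rw [Complex.conj_re] at hw
    linarith [leftAbscissa_add_one_le (u := u) p]

lemma isOpen_dom : IsOpen (u.dom ρ) :=
  (isOpen_strip (u := u)).union ((isOpen_lt Complex.continuous_re continuous_const).union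
    (isOpen_lt continuous_const Complex.continuous_re))

lemma convex_re_lt (a : ℝ) : Convex ℝ {w : ℂ | w.re < a} :=
  (convex_Iio a).linear_preimage Complex.reLm

lemma convex_re_gt (a : ℝ) : Convex ℝ {w : ℂ | a < w.re} :=
  (convex_Ioi a).linear_preimage Complex.reLm

lemma eq_on_convex (hc : u.IsPosImag) (hg : u.IsTest g) {U : Set ℂ} (hU : Convex ℝ U)
    (hp : ∀ w ∈ U, ¬ u.IsPole w) {y₁ y₂ : ℂ → ℂ} (h₁ : ∀ w ∈ U, u.SolAt lam ε g y₁ w)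
    (h₂ : ∀ w ∈ U, u.SolAt lam ε g y₂ w) {p : ℂ} (hpU : p ∈ U) (he : y₁ p = y₂ p) :
    ∀ w ∈ U, y₁ w = y₂ w := fun w hw =>
  (eventuallyEq_of_isPreconnected hc hg hU.isPreconnected h₁ h₂ hpU
    ((h₁ p hpU).eventuallyEq hc hg (hp p hpU) (h₂ p hpU) he) hw (hp w hw)).self_of_nhds

/-- To the left of the poles `gE` decays exponentially downwards, so its primitive `Φ` has a limit
`ℓ` at `-i∞`. The solution `(Φ - ℓ)/E` satisfies `|y| e^{R/ε} = |Φ - ℓ| → 0`. -/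
lemma IsPosImag.exists_recessive_left (hc : u.IsPosImag) (hg : u.IsTest g) (hlam : 0 < lam)
    (hε : 0 < ε) : ∃ y, (∀ w : ℂ, w.re < u.leftAbscissa + 1 → u.SolAt lam ε g y w) ∧
      ∀ b : ℂ, b.re ≤ u.leftAbscissa → Tendsto (fun t : ℝ => ‖y (b - t * Complex.I)‖ *
        Real.exp (u.R lam (b - t * Complex.I) / ε)) atTop (𝓝 0) := by
  set x₀ := u.leftAbscissa with hx₀
  obtain ⟨E, Φ, hF, hE⟩ := hc.exists_frame hg lam ε (convex_re_lt (x₀ + 1))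
    (isOpen_lt Complex.continuous_re continuous_const) fun w hw => not_isPole_of_re_lt hw
  obtain ⟨C, hC⟩ := hg.left
  have hC0 : 0 ≤ C := (norm_nonneg _).trans (hC (x₀ : ℂ) (by simp) (by simp [hx₀]))
  set D := C * Real.exp (u.leftBound / ε) with hD
  have hbound : ∀ w : ℂ, w.re ≤ x₀ → w.im ≤ 0 → ‖g w * E w‖ ≤ D * Real.exp (lam / ε * w.im) := by
    intro w h1 h2
    have hw : w ∈ {w : ℂ | w.re < x₀ + 1} := show w.re < x₀ + 1 by linarith
    rw [norm_mul, hE w hw, hD, mul_assoc, ← Real.exp_add]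
    refine mul_le_mul (hC w h2 h1) (Real.exp_le_exp.2 ?_) (Real.exp_pos _).le hC0
    have hR := hc.R_le_left lam h1 (not_isPole_of_re_lt hw)
    have h5 : 0 < ε⁻¹ := inv_pos.2 hε
    simp only [div_eq_mul_inv]
    nlinarith
  have hdec : ∀ b : ℝ, Tendsto (fun t => D * Real.exp (lam / ε * (b - t))) atTop (𝓝 0) := fun b => by
    have h1 : Tendsto (fun t : ℝ => lam / ε * (b - t)) atTop atBot :=
      (tendsto_atBot_add_const_left _ b tendsto_neg_atTop_atBot).const_mul_atBot (div_pos hlam hε)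
    simpa using (Real.tendsto_exp_atBot.comp h1).const_mul D
  have hmem : ∀ t : ℝ, (x₀ : ℂ) - t * Complex.I ∈ {w : ℂ | w.re < x₀ + 1} := fun t => by
    simp
  have hder : ∀ t : ℝ, HasDerivAt (fun t : ℝ => Φ (x₀ - t * Complex.I))
      (g (x₀ - t * Complex.I) * E (x₀ - t * Complex.I) * (-Complex.I)) t := fun t => by
    have h1 : HasDerivAt (fun t : ℝ => (x₀ : ℂ) - t * Complex.I) (-Complex.I) t := by
      convert! hasDerivAt_line (x₀ : ℂ) (-Complex.I) t using 2
      ring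
    exact (hF.deriv_prim _ (hmem t)).comp t h1
  have hint : IntegrableOn (fun t : ℝ => g (x₀ - t * Complex.I) * E (x₀ - t * Complex.I) *
      (-Complex.I)) (Set.Ioi 0) := by
    have h1 : IntegrableOn (fun t => D * Real.exp (-(lam / ε) * t)) (Set.Ioi 0) :=
      (exp_neg_integrableOn_Ioi 0 (div_pos hlam hε)).const_mul D
    refine h1.mono' ?_ ?_
    · have hcont : Continuous fun t : ℝ => g (x₀ - t * Complex.I) * E (x₀ - t * Complex.I) *
          (-Complex.I) := by
        rw [continuous_iff_continuousAt]
        intro t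
        have hl : ContinuousAt (fun t : ℝ => (x₀ : ℂ) - t * Complex.I) t := by fun_prop
        have h2 : ContinuousAt (fun w => g w * E w) ((x₀ : ℂ) - t * Complex.I) :=
          (hg.diff _ (ne_z_of_not_isPole (hF.not_isPole _ (hmem t)))).continuousAt.mul
            (hF.deriv_exp _ (hmem t)).continuousAt
        exact (ContinuousAt.comp (f := fun t : ℝ => (x₀ : ℂ) - t * Complex.I) h2 hl).mul
          continuousAt_const
      exact hcont.aestronglyMeasurable
    · rw [ae_restrict_iff' measurableSet_Ioi]
      refine Eventually.of_forall fun t (ht : 0 < t) => ?_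
      rw [norm_mul, norm_neg, Complex.norm_I, mul_one]
      convert! hbound _ _ _ using 3
      · simp
      · simp
      · simpa using ht.le
  have hlim := tendsto_limUnder_of_hasDerivAt_of_integrableOn_Ioi (fun t _ => hder t) hint
  set ℓ := limUnder atTop fun t : ℝ => Φ (x₀ - t * Complex.I) with hℓ
  refine ⟨fun w => (Φ w + -ℓ) / E w, fun w hw => hF.solAt _ hw, fun b hb => ?_⟩
  have hbm : ∀ t : ℝ, b - t * Complex.I ∈ {w : ℂ | w.re < x₀ + 1} := fun t => by
    simp; linarith
  have heq : ∀ t : ℝ, ‖(Φ (b - t * Complex.I) + -ℓ) / E (b - t * Complex.I)‖ *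
        Real.exp (u.R lam (b - t * Complex.I) / ε) = ‖Φ (b - t * Complex.I) - ℓ‖ := fun t => by
    rw [← hE _ (hbm t), norm_div, div_mul_cancel₀ _ (norm_ne_zero_iff.2 (hF.ne_zero _ (hbm t))),
      ← sub_eq_add_neg (Φ _)]
  simp only [heq]
  have h1 : Tendsto (fun t : ℝ => ‖Φ (x₀ - ((t - b.im : ℝ) : ℂ) * Complex.I) - ℓ‖) atTop (𝓝 0) := by
    have h2 : Tendsto (fun t : ℝ => t - b.im) atTop atTop :=
      tendsto_atTop_add_const_right _ _ tendsto_id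
    simpa using ((hlim.comp h2).sub_const ℓ).norm
  have h3 : Tendsto (fun t : ℝ => D * Real.exp (lam / ε * (b.im - t)) *
      ‖(x₀ : ℂ) - b.re‖ + ‖Φ (x₀ - ((t - b.im : ℝ) : ℂ) * Complex.I) - ℓ‖) atTop (𝓝 0) := by
    simpa using ((hdec b.im).mul_const ‖(x₀ : ℂ) - b.re‖).add h1
  refine squeeze_zero' (Eventually.of_forall fun t => norm_nonneg _) ?_ h3
  filter_upwards [eventually_ge_atTop b.im] with t ht
  -- The limit is the same along every vertical line: at equal heights `Φ` varies by at most the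
  -- horizontal distance times the exponentially small bound for `gE`.
  have hconv : Convex ℝ {w : ℂ | w.re ≤ x₀ ∧ w.im ≤ b.im - t} :=
    ((convex_Iic x₀).linear_preimage Complex.reLm).inter
      ((convex_Iic (b.im - t)).linear_preimage Complex.imLm)
  have hmv := hconv.norm_image_sub_le_of_norm_hasDerivWithin_le (f := Φ)
    (f' := fun w => g w * E w) (C := D * Real.exp (lam / ε * (b.im - t)))
    (fun w hw => (hF.deriv_prim w (show w.re < x₀ + 1 by linarith [hw.1])).hasDerivWithinAt)
    (fun w hw => (hbound w hw.1 (by linarith [hw.2])).trans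
      (mul_le_mul_of_nonneg_left (Real.exp_le_exp.2
        (mul_le_mul_of_nonneg_left hw.2 (div_pos hlam hε).le)) (by positivity)))
    (x := (x₀ : ℂ) - ((t - b.im : ℝ) : ℂ) * Complex.I) (y := b - t * Complex.I)
    (by simp) (by simpa using hb)
  have hn : ‖b - t * Complex.I - ((x₀ : ℂ) - ((t - b.im : ℝ) : ℂ) * Complex.I)‖ =
      ‖(x₀ : ℂ) - b.re‖ := by
    rw [← norm_neg]; congr 1
    apply Complex.ext <;> simp
  rw [hn] at hmv
  calc ‖Φ (b - t * Complex.I) - ℓ‖ ≤ _ := norm_sub_le_norm_sub_add_norm_sub _ _ _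
    _ ≤ _ := add_le_add hmv le_rfl

variable (u) in
/-- A solution in `dom` that is recessive at `-i∞`. -/
structure IsRecessive (lam ε ρ : ℝ) (g y : ℂ → ℂ) : Prop where
  solAt : ∀ w ∈ u.dom ρ, u.SolAt lam ε g y w
  tendsto : ∀ b : ℂ, b.re ≤ u.leftAbscissa → Tendsto (fun t : ℝ => ‖y (b - t * Complex.I)‖ *
        Real.exp (u.R lam (b - t * Complex.I) / ε)) atTop (𝓝 0)

-- The solution is continued from the left half-plane to the strip and from there to the right
-- half-plane. Each piece and each overlap is convex, so agreement at one point of an overlap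
-- suffices.
open scoped Classical in
theorem IsPosImag.exists_isRecessive (hc : u.IsPosImag) (hg : u.IsTest g) (hlam : 0 < lam)
    (hε : 0 < ε) (h : u.IsFarRadius lam ρ) (hρ : u.leftAbscissa + 1 ≤ ρ) :
    ∃ y, u.IsRecessive lam ε ρ g y := by
  obtain ⟨yL, hL, hLt⟩ := hc.exists_recessive_left hg hlam hε
  set x₀ := u.leftAbscissa with hx₀
  obtain ⟨yS, hS0, hS⟩ := hc.exists_solAt hg lam ε convex_strip isOpen_strip
    (fun w => not_isPole_of_mem_strip) (ofReal_mem_strip x₀) (yL x₀)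
  have hRp : ∀ w ∈ {w : ℂ | ρ < w.re}, ¬ u.IsPole w := fun w (hw : ρ < w.re) =>
    (h.of_re (hw.le.trans (le_abs_self _))).1
  obtain ⟨yR, hR0, hR⟩ := hc.exists_solAt hg lam ε (convex_re_gt ρ)
    (isOpen_lt continuous_const Complex.continuous_re) hRp
    (p := ((ρ + 1 : ℝ) : ℂ)) (by simp) (yS ((ρ + 1 : ℝ) : ℂ))
  have hLS : ∀ w : ℂ, w.re < x₀ + 1 → w ∈ u.strip → yL w = yS w := fun w h1 h2 =>
    eq_on_convex hc hg ((convex_re_lt (x₀ + 1)).inter convex_strip)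
      (fun w hw => not_isPole_of_mem_strip hw.2) (fun w hw => hL w hw.1) (fun w hw => hS w hw.2)
      (p := (x₀ : ℂ)) ⟨by simp, ofReal_mem_strip x₀⟩ hS0.symm w ⟨h1, h2⟩
  have hRS : ∀ w : ℂ, ρ < w.re → w ∈ u.strip → yS w = yR w := fun w h1 h2 =>
    eq_on_convex hc hg ((convex_re_gt ρ).inter convex_strip)
      (fun w hw => not_isPole_of_mem_strip hw.2) (fun w hw => hS w hw.2) (fun w hw => hR w hw.1)
      (p := ((ρ + 1 : ℝ) : ℂ)) ⟨by simp, ofReal_mem_strip _⟩ hR0.symm w ⟨h1, h2⟩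
  refine ⟨fun w => if w.re < x₀ + 1 then yL w else if w ∈ u.strip then yS w else yR w, ?_, ?_⟩
  · rintro w (hw | hw | hw)
    · refine (hS w hw).congr ?_
      filter_upwards [isOpen_strip.mem_nhds hw] with v hv
      by_cases h1 : v.re < x₀ + 1
      · simp [h1, hLS v h1 hv]
      · simp [h1, hv]
    · refine (hL w hw).congr ?_
      filter_upwards [(isOpen_lt Complex.continuous_re continuous_const).mem_nhds hw] with v hv
      have : v.re < x₀ + 1 := hv
      simp [this]
    · refine (hR w hw).congr ?_
      filter_upwards [(isOpen_lt continuous_const Complex.continuous_re).mem_nhds hw] with v hv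
      have h1 : ρ < v.re := hv
      have h2 : ¬ v.re < x₀ + 1 := by linarith
      by_cases h3 : v ∈ u.strip
      · simp [h2, h3, hRS v h1 h3]
      · simp [h2, h3]
  · intro b hb
    refine (hLt b hb).congr fun t => ?_
    have : (b - t * Complex.I).re < x₀ + 1 := by simp; linarith
    rw [if_pos this]

end BenjaminOno.RationalPotential

namespace BenjaminOno.RationalPotential

variable {P : ℕ} {u : RationalPotential P} {lam ε ρ c : ℝ} {g yi y y₁ y₂ : ℂ → ℂ}

/-! ### Solutions in sublevel sets -/

variable (u) in
/-- A solution in a sublevel set that continues the recessive solution `yi` at the real axis. -/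
structure IsSol (lam ε : ℝ) (g yi : ℂ → ℂ) (c : ℝ) (y : ℂ → ℂ) : Prop where
  solAt : ∀ w ∈ u.sub lam c, u.SolAt lam ε g y w
  real : ∀ x : ℝ, ∀ᶠ w in 𝓝 (x : ℂ), w ∈ u.sub lam c → y w = yi w

/-- The function `y` in the upper half-plane and `yi` elsewhere. -/
noncomputable def ext (y yi : ℂ → ℂ) (w : ℂ) : ℂ := if 0 < w.im then y w else yi w

lemma ext_eventuallyEq_upper {w : ℂ} (hw : 0 < w.im) : ext y yi =ᶠ[𝓝 w] y := by
  filter_upwards [eventually_im_pos hw] with v hv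
  simp [ext, hv]

lemma ext_eventuallyEq_lower {w : ℂ} (hw : w.im < 0) : ext y yi =ᶠ[𝓝 w] yi := by
  filter_upwards [(isOpen_lt Complex.continuous_im continuous_const).mem_nhds hw] with v
    (hv : v.im < 0)
  simp [ext, hv.not_gt]

lemma solAt_ext_upper (hy : ∀ w ∈ u.sub lam c, u.SolAt lam ε g y w) {w : ℂ}
    (hw : w ∈ u.sub lam c) : u.SolAt lam ε g (ext y yi) w :=
  (hy w hw).congr (ext_eventuallyEq_upper hw.1).symm

lemma solAt_ext_lower (hyi : u.IsRecessive lam ε ρ g yi) {w : ℂ} (hw : w.im < 0)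
    (hd : w ∈ u.dom ρ) : u.SolAt lam ε g (ext y yi) w :=
  (hyi.solAt w hd).congr (ext_eventuallyEq_lower hw).symm

/-- For `c > 0` all points just above the axis belong to the sublevel set, so there `y` equals `yi`
and the glued function is analytic across the axis. -/
lemma IsSol.solAt_ext_real (hc : u.IsPosImag) (hyi : u.IsRecessive lam ε ρ g yi)
    (hy : u.IsSol lam ε g yi c y) (h0 : 0 < c) (x : ℝ) : u.SolAt lam ε g (ext y yi) x := by
  refine (hyi.solAt x (Or.inl (ofReal_mem_strip x))).congr ?_
  filter_upwards [hy.real x, (hc.continuousAt_R lam (not_isPole_ofReal (u := u) x)).eventually_lt_const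
    (by rwa [hc.R_ofReal])] with w h1 h2
  by_cases h3 : 0 < w.im
  · simp [ext, h3, h1 ⟨h3, Or.inr h2⟩]
  · simp [ext, h3]

lemma IsSol.solAt_ext_of_mem (hc : u.IsPosImag) (hyi : u.IsRecessive lam ε ρ g yi)
    (hy : u.IsSol lam ε g yi c y) (h0 : 0 < c) {w : ℂ} (hw : w ∈ u.sub lam c ∨ w.im ≤ 0 ∧ w ∈ u.dom ρ) :
    u.SolAt lam ε g (ext y yi) w := by
  rcases hw with hw | ⟨h1, h2⟩
  · exact solAt_ext_upper hy.solAt hw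
  rcases h1.eq_or_lt with h1 | h1
  · have : w = (w.re : ℂ) := by apply Complex.ext <;> simp [h1]
    rw [this]
    exact hy.solAt_ext_real hc hyi h0 _
  · exact solAt_ext_lower hyi h1 h2

lemma IsSol.solAt_ext_region (hc : u.IsPosImag) (hρ : -ρ ≤ u.leftAbscissa)
    (hyi : u.IsRecessive lam ε ρ g yi) (hy : u.IsSol lam ε g yi c y) {w : ℂ}
    (hw : w ∈ u.region lam c ρ) : u.SolAt lam ε g (ext y yi) w := by
  obtain ⟨h1, -, h2, h3⟩ := hw
  by_cases him : 0 < w.im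
  · exact solAt_ext_upper hy.solAt ⟨him, Or.inr h2⟩
  · obtain ⟨h0, hre⟩ := h3.resolve_left him
    exact hy.solAt_ext_of_mem hc hyi h0 (Or.inr ⟨not_lt.1 him, Or.inr (Or.inl (by linarith))⟩)

lemma z_mem_sub (c : ℝ) (k : Fin P) : u.z k ∈ u.sub lam c := ⟨u.z_im_pos k, Or.inl ⟨k, Or.inl rfl⟩⟩

/-- Induction along the path from its end: at a well the analytic solution is unique, far down both
functions are `yi`, and along segments the identity theorem propagates equality. -/
lemma IsSol.eventuallyEq_of_reach (hc : u.IsPosImag) (hg : u.IsTest g) (hε : 0 < ε)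
    (hρ : -ρ ≤ u.leftAbscissa) (hyi : u.IsRecessive lam ε ρ g yi)
    (h₁ : u.IsSol lam ε g yi c y₁) (h₂ : u.IsSol lam ε g yi c y₂)
    {w : ℂ} (hw : u.Reach (u.region lam c ρ) w) : ext y₁ yi =ᶠ[𝓝 w] ext y₂ yi := by
  induction hw with
  | @well w k hne h =>
    have hz : ext y₁ yi =ᶠ[𝓝 (u.z k)] ext y₂ yi :=
      hc.eventuallyEq_well hε (solAt_ext_upper h₁.solAt (z_mem_sub c k))
        (solAt_ext_upper h₂.solAt (z_mem_sub c k))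
    have hseg : ∀ v ∈ segment ℝ (u.z k) w, v ∈ u.sub lam c ∨ v ∈ u.region lam c ρ := by
      intro v hv
      rw [segment_eq_image'] at hv
      obtain ⟨s, ⟨hs0, hs1⟩, rfl⟩ := hv
      rcases hs0.eq_or_lt with rfl | hs0
      · left; simpa using z_mem_sub (lam := lam) c k
      · right; simpa using h s hs0 hs1
    refine eventuallyEq_of_isPreconnected (lam := lam) (ε := ε) hc hg (convex_segment _ _).isPreconnected
      (fun v hv => ?_) (fun v hv => ?_) (left_mem_segment ℝ _ _) hz (right_mem_segment ℝ _ _) ?_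
    · exact (hseg v hv).elim (solAt_ext_upper h₁.solAt) (h₁.solAt_ext_region hc hρ hyi)
    · exact (hseg v hv).elim (solAt_ext_upper h₂.solAt) (h₂.solAt_ext_region hc hρ hyi)
    · have := h 1 one_pos le_rfl
      simp only [Complex.ofReal_one, one_mul, add_sub_cancel] at this
      exact this.1
  | @down w hre h =>
    set s : ℝ := |w.im| + 1 with hs
    have hs0 : 0 < s := by positivity
    have him : (w - s * Complex.I).im < 0 := by
      simp [hs]; linarith [le_abs_self w.im]
    have hz : ext y₁ yi =ᶠ[𝓝 (w - s * Complex.I)] ext y₂ yi :=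
      (ext_eventuallyEq_lower him).trans (ext_eventuallyEq_lower him).symm
    have hseg : ∀ v ∈ segment ℝ w (w - s * Complex.I), v ∈ u.region lam c ρ := by
      intro v hv
      rw [segment_eq_image'] at hv
      obtain ⟨r, ⟨hr0, hr1⟩, rfl⟩ := hv
      have := h (r * s) (by positivity)
      convert! this using 1
      simp; ring
    refine eventuallyEq_of_isPreconnected hc hg (convex_segment _ _).isPreconnected
      (fun v hv => h₁.solAt_ext_region hc hρ hyi (hseg v hv))
      (fun v hv => h₂.solAt_ext_region hc hρ hyi (hseg v hv)) (right_mem_segment ℝ _ _) hz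
      (left_mem_segment ℝ _ _) (hseg _ (left_mem_segment ℝ _ _)).1
  | @step w w' h hne _ ih =>
    exact eventuallyEq_of_isPreconnected hc hg (convex_segment _ _).isPreconnected
      (fun v hv => h₁.solAt_ext_region hc hρ hyi (h hv))
      (fun v hv => h₂.solAt_ext_region hc hρ hyi (h hv)) (right_mem_segment ℝ _ _) ih
      (left_mem_segment ℝ _ _) (h (left_mem_segment ℝ _ _)).1

/-- Uniqueness of the solution. -/
theorem IsSol.unique (hc : u.IsPosImag) (hg : u.IsTest g) (hlam : 0 < lam) (hε : 0 < ε)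
    (hfar : u.IsFarRadius lam ρ) (hρ : -ρ ≤ u.leftAbscissa) (hyi : u.IsRecessive lam ε ρ g yi)
    (h₁ : u.IsSol lam ε g yi c y₁) (h₂ : u.IsSol lam ε g yi c y₂) :
    ∀ w ∈ u.sub lam c, y₁ w = y₂ w := by
  -- Poles and critical points are isolated and are recovered by continuity.
  have key : ∀ w ∈ u.sub lam c, ¬ u.IsPole w → ¬ u.IsCritical lam w → y₁ w = y₂ w := by
    intro w hw hp hcr
    have := (h₁.eventuallyEq_of_reach hc hg hε hρ hyi h₂ (hc.reach hlam hfar hρ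
      ⟨hp, hcr, hw.2.resolve_left hp, Or.inl hw.1⟩ hw.1)).self_of_nhds
    simpa [ext, hw.1] using this
  intro w hw
  have hev : ∀ᶠ v in 𝓝[≠] w, y₁ v = y₂ v := by
    filter_upwards [mem_nhdsWithin_of_mem_nhds ((hc.isOpen_sub lam c).mem_nhds hw),
      eventually_not_isPole_punctured (u := u) w, self_mem_nhdsWithin,
      mem_nhdsWithin_of_mem_nhds (eventually_not_isCritical hlam w)] with v h1 h2 h3 h4
    exact key v h1 h2 (h4 h3)
  exact tendsto_nhds_unique
    (((h₁.solAt w hw).1.continuousAt.tendsto.mono_left nhdsWithin_le_nhds).congr' hev)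
    ((h₂.solAt w hw).1.continuousAt.tendsto.mono_left nhdsWithin_le_nhds)

/-! ### Consequences of the vanishing of an integral over a contour -/

/-- At a well `y` is continuous and the exponential vanishes; at `-i∞` this is the recessiveness of
`yi`. Hence an integral over a half depends only on the limit at its start. -/
lemma tendsto_half_end (hc : u.IsPosImag) (hlam : 0 < lam) (hε : 0 < ε)
    (hyi : u.IsRecessive lam ε ρ g yi) (hy : ∀ w ∈ u.sub lam c, u.SolAt lam ε g y w)
    {M : Set ℂ} {p : ℂ} {γ E : ℝ → ℂ} (h : u.Half M p γ) (hM : ∀ w ∈ M, ¬ u.IsPole w)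
    (hE : u.IsExp lam ε γ E) : Tendsto (fun t => ext y yi (γ t) * E t) atTop (𝓝 0) := by
  rcases h.ends with ⟨T, hT, ⟨k, v, hv, he⟩ | ⟨b, hb, he⟩⟩
  · have hE0 : Tendsto E atTop (𝓝 0) := by
      obtain ⟨C, κ, hκ, hb⟩ := h.norm_exp_le hc hlam hε hM hE
      refine squeeze_zero_norm' hb ?_
      have h1 : Tendsto (fun t : ℝ => -κ * t) atTop atBot :=
        tendsto_id.const_mul_atTop_of_neg (neg_neg_of_pos hκ)
      simpa using (Real.tendsto_exp_atBot.comp h1).const_mul C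
    have ht : Tendsto γ atTop (𝓝 (u.z k)) := by
      have h1 : Tendsto (fun t : ℝ => u.z k + (Real.exp (-t) : ℂ) * v) atTop
          (𝓝 (u.z k + ((0 : ℝ) : ℂ) * v)) :=
        (((Complex.continuous_ofReal.tendsto _).comp
          (Real.tendsto_exp_atBot.comp tendsto_neg_atTop_atBot)).mul_const v).const_add _
      simp only [Complex.ofReal_zero, zero_mul, add_zero] at h1
      exact h1.congr' ((eventually_ge_atTop T).mono fun t ht => (he t ht).symm)
    have hcont := (solAt_ext_upper (yi := yi) hy (z_mem_sub c k)).1.continuousAt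
    simpa using (hcont.tendsto.comp ht).mul hE0
  · rw [tendsto_zero_iff_norm_tendsto_zero]
    refine (hyi.tendsto b hb).congr' ?_
    filter_upwards [eventually_ge_atTop T, eventually_gt_atTop 0, eventually_gt_atTop b.im]
      with t h1 h2 h3
    have him : ¬ 0 < (γ t).im := by rw [he t h1]; simp; exact h3.le
    rw [norm_mul, hE.norm t h2, ext, if_neg him, he t h1]

lemma integral_half_eq (hc : u.IsPosImag) (hlam : 0 < lam) (hε : 0 < ε) (hg : u.IsTest g)
    (hyi : u.IsRecessive lam ε ρ g yi) (hy : ∀ w ∈ u.sub lam c, u.SolAt lam ε g y w)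
    {M : Set ℂ} {p : ℂ} {γ E : ℝ → ℂ} (h : u.Half M p γ) (hp : ¬ u.IsPole p)
    (hM : ∀ w ∈ M, ¬ u.IsPole w) (hMs : ∀ w ∈ M, u.SolAt lam ε g (ext y yi) w)
    (hE : u.IsExp lam ε γ E) {ℓ : ℂ}
    (h0 : Tendsto (fun t => ext y yi (γ t) * E t) (𝓝[>] 0) (𝓝 ℓ)) :
    ∫ t in Set.Ioi (0 : ℝ), g (γ t) * E t * deriv γ t = -ℓ :=
  h.integral_eq hc hlam hε hp hM hE hg
    (fun t ht => (hMs _ (h.mem t ht)).hasDerivAt (hM _ (h.mem t ht))) h0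
    (tendsto_half_end hc hlam hε hyi hy h hM hE)

/-- The integral of `g e^{-ih/ε}` over a curve. -/
noncomputable def contourIntegral (ε : ℝ) (W H : ℝ → ℂ) (g : ℂ → ℂ) : ℂ :=
  ∫ t, g (W t) * expAlong ε H t * deriv W t

section Glue
variable {M₁ M₂ : Set ℂ} {p : ℂ} {γ₁ γ₂ H : ℝ → ℂ}

lemma isExp_glue (hc : u.IsPosImag) (h₁ : u.Half M₁ p γ₁) (h₂ : u.Half M₂ p γ₂)
    (hM₁ : ∀ w ∈ M₁, ¬ u.IsPole w) (hM₂ : ∀ w ∈ M₂, ¬ u.IsPole w)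
    (hb : u.IsBranchAlong lam (glue γ₁ γ₂) H) (ε : ℝ) :
    u.IsExp lam ε γ₁ (expAlong ε H) ∧ u.IsExp lam ε γ₂ fun t => expAlong ε H (-t) := by
  have hcont : Continuous (glue γ₁ γ₂) :=
    (h₁.mono (Set.subset_union_left (t := M₂))).continuous_glue (h₂.mono Set.subset_union_right)
  have hEc := continuous_expAlong hb hcont ε
  refine ⟨⟨hEc, fun t ht => ?_, fun t d ht hd => ?_⟩,
    ⟨hEc.comp continuous_neg, fun t ht => ?_, fun t d ht hd => ?_⟩⟩
  · rw [norm_expAlong hc hb, (deriv_glue_pos γ₁ γ₂ ht).1.self_of_nhds]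
  · have he := (deriv_glue_pos γ₁ γ₂ ht).1
    have := hasDerivAt_expAlong hb ε (by rw [he.self_of_nhds]; exact hM₁ _ (h₁.mem t ht))
      (hd.congr_of_eventuallyEq he)
    rwa [he.self_of_nhds] at this
  · have ht' : -t < 0 := by linarith
    rw [norm_expAlong hc hb, (deriv_glue_neg γ₁ γ₂ ht').1.self_of_nhds]
    simp only [neg_neg]
  · have ht' : -t < 0 := by linarith
    have he := (deriv_glue_neg γ₁ γ₂ ht').1
    have hval : glue γ₁ γ₂ (-t) = γ₂ t := by rw [he.self_of_nhds]; simp only [neg_neg]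
    have hd' : HasDerivAt (fun s => γ₂ (-s)) (-d) (-t) := by
      have h3 : HasDerivAt γ₂ d (-(-t)) := by rwa [neg_neg]
      convert! h3.scomp (-t) (hasDerivAt_neg (-t)) using 1
      simp
    have h4 := hasDerivAt_expAlong hb ε (by rw [hval]; exact hM₂ _ (h₂.mem t ht))
      (hd'.congr_of_eventuallyEq he)
    rw [hval] at h4
    have h5 := h4.scomp t (hasDerivAt_neg t)
    convert! h5 using 1
    simp
    ring

lemma integrable_glue (hc : u.IsPosImag) (hlam : 0 < lam) (hε : 0 < ε) (hg : u.IsTest g)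
    (h₁ : u.Half M₁ p γ₁) (h₂ : u.Half M₂ p γ₂) (hp : ¬ u.IsPole p)
    (hM₁ : ∀ w ∈ M₁, ¬ u.IsPole w) (hM₂ : ∀ w ∈ M₂, ¬ u.IsPole w)
    (hb : u.IsBranchAlong lam (glue γ₁ γ₂) H) :
    Integrable (fun t => g (glue γ₁ γ₂ t) * expAlong ε H t * deriv (glue γ₁ γ₂) t) ∧
    contourIntegral ε (glue γ₁ γ₂) H g =
      (∫ t in Set.Ioi (0 : ℝ), g (γ₁ t) * expAlong ε H t * deriv γ₁ t) -
      ∫ t in Set.Ioi (0 : ℝ), g (γ₂ t) * expAlong ε H (-t) * deriv γ₂ t := by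
  obtain ⟨hE₁, hE₂⟩ := isExp_glue hc h₁ h₂ hM₁ hM₂ hb ε
  have i₁ := h₁.integrableOn hc hlam hε hp hM₁ hE₁ hg
  have i₂ := h₂.integrableOn hc hlam hε hp hM₂ hE₂ hg
  set F := fun t => g (glue γ₁ γ₂ t) * expAlong ε H t * deriv (glue γ₁ γ₂) t with hF
  have e₁ : Set.EqOn F (fun t => g (γ₁ t) * expAlong ε H t * deriv γ₁ t) (Set.Ioi 0) := fun t ht => by
    obtain ⟨h3, h4⟩ := deriv_glue_pos γ₁ γ₂ ht
    simp only [hF, h4, h3.self_of_nhds]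
  have e₂ : Set.EqOn (fun t => F (-t)) (fun t => -(g (γ₂ t) * expAlong ε H (-t) * deriv γ₂ t))
      (Set.Ioi 0) := fun t (ht : 0 < t) => by
    obtain ⟨h3, h4⟩ := deriv_glue_neg γ₁ γ₂ (show -t < 0 by linarith)
    simp only [hF, h4, h3.self_of_nhds, neg_neg, mul_neg]
  have j₁ : IntegrableOn F (Set.Ioi 0) := i₁.congr_fun e₁.symm measurableSet_Ioi
  have j₂ : IntegrableOn (fun t => F (-t)) (Set.Ioi 0) := i₂.neg.congr_fun e₂.symm measurableSet_Ioi
  have j₃ : IntegrableOn F (Set.Iic 0) := by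
    rw [integrableOn_Iic_iff_integrableOn_Iio]
    have := (Measure.measurePreserving_neg (volume : Measure ℝ)).integrableOn_comp_preimage
      (Homeomorph.neg ℝ).measurableEmbedding (f := F) (s := Set.Iio 0)
    rw [← this]
    convert! j₂ using 1
    ext t
    simp
  have hint : Integrable F := by
    rw [← integrableOn_univ, ← Set.Iic_union_Ioi (a := (0 : ℝ))]
    exact j₃.union j₁
  refine ⟨hint, ?_⟩
  rw [contourIntegral, ← setIntegral_univ, ← Set.Iic_union_Ioi (a := (0 : ℝ)),
    setIntegral_union (Set.Iic_disjoint_Ioi le_rfl) measurableSet_Ioi j₃ j₁,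
    setIntegral_congr_fun measurableSet_Ioi e₁]
  have h3 := integral_comp_neg_Ioi (0 : ℝ) F
  rw [neg_zero] at h3
  rw [← h3, setIntegral_congr_fun measurableSet_Ioi e₂, integral_neg]
  ring

/-- If the integral over the contour vanishes, the two limits at the critical point agree. -/
lemma limits_eq (hc : u.IsPosImag) (hlam : 0 < lam) (hε : 0 < ε) (hg : u.IsTest g)
    (hyi : u.IsRecessive lam ε ρ g yi) (hy : ∀ w ∈ u.sub lam c, u.SolAt lam ε g y w)
    (h₁ : u.Half M₁ p γ₁) (h₂ : u.Half M₂ p γ₂) (hp : ¬ u.IsPole p)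
    (hM₁ : ∀ w ∈ M₁, ¬ u.IsPole w ∧ u.SolAt lam ε g (ext y yi) w)
    (hM₂ : ∀ w ∈ M₂, ¬ u.IsPole w ∧ u.SolAt lam ε g (ext y yi) w)
    (hb : u.IsBranchAlong lam (glue γ₁ γ₂) H) (h0 : contourIntegral ε (glue γ₁ γ₂) H g = 0)
    {ℓ₁ ℓ₂ : ℂ} (hl₁ : Tendsto (fun t => ext y yi (γ₁ t) * expAlong ε H t) (𝓝[>] 0) (𝓝 ℓ₁))
    (hl₂ : Tendsto (fun t => ext y yi (γ₂ t) * expAlong ε H (-t)) (𝓝[>] 0) (𝓝 ℓ₂)) : ℓ₁ = ℓ₂ := by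
  obtain ⟨hE₁, hE₂⟩ := isExp_glue hc h₁ h₂ (fun w hw => (hM₁ w hw).1) (fun w hw => (hM₂ w hw).1) hb ε
  rw [(integrable_glue hc hlam hε hg h₁ h₂ hp (fun w hw => (hM₁ w hw).1)
    (fun w hw => (hM₂ w hw).1) hb).2,
    integral_half_eq hc hlam hε hg hyi hy h₁ hp (fun w hw => (hM₁ w hw).1)
      (fun w hw => (hM₁ w hw).2) hE₁ hl₁,
    integral_half_eq hc hlam hε hg hyi hy h₂ hp (fun w hw => (hM₂ w hw).1)
      (fun w hw => (hM₂ w hw).2) hE₂ hl₂] at h0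
  linear_combination -h0

/-- A frame near the critical point that is compatible with the branch along the contour. -/
lemma exists_frame_glue (hg : u.IsTest g) (h₁ : u.Half M₁ p γ₁) (hp : ¬ u.IsPole p)
    (hb : u.IsBranchAlong lam (glue γ₁ γ₂) H) (ε : ℝ) {N : Set ℂ} (hN : N ∈ 𝓝 p) :
    ∃ r > 0, ∃ E Φ, u.Frame lam ε g (Metric.ball p r) E Φ ∧ Metric.ball p r ⊆ N ∧
      (∀ᶠ t in 𝓝[>] 0, expAlong ε H t = E (γ₁ t)) ∧
      ∀ᶠ t in 𝓝[>] 0, expAlong ε H (-t) = E (γ₂ t) := by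
  have hval : glue γ₁ γ₂ 0 = p := by simp [glue, h₁.zero]
  obtain ⟨K, r₁, hr₁, hK, hKe⟩ := hb.exists_local (t₀ := 0) (by rwa [hval])
  rw [hval] at hK
  obtain ⟨r₂, hr₂, hball⟩ := Metric.eventually_nhds_iff_ball.1 ((eventually_not_isPole hp).and hN)
  obtain ⟨Φ, hΦ⟩ := exists_frame_of_exp (lam := lam) (ε := ε) hg (convex_ball p (min r₁ r₂))
    Metric.isOpen_ball (E := fun w => Complex.exp (-Complex.I * K w / ε))
    (fun w hw => (hball w (Metric.ball_subset_ball (min_le_right _ _) hw)).1)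
    (fun w _ => Complex.exp_ne_zero _)
    (fun w hw => (((hK w (Metric.ball_subset_ball (min_le_left _ _) hw)).const_mul
      (-Complex.I)).div_const (ε : ℂ)).cexp)
  refine ⟨min r₁ r₂, lt_min hr₁ hr₂, _, Φ, hΦ,
    fun w hw => (hball w (Metric.ball_subset_ball (min_le_right _ _) hw)).2, ?_, ?_⟩
  · filter_upwards [mem_nhdsWithin_of_mem_nhds hKe, self_mem_nhdsWithin] with t h3 h4
    rw [expAlong, h3, (deriv_glue_pos γ₁ γ₂ h4).1.self_of_nhds]
  · have hneg : Tendsto (fun t : ℝ => -t) (𝓝[>] 0) (𝓝 0) := by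
      have := (tendsto_neg_nhdsGT 0).mono_right nhdsWithin_le_nhds
      rwa [neg_zero] at this
    filter_upwards [hneg.eventually hKe, self_mem_nhdsWithin] with t h3 (h4 : 0 < t)
    rw [expAlong, h3, (deriv_glue_neg γ₁ γ₂ (show -t < 0 by linarith)).1.self_of_nhds]
    simp only [neg_neg]

lemma Half.tendsto_zero {M : Set ℂ} {γ : ℝ → ℂ} (h : u.Half M p γ) :
    Tendsto γ (𝓝[>] 0) (𝓝 p) := by
  have := h.cont.tendsto 0
  rw [h.zero] at this
  exact this.mono_left nhdsWithin_le_nhds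

lemma Frame.tendsto_of_eq {U : Set ℂ} {E Φ Y : ℂ → ℂ} (hF : u.Frame lam ε g U E Φ) (hpU : p ∈ U)
    {M : Set ℂ} {γ F : ℝ → ℂ} (h : u.Half M p γ) {a : ℂ}
    (he : ∀ᶠ t in 𝓝[>] 0, Y (γ t) = (Φ (γ t) + a) / E (γ t))
    (hFE : ∀ᶠ t in 𝓝[>] 0, F t = E (γ t)) :
    Tendsto (fun t => Y (γ t) * F t) (𝓝[>] 0) (𝓝 (Φ p + a)) := by
  have h1 : Tendsto (fun t => Φ (γ t) + a) (𝓝[>] 0) (𝓝 (Φ p + a)) :=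
    ((hF.deriv_prim p hpU).continuousAt.tendsto.comp h.tendsto_zero).add_const a
  refine h1.congr' ?_
  filter_upwards [he, hFE, h.tendsto_zero.eventually (hF.isOpen.mem_nhds hpU)] with t h2 h3 h4
  rw [h2, h3, div_mul_cancel₀ _ (hF.ne_zero _ h4)]

end Glue

end BenjaminOno.RationalPotential

namespace BenjaminOno.RationalPotential

variable {P : ℕ} {u : RationalPotential P} {lam ε ρ c : ℝ} {g yi y y₁ y₂ : ℂ → ℂ}

/-! ### Extension of solutions to larger sublevel sets -/

variable (u) in
/-- Standing assumptions for the construction of a global solution. -/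
structure Setting (lam ε ρ : ℝ) (g yi : ℂ → ℂ) : Prop where
  posImag : u.IsPosImag
  test : u.IsTest g
  lam_pos : 0 < lam
  eps_pos : 0 < ε
  far : u.IsFarRadius lam ρ
  left : -ρ ≤ u.leftAbscissa
  recessive : u.IsRecessive lam ε ρ g yi

variable (u) in
/-- Two curves leave `q` through the two sectors where `R < R q`. -/
def Sectors (lam : ℝ) (q : ℂ) (γ₁ γ₂ : ℝ → ℂ) : Prop :=
  ∀ N ∈ 𝓝 q, ∃ r > 0, ∃ S₁ S₂ : Set ℂ, IsOpen S₁ ∧ IsPreconnected S₁ ∧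
    IsOpen S₂ ∧ IsPreconnected S₂ ∧
    (∀ w ∈ S₁ ∪ S₂, w ∈ N ∧ ¬ u.IsPole w ∧ u.R lam w < u.R lam q) ∧
    (∀ w ∈ Metric.ball q r, u.R lam w < u.R lam q → w ∈ S₁ ∪ S₂) ∧
    (∀ᶠ t in 𝓝[>] 0, γ₁ t ∈ S₁) ∧ ∀ᶠ t in 𝓝[>] 0, γ₂ t ∈ S₂

variable (u) in
/-- Through the simple critical point `q` there is an admissible contour, with branch `H`, over
which the integral of `g e^{-ih/ε}` vanishes. -/
def UpperCond (lam ε ρ : ℝ) (g : ℂ → ℂ) (q : ℂ) : Prop :=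
  ∃ γ₁ γ₂ H, u.Half (u.region lam (u.R lam q) ρ) q γ₁ ∧ u.Half (u.region lam (u.R lam q) ρ) q γ₂ ∧
    u.Sectors lam q γ₁ γ₂ ∧ u.IsBranchAlong lam (glue γ₁ γ₂) H ∧
    contourIntegral ε (glue γ₁ γ₂) H g = 0

variable (u) in
/-- The same for a real critical point. -/
def RealCond (lam ε ρ : ℝ) (g : ℂ → ℂ) (q : ℂ) : Prop :=
  ∃ γ₁ γ₂ H, u.Half (u.region lam 0 ρ) q γ₁ ∧ u.Half (u.lowRegion lam ρ) q γ₂ ∧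
    u.IsBranchAlong lam (glue γ₁ γ₂) H ∧ contourIntegral ε (glue γ₁ γ₂) H g = 0

variable (u) in
/-- A local solution `Y` near the point `q` of the level set that agrees with `y`. -/
structure Chart (lam ε ρ : ℝ) (g yi : ℂ → ℂ) (c : ℝ) (y : ℂ → ℂ) (q : ℂ) (r : ℝ) (Y : ℂ → ℂ) :
    Prop where
  pos : 0 < r
  le : r ≤ 1 / 2
  le_im : q.im = 0 ∨ r ≤ q.im
  solAt : ∀ w ∈ Metric.ball q r, ¬ u.IsPole w ∧ u.SolAt lam ε g Y w
  eq : ∀ w ∈ Metric.ball q r, w ∈ u.sub lam c → Y w = y w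
  eq_infty : (q.im = 0 ∨ ρ < |q.re|) → ∀ w ∈ Metric.ball q r, Y w = yi w

lemma Setting.mem_dom_of_lt (h : u.Setting lam ε ρ g yi) {w : ℂ} (hw : ρ < |w.re|) : w ∈ u.dom ρ := by
  rcases lt_abs.1 hw with h1 | h1
  · exact Or.inr (Or.inr h1)
  · exact Or.inr (Or.inl (by linarith [h.left]))

/-- Far out `R` increases upwards from `0`, so the vertical segment from the axis to `w` stays below
the level `c`, and the equality on the axis can be continued along it. -/
lemma Setting.eq_of_far (h : u.Setting lam ε ρ g yi) (hy : u.IsSol lam ε g yi c y) {w : ℂ}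
    (hw : w ∈ u.sub lam c) (hre : ρ < |w.re|) : y w = yi w := by
  have hnp : ∀ v : ℂ, ρ < |v.re| → ¬ u.IsPole v := fun v hv => (h.far.of_re hv.le).1
  have hR : u.R lam w < c := hw.2.resolve_left (hnp w hre)
  have hpos : 0 < u.R lam w := h.posImag.R_pos_far h.far hre.le hw.1
  have hseg : ∀ v ∈ segment ℝ (w.re : ℂ) w, v.re = w.re ∧ 0 ≤ v.im ∧ v.im ≤ w.im := by
    intro v hv
    rw [segment_eq_image'] at hv
    obtain ⟨s, ⟨hs0, hs1⟩, rfl⟩ := hv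
    simp only [Complex.add_re, Complex.ofReal_re, Complex.real_smul, Complex.mul_re,
      Complex.ofReal_im, Complex.sub_re, Complex.sub_im, Complex.add_im, Complex.mul_im]
    refine ⟨by ring, ?_, ?_⟩
    · have := mul_nonneg hs0 hw.1.le
      linarith
    · nlinarith [hw.1]
  have hmem : ∀ v ∈ segment ℝ (w.re : ℂ) w, v ∈ u.sub lam c ∨ v.im ≤ 0 ∧ v ∈ u.dom ρ := by
    intro v hv
    obtain ⟨h1, h2, h3⟩ := hseg v hv
    rcases h2.eq_or_lt with h4 | h4
    · exact Or.inr ⟨h4.symm.le, h.mem_dom_of_lt (by rwa [h1])⟩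
    · refine Or.inl ⟨h4, Or.inr ?_⟩
      rcases h3.eq_or_lt with h5 | h5
      · rwa [show v = w from Complex.ext h1 h5]
      · have := h.posImag.R_lt_R_far h.far hre.le h5
        rw [← h1, Complex.re_add_im, h1, Complex.re_add_im] at this
        exact this.trans hR
  have h0 : 0 < c := hpos.trans hR
  have hz : ext y yi =ᶠ[𝓝 (w.re : ℂ)] yi := by
    filter_upwards [hy.real w.re, (h.posImag.continuousAt_R lam
      (not_isPole_ofReal (u := u) w.re)).eventually_lt_const
      (by rwa [h.posImag.R_ofReal])] with v h1 h2
    by_cases h3 : 0 < v.im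
    · simp [ext, h3, h1 ⟨h3, Or.inr h2⟩]
    · simp [ext, h3]
  have := (eventuallyEq_of_isPreconnected (lam := lam) (ε := ε) h.posImag h.test
    (convex_segment _ _).isPreconnected
    (fun v hv => hy.solAt_ext_of_mem h.posImag h.recessive h0 (hmem v hv))
    (fun v hv => h.recessive.solAt v (h.mem_dom_of_lt (by rwa [(hseg v hv).1])))
    (left_mem_segment ℝ _ _) hz (right_mem_segment ℝ _ _) (hnp w hre)).self_of_nhds
  simpa [ext, hw.1] using this

lemma exists_chart_radius {x : ℝ} (hx : 0 ≤ x) : ∃ s > (0 : ℝ), s ≤ 1 / 2 ∧ (x = 0 ∨ s ≤ x) := by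
  rcases hx.eq_or_lt with rfl | hx
  · exact ⟨1 / 2, by norm_num, le_rfl, Or.inl rfl⟩
  · exact ⟨min x (1 / 2), lt_min hx (by norm_num), min_le_right _ _, Or.inr (min_le_left _ _)⟩

lemma Setting.chart_of_infty (h : u.Setting lam ε ρ g yi) {q : ℂ} (hq : 0 ≤ q.im) (hp : ¬ u.IsPole q)
    (hd : q ∈ u.dom ρ) (he : ∀ᶠ w in 𝓝 q, w ∈ u.sub lam c → yi w = y w) :
    ∃ r Y, u.Chart lam ε ρ g yi c y q r Y := by
  obtain ⟨r, hr, hball⟩ := Metric.eventually_nhds_iff_ball.1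
    ((eventually_not_isPole hp).and ((h.recessive.solAt q hd).eventually.and he))
  obtain ⟨s, hs, hs', him⟩ := exists_chart_radius hq
  have hsub : ∀ w ∈ Metric.ball q (min r s), w ∈ Metric.ball q r :=
    fun w hw => Metric.ball_subset_ball (min_le_left _ _) hw
  exact ⟨min r s, yi, lt_min hr hs, (min_le_right _ _).trans hs',
    him.imp_right (min_le_right _ _).trans,
    fun w hw => ⟨(hball w (hsub w hw)).1, (hball w (hsub w hw)).2.1⟩,
    fun w hw => (hball w (hsub w hw)).2.2, fun _ w _ => rfl⟩

lemma Frame.chart {U : Set ℂ} {E Φ : ℂ → ℂ} (hF : u.Frame lam ε g U E Φ) {q a : ℂ} (hq : q ∈ U)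
    (him : 0 < q.im) (hre : |q.re| ≤ ρ) {r : ℝ} (hr : 0 < r)
    (he : ∀ w ∈ Metric.ball q r, ¬ u.IsPole w → w ∈ u.sub lam c → y w = (Φ w + a) / E w) :
    ∃ r Y, u.Chart lam ε ρ g yi c y q r Y := by
  obtain ⟨r', hr', hball⟩ := Metric.isOpen_iff.1 hF.isOpen q hq
  obtain ⟨d, hd, hd', him'⟩ := exists_chart_radius him.le
  set s := min (min r r') d with hs
  have h1 : ∀ w ∈ Metric.ball q s, w ∈ Metric.ball q r := fun w hw =>
    Metric.ball_subset_ball ((min_le_left _ _).trans (min_le_left _ _)) hw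
  have h2 : ∀ w ∈ Metric.ball q s, w ∈ U := fun w hw =>
    hball (Metric.ball_subset_ball ((min_le_left _ _).trans (min_le_right _ _)) hw)
  exact ⟨s, fun w => (Φ w + a) / E w, lt_min (lt_min hr hr') hd, (min_le_right _ _).trans hd',
    him'.imp_right (min_le_right _ _).trans,
    fun w hw => ⟨hF.not_isPole w (h2 w hw), hF.solAt a (h2 w hw)⟩,
    fun w hw hwc => (he w (h1 w hw) (hF.not_isPole w (h2 w hw)) hwc).symm,
    fun h => absurd h (by rintro (h | h); exacts [him.ne' h, hre.not_gt h])⟩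

/-- The solution continues across the level set. On the axis and far out, `yi` is the continuation.
At a regular point the sublevel set is one sector, so one constant describes `y`. At a simple
critical point there are two sectors with constants `a₁`, `a₂`, and the vanishing contour integral
says precisely that `a₁ = a₂`. -/
theorem Setting.exists_chart (h : u.Setting lam ε ρ g yi)
    (hup : ∀ q : ℂ, 0 < q.im → u.IsCritical lam q → u.UpperCond lam ε ρ g q)
    (hy : u.IsSol lam ε g yi c y) {q : ℂ} (hq : 0 ≤ q.im) (hp : ¬ u.IsPole q)
    (hR : u.R lam q = c) : ∃ r Y, u.Chart lam ε ρ g yi c y q r Y := by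
  have hc := h.posImag
  rcases lt_or_ge ρ |q.re| with hre | hre
  · refine h.chart_of_infty hq hp (h.mem_dom_of_lt hre) ?_
    have : ∀ᶠ w : ℂ in 𝓝 q, ρ < |w.re| :=
      (Complex.continuous_re.abs.continuousAt (x := q)).eventually_const_lt hre
    filter_upwards [this] with w hw hws
    exact (h.eq_of_far hy hws hw).symm
  rcases hq.eq_or_lt with him | him
  · have hqr : q = (q.re : ℂ) := by apply Complex.ext <;> simp [him.symm]
    rw [hqr]
    refine h.chart_of_infty (by simp) (not_isPole_ofReal (u := u) _) (Or.inl (ofReal_mem_strip _)) ?_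
    filter_upwards [hy.real q.re] with w h1 h2
    exact (h1 h2).symm
  by_cases hcr : u.IsCritical lam q
  · obtain ⟨γ₁, γ₂, H, h₁, h₂, hS, hb, h0⟩ := hup q him hcr
    rw [hR] at h₁ h₂
    obtain ⟨r, hr, E, Φ, hF, -, hE₁, hE₂⟩ :=
      exists_frame_glue h.test h₁ hp hb ε univ_mem
    obtain ⟨r', hr', S₁, S₂, hS₁, hS₁', hS₂, hS₂', hmem, hball, ht₁, ht₂⟩ := hS
      (Metric.ball q r ∩ {w | 0 < w.im}) (inter_mem (Metric.ball_mem_nhds q hr)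
        (eventually_im_pos him))
    have hsub : ∀ w ∈ S₁ ∪ S₂, w ∈ u.sub lam c := fun w hw =>
      ⟨(hmem w hw).1.2, Or.inr (by rw [← hR]; exact (hmem w hw).2.2)⟩
    obtain ⟨a₁, ha₁⟩ := hF.exists_const hS₁ hS₁' (fun w hw => (hmem w (Or.inl hw)).1.1)
      fun w hw => hy.solAt w (hsub w (Or.inl hw))
    obtain ⟨a₂, ha₂⟩ := hF.exists_const hS₂ hS₂' (fun w hw => (hmem w (Or.inr hw)).1.1)
      fun w hw => hy.solAt w (hsub w (Or.inr hw))
    have hM : ∀ w ∈ u.region lam c ρ, ¬ u.IsPole w ∧ u.SolAt lam ε g (ext y yi) w := fun w hw =>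
      ⟨hw.1, hy.solAt_ext_region hc h.left h.recessive hw⟩
    have e₁ : ∀ᶠ t in 𝓝[>] 0, ext y yi (γ₁ t) = (Φ (γ₁ t) + a₁) / E (γ₁ t) := by
      filter_upwards [ht₁] with t ht
      rw [ext, if_pos (show 0 < (γ₁ t).im from (hmem _ (Or.inl ht)).1.2), ha₁ _ ht]
    have e₂ : ∀ᶠ t in 𝓝[>] 0, ext y yi (γ₂ t) = (Φ (γ₂ t) + a₂) / E (γ₂ t) := by
      filter_upwards [ht₂] with t ht
      rw [ext, if_pos (show 0 < (γ₂ t).im from (hmem _ (Or.inr ht)).1.2), ha₂ _ ht]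
    have haa := add_left_cancel (limits_eq hc h.lam_pos h.eps_pos h.test h.recessive hy.solAt h₁ h₂
      hp hM hM hb h0 (hF.tendsto_of_eq (Metric.mem_ball_self hr) h₁ e₁ hE₁)
      (hF.tendsto_of_eq (Metric.mem_ball_self hr) h₂ e₂ hE₂))
    subst haa
    refine hF.chart (a := a₁) (Metric.mem_ball_self hr) him hre hr' fun w hw hwp hwc => ?_
    rcases hball w hw (by rw [hR]; exact hwc.2.resolve_left hwp) with h3 | h3
    exacts [ha₁ w h3, ha₂ w h3]
  · obtain ⟨r, hr, hpole⟩ := Metric.eventually_nhds_iff_ball.1 (eventually_not_isPole hp)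
    obtain ⟨E, Φ, hF, -⟩ := hc.exists_frame h.test lam ε (convex_ball q r) Metric.isOpen_ball hpole
    obtain ⟨r', hr', S, hS, hS', hmem, hball⟩ := exists_sector_regular hc hp hcr
      (N := Metric.ball q r ∩ {w | 0 < w.im}) (inter_mem (Metric.ball_mem_nhds q hr)
        (eventually_im_pos him))
    obtain ⟨a, ha⟩ := hF.exists_const hS hS' (fun w hw => (hmem w hw).1.1) fun w hw =>
      hy.solAt w ⟨(hmem w hw).1.2, Or.inr (by rw [← hR]; exact (hmem w hw).2.2)⟩
    exact hF.chart (Metric.mem_ball_self hr) him hre hr' fun w hw hwp hwc =>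
      ha w (hball w hw (by rw [hR]; exact hwc.2.resolve_left hwp))

/-- A point of the level set is not a local minimum of `R`, so it is a limit of lower points. -/
lemma Setting.mem_closure_sub (h : u.Setting lam ε ρ g yi) {q : ℂ} (hq : 0 < q.im)
    (hp : ¬ u.IsPole q) (hR : u.R lam q = c) : q ∈ closure (u.sub lam c) := by
  rw [mem_closure_iff_nhds]
  intro N hN
  obtain ⟨w, ⟨h1, h2⟩, h3⟩ := h.posImag.exists_R_lt h.lam_pos hp
    (inter_mem hN (eventually_im_pos hq))
  exact ⟨w, h1, h2, Or.inr (hR ▸ h3)⟩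

/-- Two charts agree. -/
lemma Setting.chart_eq_of_le (h : u.Setting lam ε ρ g yi) {q q' : ℂ} {r r' : ℝ} {Y Y' : ℂ → ℂ}
    (hq : 0 ≤ q.im) (hq' : q' ∈ closure (u.sub lam c) ∨ q'.im = 0)
    (h₁ : u.Chart lam ε ρ g yi c y q r Y) (h₂ : u.Chart lam ε ρ g yi c y q' r' Y') (hr : r' ≤ r)
    {w : ℂ} (hw : w ∈ Metric.ball q (r / 3)) (hw' : w ∈ Metric.ball q' (r' / 3)) : Y w = Y' w := by
  have hr0 := h₁.pos
  have hr0' := h₂.pos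
  have hwr : w ∈ Metric.ball q r := Metric.ball_subset_ball (by linarith) hw
  have hwr' : w ∈ Metric.ball q' r' := Metric.ball_subset_ball (by linarith) hw'
  -- Thirds of the radii make the larger ball contain the centre of the smaller one; near this
  -- centre there are points of the sublevel set, where both charts equal `y`.
  have hd : q' ∈ Metric.ball q r := by
    rw [Metric.mem_ball] at hw hw' ⊢
    have := dist_triangle_left q' q w
    linarith
  have key : q' ∈ closure (u.sub lam c) → Y w = Y' w := fun hcl => by
    obtain ⟨v, ⟨hv, hv'⟩, hvc⟩ := mem_closure_iff_nhds.1 hcl _ (inter_mem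
      (Metric.isOpen_ball.mem_nhds hd) (Metric.ball_mem_nhds q' hr0'))
    refine (eventuallyEq_of_isPreconnected h.posImag h.test
      ((convex_ball q r).inter (convex_ball q' r')).isPreconnected (fun v hv => (h₁.solAt v hv.1).2)
      (fun v hv => (h₂.solAt v hv.2).2) ⟨hv, hv'⟩ ?_ ⟨hwr, hwr'⟩ (h₁.solAt w hwr).1).self_of_nhds
    filter_upwards [Metric.isOpen_ball.mem_nhds hv, Metric.isOpen_ball.mem_nhds hv',
      (h.posImag.isOpen_sub lam c).mem_nhds hvc] with x h3 h4 h5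
    rw [h₁.eq x h3 h5, h₂.eq x h4 h5]
  -- If `q'` is real, then `q` is real too, since a chart around a nonreal point does not reach the
  -- axis; both charts are then `yi`.
  rcases hq' with hq' | hq'
  · exact key hq'
  rcases h₁.le_im with h3 | h3
  · rw [h₁.eq_infty (Or.inl h3) w hwr, h₂.eq_infty (Or.inl hq') w hwr']
  · have h4 := (Complex.abs_im_le_norm (q' - q)).trans_lt (mem_ball_iff_norm.1 hd)
    rw [Complex.sub_im, hq', zero_sub, abs_neg, abs_of_nonneg hq] at h4
    exact absurd h3 h4.not_ge

/-- A solution in a sublevel set can be continued to a larger one. -/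
theorem Setting.exists_isSol_add (h : u.Setting lam ε ρ g yi)
    (hup : ∀ q : ℂ, 0 < q.im → u.IsCritical lam q → u.UpperCond lam ε ρ g q)
    (hy : u.IsSol lam ε g yi c y) : ∃ δ > 0, ∃ y', u.IsSol lam ε g yi (c + δ) y' := by
  classical
  have hc := h.posImag
  set Λ : Set ℂ := {q | 0 ≤ q.im ∧ ¬ u.IsPole q ∧ u.R lam q = c} with hΛ
  have hch : ∀ q : ℂ, ∃ r Y, q ∈ Λ → u.Chart lam ε ρ g yi c y q r Y := fun q => by
    by_cases hq : q ∈ Λ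
    · obtain ⟨r, Y, hrY⟩ := h.exists_chart hup hy hq.1 hq.2.1 hq.2.2
      exact ⟨r, Y, fun _ => hrY⟩
    · exact ⟨0, 0, fun h => absurd h hq⟩
  choose r Y hY using hch
  have hcl : ∀ q ∈ Λ, q ∈ closure (u.sub lam c) ∨ q.im = 0 := fun q hq =>
    hq.1.eq_or_lt.symm.imp (fun h3 => h.mem_closure_sub h3 hq.2.1 hq.2.2) Eq.symm
  have hYY : ∀ q ∈ Λ, ∀ q' ∈ Λ, ∀ w ∈ Metric.ball q (r q / 3), w ∈ Metric.ball q' (r q' / 3) →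
      Y q w = Y q' w := fun q hq q' hq' w hw hw' => by
    rcases le_total (r q') (r q) with hr | hr
    · exact h.chart_eq_of_le hq.1 (hcl q' hq') (hY q hq) (hY q' hq') hr hw hw'
    · exact (h.chart_eq_of_le hq'.1 (hcl q hq) (hY q' hq') (hY q hq) hr hw' hw).symm
  obtain ⟨δ, hδ, hcov⟩ : ∃ δ > 0, ∀ w : ℂ, |w.re| ≤ ρ + 1 → w ∈ u.sub lam (c + δ) →
      w ∈ u.sub lam c ∨ ∃ q ∈ Λ, w ∈ Metric.ball q (r q / 3) := by
    -- Above height `B` one has `R ≥ c + 1`, so with `δ ≤ 1` the enlarged sublevel set stays below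
    -- `B`.
    obtain ⟨B, hB⟩ := hc.exists_im_bound h.lam_pos (c + 1)
    set O : Set ℂ := {w | ¬ u.IsPole w ∧ u.R lam w < c} ∪
      (u.sub lam c ∪ ⋃ q ∈ Λ, Metric.ball q (r q / 3)) with hO
    have hOo : IsOpen O := by
      refine IsOpen.union (isOpen_iff_eventually.2 fun w hw => ?_)
        ((hc.isOpen_sub lam c).union (isOpen_biUnion fun q _ => Metric.isOpen_ball))
      exact (eventually_not_isPole hw.1).and
        ((hc.continuousAt_R lam hw.1).eventually_lt_const hw.2)
    -- What is left of a compact box after removing the lower points and the chart balls; on it `R >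
    -- c`, and the minimum of `R` provides `δ`.
    set K : Set ℂ := (Set.Icc (-(ρ + 1)) (ρ + 1) ×ℂ Set.Icc 0 B) \ O with hK
    have hKc : IsCompact K := (isCompact_Icc.reProdIm isCompact_Icc).diff hOo
    have hKp : ∀ w ∈ K, ¬ u.IsPole w := by
      rintro w ⟨⟨-, hw⟩, hwO⟩ hp
      refine hwO (Or.inr (Or.inl ⟨lt_of_le_of_ne hw.1 fun h3 => ?_, Or.inl hp⟩))
      have hwr : w = (w.re : ℂ) := by apply Complex.ext <;> simp [← h3]
      exact not_isPole_ofReal w.re (hwr ▸ hp)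
    have hKR : ∀ w ∈ K, c < u.R lam w := by
      intro w hw
      have hp := hKp w hw
      refine lt_of_le_of_ne (not_lt.1 fun h3 => hw.2 (Or.inl ⟨hp, h3⟩)) fun h3 => ?_
      have hwΛ : w ∈ Λ := ⟨hw.1.2.1, hp, h3.symm⟩
      exact hw.2 (Or.inr (Or.inr (Set.mem_biUnion hwΛ
        (Metric.mem_ball_self (by linarith [(hY w hwΛ).pos])))))
    obtain ⟨δ, hδ, hδ1, hδK⟩ : ∃ δ > (0 : ℝ), δ ≤ 1 ∧ ∀ w ∈ K, c + δ ≤ u.R lam w := by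
      rcases K.eq_empty_or_nonempty with h3 | h3
      · exact ⟨1, one_pos, le_rfl, by simp [h3]⟩
      obtain ⟨w₀, hw₀, hmin⟩ := hKc.exists_isMinOn h3 fun w hw =>
        (hc.continuousAt_R lam (hKp w hw)).continuousWithinAt
      refine ⟨min 1 (u.R lam w₀ - c), lt_min one_pos (sub_pos.2 (hKR w₀ hw₀)), min_le_left _ _,
        fun w hw => ?_⟩
      have := isMinOn_iff.1 hmin w hw
      linarith [min_le_right 1 (u.R lam w₀ - c)]
    refine ⟨δ, hδ, fun w hre hw => ?_⟩
    by_contra hcon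
    rw [not_or] at hcon
    have hp : ¬ u.IsPole w := fun hp => hcon.1 ⟨hw.1, Or.inl hp⟩
    have hR := hw.2.resolve_left hp
    refine (hδK w ⟨⟨abs_le.1 hre, hw.1.le, ?_⟩, ?_⟩).not_gt hR
    · by_contra! h3
      linarith [(hB w h3.le).2]
    · rintro (h3 | h3 | h3)
      · exact hcon.1 ⟨hw.1, Or.inr h3.2⟩
      · exact hcon.1 h3
      · simp only [Set.mem_iUnion, exists_prop] at h3
        exact hcon.2 h3
  -- Charts have radius at most `1/2`, so a chart that contains a point with `|Re| > ρ + 1/2` is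
  -- centred at `|Re| > ρ`, where it is `yi`. The three clauses are therefore compatible.
  set y' : ℂ → ℂ := fun w => if w ∈ u.sub lam c then y w else if ρ + 1 / 2 < |w.re| then yi w else
    if hq : ∃ q ∈ Λ, w ∈ Metric.ball q (r q / 3) then Y hq.choose w else 0 with hy'
  have hy1 : ∀ w ∈ u.sub lam c, y' w = y w := fun w hw => by simp only [hy', if_pos hw]
  have hy2 : ∀ w, ρ + 1 / 2 < |w.re| → y' w = yi w := fun w hw => by
    by_cases hws : w ∈ u.sub lam c
    · rw [hy1 w hws, h.eq_of_far hy hws (by linarith)]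
    · simp only [hy', if_neg hws, if_pos hw]
  have hy3 : ∀ q ∈ Λ, ∀ w ∈ Metric.ball q (r q / 3), y' w = Y q w := fun q hq w hw => by
    have hwr : w ∈ Metric.ball q (r q) :=
      Metric.ball_subset_ball (by linarith [(hY q hq).pos]) hw
    by_cases hws : w ∈ u.sub lam c
    · rw [hy1 w hws, (hY q hq).eq w hwr hws]
    by_cases hre : ρ + 1 / 2 < |w.re|
    · rw [hy2 w hre, (hY q hq).eq_infty (Or.inr ?_) w hwr]
      have h4 := (Complex.abs_re_le_norm (w - q)).trans_lt (mem_ball_iff_norm.1 hwr)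
      rw [Complex.sub_re] at h4
      have h5 := abs_sub_abs_le_abs_sub w.re q.re
      linarith [(hY q hq).le]
    have hex : ∃ q ∈ Λ, w ∈ Metric.ball q (r q / 3) := ⟨q, hq, hw⟩
    simp only [hy', if_neg hws, if_neg hre, dif_pos hex]
    exact hYY _ hex.choose_spec.1 q hq w hex.choose_spec.2 hw
  have hfar : ∀ w : ℂ, ρ + 1 / 2 < |w.re| → y' =ᶠ[𝓝 w] yi := fun w hw => by
    have : ∀ᶠ v : ℂ in 𝓝 w, ρ + 1 / 2 < |v.re| :=
      (Complex.continuous_re.abs.continuousAt (x := w)).eventually_const_lt hw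
    exact this.mono hy2
  have hball : ∀ q ∈ Λ, ∀ w ∈ Metric.ball q (r q / 3), y' =ᶠ[𝓝 w] Y q := fun q hq w hw =>
    (Metric.isOpen_ball.eventually_mem hw).mono (hy3 q hq)
  -- A negative level must stay negative, so that no condition arises at the real axis; the crossing
  -- of level `0` is treated separately.
  obtain ⟨δ', hδ', hδ'le, hneg⟩ : ∃ δ' > 0, δ' ≤ δ ∧ (c < 0 → c + δ' < 0) := by
    rcases lt_or_ge c 0 with h3 | h3
    · exact ⟨min δ (-c / 2), lt_min hδ (by linarith), min_le_left _ _,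
        fun _ => by linarith [min_le_right δ (-c / 2)]⟩
    · exact ⟨δ, hδ, le_rfl, fun h4 => absurd h4 h3.not_gt⟩
  refine ⟨δ', hδ', y', fun w hw => ?_, fun x => ?_⟩
  · by_cases hws : w ∈ u.sub lam c
    · refine (hy.solAt w hws).congr ?_
      filter_upwards [(hc.isOpen_sub lam c).mem_nhds hws] with v hv
      exact (hy1 v hv).symm
    by_cases hre : ρ + 1 / 2 < |w.re|
    · exact (h.recessive.solAt w (h.mem_dom_of_lt (by linarith))).congr (hfar w hre).symm
    obtain ⟨q, hq, hwq⟩ := (hcov w (by linarith) (sub_mono (by linarith) hw)).resolve_left hws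
    exact ((hY q hq).solAt w (Metric.ball_subset_ball
      (by linarith [(hY q hq).pos]) hwq)).2.congr (hball q hq w hwq).symm
  · have hRx := hc.continuousAt_R lam (not_isPole_ofReal (u := u) x)
    rcases lt_trichotomy c 0 with h3 | h3 | h3
    · filter_upwards [eventually_not_isPole (not_isPole_ofReal (u := u) x),
        hRx.eventually_const_lt (by rw [hc.R_ofReal]; exact hneg h3)] with w h4 h5 h6
      exact absurd (h6.2.resolve_left h4) h5.not_gt
    · have hx : (x : ℂ) ∈ Λ := ⟨by simp, not_isPole_ofReal x, by rw [hc.R_ofReal, h3]⟩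
      filter_upwards [hball x hx x (Metric.mem_ball_self (by linarith [(hY x hx).pos])),
        Metric.ball_mem_nhds (x : ℂ) (hY x hx).pos] with w h4 h5 _
      rw [h4, (hY x hx).eq_infty (Or.inl (Complex.ofReal_im x)) w h5]
    · filter_upwards [hy.real x, hRx.eventually_lt_const (by rwa [hc.R_ofReal])] with w h4 h5 h6
      have h7 : w ∈ u.sub lam c := ⟨h6.1, Or.inr h5⟩
      rw [hy1 w h7, h4 h7]

end BenjaminOno.RationalPotential

namespace BenjaminOno.RationalPotential

variable {P : ℕ} {u : RationalPotential P} {lam ε ρ c : ℝ} {g yi y y₁ y₂ : ℂ → ℂ}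

/-! ### The global solution -/

lemma IsSol.mono {c' : ℝ} (h : u.IsSol lam ε g yi c y) (hcc : c' ≤ c) : u.IsSol lam ε g yi c' y :=
  ⟨fun w hw => h.solAt w (sub_mono hcc hw), fun x => (h.real x).mono fun _ h1 h2 =>
    h1 (sub_mono hcc h2)⟩

lemma eq_z_of_isPole {w : ℂ} (hw : u.IsPole w) (him : 0 < w.im) : ∃ p, w = u.z p := by
  obtain ⟨p, rfl | rfl⟩ := hw
  · exact ⟨p, rfl⟩
  · rw [Complex.conj_im] at him
    linarith [u.z_im_pos p]

lemma IsPosImag.eventually_not_mem_sub (hc : u.IsPosImag) (hneg : c < 0) (x : ℝ) :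
    ∀ᶠ w in 𝓝 (x : ℂ), w ∉ u.sub lam c := by
  filter_upwards [eventually_not_isPole (not_isPole_ofReal (u := u) x),
    (hc.continuousAt_R lam (not_isPole_ofReal (u := u) x)).eventually_const_lt
      (by rwa [hc.R_ofReal])] with w h1 h2 h3
  exact (h3.2.resolve_left h1).not_gt h2

/-- For very negative `c` the sublevel set is contained in disjoint small discs around the wells, in
each of which the local analytic solution is used. -/
theorem Setting.exists_isSol_bot (h : u.Setting lam ε ρ g yi) : ∃ c y, u.IsSol lam ε g yi c y := by
  classical
  have hc := h.posImag
  choose Y hY using fun p => hc.exists_solAt_well h.test lam h.eps_pos p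
  have h1 : ∀ᶠ r : ℝ in 𝓝[>] 0, ∀ p, ∀ w ∈ Metric.ball (u.z p) r, u.SolAt lam ε g (Y p) w := by
    refine eventually_all.2 fun p => ?_
    obtain ⟨r, hr, hball⟩ := Metric.eventually_nhds_iff_ball.1 (hY p).eventually
    filter_upwards [Ioo_mem_nhdsGT hr] with s hs w hw
    exact hball w (Metric.ball_subset_ball hs.2.le hw)
  have h2 : ∀ᶠ r : ℝ in 𝓝[>] 0, ∀ p q, p ≠ q → 2 * r < ‖u.z p - u.z q‖ := by
    refine eventually_all.2 fun p => eventually_all.2 fun q => ?_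
    by_cases hpq : p = q
    · exact Eventually.of_forall fun r hne => absurd hpq hne
    have h0 : 0 < ‖u.z p - u.z q‖ / 2 := by
      have := norm_pos_iff.2 (sub_ne_zero.2 ((z_injective (u := u)).ne hpq))
      positivity
    filter_upwards [Ioo_mem_nhdsGT h0] with s hs _
    linarith [hs.2]
  obtain ⟨r, ⟨h1, h2⟩, hr⟩ := ((h1.and h2).and self_mem_nhdsWithin).exists
  obtain ⟨c, hc0, hcr⟩ := hc.exists_near_well h.lam_pos hr
  have huniq : ∀ p q w, w ∈ Metric.ball (u.z p) r → w ∈ Metric.ball (u.z q) r → p = q := by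
    intro p q w hp hq
    by_contra hpq
    rw [Metric.mem_ball] at hp hq
    have h3 := dist_triangle_left (u.z p) (u.z q) w
    rw [dist_eq_norm (u.z p) (u.z q)] at h3
    linarith [h2 p q hpq]
  set y : ℂ → ℂ := fun w => if h : ∃ p, w ∈ Metric.ball (u.z p) r then Y h.choose w else 0 with hy
  refine ⟨c, y, fun w hw => ?_, fun x => (hc.eventually_not_mem_sub hc0 x).mono fun w h3 h4 =>
    absurd h4 h3⟩
  obtain ⟨p, hp⟩ : ∃ p, w ∈ Metric.ball (u.z p) r := by
    rcases hw.2 with h3 | h3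
    · obtain ⟨p, rfl⟩ := eq_z_of_isPole h3 hw.1
      exact ⟨p, Metric.mem_ball_self hr⟩
    · obtain ⟨p, hp⟩ := hcr w hw.1 h3
      exact ⟨p, mem_ball_iff_norm.2 hp⟩
  refine (h1 p w hp).congr ?_
  filter_upwards [Metric.isOpen_ball.mem_nhds hp] with v hv
  have hex : ∃ p, v ∈ Metric.ball (u.z p) r := ⟨p, hv⟩
  simp only [hy, dif_pos hex]
  rw [huniq _ _ v hex.choose_spec hv]

/-- Near a real point, vertical segments down to the real axis stay near it. -/
lemma eventually_vertical {x : ℝ} {p : ℂ → Prop} (hp : ∀ᶠ w in 𝓝 (x : ℂ), p w) :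
    ∀ᶠ w in 𝓝 (x : ℂ), ∀ y ∈ Set.Icc (0 : ℝ) w.im, p (w.re + y * Complex.I) := by
  obtain ⟨r, hr, hball⟩ := Metric.eventually_nhds_iff_ball.1 hp
  filter_upwards [Metric.ball_mem_nhds (x : ℂ) (half_pos hr)] with w hw y hy
  refine hball _ ?_
  rw [mem_ball_iff_norm] at hw ⊢
  have h1 := (Complex.abs_re_le_norm (w - x)).trans_lt hw
  have h2 := (Complex.abs_im_le_norm (w - x)).trans_lt hw
  simp only [Complex.sub_re, Complex.ofReal_re, Complex.sub_im, Complex.ofReal_im, sub_zero] at h1 h2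
  have h3 := Complex.norm_le_abs_re_add_abs_im ((w.re : ℂ) + y * Complex.I - x)
  simp only [Complex.sub_re, Complex.add_re, Complex.ofReal_re, Complex.mul_re, Complex.I_re,
    mul_zero, Complex.ofReal_im, Complex.I_im, mul_one, sub_self, add_zero, Complex.sub_im,
    Complex.add_im, Complex.mul_im, zero_add, sub_zero] at h3
  rw [abs_of_nonneg hy.1] at h3
  linarith [hy.2, le_abs_self w.im]

/-- `R` starts from `0` on the axis and its upward derivative is `Re h'`, which is positive near
`x`. -/
lemma IsPosImag.not_mem_sub_zero_of_pos (hc : u.IsPosImag) {x : ℝ} (hx : 0 < lam + u.onReal x) :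
    ∀ᶠ w in 𝓝 (x : ℂ), w ∉ u.sub lam 0 := by
  have hp := not_isPole_ofReal (u := u) x
  have hev : ∀ᶠ w in 𝓝 (x : ℂ), 0 < lam + (u.toFun w).re :=
    (continuousAt_const.add (Complex.continuous_re.continuousAt.comp
      (analyticAt_toFun hp).continuousAt)).eventually_const_lt hx
  filter_upwards [eventually_not_isPole hp, eventually_vertical ((eventually_not_isPole hp).and hev)]
    with w h1 h2 h3
  have := hc.R_lt_R_vertical lam w.re h3.1 h2
  rw [Complex.re_add_im, Complex.ofReal_zero, zero_mul, add_zero, hc.R_ofReal] at this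
  exact (h3.2.resolve_left h1).not_gt this

lemma IsPosImag.mem_sub_zero_of_neg (hc : u.IsPosImag) {x : ℝ} (hx : lam + u.onReal x < 0) :
    ∀ᶠ w in 𝓝 (x : ℂ), 0 < w.im → w ∈ u.sub lam 0 := by
  have hp := not_isPole_ofReal (u := u) x
  have hev : ∀ᶠ w in 𝓝 (x : ℂ), lam + (u.toFun w).re < 0 :=
    (continuousAt_const.add (Complex.continuous_re.continuousAt.comp
      (analyticAt_toFun hp).continuousAt)).eventually_lt_const hx
  filter_upwards [eventually_vertical ((eventually_not_isPole hp).and hev)] with w h2 h3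
  refine ⟨h3, Or.inr ?_⟩
  have hd := fun y hy => hc.hasDerivAt_R_vertical lam w.re y (h2 y hy).1
  have hanti : StrictAntiOn (fun t : ℝ => u.R lam (w.re + t * Complex.I)) (Set.Icc 0 w.im) :=
    strictAntiOn_of_deriv_neg (convex_Icc _ _)
      (fun y hy => (hd y hy).continuousAt.continuousWithinAt) fun y hy => by
        rw [interior_Icc] at hy
        rw [(hd y (Set.Ioo_subset_Icc_self hy)).deriv]
        exact (h2 y (Set.Ioo_subset_Icc_self hy)).2
  have := hanti (Set.left_mem_Icc.2 h3.le) (Set.right_mem_Icc.2 h3.le) h3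
  simp only [Complex.re_add_im, Complex.ofReal_zero, zero_mul, add_zero, hc.R_ofReal] at this
  exact this

/-- The part of `{R < 0}` in the upper half-plane near a real point. -/
lemma IsPosImag.exists_sector_axis (hc : u.IsPosImag) (hKS : u.IsKlausShaw)
    (hneg : ∀ x, u.onReal x < 0)
    (hreal : ∀ x : ℝ, u.IsCritical lam (x : ℂ) → deriv u.toFun (x : ℂ) = 0 →
      iteratedDeriv 2 u.toFun (x : ℂ) ≠ 0) {x : ℝ} (hx : lam + u.onReal x ≤ 0) {N : Set ℂ}
    (hN : N ∈ 𝓝 (x : ℂ)) :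
    ∃ r > 0, ∃ S, IsOpen S ∧ IsPreconnected S ∧ S ⊆ u.sub lam 0 ∩ N ∧
      (∀ w ∈ Metric.ball (x : ℂ) r, w ∈ u.sub lam 0 → w ∈ S) ∧ (x : ℂ) ∈ closure S := by
  rcases hx.lt_or_eq with hx | hx
  · obtain ⟨r, hr, hball⟩ := Metric.eventually_nhds_iff_ball.1 ((hc.mem_sub_zero_of_neg hx).and hN)
    refine ⟨r, hr, Metric.ball (x : ℂ) r ∩ {w | 0 < w.im},
      Metric.isOpen_ball.inter (isOpen_lt continuous_const Complex.continuous_im),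
      ((convex_ball _ _).inter (convex_halfSpace_im_gt 0)).isPreconnected,
      fun w hw => ⟨(hball w hw.1).1 hw.2, (hball w hw.1).2⟩, fun w hw hws => ⟨hw, hws.1⟩, ?_⟩
    rw [mem_closure_iff_nhds]
    intro N hN
    have ht : Tendsto (fun t : ℝ => (x : ℂ) + t * Complex.I) (𝓝[>] 0) (𝓝 (x : ℂ)) := by
      have : Continuous fun t : ℝ => (x : ℂ) + t * Complex.I := by fun_prop
      have := (this.tendsto 0).mono_left (nhdsWithin_le_nhds (s := Set.Ioi 0))
      simpa using this
    obtain ⟨t, ⟨h1, h2⟩, h3⟩ := ((ht.eventually (inter_mem hN (Metric.ball_mem_nhds _ hr))).and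
      self_mem_nhdsWithin).exists
    exact ⟨_, h1, h2, by simpa using h3⟩
  · obtain ⟨k, s, hs, hL⟩ := exists_realSign hKS hneg hreal (isCritical_ofReal_iff.2 hx)
    obtain ⟨r, hr, S, hS, hS', hmem, hball, hcl⟩ := exists_sector_real hc hs hL hN
    obtain ⟨r', hr', hpole⟩ := Metric.eventually_nhds_iff_ball.1
      (eventually_not_isPole (not_isPole_ofReal (u := u) x))
    refine ⟨min r r', lt_min hr hr', S, hS, hS', fun w hw =>
      ⟨⟨(hmem w hw).2.2.2, Or.inr (hmem w hw).2.2.1⟩, (hmem w hw).1⟩, fun w hw hws => ?_, hcl⟩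
    exact hball w (Metric.ball_subset_ball (min_le_left _ _) hw)
      (hws.2.resolve_left (hpole w (Metric.ball_subset_ball (min_le_right _ _) hw))) hws.1

/-- `{R < 0}` touches the axis from above only along `{lam + u₀ ≤ 0}`. At the left end of this
interval the contour through the leftmost critical point equates the constants of `y` and `yi`;
since the upper part of `{R < 0}` near each point of the interval is a connected sector, the match
spreads along it. -/
theorem Setting.eq_real_of_zero (h : u.Setting lam ε ρ g yi) (hKS : u.IsKlausShaw)
    (hneg : ∀ x, u.onReal x < 0)
    (hreal : ∀ x : ℝ, u.IsCritical lam (x : ℂ) → deriv u.toFun (x : ℂ) = 0 →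
      iteratedDeriv 2 u.toFun (x : ℂ) ≠ 0)
    (hleft : ∀ q : ℝ, u.IsLeftCritical lam q → u.RealCond lam ε ρ g q)
    (hy : ∀ w ∈ u.sub lam 0, u.SolAt lam ε g y w) (x : ℝ) :
    ∀ᶠ w in 𝓝 (x : ℂ), w ∈ u.sub lam 0 → y w = yi w := by
  have hc := h.posImag
  have hdom : ∀ x : ℝ, u.dom ρ ∈ 𝓝 (x : ℂ) := fun x =>
    isOpen_dom.mem_nhds (Or.inl (ofReal_mem_strip x))
  rcases lt_or_ge 0 (lam + u.onReal x) with hx | hx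
  · exact (hc.not_mem_sub_zero_of_pos hx).mono fun w h1 h2 => absurd h2 h1
  obtain ⟨q, hqx, hq⟩ := exists_isLeftCritical h.lam_pos hx
  have hq0 : lam + u.onReal q ≤ 0 := (isCritical_ofReal_iff.1 hq.1).le
  have hPq : ∀ᶠ w in 𝓝 (q : ℂ), w ∈ u.sub lam 0 → y w = yi w := by
    obtain ⟨γ₁, γ₂, H, h₁, h₂, hb, h0⟩ := hleft q hq
    have hp := not_isPole_ofReal (u := u) q
    obtain ⟨r, hr, E, Φ, hF, hrN, hE₁, hE₂⟩ := exists_frame_glue h.test h₁ hp hb ε (hdom q)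
    obtain ⟨r', hr', S, hS, hS', hmem, hball, hcl⟩ := hc.exists_sector_axis hKS hneg hreal hq0
      (Metric.ball_mem_nhds (q : ℂ) hr)
    obtain ⟨a₁, ha₁⟩ := hF.exists_const hS hS' (fun w hw => (hmem hw).2)
      fun w hw => hy w (hmem hw).1
    obtain ⟨a₂, ha₂⟩ := hF.exists_const Metric.isOpen_ball (convex_ball _ _).isPreconnected
      subset_rfl fun w hw => h.recessive.solAt w (hrN hw)
    have hsub : ∀ w ∈ u.region lam 0 ρ, w ∈ u.sub lam 0 := fun w hw =>
      ⟨hw.2.2.2.resolve_right fun h3 => h3.1.false, Or.inr hw.2.2.1⟩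
    have e₁ : ∀ᶠ t in 𝓝[>] 0, ext y yi (γ₁ t) = (Φ (γ₁ t) + a₁) / E (γ₁ t) := by
      filter_upwards [h₁.tendsto_zero.eventually (Metric.ball_mem_nhds _ hr'),
        self_mem_nhdsWithin] with t h3 h4
      have h5 := hsub _ (h₁.mem t h4)
      rw [ext, if_pos h5.1, ha₁ _ (hball _ h3 h5)]
    have e₂ : ∀ᶠ t in 𝓝[>] 0, ext y yi (γ₂ t) = (Φ (γ₂ t) + a₂) / E (γ₂ t) := by
      filter_upwards [h₂.tendsto_zero.eventually (Metric.ball_mem_nhds _ hr),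
        self_mem_nhdsWithin] with t h3 h4
      rw [ext, if_neg (h₂.mem t h4).2.2.2.1.not_gt, ha₂ _ h3]
    have haa := add_left_cancel (limits_eq hc h.lam_pos h.eps_pos h.test h.recessive hy h₁ h₂
      hp (fun w hw => ⟨hw.1, solAt_ext_upper hy (hsub w hw)⟩)
      (fun w hw => ⟨hw.1, solAt_ext_lower h.recessive hw.2.2.2.1 hw.2.2.2.2⟩) hb h0
      (hF.tendsto_of_eq (Metric.mem_ball_self hr) h₁ e₁ hE₁)
      (hF.tendsto_of_eq (Metric.mem_ball_self hr) h₂ e₂ hE₂))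
    filter_upwards [Metric.ball_mem_nhds (q : ℂ) hr'] with w h3 h4
    have h5 := hball w h3 h4
    rw [ha₁ w h5, ha₂ w (hmem h5).2, haa]
  have hJ : IsPreconnected {x : ℝ | lam + u.onReal x ≤ 0} :=
    (hKS.ordConnected hneg lam).isPreconnected
  -- The relation "matching holds at `a` iff it holds at `b`" is a locally constant equivalence on a
  -- connected set.
  refine (hJ.induction₂ (fun a b => (∀ᶠ w in 𝓝 (a : ℂ), w ∈ u.sub lam 0 → y w = yi w) ↔
    ∀ᶠ w in 𝓝 (b : ℂ), w ∈ u.sub lam 0 → y w = yi w) (fun a ha => ?_) (fun _ _ _ _ _ _ => Iff.trans)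
    (fun _ _ _ _ => Iff.symm) hq0 hx).1 hPq
  obtain ⟨r, hr, S, hS, hS', hmem, hball, -⟩ := hc.exists_sector_axis hKS hneg hreal ha
    (inter_mem (hdom a) (eventually_not_isPole (not_isPole_ofReal (u := u) a)))
  have hloc : ∀ b b' : ℝ, lam + u.onReal b ≤ 0 → (b : ℂ) ∈ Metric.ball (a : ℂ) r →
      (b' : ℂ) ∈ Metric.ball (a : ℂ) r → (∀ᶠ w in 𝓝 (b : ℂ), w ∈ u.sub lam 0 → y w = yi w) →
      ∀ᶠ w in 𝓝 (b' : ℂ), w ∈ u.sub lam 0 → y w = yi w := by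
    intro b b' hb hba hba' hPb
    -- Only needed to find points of `{R < 0}` arbitrarily close to `b`, where the match at `b`
    -- gives a nonvacuous equality inside the sector of `a`.
    obtain ⟨-, -, T, hT, -, hTmem, -, hTcl⟩ := hc.exists_sector_axis hKS hneg hreal hb univ_mem
    obtain ⟨v, ⟨hv1, hv2⟩, hvT⟩ := mem_closure_iff_nhds.1 hTcl _
      (inter_mem (Metric.isOpen_ball.mem_nhds hba) (eventually_eventually_nhds.2 hPb))
    have hvs := (hTmem hvT).1
    have hvS := hball v hv1 hvs
    filter_upwards [Metric.isOpen_ball.mem_nhds hba'] with w h3 h4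
    refine (eventuallyEq_of_isPreconnected hc h.test hS' (fun w hw => hy w (hmem hw).1)
      (fun w hw => h.recessive.solAt w (hmem hw).2.1) hvS ?_ (hball w h3 h4)
      (hmem (hball w h3 h4)).2.2).self_of_nhds
    filter_upwards [hv2, (hc.isOpen_sub lam 0).mem_nhds hvs] with x h5 h6
    exact h5 h6
  have hcont : Tendsto (fun b : ℝ => (b : ℂ)) (𝓝[{x : ℝ | lam + u.onReal x ≤ 0}] a) (𝓝 (a : ℂ)) :=
    (Complex.continuous_ofReal.tendsto a).mono_left nhdsWithin_le_nhds
  filter_upwards [self_mem_nhdsWithin, hcont.eventually (Metric.ball_mem_nhds _ hr)] with b hb hba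
  exact ⟨hloc a b ha (Metric.mem_ball_self hr) hba, hloc b a hb hba (Metric.mem_ball_self hr)⟩

/-- The sublevel set is the union of the lower ones, and uniqueness makes the solutions there
coherent. Only at `c = 0` does the condition at the axis not follow from lower levels. -/
theorem Setting.exists_isSol_of_lt (h : u.Setting lam ε ρ g yi) (hKS : u.IsKlausShaw)
    (hneg : ∀ x, u.onReal x < 0)
    (hreal : ∀ x : ℝ, u.IsCritical lam (x : ℂ) → deriv u.toFun (x : ℂ) = 0 →
      iteratedDeriv 2 u.toFun (x : ℂ) ≠ 0)
    (hleft : ∀ q : ℝ, u.IsLeftCritical lam q → u.RealCond lam ε ρ g q)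
    (hT : ∀ c' < c, ∃ y, u.IsSol lam ε g yi c' y) : ∃ y, u.IsSol lam ε g yi c y := by
  classical
  have hc := h.posImag
  choose! Y hY using hT
  have hex : ∀ w ∈ u.sub lam c, ∃ c' < c, w ∈ u.sub lam c' := by
    intro w hw
    rcases hw.2 with h1 | h1
    · exact ⟨c - 1, by linarith, hw.1, Or.inl h1⟩
    · obtain ⟨c', h2, h3⟩ := exists_between h1
      exact ⟨c', h3, hw.1, Or.inr h2⟩
  set y : ℂ → ℂ := fun w => if hw : w ∈ u.sub lam c then Y (hex w hw).choose w else 0 with hy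
  have huniq : ∀ c' c'', c' ≤ c'' → c'' < c → ∀ w ∈ u.sub lam c', Y c' w = Y c'' w :=
    fun c' c'' h1 h2 => IsSol.unique hc h.test h.lam_pos h.eps_pos h.far h.left h.recessive
      (hY c' (h1.trans_lt h2)) ((hY c'' h2).mono h1)
  have hyY : ∀ c' < c, ∀ w ∈ u.sub lam c', y w = Y c' w := by
    intro c' hc' w hw
    have hwc := sub_mono hc'.le hw
    obtain ⟨h1, h2⟩ := (hex w hwc).choose_spec
    simp only [hy, dif_pos hwc]
    rcases le_total (hex w hwc).choose c' with h3 | h3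
    · exact huniq _ _ h3 hc' w h2
    · exact (huniq _ _ h3 h1 w hw).symm
  have hsol : ∀ w ∈ u.sub lam c, u.SolAt lam ε g y w := by
    intro w hw
    obtain ⟨c', hc', hwc'⟩ := hex w hw
    refine ((hY c' hc').solAt w hwc').congr ?_
    filter_upwards [(hc.isOpen_sub lam c').mem_nhds hwc'] with v hv
    exact (hyY c' hc' v hv).symm
  refine ⟨y, hsol, fun x => ?_⟩
  rcases lt_trichotomy c 0 with h0 | rfl | h0
  · exact (hc.eventually_not_mem_sub h0 x).mono fun w h1 h2 => absurd h2 h1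
  · exact h.eq_real_of_zero hKS hneg hreal hleft hsol x
  · have hlt : c / 2 < c := by linarith
    filter_upwards [(hY _ hlt).real x, (hc.continuousAt_R lam
      (not_isPole_ofReal (u := u) x)).eventually_lt_const (u := c / 2)
      (by rw [hc.R_ofReal]; linarith)] with w h1 h2 h3
    have h4 : w ∈ u.sub lam (c / 2) := ⟨h3.1, Or.inr h2⟩
    rw [hyY _ hlt w h4, h1 h4]

/-- The conditions at the critical points imply that there is a solution in every sublevel set. -/
theorem Setting.exists_isSol (h : u.Setting lam ε ρ g yi) (hKS : u.IsKlausShaw)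
    (hneg : ∀ x, u.onReal x < 0)
    (hreal : ∀ x : ℝ, u.IsCritical lam (x : ℂ) → deriv u.toFun (x : ℂ) = 0 →
      iteratedDeriv 2 u.toFun (x : ℂ) ≠ 0)
    (hup : ∀ q : ℂ, 0 < q.im → u.IsCritical lam q → u.UpperCond lam ε ρ g q)
    (hleft : ∀ q : ℝ, u.IsLeftCritical lam q → u.RealCond lam ε ρ g q) (c : ℝ) :
    ∃ y, u.IsSol lam ε g yi c y := by
  set T : Set ℝ := {c | ∃ y, u.IsSol lam ε g yi c y} with hT
  have hmono : ∀ c ∈ T, ∀ c' ≤ c, c' ∈ T := fun c ⟨y, hy⟩ c' h1 => ⟨y, hy.mono h1⟩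
  obtain ⟨c₀, y₀, hy₀⟩ := h.exists_isSol_bot
  by_contra hcT
  have hb : BddAbove T := ⟨c, fun t ht => by
    by_contra! h1
    exact hcT (hmono t ht c h1.le)⟩
  -- A finite supremum of the attainable levels would be attained, and could then be exceeded.
  have hs : sSup T ∈ T := h.exists_isSol_of_lt hKS hneg hreal hleft fun c' hc' => by
    obtain ⟨t, ht, hlt⟩ := exists_lt_of_lt_csSup (s := T) ⟨c₀, y₀, hy₀⟩ hc'
    exact hmono t ht c' hlt.le
  obtain ⟨y, hy⟩ := hs
  obtain ⟨δ, hδ, hδT : sSup T + δ ∈ T⟩ := h.exists_isSol_add hup hy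
  linarith [le_csSup hb hδT]

end BenjaminOno.RationalPotential

namespace BenjaminOno.RationalPotential

variable {P : ℕ} {u : RationalPotential P} {lam ε ρ c : ℝ} {g yi y : ℂ → ℂ}

/-! ### The principal branch of `e^{-if/ε}` and the branch that is analytic above the poles -/

variable (u) in
/-- The principal branch of `e^{-if/ε}`. -/
noncomputable def princ (ε : ℝ) (w : ℂ) : ℂ := Complex.exp (-Complex.I * u.f w / ε)

variable (u) in
/-- The branch of `f` whose cuts are directed downwards, equal to `f` to the left of the poles. -/
noncomputable def fTop (w : ℂ) : ℂ :=
  ∑ p, (u.c p * (Complex.log (-Complex.I * (w - u.z p)) - Real.pi * Complex.I / 2) +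
    conj (u.c p) * (Complex.log (-Complex.I * (w - conj (u.z p))) - Real.pi * Complex.I / 2))

variable (u) in
/-- The corresponding branch of `e^{-if/ε}`. -/
noncomputable def top (ε : ℝ) (w : ℂ) : ℂ := Complex.exp (-Complex.I * u.fTop w / ε)

variable (u) in
/-- The quotient of the two branches at abscissa `x`. -/
noncomputable def mon (ε x : ℝ) : ℂ := Complex.exp (-Complex.I *
  (∑ p, if (u.z p).re < x then u.c p * (2 * Real.pi * Complex.I) else 0) / ε)

-- The plane cut vertically upwards from each `zₚ` and downwards from its conjugate, where `f` is
-- analytic.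
variable (u) in
def cut : Set ℂ := {w | ∀ p, w.re ≠ (u.z p).re ∨ |w.im| < (u.z p).im}

-- The plane cut vertically downwards from each `zₚ`, a cut that also contains the conjugate pole;
-- it includes everything above the poles.
variable (u) in
def cutTop : Set ℂ := {w | ∀ p, w.re ≠ (u.z p).re ∨ (u.z p).im < w.im}

lemma not_isPole_of_mem_cut {w : ℂ} (hw : w ∈ u.cut) : ¬ u.IsPole w := by
  rintro ⟨p, rfl | rfl⟩ <;> rcases hw p with h | h <;>
    simp [abs_of_pos (u.z_im_pos p)] at h

lemma not_isPole_of_mem_cutTop {w : ℂ} (hw : w ∈ u.cutTop) : ¬ u.IsPole w := by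
  rintro ⟨p, rfl | rfl⟩ <;> rcases hw p with h | h <;> simp at h
  linarith [u.z_im_pos p]

lemma hasDerivAt_log_mul {a z w : ℂ} (ha : a ≠ 0) (h : a * (w - z) ∈ Complex.slitPlane) :
    HasDerivAt (fun w => Complex.log (a * (w - z))) (1 / (w - z)) w := by
  have hne := Complex.slitPlane_ne_zero h
  have h1 : HasDerivAt (fun w => a * (w - z)) (a * 1) w := ((hasDerivAt_id w).sub_const z).const_mul a
  convert! h1.clog h using 1
  have := right_ne_zero_of_mul hne
  field_simp

lemma hasDerivAt_f {w : ℂ} (hw : w ∈ u.cut) : HasDerivAt u.f (u.toFun w) w := by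
  unfold f toFun
  refine HasDerivAt.fun_sum fun p _ => ?_
  have h1 : Complex.I * (w - u.z p) ∈ Complex.slitPlane := by
    rw [Complex.mem_slitPlane_iff]
    rcases hw p with h | h
    · right; simpa [sub_eq_zero] using h
    · left; simpa using (abs_lt.1 h).2
  have h2 : -Complex.I * (w - conj (u.z p)) ∈ Complex.slitPlane := by
    rw [Complex.mem_slitPlane_iff]
    rcases hw p with h | h
    · right; intro h0; apply h; simp at h0; linarith
    · left; simp; linarith [(abs_lt.1 h).1]
  convert! (((hasDerivAt_log_mul Complex.I_ne_zero h1).add_const _).const_mul (u.c p)).add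
    (((hasDerivAt_log_mul (neg_ne_zero.2 Complex.I_ne_zero) h2).sub_const _).const_mul
      (conj (u.c p))) using 1
  ring

lemma hasDerivAt_fTop {w : ℂ} (hw : w ∈ u.cutTop) : HasDerivAt u.fTop (u.toFun w) w := by
  unfold fTop toFun
  refine HasDerivAt.fun_sum fun p _ => ?_
  have h1 : -Complex.I * (w - u.z p) ∈ Complex.slitPlane := by
    rw [Complex.mem_slitPlane_iff]
    rcases hw p with h | h
    · right; intro h0; apply h; simp at h0; linarith
    · left; simpa using h
  have h2 : -Complex.I * (w - conj (u.z p)) ∈ Complex.slitPlane := by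
    rw [Complex.mem_slitPlane_iff]
    rcases hw p with h | h
    · right; intro h0; apply h; simp at h0; linarith
    · left; simp; linarith [u.z_im_pos p]
  convert! (((hasDerivAt_log_mul (neg_ne_zero.2 Complex.I_ne_zero) h1).sub_const _).const_mul
    (u.c p)).add (((hasDerivAt_log_mul (neg_ne_zero.2 Complex.I_ne_zero) h2).sub_const _).const_mul
      (conj (u.c p))) using 1
  ring

lemma log_I_mul_of_re_pos {ζ : ℂ} (h : 0 < ζ.re) :
    Complex.log (Complex.I * ζ) = Complex.log (-Complex.I * ζ) + Real.pi * Complex.I := by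
  have h1 : 0 < (Complex.I * ζ).im := by simpa
  have h2 := Complex.arg_neg_eq_arg_sub_pi_of_im_pos h1
  rw [neg_mul, Complex.log, Complex.log, h2, norm_neg]
  push_cast; ring

lemma log_I_mul_of_re_neg {ζ : ℂ} (h : ζ.re < 0) :
    Complex.log (Complex.I * ζ) = Complex.log (-Complex.I * ζ) - Real.pi * Complex.I := by
  have h1 : (Complex.I * ζ).im < 0 := by simpa
  have h2 := Complex.arg_neg_eq_arg_add_pi_of_im_neg h1
  rw [neg_mul, Complex.log, Complex.log, h2, norm_neg]
  push_cast; ring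

/-- To the left of `zₚ` the normalised logarithms of both branches agree, to the right they differ
by `2πi`. So the quotient depends on the abscissa alone. -/
lemma princ_eq {w : ℂ} (hw : ∀ p, w.re ≠ (u.z p).re) (ε : ℝ) :
    u.princ ε w = u.mon ε w.re * u.top ε w := by
  rw [princ, mon, top, ← Complex.exp_add]
  congr 1
  have : u.f w = (∑ p, if (u.z p).re < w.re then u.c p * (2 * Real.pi * Complex.I) else 0) +
      u.fTop w := by
    rw [f, fTop, ← Finset.sum_add_distrib]
    refine Finset.sum_congr rfl fun p _ => ?_
    split_ifs with h
    · rw [log_I_mul_of_re_pos (ζ := w - u.z p) (by simpa using h)]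
      ring
    · rw [log_I_mul_of_re_neg (ζ := w - u.z p)
        (by simpa using lt_of_le_of_ne (not_lt.1 h) (hw p))]
      ring
  rw [this]; ring

lemma mon_ne_zero (ε x : ℝ) : u.mon ε x ≠ 0 := Complex.exp_ne_zero _

lemma norm_princ (ε : ℝ) (w : ℂ) : ‖u.princ ε w‖ = Real.exp (u.R 0 w / ε) := by
  rw [princ, Complex.norm_exp, R, h]
  congr 1
  rw [Complex.div_ofReal_re]
  simp

lemma IsPosImag.norm_top (hc : u.IsPosImag) (ε : ℝ) (w : ℂ) :
    ‖u.top ε w‖ = Real.exp (u.R 0 w / ε) := by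
  rw [top, Complex.norm_exp, Complex.div_ofReal_re, hc.R_eq]
  congr 2
  have h1 : -Complex.I * u.fTop w =
      ∑ p, ((u.gam p : ℂ) * (Complex.log (-Complex.I * (w - u.z p)) - Real.pi * Complex.I / 2) -
        u.gam p * (Complex.log (-Complex.I * (w - conj (u.z p))) - Real.pi * Complex.I / 2)) := by
    simp only [fTop, Finset.mul_sum]
    refine Finset.sum_congr rfl fun p _ => ?_
    rw [hc.conj_c_eq, hc.c_eq]
    ring_nf
    simp only [Complex.I_sq]
    ring
  rw [h1, Complex.re_sum, zero_mul, zero_add]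
  refine Finset.sum_congr rfl fun p _ => ?_
  simp only [Complex.sub_re, Complex.re_ofReal_mul, Complex.log_re, norm_mul,
    norm_neg, Complex.norm_I, one_mul]
  simp
  ring

variable (u) in
/-- The principal branch of `e^{-ih/ε}`. -/
noncomputable def expP (ε : ℝ) (μ : ℂ) (w : ℂ) : ℂ := Complex.exp (-Complex.I * μ * w / ε) * u.princ ε w

variable (u) in
/-- The branch of `e^{-ih/ε}` that is analytic above the poles. -/
noncomputable def expT (ε : ℝ) (μ : ℂ) (w : ℂ) : ℂ := Complex.exp (-Complex.I * μ * w / ε) * u.top ε w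

lemma exp_h_eq (ε : ℝ) (μ : ℝ) (w : ℂ) :
    Complex.exp (-Complex.I * u.h μ w / ε) = u.expP ε μ w := by
  rw [expP, princ, ← Complex.exp_add, h]
  congr 1; ring

lemma expP_eq {w : ℂ} (hw : ∀ p, w.re ≠ (u.z p).re) (ε : ℝ) (μ : ℂ) :
    u.expP ε μ w = u.mon ε w.re * u.expT ε μ w := by
  rw [expP, expT, princ_eq hw]; ring

lemma norm_exp_mul (ε : ℝ) (μ : ℝ) (w : ℂ) :
    ‖Complex.exp (-Complex.I * μ * w / ε)‖ = Real.exp (μ * w.im / ε) := by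
  rw [Complex.norm_exp, Complex.div_ofReal_re]
  simp

lemma IsPosImag.R_eq_add (hc : u.IsPosImag) (lam : ℝ) (w : ℂ) :
    u.R lam w = lam * w.im + u.R 0 w := by
  rw [hc.R_eq, hc.R_eq 0]; ring

lemma IsPosImag.norm_expP (hc : u.IsPosImag) (ε : ℝ) (μ : ℝ) (w : ℂ) :
    ‖u.expP ε μ w‖ = Real.exp (u.R μ w / ε) := by
  rw [expP, norm_mul, norm_exp_mul, norm_princ, ← Real.exp_add, hc.R_eq_add μ, add_div]

lemma IsPosImag.norm_expT (hc : u.IsPosImag) (ε : ℝ) (μ : ℝ) (w : ℂ) :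
    ‖u.expT ε μ w‖ = Real.exp (u.R μ w / ε) := by
  rw [expT, norm_mul, norm_exp_mul, hc.norm_top, ← Real.exp_add, hc.R_eq_add μ, add_div]

lemma hasDerivAt_exp_mul (ε : ℝ) (μ w : ℂ) :
    HasDerivAt (fun w => Complex.exp (-Complex.I * μ * w / ε))
      (Complex.exp (-Complex.I * μ * w / ε) * (-Complex.I * μ / ε)) w := by
  have : HasDerivAt (fun w : ℂ => -Complex.I * μ * w / ε) (-Complex.I * μ * 1 / ε) w :=
    ((hasDerivAt_id w).const_mul _).div_const _
  simpa using this.cexp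

lemma hasDerivAt_expP {w : ℂ} (hw : w ∈ u.cut) (ε : ℝ) (μ : ℂ) :
    HasDerivAt (u.expP ε μ) (u.expP ε μ w * (-Complex.I * (μ + u.toFun w) / ε)) w := by
  convert! (hasDerivAt_exp_mul ε μ w).mul
    ((((hasDerivAt_f hw).const_mul (-Complex.I)).div_const (ε : ℂ)).cexp) using 1
  simp only [expP, princ]
  ring

lemma hasDerivAt_expT {w : ℂ} (hw : w ∈ u.cutTop) (ε : ℝ) (μ : ℂ) :
    HasDerivAt (u.expT ε μ) (u.expT ε μ w * (-Complex.I * (μ + u.toFun w) / ε)) w := by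
  convert! (hasDerivAt_exp_mul ε μ w).mul
    ((((hasDerivAt_fTop hw).const_mul (-Complex.I)).div_const (ε : ℂ)).cexp) using 1
  simp only [expT, top]
  ring

/-! ### The loops -/

/-- The integral over a horizontal segment at height `y`. -/
noncomputable def hInt (F : ℂ → ℂ) (y a b : ℝ) : ℂ := ∫ x in a..b, F (x + y * Complex.I)

/-- The integral over a vertical segment at abscissa `x`. -/
noncomputable def vInt (F : ℂ → ℂ) (x a b : ℝ) : ℂ := ∫ y in a..b, F (x + y * Complex.I) * Complex.I

/-- The integral over the vertical ray from `w` to `-i∞`. -/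
noncomputable def downInt (F : ℂ → ℂ) (w : ℂ) : ℂ :=
  ∫ t in Set.Ioi (0 : ℝ), F (w - t * Complex.I) * -Complex.I

variable (u) in
/-- A height above all poles. -/
noncomputable def height : ℝ := 1 + ∑ p, (u.z p).im

variable (u) in
/-- The top left corner of the loops. -/
noncomputable def corner : ℂ := u.leftAbscissa + u.height * Complex.I

open scoped Classical in
variable (u) in
/-- The integral over the `m`-th loop, of a function with principal branch `F` and upper branch `B`;
`D` is its integral from the corner to infinity. -/
noncomputable def loopInt (ε : ℝ) (m : Fin P) (F B : ℂ → ℂ) (D : ℂ) : ℂ :=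
  if u.IsExceptional ε m then
    vInt F u.leftAbscissa u.height 0 + hInt F 0 u.leftAbscissa (u.z m).re +
      vInt F (u.z m).re 0 (u.z m).im - D
  else
    vInt F u.leftAbscissa u.height 0 + hInt F 0 u.leftAbscissa (u.gapAbscissa m) +
      vInt F (u.gapAbscissa m) 0 u.height +
      u.mon ε (u.gapAbscissa m) * hInt B u.height (u.gapAbscissa m) u.leftAbscissa +
      -- The tail is traversed inwards on the principal branch and, after the turn around the poles,
      -- outwards on a multiple of it.
      (u.mon ε (u.gapAbscissa m) - 1) * D

variable (u) in
/-- The integral of `g e^{-ih/ε}` over the `m`-th loop, which begins and (unless it ends at `zₘ`)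
ends at `-i∞`. -/
noncomputable def loop (ε lam : ℝ) (m : Fin P) (g : ℂ → ℂ) : ℂ :=
  u.loopInt ε m (fun w => g w * u.expP ε lam w) (fun w => g w * u.expT ε lam w)
    (downInt (fun w => g w * u.expP ε lam w) u.corner)

lemma im_add_one_le_height (p : Fin P) : (u.z p).im + 1 ≤ u.height := by
  have := Finset.single_le_sum (f := fun p => (u.z p).im) (fun p _ => (u.z_im_pos p).le)
    (Finset.mem_univ p)
  rw [height]; linarith

lemma height_pos : 0 < u.height := by
  have := Finset.sum_nonneg (s := Finset.univ) fun p _ => (u.z_im_pos p).le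
  rw [height]; linarith

lemma re_lt_gapAbscissa (m : Fin P) : (u.z m).re < u.gapAbscissa m := by
  rw [gapAbscissa]
  split_ifs with h
  · have := u.z_re_strictMono (show m < ⟨m.val + 1, h⟩ from Nat.lt_succ_self m.val)
    simp only at this
    linarith
  · linarith

lemma gapAbscissa_lt_re {m p : Fin P} (h : m < p) : u.gapAbscissa m < (u.z p).re := by
  have hm : m.val + 1 < P := lt_of_le_of_lt (Nat.succ_le_of_lt h) p.isLt
  rw [gapAbscissa, dif_pos hm]
  have h1 := u.z_re_strictMono (show m < ⟨m.val + 1, hm⟩ from Nat.lt_succ_self m.val)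
  have h2 : (u.z ⟨m.val + 1, hm⟩).re ≤ (u.z p).re :=
    u.z_re_strictMono.monotone (Nat.succ_le_of_lt h)
  simp only at h1
  linarith

lemma gapAbscissa_ne_re (m p : Fin P) : u.gapAbscissa m ≠ (u.z p).re := by
  rcases lt_or_ge m p with h | h
  · exact (gapAbscissa_lt_re h).ne
  · have : (u.z p).re ≤ (u.z m).re := u.z_re_strictMono.monotone h
    exact (this.trans_lt (re_lt_gapAbscissa m)).ne'

lemma re_eq_iff {p q : Fin P} : (u.z p).re = (u.z q).re ↔ p = q := u.z_re_strictMono.injective.eq_iff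

lemma mem_cut_of_re {x : ℝ} (hx : ∀ p, x ≠ (u.z p).re) (y : ℝ) : (x : ℂ) + y * Complex.I ∈ u.cut :=
  fun p => Or.inl (by simpa using hx p)

lemma mem_cut_zero (x : ℝ) : (x : ℂ) + (0 : ℝ) * Complex.I ∈ u.cut :=
  fun p => Or.inr (by simpa using u.z_im_pos p)

lemma mem_cut_well (m : Fin P) {y : ℝ} (hy : |y| < (u.z m).im) :
    ((u.z m).re : ℂ) + y * Complex.I ∈ u.cut := fun p => by
  by_cases h : m = p
  · subst h; exact Or.inr (by simpa using hy)
  · exact Or.inl (by simpa [re_eq_iff] using h)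

lemma mem_cutTop_height (x : ℝ) : (x : ℂ) + u.height * Complex.I ∈ u.cutTop :=
  fun p => Or.inr (by simpa using (lt_add_one _).trans_le (im_add_one_le_height p))

end BenjaminOno.RationalPotential

namespace BenjaminOno.RationalPotential

variable {P : ℕ} {u : RationalPotential P} {lam ε ρ c : ℝ} {g yi y : ℂ → ℂ}

/-! ### Loop integrals vanish when there is a solution -/

lemma hInt_eq_sub {F Q : ℂ → ℂ} {y a b : ℝ}
    (hF : ∀ x ∈ Set.uIcc a b, ContinuousAt F (x + y * Complex.I))
    (hQ : ∀ x ∈ Set.uIcc a b, HasDerivAt Q (F (x + y * Complex.I)) (x + y * Complex.I)) :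
    hInt F y a b = Q (b + y * Complex.I) - Q (a + y * Complex.I) := by
  have hd : ∀ x : ℝ, HasDerivAt (fun x : ℝ => (x : ℂ) + y * Complex.I) 1 x := fun x =>
    (Complex.ofRealCLM.hasDerivAt (x := x)).add_const _
  refine intervalIntegral.integral_eq_sub_of_hasDerivAt
    (f := fun x : ℝ => Q ((x : ℂ) + y * Complex.I)) (fun x hx => ?_) ?_
  · convert! (hQ x hx).comp x (hd x) using 1
    rw [mul_one]
  · refine ContinuousOn.intervalIntegrable fun x hx => ContinuousAt.continuousWithinAt ?_
    exact ContinuousAt.comp (f := fun x : ℝ => (x : ℂ) + y * Complex.I) (hF x hx)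
      (hd x).continuousAt

lemma hasDerivAt_vertical (x y : ℝ) :
    HasDerivAt (fun y : ℝ => (x : ℂ) + y * Complex.I) Complex.I y := by
  simpa using ((Complex.ofRealCLM.hasDerivAt (x := y)).mul_const Complex.I).const_add (x : ℂ)

lemma intervalIntegrable_vertical {F : ℂ → ℂ} {x a b : ℝ}
    (hF : ∀ y ∈ Set.uIcc a b, ContinuousAt F (x + y * Complex.I)) :
    IntervalIntegrable (fun y : ℝ => F (x + y * Complex.I) * Complex.I) volume a b :=
  ContinuousOn.intervalIntegrable fun y hy => ContinuousAt.continuousWithinAt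
    ((ContinuousAt.comp (f := fun y : ℝ => (x : ℂ) + y * Complex.I) (hF y hy)
      (hasDerivAt_vertical x y).continuousAt).mul continuousAt_const)

lemma intervalIntegrable_horizontal {F : ℂ → ℂ} {y a b : ℝ}
    (hF : ∀ x ∈ Set.uIcc a b, ContinuousAt F (x + y * Complex.I)) :
    IntervalIntegrable (fun x : ℝ => F (x + y * Complex.I)) volume a b :=
  ContinuousOn.intervalIntegrable fun x hx => ContinuousAt.continuousWithinAt
    (ContinuousAt.comp (f := fun x : ℝ => (x : ℂ) + y * Complex.I) (hF x hx) (by fun_prop))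

lemma vInt_eq_sub {F Q : ℂ → ℂ} {x a b : ℝ}
    (hF : ∀ y ∈ Set.uIcc a b, ContinuousAt F (x + y * Complex.I))
    (hQ : ∀ y ∈ Set.uIcc a b, HasDerivAt Q (F (x + y * Complex.I)) (x + y * Complex.I)) :
    vInt F x a b = Q (x + b * Complex.I) - Q (x + a * Complex.I) := by
  refine intervalIntegral.integral_eq_sub_of_hasDerivAt
    (f := fun y : ℝ => Q ((x : ℂ) + y * Complex.I)) (fun y hy => ?_) (intervalIntegrable_vertical hF)
  exact (hQ y hy).comp y (hasDerivAt_vertical x y)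

lemma IsTest.continuousAt (hg : u.IsTest g) {w : ℂ} (hw : ¬ u.IsPole w) : ContinuousAt g w :=
  (hg.analyticAt (ne_z_of_not_isPole hw)).continuousAt

lemma IsTest.continuousAt_mul_expP (hg : u.IsTest g) {w : ℂ} (hw : w ∈ u.cut) (ε : ℝ) (μ : ℂ) :
    ContinuousAt (fun w => g w * u.expP ε μ w) w :=
  (hg.continuousAt (not_isPole_of_mem_cut hw)).mul (hasDerivAt_expP hw ε μ).continuousAt

lemma IsTest.continuousAt_mul_expT (hg : u.IsTest g) {w : ℂ} (hw : w ∈ u.cutTop) (ε : ℝ) (μ : ℂ) :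
    ContinuousAt (fun w => g w * u.expT ε μ w) w :=
  (hg.continuousAt (not_isPole_of_mem_cutTop hw)).mul (hasDerivAt_expT hw ε μ).continuousAt

lemma SolAt.hasDerivAt_mul_expP {Y : ℂ → ℂ} {w : ℂ} (h : u.SolAt lam ε g Y w) (hw : w ∈ u.cut) :
    HasDerivAt (fun w => Y w * u.expP ε lam w) (g w * u.expP ε lam w) w := by
  convert! (h.hasDerivAt (not_isPole_of_mem_cut hw)).mul (hasDerivAt_expP hw ε lam) using 1
  ring

lemma SolAt.hasDerivAt_mul_expT {Y : ℂ → ℂ} {w : ℂ} (h : u.SolAt lam ε g Y w) (hw : w ∈ u.cutTop) :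
    HasDerivAt (fun w => Y w * u.expT ε lam w) (g w * u.expT ε lam w) w := by
  convert! (h.hasDerivAt (not_isPole_of_mem_cutTop hw)).mul (hasDerivAt_expT hw ε lam) using 1
  ring

lemma leftAbscissa_ne_re (p : Fin P) : u.leftAbscissa ≠ (u.z p).re := (leftAbscissa_lt p).ne

lemma corner_sub (t : ℝ) :
    u.corner - t * Complex.I = u.leftAbscissa + (u.height - t : ℝ) * Complex.I := by
  rw [corner]; push_cast; ring

lemma IsPosImag.norm_expP_corner_le (hc : u.IsPosImag) (hε : 0 < ε) (lam t : ℝ) :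
    ‖u.expP ε lam (u.corner - t * Complex.I)‖ ≤
      Real.exp ((lam * u.height + u.leftBound) / ε) * Real.exp (-(lam / ε) * t) := by
  rw [hc.norm_expP, ← Real.exp_add, Real.exp_le_exp, corner_sub]
  have := hc.R_le_left lam (w := u.leftAbscissa + (u.height - t : ℝ) * Complex.I) (by simp)
    (not_isPole_of_mem_cut (mem_cut_of_re leftAbscissa_ne_re _))
  have h2 : ((u.leftAbscissa : ℂ) + (u.height - t : ℝ) * Complex.I).im = u.height - t := by simp
  rw [h2] at this
  rw [div_add' _ _ _ hε.ne', div_le_div_iff_of_pos_right hε]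
  refine this.trans (le_of_eq ?_)
  field_simp
  ring

lemma hasDerivAt_corner (t : ℝ) :
    HasDerivAt (fun t : ℝ => u.corner - t * Complex.I) (-Complex.I) t := by
  simpa using ((Complex.ofRealCLM.hasDerivAt (x := t)).mul_const Complex.I).const_sub u.corner

lemma corner_sub_mem_cut (t : ℝ) : u.corner - t * Complex.I ∈ u.cut := by
  rw [corner_sub]; exact mem_cut_of_re leftAbscissa_ne_re _

lemma integrableOn_Ioi_of_norm_le_exp {f : ℝ → ℂ} {C b a : ℝ} (hb : 0 < b)
    (hf : ContinuousOn f (Set.Ici a)) (ho : ∀ᶠ t in atTop, ‖f t‖ ≤ C * Real.exp (-b * t)) :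
    IntegrableOn f (Set.Ioi a) := by
  rw [← integrableOn_Ici_iff_integrableOn_Ioi (by finiteness)]
  refine (hf.locallyIntegrableOn measurableSet_Ici).integrableOn_of_isBigO_atTop
    (g := fun t => Real.exp (-b * t)) (Asymptotics.IsBigO.of_bound C ?_)
    ⟨Set.Ioi 0, Ioi_mem_atTop 0, exp_neg_integrableOn_Ioi 0 hb⟩
  filter_upwards [ho] with t ht
  rwa [Real.norm_eq_abs, Real.abs_exp]

lemma IsTest.integrableOn_down (hc : u.IsPosImag) (hg : u.IsTest g) (hlam : 0 < lam) (hε : 0 < ε) :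
    IntegrableOn (fun t : ℝ => g (u.corner - t * Complex.I) * u.expP ε lam (u.corner - t * Complex.I)
      * -Complex.I) (Set.Ioi 0) := by
  have hcont : Continuous fun t : ℝ => g (u.corner - t * Complex.I) *
      u.expP ε lam (u.corner - t * Complex.I) * -Complex.I :=
    continuous_iff_continuousAt.2 fun t =>
    (ContinuousAt.comp (f := fun t : ℝ => u.corner - t * Complex.I)
      (hg.continuousAt_mul_expP (corner_sub_mem_cut t) ε lam)
      (hasDerivAt_corner t).continuousAt).mul continuousAt_const
  obtain ⟨C, hC⟩ := hg.left
  refine integrableOn_Ioi_of_norm_le_exp (b := lam / ε)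
    (C := |C| * Real.exp ((lam * u.height + u.leftBound) / ε)) (by positivity) hcont.continuousOn ?_
  filter_upwards [eventually_ge_atTop u.height] with t ht
  rw [norm_mul, norm_mul, norm_neg, Complex.norm_I, mul_one, mul_assoc]
  refine mul_le_mul ((hC _ ?_ ?_).trans (le_abs_self C)) (hc.norm_expP_corner_le hε lam t)
    (norm_nonneg _) (abs_nonneg C)
  · rw [corner_sub]; simpa using ht
  · rw [corner_sub]; simp

lemma downInt_eq (hc : u.IsPosImag) (hlam : 0 < lam) (hε : 0 < ε) (hg : u.IsTest g) {Y : ℂ → ℂ}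
    (hY : ∀ t : ℝ, 0 ≤ t → u.SolAt lam ε g Y (u.corner - t * Complex.I))
    (ht : Tendsto (fun t : ℝ => Y (u.corner - t * Complex.I) *
      u.expP ε lam (u.corner - t * Complex.I)) atTop (𝓝 0)) :
    downInt (fun w => g w * u.expP ε lam w) u.corner = -(Y u.corner * u.expP ε lam u.corner) := by
  have hd : ∀ t : ℝ, 0 ≤ t → HasDerivAt (fun t : ℝ => Y (u.corner - t * Complex.I) *
      u.expP ε lam (u.corner - t * Complex.I)) (g (u.corner - t * Complex.I) *
      u.expP ε lam (u.corner - t * Complex.I) * -Complex.I) t := fun t h0 =>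
    HasDerivAt.comp (h₂ := fun w => Y w * u.expP ε lam w) t
      ((hY t h0).hasDerivAt_mul_expP (corner_sub_mem_cut t)) (hasDerivAt_corner t)
  have := integral_Ioi_of_hasDerivAt_of_tendsto (hd 0 le_rfl).continuousAt.continuousWithinAt
    (fun t h0 => hd t (Set.mem_Ioi.1 h0).le) (hg.integrableOn_down hc hlam hε) ht
  simpa [downInt] using this

/-- In the exceptional case `γₘ/ε` is a positive integer, so `e^{R/ε}` vanishes at least linearly at
`zₘ`. This compensates a simple pole of `g` there. -/
lemma IsPosImag.norm_exp_well (hc : u.IsPosImag) (hε : 0 < ε) {m : Fin P}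
    (hm : u.IsExceptional ε m) (lam : ℝ) :
    ∃ C, ∀ᶠ w in 𝓝[≠] (u.z m), ‖u.expP ε lam w‖ ≤ C * ‖w - u.z m‖ := by
  obtain ⟨n, hn, he⟩ := hm
  have hgam : 1 ≤ u.gam m / ε := by
    have h1 : Complex.I * u.c m / ε = ((-(u.gam m / ε) : ℝ) : ℂ) := by
      rw [hc.c_eq, ← mul_assoc, Complex.I_mul_I]; push_cast; ring
    rw [h1] at he
    have h2 : -(u.gam m / ε) = -(n : ℝ) := by exact_mod_cast he
    rw [neg_inj.1 h2]
    exact_mod_cast hn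
  obtain ⟨C, hC⟩ := hc.R_sub_log_near lam m
  have hball : ∀ᶠ w in 𝓝 (u.z m), ‖w - u.z m‖ < 1 := by
    filter_upwards [Metric.ball_mem_nhds (u.z m) one_pos] with w hw
    exact mem_ball_iff_norm.1 hw
  refine ⟨Real.exp (C / ε), ?_⟩
  filter_upwards [mem_nhdsWithin_of_mem_nhds hC, mem_nhdsWithin_of_mem_nhds hball,
    self_mem_nhdsWithin] with w h1 h2 h3
  have h0 : 0 < ‖w - u.z m‖ := norm_pos_iff.2 (sub_ne_zero.2 h3)
  have h7 : Real.exp (C / ε) * ‖w - u.z m‖ = Real.exp (C / ε + Real.log ‖w - u.z m‖) := by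
    rw [Real.exp_add, Real.exp_log h0]
  rw [hc.norm_expP, h7, Real.exp_le_exp]
  have h4 : Real.log ‖w - u.z m‖ ≤ 0 := Real.log_nonpos h0.le h2.le
  have h5 : u.R lam w / ε ≤ (u.gam m * Real.log ‖w - u.z m‖ + C) / ε :=
    div_le_div_of_nonneg_right h1 hε.le
  have h6 : (u.gam m * Real.log ‖w - u.z m‖ + C) / ε =
      u.gam m / ε * Real.log ‖w - u.z m‖ + C / ε := by ring
  nlinarith

lemma tendsto_well_below (m : Fin P) :
    Tendsto (fun y : ℝ => ((u.z m).re : ℂ) + y * Complex.I) (𝓝[<] (u.z m).im) (𝓝[≠] (u.z m)) := by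
  refine tendsto_nhdsWithin_iff.2 ⟨?_, ?_⟩
  · have := (hasDerivAt_vertical (u.z m).re (u.z m).im).continuousAt.tendsto
    rw [Complex.re_add_im] at this
    exact this.mono_left nhdsWithin_le_nhds
  · filter_upwards [self_mem_nhdsWithin] with y (hy : y < _) h
    have := congrArg Complex.im h
    simp at this
    exact hy.ne this

lemma IsTest.intervalIntegrable_well (hc : u.IsPosImag) (hε : 0 < ε) (hg : u.IsTest g) {m : Fin P}
    (hm : u.IsExceptional ε m) (lam : ℝ) :
    IntervalIntegrable (fun y : ℝ => g ((u.z m).re + y * Complex.I) *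
      u.expP ε lam ((u.z m).re + y * Complex.I) * Complex.I) volume 0 (u.z m).im := by
  obtain ⟨C₁, hC₁⟩ := hg.well m
  obtain ⟨C₂, hC₂⟩ := hc.norm_exp_well hε hm lam
  have hb := u.z_im_pos m
  obtain ⟨a, ⟨ha0, ha⟩, hbd⟩ : ∃ a, (0 ≤ a ∧ a < (u.z m).im) ∧ ∀ y ∈ Set.Ioo a (u.z m).im,
      ‖g ((u.z m).re + y * Complex.I) * u.expP ε lam ((u.z m).re + y * Complex.I) * Complex.I‖ ≤
        C₁ * C₂ := by
    have hev : ∀ᶠ y : ℝ in 𝓝[<] (u.z m).im, ‖g ((u.z m).re + y * Complex.I) *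
        u.expP ε lam ((u.z m).re + y * Complex.I) * Complex.I‖ ≤ C₁ * C₂ := by
      filter_upwards [(tendsto_well_below m).eventually hC₁, (tendsto_well_below m).eventually hC₂,
        (tendsto_well_below m).eventually self_mem_nhdsWithin] with y h1 h2 h3
      set w := ((u.z m).re : ℂ) + y * Complex.I
      have h0 : 0 < ‖w - u.z m‖ := norm_pos_iff.2 (sub_ne_zero.2 h3)
      have h4 : 0 ≤ C₂ := nonneg_of_mul_nonneg_left ((norm_nonneg _).trans h2) h0
      rw [norm_mul, Complex.norm_I, mul_one, norm_mul]
      calc ‖g w‖ * ‖u.expP ε lam w‖ ≤ ‖g w‖ * (C₂ * ‖w - u.z m‖) := by gcongr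
        _ = ‖w - u.z m‖ * ‖g w‖ * C₂ := by ring
        _ ≤ C₁ * C₂ := by gcongr
    obtain ⟨l, hl, hlt⟩ := (mem_nhdsLT_iff_exists_Ioo_subset' hb).1 hev
    exact ⟨max l 0, ⟨le_max_right _ _, max_lt (Set.mem_Iio.1 hl) hb⟩, fun y hy =>
      hlt ⟨(le_max_left _ _).trans_lt hy.1, hy.2⟩⟩
  have hcont : ∀ y ∈ Set.Ico 0 (u.z m).im, ContinuousAt
      (fun w => g w * u.expP ε lam w) ((u.z m).re + y * Complex.I) := fun y hy =>
    hg.continuousAt_mul_expP (mem_cut_well m (by rw [abs_of_nonneg hy.1]; exact hy.2)) ε lam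
  refine (intervalIntegrable_vertical (F := fun w => g w * u.expP ε lam w) (a := 0) (b := a)
    fun y hy => hcont y ?_).trans ?_
  · rw [Set.uIcc_of_le ha0] at hy
    exact ⟨hy.1, hy.2.trans_lt ha⟩
  · rw [intervalIntegrable_iff_integrableOn_Ioo_of_le ha.le]
    refine Integrable.of_bound (C := C₁ * C₂) ?_
      ((ae_restrict_iff' measurableSet_Ioo).2 (ae_of_all _ hbd))
    refine ContinuousOn.aestronglyMeasurable (fun y hy => ContinuousAt.continuousWithinAt ?_)
      measurableSet_Ioo
    exact (ContinuousAt.comp (f := fun y : ℝ => ((u.z m).re : ℂ) + y * Complex.I)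
      (hcont y ⟨ha0.trans hy.1.le, hy.2⟩)
      (hasDerivAt_vertical _ y).continuousAt).mul continuousAt_const

/-- If there is a solution in a neighbourhood of the loops, then the integrals vanish. -/
theorem loop_eq_zero (hc : u.IsPosImag) (hlam : 0 < lam) (hε : 0 < ε) (hg : u.IsTest g)
    {Y : ℂ → ℂ} (hup : ∀ w : ℂ, 0 ≤ w.im → w.im ≤ u.height → u.SolAt lam ε g Y w)
    (hdown : ∀ w : ℂ, w.im ≤ 0 → w.re = u.leftAbscissa → u.SolAt lam ε g Y w)
    (ht : Tendsto (fun t : ℝ => Y (u.corner - t * Complex.I) *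
      u.expP ε lam (u.corner - t * Complex.I)) atTop (𝓝 0)) (m : Fin P) :
    u.loop ε lam m g = 0 := by
  have hD := downInt_eq hc hlam hε hg (Y := Y) (fun t h0 => by
    rw [corner_sub]
    rcases le_total t u.height with h1 | h1
    · exact hup _ (by simpa using h1) (by simpa using h0)
    · exact hdown _ (by simpa using h1) (by simp)) ht
  have hh := (height_pos (u := u)).le
  have hv : ∀ x : ℝ, (∀ p, x ≠ (u.z p).re) → ∀ a ∈ Set.Icc 0 u.height, ∀ b ∈ Set.Icc 0 u.height,
      vInt (fun w => g w * u.expP ε lam w) x a b =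
      Y (x + b * Complex.I) * u.expP ε lam (x + b * Complex.I) -
        Y (x + a * Complex.I) * u.expP ε lam (x + a * Complex.I) := by
    intro x hx a ha b hb
    refine vInt_eq_sub (F := fun w => g w * u.expP ε lam w) (Q := fun w => Y w * u.expP ε lam w)
      (fun y _ => hg.continuousAt_mul_expP (mem_cut_of_re hx y) ε lam) fun y hy => ?_
    have hy' := Set.uIcc_subset_Icc ha hb hy
    exact (hup _ (by simpa using hy'.1) (by simpa using hy'.2)).hasDerivAt_mul_expP
      (mem_cut_of_re hx y)
  have hz : ∀ a b : ℝ, hInt (fun w => g w * u.expP ε lam w) 0 a b =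
      Y (b + (0 : ℝ) * Complex.I) * u.expP ε lam (b + (0 : ℝ) * Complex.I) -
        Y (a + (0 : ℝ) * Complex.I) * u.expP ε lam (a + (0 : ℝ) * Complex.I) := fun a b =>
    hInt_eq_sub (F := fun w => g w * u.expP ε lam w) (Q := fun w => Y w * u.expP ε lam w)
      (fun x _ => hg.continuousAt_mul_expP (mem_cut_zero x) ε lam)
      fun x _ => (hup _ (by simp) (by simpa using hh)).hasDerivAt_mul_expP (mem_cut_zero x)
  have h0 : (0 : ℝ) ∈ Set.Icc 0 u.height := ⟨le_rfl, hh⟩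
  have h1 : u.height ∈ Set.Icc 0 u.height := ⟨hh, le_rfl⟩
  rw [loop, loopInt, hD, hv _ leftAbscissa_ne_re _ h1 _ h0]
  split_ifs with hm
  · have hE : vInt (fun w => g w * u.expP ε lam w) (u.z m).re 0 (u.z m).im = 0 -
        Y ((u.z m).re + (0 : ℝ) * Complex.I) * u.expP ε lam ((u.z m).re + (0 : ℝ) * Complex.I) := by
      have hd : ∀ y ∈ Set.Ico 0 (u.z m).im, HasDerivAt (fun y : ℝ =>
          Y ((u.z m).re + y * Complex.I) * u.expP ε lam ((u.z m).re + y * Complex.I))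
          (g ((u.z m).re + y * Complex.I) * u.expP ε lam ((u.z m).re + y * Complex.I) * Complex.I)
          y := fun y hy =>
        HasDerivAt.comp (h₂ := fun w => Y w * u.expP ε lam w) y ((hup _ (by simpa using hy.1) (by
          have := im_add_one_le_height (u := u) m
          simp; linarith [hy.2])).hasDerivAt_mul_expP (mem_cut_well m
          (by rw [abs_of_nonneg hy.1]; exact hy.2))) (hasDerivAt_vertical _ y)
      refine intervalIntegral.integral_eq_sub_of_hasDerivAt_of_tendsto (u.z_im_pos m)
        (fun y hy => hd y (Set.Ioo_subset_Ico_self hy))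
        (hg.intervalIntegrable_well hc hε hm lam) ?_ ?_
      · exact (hd 0 ⟨le_rfl, u.z_im_pos m⟩).continuousAt.tendsto.mono_left nhdsWithin_le_nhds
      · obtain ⟨C, hC⟩ := hc.norm_exp_well hε hm lam
        have hYc := (hup (u.z m) (u.z_im_pos m).le
          (by linarith [im_add_one_le_height (u := u) m])).1.continuousAt.tendsto
        have hE0 : Tendsto (u.expP ε lam) (𝓝[≠] (u.z m)) (𝓝 0) := by
          refine squeeze_zero_norm' hC ?_
          have : Tendsto (fun w => C * ‖w - u.z m‖) (𝓝 (u.z m)) (𝓝 (C * ‖u.z m - u.z m‖)) :=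
            Continuous.tendsto (by fun_prop) _
          simp only [sub_self, norm_zero, mul_zero] at this
          exact this.mono_left nhdsWithin_le_nhds
        have := ((hYc.mono_left nhdsWithin_le_nhds).mul hE0).comp (tendsto_well_below m)
        rw [mul_zero] at this
        exact this
    rw [hz, hE, corner]
    ring
  · have hT : hInt (fun w => g w * u.expT ε lam w) u.height (u.gapAbscissa m) u.leftAbscissa =
        Y (u.leftAbscissa + u.height * Complex.I) *
            u.expT ε lam (u.leftAbscissa + u.height * Complex.I) -
          Y (u.gapAbscissa m + u.height * Complex.I) *
            u.expT ε lam (u.gapAbscissa m + u.height * Complex.I) :=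
      hInt_eq_sub (F := fun w => g w * u.expT ε lam w) (Q := fun w => Y w * u.expT ε lam w)
        (fun x _ => hg.continuousAt_mul_expT (mem_cutTop_height x) ε lam)
        fun x _ => (hup _ (by simpa using hh) (by simp)).hasDerivAt_mul_expT (mem_cutTop_height x)
    have e1 : u.expP ε lam (u.leftAbscissa + u.height * Complex.I) =
        u.expT ε lam (u.leftAbscissa + u.height * Complex.I) := by
      rw [expP_eq (by simpa using leftAbscissa_ne_re)]
      -- The two branches are normalised to agree to the left of all poles, so the loop closes up at
      -- the corner.
      have : u.mon ε u.leftAbscissa = 1 := by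
        rw [mon, Finset.sum_eq_zero fun p _ => if_neg (leftAbscissa_lt p).not_gt]
        simp
      simp [this]
    have e2 : u.expP ε lam (u.gapAbscissa m + u.height * Complex.I) =
        u.mon ε (u.gapAbscissa m) * u.expT ε lam (u.gapAbscissa m + u.height * Complex.I) := by
      rw [expP_eq (by simpa using gapAbscissa_ne_re m)]
      simp
    rw [hz, hv _ (gapAbscissa_ne_re m) _ h0 _ h1, hT, e2, corner, e1]
    ring

end BenjaminOno.RationalPotential

namespace BenjaminOno.RationalPotential

variable {P : ℕ} {u : RationalPotential P} {lam ε ρ c : ℝ} {g g₁ g₂ yi y : ℂ → ℂ}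

/-! ### Loop integrals as linear functionals -/

lemma IsTest.add (h₁ : u.IsTest g₁) (h₂ : u.IsTest g₂) : u.IsTest (g₁ + g₂) where
  diff w hw := (h₁.diff w hw).add (h₂.diff w hw)
  well p := by
    obtain ⟨C₁, hC₁⟩ := h₁.well p
    obtain ⟨C₂, hC₂⟩ := h₂.well p
    refine ⟨C₁ + C₂, ?_⟩
    filter_upwards [hC₁, hC₂] with w h3 h4
    have := mul_le_mul_of_nonneg_left (norm_add_le (g₁ w) (g₂ w)) (norm_nonneg (w - u.z p))
    rw [Pi.add_apply]
    linarith
  left := by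
    obtain ⟨C₁, hC₁⟩ := h₁.left
    obtain ⟨C₂, hC₂⟩ := h₂.left
    exact ⟨C₁ + C₂, fun w h3 h4 => (norm_add_le _ _).trans (add_le_add (hC₁ w h3 h4) (hC₂ w h3 h4))⟩

lemma IsTest.smul (h : u.IsTest g) (a : ℂ) : u.IsTest (a • g) where
  diff w hw := (h.diff w hw).const_smul a
  well p := by
    obtain ⟨C, hC⟩ := h.well p
    refine ⟨‖a‖ * C, ?_⟩
    filter_upwards [hC] with w h3
    rw [Pi.smul_apply, norm_smul, mul_left_comm]
    gcongr
  left := by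
    obtain ⟨C, hC⟩ := h.left
    refine ⟨‖a‖ * C, fun w h3 h4 => ?_⟩
    rw [Pi.smul_apply, norm_smul]
    gcongr
    exact hC w h3 h4

lemma IsTest.const (a : ℂ) : u.IsTest fun _ => a where
  diff w _ := differentiableAt_const a
  well p := by
    have : Tendsto (fun w => ‖w - u.z p‖ * ‖a‖) (𝓝 (u.z p)) (𝓝 (‖u.z p - u.z p‖ * ‖a‖)) :=
      Continuous.tendsto (by fun_prop) _
    exact ⟨1, ((this.eventually_lt_const (by simp)).filter_mono nhdsWithin_le_nhds).mono
      fun w hw => hw.le⟩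
  left := ⟨‖a‖, fun _ _ _ => le_rfl⟩

variable (u) in
/-- The space of test functions. -/
def testSpace : Submodule ℂ (ℂ → ℂ) where
  carrier := {g | u.IsTest g}
  add_mem' := IsTest.add
  zero_mem' := IsTest.const 0
  smul_mem' a _ h := IsTest.smul h a

lemma IsTest.integrable_vertical (hg : u.IsTest g) {x : ℝ} (hx : ∀ p, x ≠ (u.z p).re) (a b : ℝ)
    (ε lam : ℝ) : IntervalIntegrable (fun y : ℝ => g (x + y * Complex.I) *
      u.expP ε lam (x + y * Complex.I) * Complex.I) volume a b :=
  intervalIntegrable_vertical (F := fun w => g w * u.expP ε lam w) fun y _ =>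
    hg.continuousAt_mul_expP (mem_cut_of_re hx y) ε lam

lemma IsTest.integrable_zero (hg : u.IsTest g) (a b ε lam : ℝ) :
    IntervalIntegrable (fun x : ℝ => g (x + (0 : ℝ) * Complex.I) *
      u.expP ε lam (x + (0 : ℝ) * Complex.I)) volume a b :=
  intervalIntegrable_horizontal (F := fun w => g w * u.expP ε lam w) fun x _ =>
    hg.continuousAt_mul_expP (mem_cut_zero x) ε lam

lemma IsTest.integrable_height (hg : u.IsTest g) (a b ε lam : ℝ) :
    IntervalIntegrable (fun x : ℝ => g (x + u.height * Complex.I) *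
      u.expT ε lam (x + u.height * Complex.I)) volume a b :=
  intervalIntegrable_horizontal (F := fun w => g w * u.expT ε lam w) fun x _ =>
    hg.continuousAt_mul_expT (mem_cutTop_height x) ε lam

lemma loop_add (hc : u.IsPosImag) (hlam : 0 < lam) (hε : 0 < ε) (h₁ : u.IsTest g₁)
    (h₂ : u.IsTest g₂) (m : Fin P) :
    u.loop ε lam m (g₁ + g₂) = u.loop ε lam m g₁ + u.loop ε lam m g₂ := by
  have hv : ∀ x : ℝ, (∀ p, x ≠ (u.z p).re) → ∀ a b,
      vInt (fun w => (g₁ w + g₂ w) * u.expP ε lam w) x a b =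
      vInt (fun w => g₁ w * u.expP ε lam w) x a b + vInt (fun w => g₂ w * u.expP ε lam w) x a b :=
    fun x hx a b => by
      simp only [vInt, add_mul]
      exact intervalIntegral.integral_add (h₁.integrable_vertical hx a b ε lam)
        (h₂.integrable_vertical hx a b ε lam)
  have hz : ∀ a b, hInt (fun w => (g₁ w + g₂ w) * u.expP ε lam w) 0 a b =
      hInt (fun w => g₁ w * u.expP ε lam w) 0 a b + hInt (fun w => g₂ w * u.expP ε lam w) 0 a b :=
    fun a b => by
      simp only [hInt, add_mul]
      exact intervalIntegral.integral_add (h₁.integrable_zero a b ε lam)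
        (h₂.integrable_zero a b ε lam)
  have hT : ∀ a b, hInt (fun w => (g₁ w + g₂ w) * u.expT ε lam w) u.height a b =
      hInt (fun w => g₁ w * u.expT ε lam w) u.height a b +
        hInt (fun w => g₂ w * u.expT ε lam w) u.height a b := fun a b => by
      simp only [hInt, add_mul]
      exact intervalIntegral.integral_add (h₁.integrable_height a b ε lam)
        (h₂.integrable_height a b ε lam)
  have hD : downInt (fun w => (g₁ w + g₂ w) * u.expP ε lam w) u.corner =
      downInt (fun w => g₁ w * u.expP ε lam w) u.corner +
        downInt (fun w => g₂ w * u.expP ε lam w) u.corner := by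
      simp only [downInt, add_mul]
      exact integral_add (h₁.integrableOn_down hc hlam hε) (h₂.integrableOn_down hc hlam hε)
  simp only [loop, loopInt, Pi.add_apply, hD, hz]
  split_ifs with hm
  · have hw : vInt (fun w => (g₁ w + g₂ w) * u.expP ε lam w) (u.z m).re 0 (u.z m).im =
        vInt (fun w => g₁ w * u.expP ε lam w) (u.z m).re 0 (u.z m).im +
          vInt (fun w => g₂ w * u.expP ε lam w) (u.z m).re 0 (u.z m).im := by
      simp only [vInt, add_mul]
      exact intervalIntegral.integral_add (h₁.intervalIntegrable_well hc hε hm lam)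
        (h₂.intervalIntegrable_well hc hε hm lam)
    rw [hv _ leftAbscissa_ne_re, hw]
    ring
  · rw [hv _ leftAbscissa_ne_re, hv _ (gapAbscissa_ne_re m), hT]
    ring

lemma loop_smul (ε lam : ℝ) (m : Fin P) (a : ℂ) (g : ℂ → ℂ) :
    u.loop ε lam m (a • g) = a * u.loop ε lam m g := by
  have hv : ∀ (F : ℂ → ℂ) x b c, vInt (fun w => a * g w * F w) x b c =
      a * vInt (fun w => g w * F w) x b c := fun F x b c => by
    simp only [vInt, mul_assoc]
    exact intervalIntegral.integral_const_mul _ _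
  have hh : ∀ (F : ℂ → ℂ) x b c, hInt (fun w => a * g w * F w) x b c =
      a * hInt (fun w => g w * F w) x b c := fun F x b c => by
    simp only [hInt, mul_assoc]
    exact intervalIntegral.integral_const_mul _ _
  have hD : ∀ (F : ℂ → ℂ) w, downInt (fun w => a * g w * F w) w =
      a * downInt (fun w => g w * F w) w := fun F x => by
    simp only [downInt, mul_assoc]
    exact integral_const_mul _ _
  simp only [loop, loopInt, Pi.smul_apply, smul_eq_mul, hv, hh, hD]
  split_ifs <;> ring

/-- The loop integrals as linear functionals. -/
noncomputable def loopLinear (hc : u.IsPosImag) (hlam : 0 < lam) (hε : 0 < ε) (m : Fin P) :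
    u.testSpace →ₗ[ℂ] ℂ where
  toFun g := u.loop ε lam m g
  map_add' g₁ g₂ := loop_add hc hlam hε g₁.2 g₂.2 m
  map_smul' a g := loop_smul ε lam m a g

section
variable {M₁ M₂ : Set ℂ} {p : ℂ} {γ₁ γ₂ H : ℝ → ℂ}

/-- The integrals over an admissible contour as linear functionals. -/
noncomputable def contourLinear (hc : u.IsPosImag) (hlam : 0 < lam) (hε : 0 < ε)
    (h₁ : u.Half M₁ p γ₁) (h₂ : u.Half M₂ p γ₂) (hp : ¬ u.IsPole p)
    (hM₁ : ∀ w ∈ M₁, ¬ u.IsPole w) (hM₂ : ∀ w ∈ M₂, ¬ u.IsPole w)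
    (hb : u.IsBranchAlong lam (glue γ₁ γ₂) H) : u.testSpace →ₗ[ℂ] ℂ where
  toFun g := contourIntegral ε (glue γ₁ γ₂) H g
  map_add' g₁ g₂ := by
    simp only [contourIntegral, Submodule.coe_add, Pi.add_apply, add_mul]
    exact integral_add (integrable_glue hc hlam hε g₁.2 h₁ h₂ hp hM₁ hM₂ hb).1
      (integrable_glue hc hlam hε g₂.2 h₁ h₂ hp hM₁ hM₂ hb).1
  map_smul' a g := by
    simp only [contourIntegral, Submodule.coe_smul, Pi.smul_apply, smul_eq_mul, mul_assoc,
      RingHom.id_apply]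
    exact integral_const_mul _ _

end

/-! ### Deformation of the loops -/

lemma hInt_add_hInt {F : ℂ → ℂ} {y a b c : ℝ}
    (h₁ : IntervalIntegrable (fun x : ℝ => F (x + y * Complex.I)) volume a b)
    (h₂ : IntervalIntegrable (fun x : ℝ => F (x + y * Complex.I)) volume b c) :
    hInt F y a b + hInt F y b c = hInt F y a c :=
  intervalIntegral.integral_add_adjacent_intervals h₁ h₂

lemma rect_eq_zero {F : ℂ → ℂ} {x₁ x₂ y₁ y₂ : ℝ} (hx : x₁ ≤ x₂) (hy : y₁ ≤ y₂)
    (hF : ContinuousOn F (Set.Icc x₁ x₂ ×ℂ Set.Icc y₁ y₂))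
    (hd : ∀ w : ℂ, w.re ∈ Set.Ioo x₁ x₂ → w.im ∈ Set.Ioo y₁ y₂ → DifferentiableAt ℂ F w) :
    hInt F y₁ x₁ x₂ + vInt F x₂ y₁ y₂ = vInt F x₁ y₁ y₂ + hInt F y₂ x₁ x₂ := by
  have := Complex.integral_boundary_rect_eq_zero_of_differentiable_on_off_countable F
    (x₁ + y₁ * Complex.I) (x₂ + y₂ * Complex.I) ∅ Set.countable_empty
    (by simpa [Set.uIcc_of_le hx, Set.uIcc_of_le hy] using hF)
    (by
      intro w hw
      simp [hx, hy, Complex.mem_reProdIm] at hw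
      exact hd w hw.1 hw.2)
  simp [-intervalIntegral.integral_mul_const] at this
  simp only [hInt, vInt, intervalIntegral.integral_mul_const]
  linear_combination this

end BenjaminOno.RationalPotential

namespace BenjaminOno.RationalPotential

variable {P : ℕ} {u : RationalPotential P} {lam ε ρ c : ℝ} {g g₁ g₂ yi y : ℂ → ℂ}

/-! ### Rectangles with a well on the boundary -/

lemma hInt_update (F : ℂ → ℂ) (z v : ℂ) (y a b : ℝ) :
    hInt (Function.update F z v) y a b = hInt F y a b := by
  refine intervalIntegral.integral_congr_ae ?_
  have : ∀ᵐ x : ℝ, x ≠ z.re := by simp [ae_iff]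
  filter_upwards [this] with x hx _
  rw [Function.update_of_ne]
  rintro rfl
  simp at hx

lemma vInt_update (F : ℂ → ℂ) (z v : ℂ) (x a b : ℝ) :
    vInt (Function.update F z v) x a b = vInt F x a b := by
  refine intervalIntegral.integral_congr_ae ?_
  have : ∀ᵐ y : ℝ, y ≠ z.im := by simp [ae_iff]
  filter_upwards [this] with y hy _
  rw [Function.update_of_ne]
  rintro rfl
  simp at hy

lemma continuousAt_update_of_tendsto {F : ℂ → ℂ} {z w : ℂ} (hF : w ≠ z → ContinuousAt F w)
    (hz : Tendsto F (𝓝[≠] z) (𝓝 0)) : ContinuousAt (Function.update F z 0) w := by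
  by_cases h : w = z
  · subst h
    exact continuousAt_update_same.2 hz
  · exact (continuousAt_update_of_ne h).2 (hF h)

/-- Cauchy's theorem needs only continuity up to the boundary; giving `F` the value `0` at the
boundary point `z` makes it continuous and changes no integral. -/
lemma rect_eq_of_tendsto {F : ℂ → ℂ} {z : ℂ} {x₁ x₂ y₁ y₂ : ℝ} (hx : x₁ ≤ x₂) (hy : y₁ ≤ y₂)
    (hF : ∀ w : ℂ, w.re ∈ Set.Icc x₁ x₂ → w.im ∈ Set.Icc y₁ y₂ → w ≠ z → DifferentiableAt ℂ F w)
    (hzi : z.im ∉ Set.Ioo y₁ y₂) (hz : Tendsto F (𝓝[≠] z) (𝓝 0)) :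
    hInt F y₁ x₁ x₂ + vInt F x₂ y₁ y₂ = vInt F x₁ y₁ y₂ + hInt F y₂ x₁ x₂ := by
  have := rect_eq_zero (F := Function.update F z 0) hx hy
    (fun w hw => (continuousAt_update_of_tendsto
      (fun h => (hF w hw.1 hw.2 h).continuousAt) hz).continuousWithinAt)
    fun w h1 h2 => by
      have hne : w ≠ z := by rintro rfl; exact hzi h2
      refine (hF w (Set.Ioo_subset_Icc_self h1) (Set.Ioo_subset_Icc_self h2) hne).congr_of_eventuallyEq
        ?_
      filter_upwards [isOpen_ne.mem_nhds hne] with v hv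
      exact Function.update_of_ne hv _ _
  simpa only [hInt_update, vInt_update] using this

lemma intervalIntegrable_of_tendsto {F : ℂ → ℂ} {z : ℂ} {y a b : ℝ}
    (hF : ∀ x ∈ Set.uIcc a b, (x : ℂ) + y * Complex.I ≠ z → ContinuousAt F (x + y * Complex.I))
    (hz : Tendsto F (𝓝[≠] z) (𝓝 0)) :
    IntervalIntegrable (fun x : ℝ => F (x + y * Complex.I)) volume a b := by
  refine (intervalIntegrable_horizontal (F := Function.update F z 0) fun x hx =>
    continuousAt_update_of_tendsto (hF x hx) hz).congr_ae ?_
  refine ae_restrict_of_ae ?_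
  have : ∀ᵐ x : ℝ, x ≠ z.re := by simp [ae_iff]
  filter_upwards [this] with x hx
  rw [Function.update_of_ne]
  rintro rfl
  simp at hx

lemma tendsto_exp_R_well (hc : u.IsPosImag) (hε : 0 < ε) (lam : ℝ) (m : Fin P) {F : ℂ → ℂ}
    (hF : ∀ w, ‖F w‖ = Real.exp (u.R lam w / ε)) (hg : ContinuousAt g (u.z m)) :
    Tendsto (fun w => g w * F w) (𝓝[≠] (u.z m)) (𝓝 0) := by
  have h1 : Tendsto F (𝓝[≠] (u.z m)) (𝓝 0) := by
    rw [tendsto_zero_iff_norm_tendsto_zero]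
    simp only [hF]
    exact Real.tendsto_exp_atBot.comp ((hc.tendsto_R_well lam m).atBot_div_const hε)
  simpa using (hg.tendsto.mono_left nhdsWithin_le_nhds).mul h1

open scoped Classical in
/-- The part of the loop to the right of `x₁` contracted to a segment ending at `zₘ`. -/
lemma loop_deform (hc : u.IsPosImag) (hε : 0 < ε) (lam : ℝ) (hg : Differentiable ℂ g)
    {m : Fin P} {x₁ : ℝ} (hx₁ : x₁ < (u.z m).re) (hx₁' : ∀ p < m, (u.z p).re < x₁) :
    u.loop ε lam m g =
      (if u.IsExceptional ε m then
        vInt (fun w => g w * u.expP ε lam w) u.leftAbscissa u.height 0 +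
        hInt (fun w => g w * u.expP ε lam w) 0 u.leftAbscissa x₁ +
        vInt (fun w => g w * u.expP ε lam w) x₁ 0 (u.z m).im -
        downInt (fun w => g w * u.expP ε lam w) u.corner
      else
        vInt (fun w => g w * u.expP ε lam w) u.leftAbscissa u.height 0 +
        hInt (fun w => g w * u.expP ε lam w) 0 u.leftAbscissa x₁ +
        vInt (fun w => g w * u.expP ε lam w) x₁ 0 (u.z m).im +
        u.mon ε (u.gapAbscissa m) * vInt (fun w => g w * u.expT ε lam w) x₁ (u.z m).im u.height +
        u.mon ε (u.gapAbscissa m) * hInt (fun w => g w * u.expT ε lam w) u.height x₁ u.leftAbscissa +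
        (u.mon ε (u.gapAbscissa m) - 1) * downInt (fun w => g w * u.expP ε lam w) u.corner) +
      (if u.IsExceptional ε m then 1 else 1 - u.mon ε (u.gapAbscissa m) / u.mon ε x₁) *
        hInt (fun w => g w * u.expP ε lam w) (u.z m).im x₁ (u.z m).re := by
  set F := fun w => g w * u.expP ε lam w with hFdef
  set B := fun w => g w * u.expT ε lam w with hBdef
  set b := (u.z m).im with hb
  have hb0 : 0 < b := u.z_im_pos m
  have hbY : b ≤ u.height := by linarith [im_add_one_le_height (u := u) m]
  have hgap := re_lt_gapAbscissa (u := u) m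
  have honly : ∀ x, x₁ ≤ x → x ≤ u.gapAbscissa m → ∀ p, p ≠ m → x ≠ (u.z p).re := by
    intro x h1 h2 p hp
    rcases lt_or_gt_of_ne hp with h | h
    · exact ((hx₁' p h).trans_le h1).ne'
    · exact (h2.trans_lt (gapAbscissa_lt_re h)).ne
  have hne : ∀ x, x₁ ≤ x → x ≤ u.gapAbscissa m → x ≠ (u.z m).re → ∀ p, x ≠ (u.z p).re := by
    intro x h1 h2 h3 p
    by_cases hp : p = m
    · rwa [hp]
    · exact honly x h1 h2 p hp
  have hFd : ∀ w : ℂ, w.re ∈ Set.Icc x₁ (u.gapAbscissa m) → w.im ∈ Set.Icc 0 b → w ≠ u.z m →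
      DifferentiableAt ℂ F w := by
    intro w h1 h2 h3
    refine (hg w).mul (hasDerivAt_expP (fun p => ?_) ε lam).differentiableAt
    by_cases hp : p = m
    · subst hp
      by_cases hre : w.re = (u.z p).re
      · right
        rw [abs_of_nonneg h2.1]
        exact lt_of_le_of_ne h2.2 fun him => h3 (Complex.ext hre him)
      · exact Or.inl hre
    · exact Or.inl (honly w.re h1.1 h1.2 p hp)
  have hBd : ∀ w : ℂ, w.re ∈ Set.Icc x₁ (u.gapAbscissa m) → w.im ∈ Set.Icc b u.height →
      w ≠ u.z m → DifferentiableAt ℂ B w := by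
    intro w h1 h2 h3
    refine (hg w).mul (hasDerivAt_expT (fun p => ?_) ε lam).differentiableAt
    by_cases hp : p = m
    · subst hp
      by_cases hre : w.re = (u.z p).re
      · right
        exact lt_of_le_of_ne h2.1 fun him => h3 (Complex.ext hre him.symm)
      · exact Or.inl hre
    · exact Or.inl (honly w.re h1.1 h1.2 p hp)
  have hFz : Tendsto F (𝓝[≠] (u.z m)) (𝓝 0) :=
    tendsto_exp_R_well hc hε lam m (hc.norm_expP ε lam) (hg _).continuousAt
  have hBz : Tendsto B (𝓝[≠] (u.z m)) (𝓝 0) :=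
    tendsto_exp_R_well hc hε lam m (hc.norm_expT ε lam) (hg _).continuousAt
  have hF0 : ∀ x : ℝ, ContinuousAt F (x + (0 : ℝ) * Complex.I) := fun x =>
    (hg _).continuousAt.mul (hasDerivAt_expP (mem_cut_zero x) ε lam).continuousAt
  have s1 : ∀ x, hInt F 0 u.leftAbscissa x₁ + hInt F 0 x₁ x = hInt F 0 u.leftAbscissa x := fun x =>
    hInt_add_hInt (intervalIntegrable_horizontal fun x _ => hF0 x)
      (intervalIntegrable_horizontal fun x _ => hF0 x)
  have r1 : ∀ x, (u.z m).re ≤ x → x ≤ u.gapAbscissa m →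
      hInt F 0 x₁ x + vInt F x 0 b = vInt F x₁ 0 b + hInt F b x₁ x := fun x h1 h2 =>
    rect_eq_of_tendsto (hx₁.le.trans h1) hb0.le
      (fun w h3 h4 h5 => hFd w ⟨h3.1, h3.2.trans h2⟩ h4 h5) (by simp [hb]) hFz
  rw [loop, loopInt]
  split_ifs with hm
  · rw [← s1]
    linear_combination r1 _ le_rfl hgap.le
  -- Below the height of `zₘ` the principal branch is used and above it the upper branch. On the
  -- common edge their ratio is `k` to the right of `zₘ` and `mon x₁` to the left, so the right
  -- parts cancel and the left part survives with factor `1 - k / mon x₁`.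
  · set k := u.mon ε (u.gapAbscissa m) with hk
    have r2 : hInt B b x₁ (u.gapAbscissa m) + vInt B (u.gapAbscissa m) b u.height =
        vInt B x₁ b u.height + hInt B u.height x₁ (u.gapAbscissa m) :=
      rect_eq_of_tendsto (hx₁.le.trans hgap.le) hbY hBd (by simp [hb]) hBz
    have hBi : ∀ a c, a ∈ Set.Icc x₁ (u.gapAbscissa m) → c ∈ Set.Icc x₁ (u.gapAbscissa m) →
        IntervalIntegrable (fun x : ℝ => B (x + b * Complex.I)) volume a c := fun a c ha hc' =>
      intervalIntegrable_of_tendsto (fun x hx h => (hBd _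
        (by simpa using Set.uIcc_subset_Icc ha hc' hx) (by simpa using hbY) h).continuousAt) hBz
    have hFi : ∀ a c, a ∈ Set.Icc x₁ (u.gapAbscissa m) → c ∈ Set.Icc x₁ (u.gapAbscissa m) →
        IntervalIntegrable (fun x : ℝ => F (x + b * Complex.I)) volume a c := fun a c ha hc' =>
      intervalIntegrable_of_tendsto (fun x hx h => (hFd _
        (by simpa using Set.uIcc_subset_Icc ha hc' hx) (by simpa using hb0.le) h).continuousAt) hFz
    have m1 : x₁ ∈ Set.Icc x₁ (u.gapAbscissa m) := ⟨le_rfl, (hx₁.trans hgap).le⟩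
    have m2 : (u.z m).re ∈ Set.Icc x₁ (u.gapAbscissa m) := ⟨hx₁.le, hgap.le⟩
    have m3 : u.gapAbscissa m ∈ Set.Icc x₁ (u.gapAbscissa m) := ⟨(hx₁.trans hgap).le, le_rfl⟩
    have s2 := hInt_add_hInt (hFi _ _ m1 m2) (hFi _ _ m2 m3)
    have s3 := hInt_add_hInt (hBi _ _ m1 m2) (hBi _ _ m2 m3)
    have hgv : ∀ y : ℝ, ContinuousAt F (u.gapAbscissa m + y * Complex.I) := fun y =>
      (hg _).continuousAt.mul (hasDerivAt_expP (mem_cut_of_re (gapAbscissa_ne_re m) y) ε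
        lam).continuousAt
    have s4 : vInt F (u.gapAbscissa m) 0 b + vInt F (u.gapAbscissa m) b u.height =
        vInt F (u.gapAbscissa m) 0 u.height :=
      intervalIntegral.integral_add_adjacent_intervals
        (intervalIntegrable_vertical fun y _ => hgv y) (intervalIntegrable_vertical fun y _ => hgv y)
    have hBY : ∀ x : ℝ, ContinuousAt B (x + u.height * Complex.I) := fun x =>
      (hg _).continuousAt.mul (hasDerivAt_expT (mem_cutTop_height x) ε lam).continuousAt
    have s5 : hInt B u.height (u.gapAbscissa m) x₁ + hInt B u.height x₁ u.leftAbscissa =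
        hInt B u.height (u.gapAbscissa m) u.leftAbscissa :=
      hInt_add_hInt (intervalIntegrable_horizontal fun x _ => hBY x)
        (intervalIntegrable_horizontal fun x _ => hBY x)
    have s6 : hInt B u.height (u.gapAbscissa m) x₁ = -hInt B u.height x₁ (u.gapAbscissa m) :=
      intervalIntegral.integral_symm _ _
    have e1 : vInt F (u.gapAbscissa m) b u.height = k * vInt B (u.gapAbscissa m) b u.height := by
      rw [vInt, vInt, ← intervalIntegral.integral_const_mul]
      refine intervalIntegral.integral_congr fun y _ => ?_
      simp only [hFdef, hBdef]
      rw [expP_eq (by simpa using gapAbscissa_ne_re m)]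
      simp only [Complex.add_re, Complex.ofReal_re, Complex.mul_re, Complex.I_re, mul_zero,
        Complex.ofReal_im, Complex.I_im, mul_one, sub_self, add_zero, ← hk]
      ring
    have hmon : ∀ x ∈ Set.Icc x₁ (u.gapAbscissa m), x ≠ (u.z m).re → F (x + b * Complex.I) =
        u.mon ε x * B (x + b * Complex.I) := by
      intro x hx h
      simp only [hFdef, hBdef]
      rw [expP_eq (by simpa using hne x hx.1 hx.2 h)]
      simp only [Complex.add_re, Complex.ofReal_re, Complex.mul_re, Complex.I_re, mul_zero,
        Complex.ofReal_im, Complex.I_im, mul_one, sub_self, add_zero]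
      ring
    have hmonr : ∀ x ∈ Set.Ioc (u.z m).re (u.gapAbscissa m), u.mon ε x = k := by
      intro x hx
      rw [hk, mon, mon]
      congr 3
      refine Finset.sum_congr rfl fun p _ => ?_
      rcases le_or_gt p m with h | h
      · have h1 : (u.z p).re ≤ (u.z m).re := u.z_re_strictMono.monotone h
        rw [if_pos (h1.trans_lt hx.1), if_pos (h1.trans_lt hgap)]
      · have h1 := gapAbscissa_lt_re (u := u) h
        rw [if_neg (hx.2.trans h1.le).not_gt, if_neg h1.not_gt]
    have hmonl : ∀ x ∈ Set.Icc x₁ (u.z m).re, u.mon ε x = u.mon ε x₁ := by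
      intro x hx
      rw [mon, mon]
      congr 3
      refine Finset.sum_congr rfl fun p _ => ?_
      rcases lt_or_ge p m with h | h
      · rw [if_pos (hx₁' p h), if_pos ((hx₁' p h).trans_le hx.1)]
      · have h1 : (u.z m).re ≤ (u.z p).re := u.z_re_strictMono.monotone h
        rw [if_neg (hx.2.trans h1).not_gt, if_neg (hx₁.le.trans h1).not_gt]
    have e2 : hInt F b (u.z m).re (u.gapAbscissa m) = k * hInt B b (u.z m).re (u.gapAbscissa m) := by
      rw [hInt, hInt, ← intervalIntegral.integral_const_mul]
      refine intervalIntegral.integral_congr_ae (ae_of_all _ fun x hx => ?_)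
      rw [Set.uIoc_of_le hgap.le] at hx
      rw [hmon x ⟨hx₁.le.trans hx.1.le, hx.2⟩ hx.1.ne', hmonr x hx]
    have e3 : hInt F b x₁ (u.z m).re = u.mon ε x₁ * hInt B b x₁ (u.z m).re := by
      rw [hInt, hInt, ← intervalIntegral.integral_const_mul]
      have hae : ∀ᵐ x : ℝ, x ≠ (u.z m).re := by simp [ae_iff]
      refine intervalIntegral.integral_congr_ae ?_
      filter_upwards [hae] with x h1 hx
      rw [Set.uIoc_of_le hx₁.le] at hx
      rw [hmon x ⟨hx.1.le, hx.2.trans hgap.le⟩ h1, hmonl x ⟨hx.1.le, hx.2⟩]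
    have hk1 := mon_ne_zero (u := u) ε x₁
    have e4 : k / u.mon ε x₁ * hInt F b x₁ (u.z m).re = k * hInt B b x₁ (u.z m).re := by
      rw [e3]; field_simp
    rw [← s1, ← s4, ← s5, s6, e1]
    linear_combination r1 _ hgap.le le_rfl + k * r2 + e4 - s2 + e2 + k * s3

/-! ### Growth of the loop integrals of exponentials -/

lemma isTest_exp {κ : ℝ} (hκ : 0 ≤ κ) : u.IsTest fun w => Complex.exp (κ * w) where
  diff w _ := by fun_prop
  well p := by
    have : Tendsto (fun w => ‖w - u.z p‖ * ‖Complex.exp (κ * w)‖) (𝓝 (u.z p))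
        (𝓝 (‖u.z p - u.z p‖ * ‖Complex.exp (κ * u.z p)‖)) := Continuous.tendsto (by fun_prop) _
    exact ⟨1, ((this.eventually_lt_const (by simp)).filter_mono nhdsWithin_le_nhds).mono
      fun w hw => hw.le⟩
  left := ⟨Real.exp (κ * u.leftAbscissa), fun w _ hw => by
    rw [Complex.norm_exp, Complex.re_ofReal_mul]
    gcongr⟩

lemma norm_exp_ofReal_mul_le {κ x : ℝ} (hκ : 0 ≤ κ) {w : ℂ} (hw : w.re ≤ x) :
    ‖Complex.exp (κ * w)‖ ≤ Real.exp (κ * x) := by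
  rw [Complex.norm_exp, Complex.re_ofReal_mul]
  gcongr

/-- For `κ ≥ 0` a piece of contour with abscissae at most `x'` contributes `O(e^{κx'})`. -/
lemma isBigO_intervalIntegral {E ℓ : ℝ → ℂ} {a b x' : ℝ} (hE : IntervalIntegrable E volume a b)
    (h : ∀ x ∈ Set.uIcc a b, (ℓ x).re ≤ x') :
    (fun κ : ℝ => ∫ x in a..b, Complex.exp (κ * ℓ x) * E x) =O[atTop]
      fun κ => Real.exp (κ * x') := by
  refine Asymptotics.IsBigO.of_bound |∫ x in a..b, ‖E x‖| ?_
  filter_upwards [eventually_ge_atTop 0] with κ hκ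
  have := intervalIntegral.norm_integral_le_abs_of_norm_le (f := fun x => Complex.exp (κ * ℓ x) * E x)
    (g := fun x => Real.exp (κ * x') * ‖E x‖) (μ := volume) (a := a) (b := b)
    (ae_restrict_of_forall_mem measurableSet_uIoc fun x hx => by
      rw [norm_mul]
      gcongr
      exact norm_exp_ofReal_mul_le hκ (h x (Set.uIoc_subset_uIcc hx))) (hE.norm.const_mul _)
  refine this.trans (le_of_eq ?_)
  rw [intervalIntegral.integral_const_mul, abs_mul, Real.abs_exp, Real.norm_eq_abs, Real.abs_exp,
    mul_comm]

lemma isBigO_hInt {E : ℂ → ℂ} {y a b x' : ℝ}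
    (hE : IntervalIntegrable (fun x : ℝ => E (x + y * Complex.I)) volume a b)
    (ha : a ≤ x') (hb : b ≤ x') :
    (fun κ : ℝ => hInt (fun w => Complex.exp (κ * w) * E w) y a b) =O[atTop]
      fun κ => Real.exp (κ * x') :=
  isBigO_intervalIntegral (ℓ := fun x => x + y * Complex.I) hE fun x hx => by
    simpa using hx.2.trans (max_le ha hb)

lemma isBigO_vInt {E : ℂ → ℂ} {x a b x' : ℝ}
    (hE : IntervalIntegrable (fun y : ℝ => E (x + y * Complex.I) * Complex.I) volume a b)
    (hx : x ≤ x') :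
    (fun κ : ℝ => vInt (fun w => Complex.exp (κ * w) * E w) x a b) =O[atTop]
      fun κ => Real.exp (κ * x') := by
  have := isBigO_intervalIntegral (ℓ := fun y => x + y * Complex.I) (x' := x') hE fun y _ => by
    simpa using hx
  simpa only [vInt, mul_assoc] using this

lemma isBigO_downInt {E : ℂ → ℂ} {w : ℂ} {x' : ℝ}
    (hE : IntegrableOn (fun t : ℝ => E (w - t * Complex.I) * -Complex.I) (Set.Ioi 0))
    (hx : w.re ≤ x') :
    (fun κ : ℝ => downInt (fun w => Complex.exp (κ * w) * E w) w) =O[atTop]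
      fun κ => Real.exp (κ * x') := by
  refine Asymptotics.IsBigO.of_bound (∫ t in Set.Ioi (0 : ℝ), ‖E (w - t * Complex.I) * -Complex.I‖) ?_
  filter_upwards [eventually_ge_atTop 0] with κ hκ
  refine (norm_integral_le_of_norm_le (hE.norm.const_mul (Real.exp (κ * x')))
    (ae_of_all _ fun t => ?_)).trans (le_of_eq ?_)
  · rw [mul_assoc, norm_mul]
    gcongr
    exact norm_exp_ofReal_mul_le hκ (by simpa using hx)
  · rw [integral_const_mul, Real.norm_eq_abs, Real.abs_exp, mul_comm]

end BenjaminOno.RationalPotential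

namespace BenjaminOno.RationalPotential

variable {P : ℕ} {u : RationalPotential P} {lam ε ρ c : ℝ} {g g₁ g₂ yi y : ℂ → ℂ}

/-! ### Linear independence of the loop integrals -/

lemma expP_integrable_vertical {x : ℝ} (hx : ∀ p, x ≠ (u.z p).re) (a b ε lam : ℝ) :
    IntervalIntegrable (fun y : ℝ => u.expP ε lam (x + y * Complex.I) * Complex.I) volume a b :=
  intervalIntegrable_vertical fun y _ => (hasDerivAt_expP (mem_cut_of_re hx y) ε lam).continuousAt

lemma expP_integrable_zero (a b ε lam : ℝ) :
    IntervalIntegrable (fun x : ℝ => u.expP ε lam (x + (0 : ℝ) * Complex.I)) volume a b :=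
  intervalIntegrable_horizontal fun x _ => (hasDerivAt_expP (mem_cut_zero x) ε lam).continuousAt

lemma expT_integrable_height (a b ε lam : ℝ) :
    IntervalIntegrable (fun x : ℝ => u.expT ε lam (x + u.height * Complex.I)) volume a b :=
  intervalIntegrable_horizontal fun x _ => (hasDerivAt_expT (mem_cutTop_height x) ε lam).continuousAt

lemma isBigO_down (hc : u.IsPosImag) (hlam : 0 < lam) (hε : 0 < ε) {x' : ℝ}
    (h : u.leftAbscissa ≤ x') :
    (fun κ : ℝ => downInt (fun w => Complex.exp (κ * w) * u.expP ε lam w) u.corner) =O[atTop]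
      fun κ => Real.exp (κ * x') :=
  isBigO_downInt (by simpa using (IsTest.const (u := u) 1).integrableOn_down hc hlam hε)
    (by simpa [corner] using h)

lemma isBigO_loop (hc : u.IsPosImag) (hlam : 0 < lam) (hε : 0 < ε) {m : Fin P} {x' : ℝ}
    (h₁ : u.leftAbscissa ≤ x') (h₂ : u.gapAbscissa m ≤ x') :
    (fun κ : ℝ => u.loop ε lam m fun w => Complex.exp (κ * w)) =O[atTop]
      fun κ => Real.exp (κ * x') := by
  have h₃ : (u.z m).re ≤ x' := (re_lt_gapAbscissa m).le.trans h₂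
  have o1 := isBigO_vInt (expP_integrable_vertical leftAbscissa_ne_re u.height 0 ε lam) h₁
  have o2 := isBigO_hInt (expP_integrable_zero (u := u) u.leftAbscissa (u.z m).re ε lam) h₁ h₃
  have o3 := isBigO_hInt (expP_integrable_zero (u := u) u.leftAbscissa (u.gapAbscissa m) ε lam) h₁ h₂
  have o4 := isBigO_vInt (expP_integrable_vertical (gapAbscissa_ne_re m) 0 u.height ε lam) h₂
  have o5 := isBigO_hInt (expT_integrable_height (u := u) (u.gapAbscissa m) u.leftAbscissa ε lam) h₂ h₁
  have o6 := isBigO_down hc hlam hε h₁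
  simp only [loop, loopInt]
  split_ifs with hm
  · have o7 := isBigO_vInt (E := u.expP ε lam) (x' := x')
      (by simpa using (IsTest.const (u := u) 1).intervalIntegrable_well hc hε hm lam) h₃
    exact ((o1.add o2).add o7).sub o6
  · exact (((o1.add o3).add o4).add (o5.const_mul_left _)).add (o6.const_mul_left _)

/-- The quotient is the monodromy `e^{2πiγₘ/ε}` of the single pole `zₘ`, equal to `1` only if `γₘ/ε`
is an integer, which is the exceptional case. -/
lemma IsPosImag.one_sub_ne_zero (hc : u.IsPosImag) (hε : 0 < ε) {m : Fin P}
    (hm : ¬ u.IsExceptional ε m) {x₁ : ℝ} (hx₁ : x₁ < (u.z m).re)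
    (hx₁' : ∀ p < m, (u.z p).re < x₁) :
    1 - u.mon ε (u.gapAbscissa m) / u.mon ε x₁ ≠ 0 := by
  intro h
  rw [sub_eq_zero, mon, mon, ← Complex.exp_sub, ← sub_div, ← mul_sub, ← Finset.sum_sub_distrib,
    Finset.sum_eq_single m, if_pos (re_lt_gapAbscissa m), if_neg hx₁.not_gt, sub_zero, eq_comm,
    Complex.exp_eq_one_iff] at h
  · obtain ⟨n, hn⟩ := h
    have hε' : (ε : ℂ) ≠ 0 := by exact_mod_cast hε.ne'
    have hπ : (Real.pi : ℂ) ≠ 0 := by exact_mod_cast Real.pi_ne_zero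
    have h1 : (u.gam m : ℂ) / ε = n := by
      rw [hc.c_eq] at hn
      have h2 : (2 * Real.pi * Complex.I) * (u.gam m / ε) = (2 * Real.pi * Complex.I) * n := by
        rw [mul_comm _ (n : ℂ), ← hn]
        ring_nf
        simp only [show Complex.I ^ 3 = -Complex.I by rw [pow_succ, Complex.I_sq]; ring]
        ring
      exact mul_left_cancel₀ (by simp [hπ]) h2
    have h3 : u.gam m / ε = n := by exact_mod_cast h1
    have h4 : (0 : ℝ) < n := by rw [← h3]; exact div_pos (hc.gam_pos m) hε
    have h5 : 0 < n := by exact_mod_cast h4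
    refine hm ⟨n.toNat, by omega, ?_⟩
    have h6 : ((n.toNat : ℕ) : ℂ) = n := by exact_mod_cast Int.toNat_of_nonneg h5.le
    rw [h6, ← h1, hc.c_eq, ← mul_assoc, Complex.I_mul_I]
    ring
  · intro p _ hp
    rcases lt_or_gt_of_ne hp with h1 | h1
    · have h2 := hx₁' p h1
      rw [if_pos h2, if_pos (h2.trans (hx₁.trans (re_lt_gapAbscissa m))), sub_self]
    · have h2 : (u.z m).re < (u.z p).re := u.z_re_strictMono h1
      rw [if_neg (gapAbscissa_lt_re h1).not_gt, if_neg (hx₁.trans h2).not_gt, sub_self]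
  · simp

/-- The behaviour of `e^{-ih/ε}` to the left of the well `zₘ`. -/
lemma IsPosImag.expP_left_well (hc : u.IsPosImag) (ε lam : ℝ) (m : Fin P) :
    ∃ K : ℂ → ℂ, AnalyticAt ℂ K (u.z m) ∧ K (u.z m) ≠ 0 ∧ ∀ x < (u.z m).re,
      u.expP ε lam (x + (u.z m).im * Complex.I) =
        (((u.z m).re - x) ^ (u.gam m / ε) : ℝ) * K (x + (u.z m).im * Complex.I) := by
  set fm : ℂ → ℂ := fun w =>
    ∑ p ∈ Finset.univ.erase m, u.c p * (Complex.log (Complex.I * (w - u.z p)) + Real.pi * Complex.I / 2) +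
    ∑ p, conj (u.c p) * (Complex.log (-Complex.I * (w - conj (u.z p))) - Real.pi * Complex.I / 2)
    with hfm
  have hfc : AnalyticAt ℂ fm (u.z m) := by
    refine (Finset.analyticAt_fun_sum _ fun p hp => ?_).add (Finset.analyticAt_fun_sum _ fun p _ => ?_)
    · have h1 : Complex.I * (u.z m - u.z p) ∈ Complex.slitPlane := by
        rw [Complex.mem_slitPlane_iff]
        right
        have := re_eq_iff (u := u).not.2 (Finset.ne_of_mem_erase hp).symm
        simpa [sub_eq_zero] using this
      exact analyticAt_const.mul (((analyticAt_const.mul (analyticAt_id.sub analyticAt_const)).clog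
        h1).add analyticAt_const)
    · have h1 : -Complex.I * (u.z m - conj (u.z p)) ∈ Complex.slitPlane := by
        rw [Complex.mem_slitPlane_iff]
        left
        have h1 := u.z_im_pos m
        have h2 := u.z_im_pos p
        simp
        linarith
      exact analyticAt_const.mul (((analyticAt_const.mul (analyticAt_id.sub analyticAt_const)).clog
        h1).sub analyticAt_const)
  refine ⟨fun w => Complex.exp (-Complex.I * lam * w / ε) * Complex.exp (-Complex.I * fm w / ε),
    ((analyticAt_const.mul analyticAt_id).mul (analyticAt_const (v := (ε : ℂ)⁻¹))).cexp.mul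
      ((analyticAt_const.mul hfc).mul (analyticAt_const (v := (ε : ℂ)⁻¹))).cexp,
    mul_ne_zero (Complex.exp_ne_zero _) (Complex.exp_ne_zero _), fun x hx => ?_⟩
  set w : ℂ := x + (u.z m).im * Complex.I with hw
  have hs : 0 < (u.z m).re - x := sub_pos.2 hx
  have hf : u.f w = u.c m * (Real.log ((u.z m).re - x) : ℂ) + fm w := by
    rw [f, hfm, Finset.sum_add_distrib, ← Finset.add_sum_erase _ _ (Finset.mem_univ m)]
    have h1 : Complex.I * (w - u.z m) = (((u.z m).re - x : ℝ) : ℂ) * -Complex.I := by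
      apply Complex.ext <;> simp [hw]
    have h2 : Complex.log (-Complex.I) = -(Real.pi / 2) * Complex.I := Complex.log_neg_I
    rw [h1, Complex.log_ofReal_mul hs (neg_ne_zero.2 Complex.I_ne_zero), h2]
    ring
  have hpow : (((u.z m).re - x) ^ (u.gam m / ε) : ℝ) =
      Real.exp (Real.log ((u.z m).re - x) * (u.gam m / ε)) := Real.rpow_def_of_pos hs _
  rw [expP, princ, hf, hpow, hc.c_eq, mul_left_comm, Complex.ofReal_exp, ← Complex.exp_add, ← Complex.exp_add,
    ← Complex.exp_add]
  congr 1
  push_cast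
  ring_nf
  simp only [Complex.I_sq]
  ring

/-- On the window from `x₂ - 1/κ` to `x₂ - 1/(2κ)` the exponential is at least `e^{κx₂ - 1}` and the
power at least `(1/(2κ))^a`. -/
lemma le_integral_exp_mul_rpow {x₁ x₂ a κ : ℝ} (ha : 0 < a) (hκ : 0 < κ) (h : 1 / κ ≤ x₂ - x₁) :
    Real.exp (κ * x₂) * (Real.exp (-1) * (1 / (2 * κ)) ^ a * (1 / (2 * κ))) ≤
      ∫ x in x₁..x₂, Real.exp (κ * x) * (x₂ - x) ^ a := by
  have hcont : Continuous fun x : ℝ => Real.exp (κ * x) * (x₂ - x) ^ a :=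
    (by fun_prop : Continuous fun x : ℝ => Real.exp (κ * x)).mul
      ((continuous_const.sub continuous_id).rpow_const fun _ => Or.inr ha.le)
  have h2 : 1 / (2 * κ) = 1 / κ - 1 / (2 * κ) := by field_simp; norm_num
  have hpos : 0 < 1 / (2 * κ) := by positivity
  calc Real.exp (κ * x₂) * (Real.exp (-1) * (1 / (2 * κ)) ^ a * (1 / (2 * κ)))
      = ∫ x in (x₂ - 1 / κ)..(x₂ - 1 / (2 * κ)), Real.exp (κ * x₂) * (Real.exp (-1) *
          (1 / (2 * κ)) ^ a) := by
        rw [intervalIntegral.integral_const, smul_eq_mul, sub_sub_sub_cancel_left, ← h2]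
        ring
    _ ≤ ∫ x in (x₂ - 1 / κ)..(x₂ - 1 / (2 * κ)), Real.exp (κ * x) * (x₂ - x) ^ a := by
        refine intervalIntegral.integral_mono_on (by linarith)
          intervalIntegrable_const (hcont.intervalIntegrable _ _) fun x hx => ?_
        rw [← mul_assoc, ← Real.exp_add]
        have h3 : κ * x₂ + -1 ≤ κ * x := by
          have := mul_le_mul_of_nonneg_left hx.1 hκ.le
          rw [mul_sub, mul_one_div_cancel hκ.ne'] at this
          linarith
        have h4 : 1 / (2 * κ) ≤ x₂ - x := by linarith [hx.2]
        gcongr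
    _ ≤ _ := by
        refine intervalIntegral.integral_mono_interval (by linarith) (by linarith) (by linarith) ?_
          (hcont.intervalIntegrable _ _)
        refine (ae_restrict_iff' measurableSet_Ioc).2 (ae_of_all _ fun x hx => ?_)
        exact mul_nonneg (Real.exp_pos _).le (Real.rpow_nonneg (by linarith [hx.2]) _)

/-- Near its right end the integrand is `(Re zₘ - x)^a K` with `K ≠ 0`, so the integral is at least
a constant times `e^{κ Re zₘ} κ^{-a-1}`. -/
lemma IsPosImag.exists_not_isBigO (hc : u.IsPosImag) (hε : 0 < ε) (lam : ℝ) (m : Fin P) :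
    ∀ᶠ x₁ in 𝓝[<] (u.z m).re, ¬ (fun κ : ℝ =>
      hInt (fun w => Complex.exp (κ * w) * u.expP ε lam w) (u.z m).im x₁ (u.z m).re) =O[atTop]
      fun κ => Real.exp (κ * x₁) := by
  obtain ⟨K, hK, hK0, hKe⟩ := hc.expP_left_well ε lam m
  set z := u.z m with hz
  set a := u.gam m / ε with ha
  have ha0 : 0 < a := div_pos (hc.gam_pos m) hε
  have hK0' := norm_pos_iff.2 hK0
  obtain ⟨r, hr, hrK⟩ := Metric.eventually_nhds_iff.1 (hK.eventually_continuousAt.and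
    (hK.continuousAt.eventually (Metric.ball_mem_nhds _ (half_pos hK0'))))
  have hline : ∀ x ∈ Set.Ioc (z.re - r) z.re, dist (x + z.im * Complex.I : ℂ) z < r := by
    intro x hx
    have h1 : (x + z.im * Complex.I : ℂ) - z = ((x - z.re : ℝ) : ℂ) := by
      apply Complex.ext <;> simp
    rw [dist_eq_norm, h1, Complex.norm_real, Real.norm_eq_abs, abs_lt]
    constructor <;> linarith [hx.1, hx.2]
  filter_upwards [Ioo_mem_nhdsLT (sub_lt_self z.re hr)] with x₁ hx₁ hO
  obtain ⟨C, hC⟩ := hO.bound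
  have hd : 0 < z.re - x₁ := sub_pos.2 hx₁.2
  have hlow : ∀ᶠ κ : ℝ in atTop, ‖K z‖ / 2 * (Real.exp (κ * z.re) * (Real.exp (-1) *
      (1 / (2 * κ)) ^ a * (1 / (2 * κ)))) ≤ ‖hInt (fun w => Complex.exp (κ * w) * u.expP ε lam w)
        z.im x₁ z.re‖ := by
    filter_upwards [eventually_ge_atTop (1 / (z.re - x₁)), eventually_gt_atTop 0] with κ h1 h2
    refine (mul_le_mul_of_nonneg_left (le_integral_exp_mul_rpow ha0 h2
      (by rw [div_le_iff₀ h2, ← div_le_iff₀' hd]; exact h1)) (by positivity)).trans ?_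
    set φ : ℝ → ℝ := fun x => Real.exp (κ * x) * (z.re - x) ^ a with hφ
    have hφc : Continuous φ :=
      (by fun_prop : Continuous fun x : ℝ => Real.exp (κ * x)).mul
        ((continuous_const.sub continuous_id).rpow_const fun _ => Or.inr ha0.le)
    have hφn : ∀ x ∈ Set.Ioc x₁ z.re, 0 ≤ φ x := fun x hx =>
      mul_nonneg (Real.exp_pos _).le (Real.rpow_nonneg (by linarith [hx.2]) _)
    have hae : ∀ᵐ x : ℝ, x ≠ z.re := by simp [ae_iff]
    -- After the unimodular phase is removed, `K` is replaced by its value at `zₘ`; on the chosen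
    -- segment the error is at most half the main term.
    have hJ : Complex.exp (-(κ * (z.im * Complex.I))) *
        hInt (fun w => Complex.exp (κ * w) * u.expP ε lam w) z.im x₁ z.re -
        K z * ((∫ x in x₁..z.re, φ x : ℝ) : ℂ) =
        ∫ x in x₁..z.re, (φ x : ℂ) * (K (x + z.im * Complex.I) - K z) := by
      have hφc' : Continuous fun x => (φ x : ℂ) := Complex.continuous_ofReal.comp hφc
      have hi : IntervalIntegrable (fun x : ℝ => (φ x : ℂ) * K (x + z.im * Complex.I)) volume
          x₁ z.re := by
        refine ContinuousOn.intervalIntegrable fun x hx => ContinuousAt.continuousWithinAt ?_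
        rw [Set.uIcc_of_le hx₁.2.le] at hx
        exact hφc'.continuousAt.mul (ContinuousAt.comp (f := fun x : ℝ => (x : ℂ) + z.im * Complex.I)
          (hrK (hline x ⟨hx₁.1.trans_le hx.1, hx.2⟩)).1 (by fun_prop))
      have hi₂ : IntervalIntegrable (fun x : ℝ => (φ x : ℂ) * K z) volume x₁ z.re :=
        (hφc'.mul continuous_const).intervalIntegrable _ _
      simp only [mul_sub]
      rw [intervalIntegral.integral_sub hi hi₂,
        intervalIntegral.integral_mul_const, intervalIntegral.integral_ofReal, mul_comm (K z), hInt,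
        ← intervalIntegral.integral_const_mul]
      congr 1
      refine intervalIntegral.integral_congr_ae ?_
      filter_upwards [hae] with x h3 h4
      rw [Set.uIoc_of_le hx₁.2.le] at h4
      rw [hKe x (lt_of_le_of_ne h4.2 h3), hφ]
      push_cast
      rw [← mul_assoc, ← Complex.exp_add]
      ring_nf
    have hb : ‖∫ x in x₁..z.re, (φ x : ℂ) * (K (x + z.im * Complex.I) - K z)‖ ≤
        ∫ x in x₁..z.re, φ x * (‖K z‖ / 2) := by
      refine intervalIntegral.norm_integral_le_of_norm_le hx₁.2.le ?_
        ((hφc.mul continuous_const).intervalIntegrable _ _)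
      refine ae_of_all _ fun x h4 => ?_
      rw [norm_mul, Complex.norm_real, Real.norm_eq_abs, abs_of_nonneg (hφn x h4)]
      have h5 : ‖K (x + z.im * Complex.I) - K z‖ ≤ ‖K z‖ / 2 :=
        (mem_ball_iff_norm.1 (hrK (hline x ⟨hx₁.1.trans h4.1, h4.2⟩)).2).le
      exact mul_le_mul_of_nonneg_left h5 (hφn x h4)
    rw [← hJ, intervalIntegral.integral_mul_const] at hb
    have h6 : ‖Complex.exp (-(κ * (z.im * Complex.I)))‖ = 1 := by
      rw [Complex.norm_exp]; simp
    have h7 := norm_sub_norm_le (K z * ((∫ x in x₁..z.re, φ x : ℝ) : ℂ))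
      (Complex.exp (-(κ * (z.im * Complex.I))) *
        hInt (fun w => Complex.exp (κ * w) * u.expP ε lam w) z.im x₁ z.re)
    rw [norm_sub_rev, norm_mul, norm_mul, h6, one_mul, Complex.norm_real, Real.norm_eq_abs] at h7
    have h8 := mul_le_mul_of_nonneg_left (le_abs_self (∫ x in x₁..z.re, φ x)) hK0'.le
    linarith
  -- The surplus exponential `e^{κ(Re zₘ - x₁)}` outgrows `κ^{a+1}`.
  have hT := tendsto_exp_mul_div_rpow_atTop (a + 1) (z.re - x₁) hd
  set A := ‖K z‖ / 2 * (Real.exp (-1) * (1 / 2) ^ a * (1 / 2)) with hA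
  have hA0 : 0 < A := by positivity
  obtain ⟨κ, ⟨⟨h1, h2⟩, h3⟩, h4⟩ := (((hC.and hlow).and (hT.eventually_gt_atTop (C / A))).and
    (eventually_gt_atTop 0)).exists
  have h5 := h2.trans h1
  rw [Real.norm_eq_abs, Real.abs_exp] at h5
  have h6 : ‖K z‖ / 2 * (Real.exp (κ * z.re) * (Real.exp (-1) * (1 / (2 * κ)) ^ a * (1 / (2 * κ)))) =
      A * (Real.exp ((z.re - x₁) * κ) / κ ^ (a + 1)) * Real.exp (κ * x₁) := by
    have e1 : Real.exp (κ * z.re) = Real.exp ((z.re - x₁) * κ) * Real.exp (κ * x₁) := by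
      rw [← Real.exp_add]; congr 1; ring
    have e2 : (1 / (2 * κ)) ^ a = (1 / 2) ^ a / κ ^ a := by
      rw [← Real.div_rpow (by norm_num) h4.le, div_div]
    rw [e1, e2, hA, Real.rpow_add_one h4.ne']
    field_simp
  rw [h6] at h5
  have h7 := le_of_mul_le_mul_right h5 (Real.exp_pos _)
  rw [div_lt_iff₀' hA0] at h3
  linarith

-- By the deformation, all of the `m`-th loop except the segment ending at `zₘ` lies to the left of
-- `x₁`, and the coefficient of that segment is not zero.
open scoped Classical in
lemma not_isBigO_loop (hc : u.IsPosImag) (hlam : 0 < lam) (hε : 0 < ε) (m : Fin P) :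
    ∀ᶠ x₁ in 𝓝[<] (u.z m).re, ¬ (fun κ : ℝ => u.loop ε lam m fun w => Complex.exp (κ * w)) =O[atTop]
      fun κ => Real.exp (κ * x₁) := by
  have h1 : ∀ᶠ x in 𝓝[<] (u.z m).re, ∀ p < m, (u.z p).re < x := by
    refine eventually_all.2 fun p => ?_
    by_cases hp : p < m
    · have : (u.z p).re < (u.z m).re := u.z_re_strictMono hp
      filter_upwards [Ioo_mem_nhdsLT this] with x hx _ using hx.1
    · exact Eventually.of_forall fun x h => absurd h hp
  filter_upwards [hc.exists_not_isBigO hε lam m, h1, Ioo_mem_nhdsLT (leftAbscissa_lt m),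
    self_mem_nhdsWithin] with x₁ h2 h3 h4 (h5 : x₁ < _) hO
  have hne : ∀ p, x₁ ≠ (u.z p).re := by
    intro p
    rcases lt_or_ge p m with h | h
    · exact (h3 p h).ne'
    · have : (u.z m).re ≤ (u.z p).re := u.z_re_strictMono.monotone h
      exact (h5.trans_le this).ne
  have o1 := isBigO_vInt (x' := x₁) (expP_integrable_vertical leftAbscissa_ne_re u.height 0 ε lam)
    h4.1.le
  have o2 := isBigO_hInt (expP_integrable_zero (u := u) u.leftAbscissa x₁ ε lam) h4.1.le le_rfl
  have o3 := isBigO_vInt (expP_integrable_vertical hne 0 (u.z m).im ε lam) le_rfl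
  have o4 := isBigO_down hc hlam hε h4.1.le
  have o5 := isBigO_hInt (expT_integrable_height (u := u) x₁ u.leftAbscissa ε lam) le_rfl h4.1.le
  have o6 := isBigO_vInt (x' := x₁) (intervalIntegrable_vertical (F := u.expT ε lam) (x := x₁)
    (a := (u.z m).im) (b := u.height) fun y _ =>
      (hasDerivAt_expT (fun p => Or.inl (by simpa using hne p)) ε lam).continuousAt) le_rfl
  have hdef : ∀ κ : ℝ, _ := fun κ => loop_deform hc hε lam (g := fun w => Complex.exp (κ * w))
    (by fun_prop) h5 h3
  simp only [hdef] at hO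
  split_ifs at hO with hm
  · refine h2 ?_
    have := hO.sub (((o1.add o2).add o3).sub o4)
    simpa using this
  · refine h2 ?_
    have := (hO.sub (((((o1.add o2).add o3).add (o6.const_mul_left
      (u.mon ε (u.gapAbscissa m)))).add (o5.const_mul_left (u.mon ε (u.gapAbscissa m)))).add
      (o4.const_mul_left (u.mon ε (u.gapAbscissa m) - 1)))).const_mul_left
      (1 - u.mon ε (u.gapAbscissa m) / u.mon ε x₁)⁻¹
    refine this.congr_left fun κ => ?_
    have h6 := hc.one_sub_ne_zero hε hm h5 h3
    rw [add_sub_cancel_left, inv_mul_cancel_left₀ h6]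

/-- In a linear relation let `m` be the last index with nonzero coefficient. The earlier loops lie
to the left of some `x₁ < Re zₘ`, so on `e^{κw}` they are `O(e^{κx₁})`, and the `m`-th one is not.
-/
theorem linearIndependent_loop (hc : u.IsPosImag) (hlam : 0 < lam) (hε : 0 < ε) :
    LinearIndependent ℂ fun m => loopLinear hc hlam hε m := by
  rw [Fintype.linearIndependent_iff]
  intro α hα
  by_contra! hne
  have hne' : (Finset.univ.filter fun m => α m ≠ 0).Nonempty := by
    obtain ⟨m, hm⟩ := hne
    exact ⟨m, by simpa using hm⟩
  set m := (Finset.univ.filter fun m => α m ≠ 0).max' hne' with hmdef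
  have hm : α m ≠ 0 := by
    have := Finset.max'_mem _ hne'
    simpa using this
  have hmax : ∀ p, m < p → α p = 0 := by
    intro p hp
    by_contra h
    exact absurd (Finset.le_max' (Finset.univ.filter fun m => α m ≠ 0) p (by simpa using h)) hp.not_ge
  have h1 : ∀ᶠ x in 𝓝[<] (u.z m).re, ∀ p < m, u.gapAbscissa p ≤ x := by
    refine eventually_all.2 fun p => ?_
    by_cases hp : p < m
    · filter_upwards [Ioo_mem_nhdsLT (gapAbscissa_lt_re (u := u) hp)] with x hx _ using hx.1.le
    · exact Eventually.of_forall fun x h => absurd h hp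
  obtain ⟨x₁, ⟨h2, h3⟩, h4⟩ := (((not_isBigO_loop hc hlam hε m).and h1).and
    (Ioo_mem_nhdsLT (leftAbscissa_lt m))).exists
  refine h2 ?_
  have hsum : (fun κ : ℝ => ∑ p ∈ Finset.univ.erase m, α p *
      u.loop ε lam p fun w => Complex.exp (κ * w)) =O[atTop] fun κ => Real.exp (κ * x₁) := by
    refine Asymptotics.IsBigO.fun_sum (E' := ℂ) fun p hp => ?_
    rcases lt_or_gt_of_ne (Finset.ne_of_mem_erase hp) with h | h
    · exact (isBigO_loop hc hlam hε h4.1.le (h3 p h)).const_mul_left _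
    · simp only [hmax p h, zero_mul]
      exact Asymptotics.isBigO_zero (E' := ℂ) _ _
  refine Asymptotics.IsBigO.congr' (hsum.const_mul_left (-(α m)⁻¹)) ?_ EventuallyEq.rfl
  filter_upwards [eventually_ge_atTop 0] with κ hκ
  have := LinearMap.congr_fun hα ⟨fun w => Complex.exp (κ * w), isTest_exp hκ⟩
  simp only [LinearMap.coe_sum, Finset.sum_apply, LinearMap.smul_apply, smul_eq_mul,
    LinearMap.zero_apply] at this
  rw [← Finset.add_sum_erase _ _ (Finset.mem_univ m)] at this
  have h5 : α m * u.loop ε lam m (fun w => Complex.exp (κ * w)) + ∑ p ∈ Finset.univ.erase m, α p *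
      u.loop ε lam p (fun w => Complex.exp (κ * w)) = 0 := this
  rw [eq_neg_of_add_eq_zero_right h5]
  field_simp

end BenjaminOno.RationalPotential

namespace BenjaminOno.RationalPotential

variable {P : ℕ} {u : RationalPotential P} {lam ε ρ c : ℝ} {g yi y : ℂ → ℂ}

/-! ### Analytic dependence of the integrals on the spectral parameter -/

/-- Half of the slack `e^{r|t|}` absorbs a perturbation of the exponent by less than `r/2`, the
other half the factor `t` from differentiation. -/
lemma differentiableAt_integral_exp {ν : Measure ℝ} {φ : ℝ → ℂ} {b : ℂ} {r : ℝ} (hr : 0 < r)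
    (h : Integrable (fun t => φ t * Complex.exp (b * t) * Real.exp (r * |t|)) ν) :
    DifferentiableAt ℂ (fun z => ∫ t, φ t * Complex.exp (z * t) ∂ν) b := by
  have hφ : AEStronglyMeasurable φ ν := by
    have h1 : Continuous fun t : ℝ => Complex.exp (-b * t) * Real.exp (-(r * |t|)) := by fun_prop
    refine (h.aestronglyMeasurable.mul h1.aestronglyMeasurable).congr (ae_of_all _ fun t => ?_)
    have : φ t * Complex.exp (b * t) * Real.exp (r * |t|) *
        (Complex.exp (-b * t) * Real.exp (-(r * |t|))) = φ t * (Complex.exp (b * t) *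
          Complex.exp (-b * t)) * ((Real.exp (r * |t|) * Real.exp (-(r * |t|)) : ℝ) : ℂ) := by
      push_cast; ring
    simp only [Pi.mul_apply]
    rw [this, ← Complex.exp_add, ← Real.exp_add]
    simp
  have hm : ∀ z : ℂ, AEStronglyMeasurable (fun t : ℝ => φ t * Complex.exp (z * t)) ν := fun z =>
    hφ.mul (by fun_prop : Continuous fun t : ℝ => Complex.exp (z * t)).aestronglyMeasurable
  refine (hasDerivAt_integral_of_dominated_loc_of_deriv_le (𝕜 := ℂ)
    (F := fun z t => φ t * Complex.exp (z * t)) (F' := fun z t => φ t * Complex.exp (z * t) * t)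
    (bound := fun t => 2 / r * ‖φ t * Complex.exp (b * t) * Real.exp (r * |t|)‖)
    (Metric.ball_mem_nhds b (half_pos hr)) (Eventually.of_forall hm) ?_
    ((hm b).mul Complex.continuous_ofReal.aestronglyMeasurable) (ae_of_all _ fun t z hz => ?_)
    (h.norm.const_mul _) (ae_of_all _ fun t z _ => ?_)).2.differentiableAt
  · refine h.mono (hm b) (ae_of_all _ fun t => ?_)
    rw [norm_mul _ (Real.exp _ : ℂ), Complex.norm_real, Real.norm_eq_abs, Real.abs_exp]
    exact le_mul_of_one_le_right (norm_nonneg _) (Real.one_le_exp (by positivity))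
  · have h1 : Complex.exp (z * t) = Complex.exp (b * t) * Complex.exp ((z - b) * t) := by
      rw [← Complex.exp_add]; ring_nf
    have h2 : ‖Complex.exp ((z - b) * t)‖ ≤ Real.exp (r / 2 * |t|) := by
      rw [Complex.norm_exp, Real.exp_le_exp]
      refine (Complex.re_le_norm _).trans ?_
      rw [norm_mul, Complex.norm_real, Real.norm_eq_abs]
      exact mul_le_mul_of_nonneg_right (mem_ball_iff_norm.1 hz).le (abs_nonneg _)
    have h3 : |t| ≤ 2 / r * Real.exp (r / 2 * |t|) := by
      rw [div_mul_eq_mul_div, le_div_iff₀ hr]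
      linarith [Real.add_one_le_exp (r / 2 * |t|)]
    have h4 : Real.exp (r * |t|) = Real.exp (r / 2 * |t|) * Real.exp (r / 2 * |t|) := by
      rw [← Real.exp_add]; ring_nf
    rw [h1, ← mul_assoc]
    simp only [norm_mul, Complex.norm_real, Real.norm_eq_abs, Real.abs_exp]
    rw [h4]
    calc ‖φ t‖ * ‖Complex.exp (b * t)‖ * ‖Complex.exp ((z - b) * t)‖ * |t|
        ≤ ‖φ t‖ * ‖Complex.exp (b * t)‖ * Real.exp (r / 2 * |t|) *
          (2 / r * Real.exp (r / 2 * |t|)) := by gcongr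
      _ = _ := by ring
  · have h1 : HasDerivAt (fun z : ℂ => z * t) (1 * (t : ℂ)) z := (hasDerivAt_id z).mul_const _
    convert! h1.cexp.const_mul (φ t) using 1
    ring

lemma differentiable_intervalIntegral_exp {φ : ℝ → ℂ} {a b : ℝ}
    (h : IntervalIntegrable φ volume a b) :
    Differentiable ℂ fun z : ℂ => ∫ t in a..b, φ t * Complex.exp (z * t) := by
  intro z
  have h1 : IntervalIntegrable (fun t => φ t * Complex.exp (z * t) * Real.exp (1 * |t|)) volume a b :=
    (h.mul_continuousOn (by fun_prop)).mul_continuousOn (by fun_prop)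
  exact (differentiableAt_integral_exp one_pos h1.1).sub (differentiableAt_integral_exp one_pos h1.2)

lemma differentiable_hInt {G : ℂ → ℂ} {y a b : ℝ}
    (h : IntervalIntegrable (fun x : ℝ => G (x + y * Complex.I)) volume a b) (ε : ℝ) :
    Differentiable ℂ fun μ : ℂ => hInt (fun w => G w * Complex.exp (-Complex.I * μ * w / ε)) y a b := by
  have h1 : Differentiable ℂ fun μ : ℂ => Complex.exp (-Complex.I * μ * (y * Complex.I) / ε) *
      (fun z : ℂ => ∫ t in a..b, G (t + y * Complex.I) * Complex.exp (z * t)) (-Complex.I * μ / ε) :=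
    (by fun_prop : Differentiable ℂ fun μ : ℂ => _).mul
      ((differentiable_intervalIntegral_exp h).comp (by fun_prop))
  convert! h1 using 2 with μ
  rw [hInt, ← intervalIntegral.integral_const_mul]
  congr 1 with x
  rw [mul_left_comm, ← Complex.exp_add]
  ring_nf

lemma differentiable_vInt {G : ℂ → ℂ} {x a b : ℝ}
    (h : IntervalIntegrable (fun y : ℝ => G (x + y * Complex.I) * Complex.I) volume a b) (ε : ℝ) :
    Differentiable ℂ fun μ : ℂ => vInt (fun w => G w * Complex.exp (-Complex.I * μ * w / ε)) x a b := by
  have h1 : Differentiable ℂ fun μ : ℂ => Complex.exp (-Complex.I * μ * x / ε) *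
      (fun z : ℂ => ∫ t in a..b, G (x + t * Complex.I) * Complex.I * Complex.exp (z * t))
        (-Complex.I * μ * Complex.I / ε) :=
    (by fun_prop : Differentiable ℂ fun μ : ℂ => _).mul
      ((differentiable_intervalIntegral_exp h).comp (by fun_prop))
  convert! h1 using 2 with μ
  rw [vInt, ← intervalIntegral.integral_const_mul]
  congr 1 with y
  rw [mul_left_comm, ← Complex.exp_add, mul_right_comm]
  ring_nf

/-- The integral of `G e^{-iμw/ε}` over the ray from `w` in direction `d`. -/
noncomputable def rayInt (ε : ℝ) (G : ℂ → ℂ) (w d μ : ℂ) : ℂ :=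
  ∫ t in Set.Ioi (0 : ℝ), G (w + t * d) * Complex.exp (-Complex.I * μ * (w + t * d) / ε) * d

/-- Along the ray the modulus of the exponential changes at rate `Im (μd)/ε < 0`. -/
lemma differentiableAt_rayInt {G : ℂ → ℂ} {w d μ : ℂ} {C : ℝ} (hε : 0 < ε)
    (hG : ∀ t : ℝ, 0 ≤ t → ContinuousAt G (w + t * d) ∧ ‖G (w + t * d)‖ ≤ C)
    (hμ : (μ * d).im < 0) : DifferentiableAt ℂ (rayInt ε G w d) μ := by
  set b : ℂ := -Complex.I * μ * d / ε with hb
  have hbre : b.re = (μ * d).im / ε := by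
    rw [hb, Complex.div_ofReal_re, mul_assoc]; simp
  have hbneg : b.re < 0 := by rw [hbre]; exact div_neg_of_neg_of_pos hμ hε
  have hint : IntegrableOn (fun t : ℝ => G (w + t * d) * Complex.exp (b * t) *
      Real.exp (-b.re / 2 * |t|)) (Set.Ioi 0) := by
    refine integrableOn_Ioi_of_norm_le_exp (C := C) (b := -b.re / 2) (by linarith) ?_ ?_
    · intro t ht
      have h1 : ContinuousAt (fun t : ℝ => G (w + t * d)) t :=
        ContinuousAt.comp (f := fun t : ℝ => w + t * d) (hG t ht).1 (by fun_prop)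
      exact ((h1.mul (by fun_prop)).mul (by fun_prop)).continuousWithinAt
    · filter_upwards [eventually_ge_atTop 0] with t ht
      rw [norm_mul, norm_mul, Complex.norm_real, Real.norm_eq_abs, Real.abs_exp, Complex.norm_exp,
        mul_assoc, ← Real.exp_add, abs_of_nonneg ht]
      refine mul_le_mul (hG t ht).2 (Real.exp_le_exp.2 ?_) (Real.exp_pos _).le
        ((norm_nonneg _).trans (hG t ht).2)
      simp
      linarith
  have h1 := (differentiableAt_integral_exp (by linarith : 0 < -b.re / 2) hint).comp μ
    (f := fun μ : ℂ => -Complex.I * μ * d / ε) (by fun_prop)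
  have h2 : DifferentiableAt ℂ (fun μ : ℂ => Complex.exp (-Complex.I * μ * w / ε) * d) μ := by fun_prop
  refine (h2.mul h1).congr_of_eventuallyEq (Eventually.of_forall fun μ => ?_)
  simp only [rayInt, Pi.mul_apply, Function.comp]
  rw [← integral_const_mul]
  congr 1 with t
  rw [show -Complex.I * μ * (w + t * d) / ε = -Complex.I * μ * w / ε + -Complex.I * μ * d / ε * t by
    ring, Complex.exp_add]
  ring

/-- Rotation of the contour of integration in a quadrant. -/
lemma integral_quadrant {Ψ : ℂ → ℂ} {k : ℂ} {C : ℝ}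
    (hΨ : ∀ x y : ℝ, 0 ≤ x → 0 ≤ y → DifferentiableAt ℂ Ψ (x + y * Complex.I) ∧
      ‖Ψ (x + y * Complex.I)‖ ≤ C) (hre : k.re < 0) (him : 0 < k.im) :
    ∫ x in Set.Ioi (0 : ℝ), Ψ (x + (0 : ℝ) * Complex.I) * Complex.exp (k * (x + (0 : ℝ) * Complex.I)) =
      ∫ y in Set.Ioi (0 : ℝ), Ψ ((0 : ℝ) + y * Complex.I) *
        Complex.exp (k * ((0 : ℝ) + y * Complex.I)) * Complex.I := by
  set F : ℂ → ℂ := fun w => Ψ w * Complex.exp (k * w) with hF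
  have hC : 0 ≤ C := (norm_nonneg _).trans (hΨ 0 0 le_rfl le_rfl).2
  have hFd : ∀ x y : ℝ, 0 ≤ x → 0 ≤ y → DifferentiableAt ℂ F (x + y * Complex.I) := fun x y hx hy =>
    (hΨ x y hx hy).1.mul (by fun_prop)
  have hFn : ∀ x y : ℝ, 0 ≤ x → 0 ≤ y → ‖F (x + y * Complex.I)‖ ≤
      C * Real.exp (- -k.re * x) * Real.exp (-k.im * y) := fun x y hx hy => by
    rw [hF, norm_mul, Complex.norm_exp, mul_assoc, ← Real.exp_add]
    refine mul_le_mul (hΨ x y hx hy).2 (Real.exp_le_exp.2 (le_of_eq ?_)) (Real.exp_pos _).le hC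
    simp
    ring
  have hcont : ∀ x y : ℝ, 0 ≤ x → 0 ≤ y → ContinuousAt F (x + y * Complex.I) := fun x y hx hy =>
    (hFd x y hx hy).continuousAt
  have hle : ∀ a : ℝ, 0 < a → ∀ t : ℝ, 0 ≤ t → Real.exp (-a * t) ≤ 1 := fun a ha t ht =>
    Real.exp_le_one_iff.2 (by nlinarith)
  have hz : ∀ a : ℝ, 0 < a → Tendsto (fun n : ℝ => C * Real.exp (-a * n) * n) atTop (𝓝 0) := by
    intro a ha
    have := (tendsto_rpow_mul_exp_neg_mul_atTop_nhds_zero 1 a ha).const_mul C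
    rw [mul_zero] at this
    refine this.congr fun n => by rw [Real.rpow_one]; ring
  have t1 : Tendsto (fun n : ℝ => hInt F 0 0 n) atTop
      (𝓝 (∫ x in Set.Ioi (0 : ℝ), F (x + (0 : ℝ) * Complex.I))) := by
    refine intervalIntegral_tendsto_integral_Ioi 0 (integrableOn_Ioi_of_norm_le_exp (C := C)
      (neg_pos.2 hre) (fun x hx => (ContinuousAt.comp (f := fun x : ℝ => (x : ℂ) + (0 : ℝ) * Complex.I)
        (hcont x 0 hx le_rfl) (by fun_prop)).continuousWithinAt) ?_) tendsto_id
    filter_upwards [eventually_ge_atTop 0] with x hx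
    simpa using hFn x 0 hx le_rfl
  have t2 : Tendsto (fun n : ℝ => vInt F 0 0 n) atTop
      (𝓝 (∫ y in Set.Ioi (0 : ℝ), F ((0 : ℝ) + y * Complex.I) * Complex.I)) := by
    refine intervalIntegral_tendsto_integral_Ioi 0 (integrableOn_Ioi_of_norm_le_exp (C := C)
      him (fun y hy => ((ContinuousAt.comp (f := fun y : ℝ => ((0 : ℝ) : ℂ) + y * Complex.I)
        (hcont 0 y le_rfl hy) (by fun_prop)).mul continuousAt_const).continuousWithinAt) ?_) tendsto_id
    filter_upwards [eventually_ge_atTop 0] with y hy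
    simpa using hFn 0 y le_rfl hy
  have t3 : Tendsto (fun n : ℝ => hInt F n 0 n) atTop (𝓝 0) := by
    refine squeeze_zero_norm' ?_ (hz _ him)
    filter_upwards [eventually_ge_atTop 0] with n hn
    refine (intervalIntegral.norm_integral_le_of_norm_le_const (C := C * Real.exp (-k.im * n))
      fun x hx => ?_).trans (by rw [sub_zero, abs_of_nonneg hn])
    rw [Set.uIoc_of_le hn] at hx
    refine (hFn x n hx.1.le hn).trans (mul_le_mul_of_nonneg_right ?_ (Real.exp_pos _).le)
    exact mul_le_of_le_one_right hC (hle _ (neg_pos.2 hre) _ hx.1.le)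
  have t4 : Tendsto (fun n : ℝ => vInt F n 0 n) atTop (𝓝 0) := by
    refine squeeze_zero_norm' ?_ (hz _ (neg_pos.2 hre))
    filter_upwards [eventually_ge_atTop 0] with n hn
    refine (intervalIntegral.norm_integral_le_of_norm_le_const (C := C * Real.exp (- -k.re * n))
      fun y hy => ?_).trans (by rw [sub_zero, abs_of_nonneg hn])
    rw [Set.uIoc_of_le hn] at hy
    rw [norm_mul, Complex.norm_I, mul_one]
    exact (hFn n y hn hy.1.le).trans (mul_le_of_le_one_right (by positivity) (hle _ him _ hy.1.le))
  refine tendsto_nhds_unique (t1.congr' ?_) (by simpa using (t2.add t3).sub t4)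
  filter_upwards [eventually_ge_atTop 0] with n hn
  refine eq_sub_of_add_eq (rect_eq_zero hn hn (fun w hw => ?_) fun w h1 h2 => ?_)
  · have := hcont w.re w.im hw.1.1 hw.2.1
    rw [Complex.re_add_im] at this
    exact this.continuousWithinAt
  · have := hFd w.re w.im h1.1.le h2.1.le
    rwa [Complex.re_add_im] at this

/-- Decay on both bounding rays, `Im (μd) < 0` and `Im (μdi) = Re (μd) < 0`, gives decay throughout
the quadrant between them. -/
lemma rayInt_rotate {G : ℂ → ℂ} {w d μ : ℂ} {C : ℝ} (hε : 0 < ε)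
    (hG : ∀ x y : ℝ, 0 ≤ x → 0 ≤ y → DifferentiableAt ℂ G (w + (x + y * Complex.I) * d) ∧
      ‖G (w + (x + y * Complex.I) * d)‖ ≤ C)
    (him : (μ * d).im < 0) (hre : (μ * d).re < 0) :
    rayInt ε G w d μ = rayInt ε G w (d * Complex.I) μ := by
  have hk : ∀ a : ℂ, -Complex.I * μ * (w + a * d) / ε =
      -Complex.I * μ * w / ε + -Complex.I * (μ * d) / ε * a := fun a => by ring
  have := integral_quadrant (Ψ := fun ζ => G (w + ζ * d) * (Complex.exp (-Complex.I * μ * w / ε) * d))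
    (k := -Complex.I * (μ * d) / ε)
    (C := C * ‖Complex.exp (-Complex.I * μ * w / ε) * d‖) (fun x y hx hy => ⟨?_, ?_⟩)
    (by rw [Complex.div_ofReal_re]; exact div_neg_of_neg_of_pos (by simpa using him) hε)
    (by rw [Complex.div_ofReal_im]; exact div_pos (by simpa using hre) hε)
  · convert! this using 1
    · refine setIntegral_congr_fun measurableSet_Ioi fun t _ => ?_
      simp only [hk, Complex.exp_add, Complex.ofReal_zero, zero_mul, add_zero]
      ring
    · refine setIntegral_congr_fun measurableSet_Ioi fun t _ => ?_
      have h1 : (t : ℂ) * (d * Complex.I) = (t * Complex.I) * d := by ring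
      simp only [h1, hk, Complex.exp_add, Complex.ofReal_zero, zero_add]
      ring
  · exact (DifferentiableAt.comp (f := fun ζ => w + ζ * d) _ (hG x y hx hy).1 (by fun_prop)).mul
      (differentiableAt_const _)
  · rw [norm_mul]
    exact mul_le_mul_of_nonneg_right (hG x y hx hy).2 (norm_nonneg _)

end BenjaminOno.RationalPotential

namespace BenjaminOno.RationalPotential

variable {P : ℕ} {u : RationalPotential P} {lam ε ρ c : ℝ} {g yi y : ℂ → ℂ}

/-! ### Analytic continuation of the loop integrals -/

lemma re_lt_of_re_le_left {w : ℂ} (hw : w.re ≤ u.leftAbscissa) (p : Fin P) : w.re ≠ (u.z p).re :=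
  (hw.trans_lt (leftAbscissa_lt p)).ne

lemma mem_cutTop_of_height_le {w : ℂ} (hw : u.height ≤ w.im) : w ∈ u.cutTop := fun p =>
  Or.inr (by linarith [im_add_one_le_height (u := u) p])

lemma IsPosImag.R_le_outer (hc : u.IsPosImag) (lam : ℝ) {w : ℂ}
    (hw : w.re ≤ u.leftAbscissa ∨ u.height ≤ w.im) : u.R lam w ≤ lam * w.im + u.leftBound := by
  rcases hw with hw | hw
  · exact hc.R_le_left lam hw (not_isPole_of_mem_cut fun p => Or.inl (re_lt_of_re_le_left hw p))
  · refine hc.R_le lam one_pos (not_isPole_of_mem_cutTop (mem_cutTop_of_height_le hw)) fun p => ?_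
    refine le_trans ?_ ((le_abs_self _).trans (Complex.abs_im_le_norm (w - conj (u.z p))))
    rw [Complex.sub_im, Complex.conj_im]
    linarith [im_add_one_le_height (u := u) p, u.z_im_pos p]

/-- Test functions that are bounded to the left of the poles and above them. -/
structure IsOuterTest (u : RationalPotential P) (g : ℂ → ℂ) (C : ℝ) : Prop where
  test : u.IsTest g
  bound : ∀ w : ℂ, w.re ≤ u.leftAbscissa ∨ u.height ≤ w.im → ‖g w‖ ≤ C

lemma IsOuterTest.left (hc : u.IsPosImag) (hε : 0 < ε) {C : ℝ} (hg : u.IsOuterTest g C) {w : ℂ}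
    (hw : w.re ≤ u.leftAbscissa) : DifferentiableAt ℂ (fun w => g w * u.princ ε w) w ∧
      ‖g w * u.princ ε w‖ ≤ C * Real.exp (u.leftBound / ε) := by
  have h1 : w ∈ u.cut := fun p => Or.inl (re_lt_of_re_le_left hw p)
  refine ⟨(hg.test.diff w (ne_z_of_not_isPole (not_isPole_of_mem_cut h1))).mul
    (((hasDerivAt_f h1).differentiableAt.const_mul _).div_const _).cexp, ?_⟩
  rw [norm_mul, norm_princ]
  have h2 := hc.R_le_outer 0 (Or.inl hw)
  rw [zero_mul, zero_add] at h2
  have h3 := hg.bound w (Or.inl hw)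
  have h4 := (norm_nonneg _).trans h3
  gcongr

lemma IsOuterTest.above (hc : u.IsPosImag) (hε : 0 < ε) {C : ℝ} (hg : u.IsOuterTest g C) {w : ℂ}
    (hw : u.height ≤ w.im) : DifferentiableAt ℂ (fun w => g w * u.top ε w) w ∧
      ‖g w * u.top ε w‖ ≤ C * Real.exp (u.leftBound / ε) := by
  have h1 := mem_cutTop_of_height_le hw
  refine ⟨(hg.test.diff w (ne_z_of_not_isPole (not_isPole_of_mem_cutTop h1))).mul
    (((hasDerivAt_fTop h1).differentiableAt.const_mul _).div_const _).cexp, ?_⟩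
  rw [norm_mul, hc.norm_top]
  have h2 := hc.R_le_outer 0 (Or.inr hw)
  rw [zero_mul, zero_add] at h2
  have h3 := hg.bound w (Or.inr hw)
  have h4 := (norm_nonneg _).trans h3
  gcongr

lemma mon_left (ε : ℝ) : u.mon ε u.leftAbscissa = 1 := by
  rw [mon, Finset.sum_eq_zero fun p _ => if_neg (leftAbscissa_lt p).not_gt]
  simp

lemma corner_re : u.corner.re = u.leftAbscissa := by simp [corner]

lemma corner_im : u.corner.im = u.height := by simp [corner]

variable (u) in
/-- The integral from the corner to infinity, for spectral parameters off `[0, ∞)`. -/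
noncomputable def tail (ε : ℝ) (g : ℂ → ℂ) (μ : ℂ) : ℂ :=
  if μ.re < 0 then rayInt ε (fun w => g w * u.princ ε w) u.corner Complex.I μ
  else if 0 < μ.im then rayInt ε (fun w => g w * u.princ ε w) u.corner (-1) μ
  else rayInt ε (fun w => g w * u.top ε w) u.corner 1 μ

section Tail

variable {C : ℝ} {μ : ℂ}

/-- Where both rays converge, the one to `i∞` can be turned into the one to `-∞` in a quadrant to
the left of the poles. So the pieces defining the tail agree on overlaps. -/
lemma tail_of_im_pos (hc : u.IsPosImag) (hε : 0 < ε) (hg : u.IsOuterTest g C) (hμ : 0 < μ.im) :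
    u.tail ε g μ = rayInt ε (fun w => g w * u.princ ε w) u.corner (-1) μ := by
  rw [tail]
  split_ifs with h
  · rw [rayInt_rotate hε (fun x y hx hy => hg.left hc hε (by simp [corner_re, hy]))
      (by simpa using h) (by simpa using hμ), Complex.I_mul_I]
  · rfl

/-- Here the ray turns to `+∞` above all poles, where the upper branch is analytic; the branches
coincide on the starting ray. -/
lemma tail_of_im_neg (hc : u.IsPosImag) (hε : 0 < ε) (hg : u.IsOuterTest g C) (hμ : μ.im < 0) :
    u.tail ε g μ = rayInt ε (fun w => g w * u.top ε w) u.corner 1 μ := by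
  rw [tail]
  split_ifs with h h'
  · rw [rayInt_rotate hε (fun x y hx hy => hg.above hc hε (by simp [corner_im, hy]))
      (by simpa using hμ) (by simpa using h), one_mul, rayInt, rayInt]
    refine setIntegral_congr_fun measurableSet_Ioi fun t _ => ?_
    have h1 : (u.corner + t * Complex.I).re = u.leftAbscissa := by simp [corner_re]
    simp only [princ_eq (u := u) (w := u.corner + t * Complex.I)
      (fun p => re_lt_of_re_le_left h1.le p) ε, h1, mon_left, one_mul]
  · exact absurd h' hμ.not_gt
  · rfl

/-- A second quarter turn, from `-∞` to `-i∞`; the resulting integral still converges at `lam > 0`.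
-/
lemma tail_eq_down (hc : u.IsPosImag) (hε : 0 < ε) (hg : u.IsOuterTest g C) (hμ : 0 < μ.im)
    (hμ' : 0 < μ.re) :
    u.tail ε g μ = rayInt ε (fun w => g w * u.princ ε w) u.corner (-Complex.I) μ := by
  rw [tail_of_im_pos hc hε hg hμ, rayInt_rotate hε
    (fun x y hx hy => hg.left hc hε (by simp [corner_re, hx])) (by simpa using hμ)
    (by simpa using hμ'), neg_one_mul]

lemma differentiableAt_rayInt_left (hc : u.IsPosImag) (hε : 0 < ε) (hg : u.IsOuterTest g C) {d : ℂ}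
    (hd : d.re ≤ 0) (hμ : (μ * d).im < 0) :
    DifferentiableAt ℂ (rayInt ε (fun w => g w * u.princ ε w) u.corner d) μ :=
  differentiableAt_rayInt hε (fun t ht =>
    have h := hg.left hc hε (w := u.corner + t * d)
      (by simpa [corner_re] using mul_nonpos_of_nonneg_of_nonpos ht hd)
    ⟨h.1.continuousAt, h.2⟩) hμ

lemma differentiableAt_tail (hc : u.IsPosImag) (hε : 0 < ε) (hg : u.IsOuterTest g C)
    (hμ : ¬ (μ.im = 0 ∧ 0 ≤ μ.re)) : DifferentiableAt ℂ (u.tail ε g) μ := by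
  rcases lt_trichotomy μ.im 0 with h | h | h
  · refine (differentiableAt_rayInt (C := C * Real.exp (u.leftBound / ε))
      (G := fun w => g w * u.top ε w) (w := u.corner) (d := 1) hε
      (fun t ht => ?_) (by simpa using h)).congr_of_eventuallyEq ?_
    · have h := hg.above hc hε (w := u.corner + t * 1) (by simp [corner_im])
      exact ⟨h.1.continuousAt, h.2⟩
    · filter_upwards [(isOpen_lt Complex.continuous_im continuous_const).mem_nhds h] with ν hν
      exact tail_of_im_neg hc hε hg hν
  · have h' : μ.re < 0 := lt_of_not_ge fun h' => hμ ⟨h, h'⟩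
    refine (differentiableAt_rayInt_left hc hε hg (d := Complex.I) (by simp)
      (by simpa using h')).congr_of_eventuallyEq ?_
    filter_upwards [(isOpen_lt Complex.continuous_re continuous_const).mem_nhds h'] with ν hν
    exact if_pos hν
  · refine (differentiableAt_rayInt_left hc hε hg (d := -1) (by simp)
      (by simpa using h)).congr_of_eventuallyEq ?_
    filter_upwards [(isOpen_lt continuous_const Complex.continuous_im).mem_nhds h] with ν hν
    exact tail_of_im_pos hc hε hg hν

end Tail

lemma mul_expP_eq (ε : ℝ) (μ : ℂ) : (fun w => g w * u.expP ε μ w) =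
    fun w => g w * u.princ ε w * Complex.exp (-Complex.I * μ * w / ε) := by
  funext w; rw [expP]; ring

lemma mul_expT_eq (ε : ℝ) (μ : ℂ) : (fun w => g w * u.expT ε μ w) =
    fun w => g w * u.top ε w * Complex.exp (-Complex.I * μ * w / ε) := by
  funext w; rw [expT]; ring

lemma differentiableAt_loopInt (hc : u.IsPosImag) (hε : 0 < ε) (hg : u.IsTest g) (m : Fin P)
    {D : ℂ → ℂ} {μ : ℂ} (hD : DifferentiableAt ℂ D μ) :
    DifferentiableAt ℂ (fun μ => u.loopInt ε m (fun w => g w * u.expP ε μ w)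
      (fun w => g w * u.expT ε μ w) (D μ)) μ := by
  have hP : ∀ w, u.expP ε (0 : ℝ) w = u.princ ε w := fun w => by simp [expP]
  have hT : ∀ w, u.expT ε (0 : ℝ) w = u.top ε w := fun w => by simp [expT]
  have hv : ∀ x : ℝ, (∀ p, x ≠ (u.z p).re) → ∀ a b, DifferentiableAt ℂ (fun μ : ℂ =>
      vInt (fun w => g w * u.expP ε μ w) x a b) μ := fun x hx a b => by
    simp only [mul_expP_eq]
    refine differentiable_vInt (G := fun w => g w * u.princ ε w) ?_ ε μ
    simpa only [hP] using hg.integrable_vertical hx a b ε 0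
  have hh : ∀ a b, DifferentiableAt ℂ (fun μ : ℂ =>
      hInt (fun w => g w * u.expP ε μ w) 0 a b) μ := fun a b => by
    simp only [mul_expP_eq]
    refine differentiable_hInt (G := fun w => g w * u.princ ε w) ?_ ε μ
    simpa only [hP] using hg.integrable_zero a b ε 0
  have ht : ∀ a b, DifferentiableAt ℂ (fun μ : ℂ =>
      hInt (fun w => g w * u.expT ε μ w) u.height a b) μ := fun a b => by
    simp only [mul_expT_eq]
    refine differentiable_hInt (G := fun w => g w * u.top ε w) ?_ ε μ
    simpa only [hT] using hg.integrable_height a b ε 0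
  have hl := hv _ leftAbscissa_ne_re u.height 0
  simp only [loopInt]
  split_ifs with hm
  · have hw : DifferentiableAt ℂ (fun μ : ℂ =>
        vInt (fun w => g w * u.expP ε μ w) (u.z m).re 0 (u.z m).im) μ := by
      simp only [mul_expP_eq]
      refine differentiable_vInt (G := fun w => g w * u.princ ε w) ?_ ε μ
      simpa only [hP] using hg.intervalIntegrable_well hc hε hm 0
    exact ((hl.add (hh _ _)).add hw).sub hD
  · exact (((hl.add (hh _ _)).add (hv _ (gapAbscissa_ne_re m) _ _)).add
      ((ht _ _).const_mul _)).add (hD.const_mul _)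

/-- Cauchy's theorem in a half-strip. -/
lemma hInt_add_up {F : ℂ → ℂ} {x₀ x₁ h C b : ℝ} (hx : x₀ ≤ x₁) (hb : 0 < b)
    (hF : ∀ x y : ℝ, x ∈ Set.Icc x₀ x₁ → h ≤ y → DifferentiableAt ℂ F (x + y * Complex.I) ∧
      ‖F (x + y * Complex.I)‖ ≤ C * Real.exp (-b * y)) :
    hInt F h x₀ x₁ + ∫ y in Set.Ioi h, F (x₁ + y * Complex.I) * Complex.I =
      ∫ y in Set.Ioi h, F (x₀ + y * Complex.I) * Complex.I := by
  have hv : ∀ x ∈ Set.Icc x₀ x₁, Tendsto (fun n : ℝ => vInt F x h n) atTop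
      (𝓝 (∫ y in Set.Ioi h, F (x + y * Complex.I) * Complex.I)) := by
    intro x hx
    refine intervalIntegral_tendsto_integral_Ioi h (integrableOn_Ioi_of_norm_le_exp (C := C) hb
      (fun y hy => ((ContinuousAt.comp (f := fun y : ℝ => (x : ℂ) + y * Complex.I)
        (hF x y hx hy).1.continuousAt (by fun_prop)).mul continuousAt_const).continuousWithinAt) ?_)
      tendsto_id
    filter_upwards [eventually_ge_atTop h] with y hy
    simpa using (hF x y hx hy).2
  have t3 : Tendsto (fun n : ℝ => hInt F n x₀ x₁) atTop (𝓝 0) := by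
    have h0 : Tendsto (fun n : ℝ => C * Real.exp (-b * n) * |x₁ - x₀|) atTop
        (𝓝 (C * 0 * |x₁ - x₀|)) :=
      ((Real.tendsto_exp_atBot.comp (tendsto_id.const_mul_atTop_of_neg
        (neg_lt_zero.2 hb))).const_mul C).mul_const _
    rw [mul_zero, zero_mul] at h0
    refine squeeze_zero_norm' ?_ h0
    filter_upwards [eventually_ge_atTop h] with n hn
    refine intervalIntegral.norm_integral_le_of_norm_le_const fun x hx' => ?_
    rw [Set.uIoc_of_le hx] at hx'
    exact (hF x n ⟨hx'.1.le, hx'.2⟩ hn).2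
  have key : Tendsto (fun n : ℝ => hInt F h x₀ x₁ + vInt F x₁ h n) atTop
      (𝓝 (∫ y in Set.Ioi h, F (x₀ + y * Complex.I) * Complex.I)) := by
    have := (hv x₀ ⟨le_rfl, hx⟩).add t3
    rw [add_zero] at this
    refine this.congr' ?_
    filter_upwards [eventually_ge_atTop h] with n hn
    refine (rect_eq_zero hx hn (fun w hw => ?_) fun w h1 h2 => ?_).symm
    · have := (hF w.re w.im hw.1 hw.2.1).1.continuousAt
      rw [Complex.re_add_im] at this
      exact this.continuousWithinAt
    · have := (hF w.re w.im (Set.Ioo_subset_Icc_self h1) h2.1.le).1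
      rwa [Complex.re_add_im] at this
  exact tendsto_nhds_unique ((hv x₁ ⟨hx, le_rfl⟩).const_add _) key

/-- For `μ < 0` the ray on the right, above the poles, is moved to the left abscissa by Cauchy's
theorem in a half-strip. Both ends then share one tail, the outgoing one with the monodromy factor.
-/
lemma integralC_eq_loopInt (hc : u.IsPosImag) (hε : 0 < ε) {C : ℝ} (hg : u.IsOuterTest g C)
    (m : Fin P) {μ : ℝ} (hμ : μ < 0) :
    u.integralC ε m (fun w => g w * u.expP ε μ w) = u.loopInt ε m (fun w => g w * u.expP ε μ w)
      (fun w => g w * u.expT ε μ w) (u.tail ε g μ) := by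
  set F := fun w => g w * u.expP ε μ w with hF
  set B := fun w => g w * u.expT ε μ w with hB
  set V : ℝ → ℂ := fun x => ∫ y in Set.Ioi u.height, B (x + y * Complex.I) * Complex.I with hV
  have hb : 0 < -μ / ε := div_pos (neg_pos.2 hμ) hε
  have hBd : ∀ x y : ℝ, u.height ≤ y → DifferentiableAt ℂ B (x + y * Complex.I) ∧
      ‖B (x + y * Complex.I)‖ ≤ C * Real.exp (u.leftBound / ε) * Real.exp (-(-μ / ε) * y) := by
    intro x y hy
    have h1 := hg.above hc hε (w := x + y * Complex.I) (by simpa using hy)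
    simp only [hB, mul_expT_eq]
    refine ⟨h1.1.mul (hasDerivAt_exp_mul ε μ _).differentiableAt, ?_⟩
    rw [norm_mul, norm_exp_mul]
    refine mul_le_mul h1.2 (Real.exp_le_exp.2 (le_of_eq ?_)) (Real.exp_pos _).le
      ((norm_nonneg _).trans h1.2)
    simp
    ring
  have hFB : ∀ x : ℝ, (∀ p, x ≠ (u.z p).re) → ∀ y : ℝ, F (x + y * Complex.I) =
      u.mon ε x * B (x + y * Complex.I) := by
    intro x hx y
    simp only [hF, hB]
    rw [expP_eq (by simpa using hx)]
    simp
    ring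
  have hray : ∀ x : ℝ, (∀ p, x ≠ (u.z p).re) →
      rayIntegral F x = vInt F x 0 u.height + u.mon ε x * V x := by
    intro x hx
    have hint : ∀ a : ℝ, IntegrableOn (fun y : ℝ => F (x + y * Complex.I) * Complex.I) (Set.Ioi a) := by
      intro a
      refine integrableOn_Ioi_of_norm_le_exp (C := ‖u.mon ε x‖ * (C * Real.exp (u.leftBound / ε))) hb
        (fun y _ => ((ContinuousAt.comp (f := fun y : ℝ => (x : ℂ) + y * Complex.I)
          (hg.test.continuousAt_mul_expP (mem_cut_of_re hx y) ε μ) (by fun_prop)).mul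
          continuousAt_const).continuousWithinAt) ?_
      filter_upwards [eventually_ge_atTop u.height] with y hy
      rw [norm_mul, Complex.norm_I, mul_one, hFB x hx, norm_mul, mul_assoc]
      exact mul_le_mul_of_nonneg_left (hBd x y hy).2 (norm_nonneg _)
    rw [rayIntegral, ← intervalIntegral.integral_interval_add_Ioi (hint 0) (hint u.height), vInt, hV,
      ← integral_const_mul]
    simp only [hFB x hx, mul_assoc]
  have hgap : V (u.gapAbscissa m) = V u.leftAbscissa - hInt B u.height u.leftAbscissa (u.gapAbscissa m) :=
    eq_sub_of_add_eq' (hInt_add_up ((leftAbscissa_lt m).le.trans (re_lt_gapAbscissa m).le) hb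
      fun x y _ hy => hBd x y hy)
  have htail : u.tail ε g μ = V u.leftAbscissa := by
    rw [tail, if_pos (by simpa using hμ), rayInt, hV]
    have h1 := (measurePreserving_add_left volume u.height).setIntegral_preimage_emb
      (measurableEmbedding_addLeft u.height)
      (fun y : ℝ => B (u.leftAbscissa + y * Complex.I) * Complex.I) (Set.Ioi u.height)
    rw [Set.preimage_const_add_Ioi, sub_self] at h1
    simp only [← h1]
    refine setIntegral_congr_fun measurableSet_Ioi fun t _ => ?_
    have h2 := hFB u.leftAbscissa leftAbscissa_ne_re (u.height + t)
    rw [mon_left, one_mul] at h2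
    have h3 : u.corner + t * Complex.I = u.leftAbscissa + (u.height + t : ℝ) * Complex.I := by
      rw [corner]; push_cast; ring
    simp only [h3, ← h2, hF, mul_expP_eq]
  have hh : ∀ a b : ℝ, ∫ x in a..b, F x = hInt F 0 a b := fun a b => by simp [hInt]
  have hsym : vInt F u.leftAbscissa u.height 0 = - vInt F u.leftAbscissa 0 u.height :=
    intervalIntegral.integral_symm _ _
  have hsym' : hInt B u.height (u.gapAbscissa m) u.leftAbscissa =
      - hInt B u.height u.leftAbscissa (u.gapAbscissa m) := intervalIntegral.integral_symm _ _
  rw [integralC, loopInt, hray _ leftAbscissa_ne_re, hray _ (gapAbscissa_ne_re m), mon_left, htail,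
    hgap, hh, hh, hsym, hsym']
  split_ifs
  · rw [vInt, vInt]; ring
  · ring

/-- The loop integrals are the boundary values of the entries of the linear system. -/
theorem isUpperBoundaryValue_loop (hc : u.IsPosImag) (hlam : 0 < lam) (hε : 0 < ε) {C : ℝ}
    (hg : u.IsOuterTest g C) (m : Fin P) :
    IsUpperBoundaryValue (fun μ => u.integralC ε m fun w => g w * u.expP ε μ w) lam
      (u.loop ε lam m g) := by
  refine ⟨fun μ => u.loopInt ε m (fun w => g w * u.expP ε μ w) (fun w => g w * u.expT ε μ w)
    (u.tail ε g μ), fun μ hμ => (differentiableAt_loopInt hc hε hg.test m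
      (differentiableAt_tail hc hε hg hμ)).differentiableWithinAt,
    fun μ hμ => (integralC_eq_loopInt hc hε hg m hμ).symm, ?_⟩
  -- With the tail already turned down, the expression is continuous at `lam` itself, and it equals
  -- the continuation when `Re μ` and `Im μ` are positive.
  have h1 := (differentiableAt_loopInt hc hε hg.test m (differentiableAt_rayInt_left hc hε hg
    (d := -Complex.I) (μ := lam) (by simp) (by simpa using hlam))).continuousAt.tendsto
  have h2 : rayInt ε (fun w => g w * u.princ ε w) u.corner (-Complex.I) lam =
      downInt (fun w => g w * u.expP ε lam w) u.corner := by
    rw [rayInt, downInt]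
    refine setIntegral_congr_fun measurableSet_Ioi fun t _ => ?_
    simp only [expP, mul_neg, ← sub_eq_add_neg]
    ring
  rw [h2] at h1
  refine (h1.mono_left nhdsWithin_le_nhds).congr' ?_
  have h3 : ∀ᶠ μ in 𝓝 (lam : ℂ), 0 < μ.re :=
    (isOpen_lt continuous_const Complex.continuous_re).mem_nhds (by simpa using hlam)
  filter_upwards [nhdsWithin_le_nhds h3, self_mem_nhdsWithin] with μ h4 h5
  rw [tail_eq_down hc hε hg h5 h4]

end BenjaminOno.RationalPotential

namespace BenjaminOno.RationalPotential

variable {P : ℕ} {u : RationalPotential P} {lam ε ρ c : ℝ} {g yi y : ℂ → ℂ}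

/-! ### The suitable contours -/

lemma isOuterTest_one : u.IsOuterTest (fun _ => 1) 1 := ⟨IsTest.const 1, fun _ _ => by simp⟩

lemma isOuterTest_inv (p : Fin P) : u.IsOuterTest (fun w => 1 / (w - u.z p)) 1 := by
  have hb : ∀ w : ℂ, 1 ≤ ‖w - u.z p‖ → ‖1 / (w - u.z p)‖ ≤ 1 := fun w hw => by
    rw [norm_div, norm_one]
    exact div_le_one_of_le₀ hw (norm_nonneg _)
  have hl : ∀ w : ℂ, w.re ≤ u.leftAbscissa → 1 ≤ ‖w - u.z p‖ := fun w hw => by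
    refine le_trans ?_ ((neg_le_abs _).trans (Complex.abs_re_le_norm _))
    rw [Complex.sub_re]
    linarith [leftAbscissa_add_one_le (u := u) p]
  refine ⟨⟨fun w hw => ?_, fun q => ?_, 1, fun w _ hw => hb w (hl w hw)⟩, fun w hw => hb w ?_⟩
  · have := sub_ne_zero.2 (hw p)
    fun_prop (disch := assumption)
  · rcases eq_or_ne q p with rfl | hq
    · refine ⟨1, eventually_nhdsWithin_of_forall fun w hw => ?_⟩
      rw [← norm_mul, mul_one_div_cancel (sub_ne_zero.2 hw), norm_one]
    · have h1 : u.z q - u.z p ≠ 0 := sub_ne_zero.2 fun h => hq (re_eq_iff.1 (congrArg Complex.re h))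
      have h2 : ContinuousAt (fun w => ‖w - u.z q‖ * ‖1 / (w - u.z p)‖) (u.z q) := by
        fun_prop (disch := assumption)
      exact ⟨1, ((h2.eventually_lt_const (by simp)).filter_mono nhdsWithin_le_nhds).mono
        fun w hw => hw.le⟩
  · rcases hw with hw | hw
    · exact hl w hw
    · refine le_trans ?_ ((le_abs_self _).trans (Complex.abs_im_le_norm _))
      rw [Complex.sub_im]
      linarith [im_add_one_le_height (u := u) p]

variable (u) in
/-- The critical points through which the contours pass. -/
def IsNode (lam : ℝ) (q : ℂ) : Prop :=
  0 < q.im ∧ u.IsCritical lam q ∨ ∃ x : ℝ, u.IsLeftCritical lam x ∧ q = x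

lemma IsNode.isCritical {q : ℂ} (h : u.IsNode lam q) : u.IsCritical lam q := by
  rcases h with h | ⟨x, h, rfl⟩
  exacts [h.2, h.1]

lemma finite_isNode (hlam : 0 < lam) : {q | u.IsNode lam q}.Finite :=
  (finite_isCritical hlam).subset fun _ h => IsNode.isCritical h

/-- The leftmost real critical point is unique, and when it exists the polynomial count leaves room
for it. -/
lemma card_isNode_le (hlam : 0 < lam) : (finite_isNode (u := u) hlam).toFinset.card ≤ P := by
  classical
  set X := (finite_isNode (u := u) hlam).toFinset with hX
  have hmem : ∀ q, q ∈ X ↔ u.IsNode lam q := fun q => by simp [hX]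
  set S := X.filter fun q => 0 < q.im with hS
  obtain ⟨h1, h2⟩ := card_upper_critical_le hlam S fun q hq =>
    ⟨((hmem q).1 (Finset.mem_filter.1 hq).1).isCritical, (Finset.mem_filter.1 hq).2⟩
  by_cases hx : ∃ x : ℝ, u.IsLeftCritical lam x
  · obtain ⟨x, hx⟩ := hx
    refine (Finset.card_le_card (t := insert (x : ℂ) S) fun q hq => ?_).trans
      ((Finset.card_insert_le _ _).trans (h2 ⟨x, hx.1⟩))
    rcases (hmem q).1 hq with h | ⟨y, hy, rfl⟩
    · exact Finset.mem_insert_of_mem (Finset.mem_filter.2 ⟨hq, h.1⟩)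
    · have : y = x := by
        rcases lt_trichotomy x y with h | h | h
        · have := hy.2 x h
          rw [isCritical_ofReal_iff.1 hx.1] at this
          exact absurd this (lt_irrefl _)
        · exact h.symm
        · have := hx.2 y h
          rw [isCritical_ofReal_iff.1 hy.1] at this
          exact absurd this (lt_irrefl _)
      rw [this]
      exact Finset.mem_insert_self _ _
  · refine (Finset.card_le_card fun q hq => ?_).trans h1
    rcases (hmem q).1 hq with h | ⟨y, hy, rfl⟩
    · exact Finset.mem_filter.2 ⟨hq, h.1⟩
    · exact absurd ⟨y, hy⟩ hx

variable (u) in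
/-- The points below the level of the critical point `q`. -/
def below (lam : ℝ) (q : ℂ) : Set ℂ := {w | ¬ u.IsPole w ∧ ¬ u.IsCritical lam w ∧ u.R lam w < u.R lam q}

variable (u) in
/-- The two halves of a contour through the node `q`, with a branch of `h`. -/
structure IsNodeContour (lam ρ : ℝ) (q : ℂ) (γ₁ γ₂ H : ℝ → ℂ) : Prop where
  half₁ : u.Half (u.below lam q) q γ₁
  half₂ : u.Half (u.below lam q) q γ₂
  branch : u.IsBranchAlong lam (glue γ₁ γ₂) H
  upper : 0 < q.im → ∀ ε g, contourIntegral ε (glue γ₁ γ₂) H g = 0 → u.UpperCond lam ε ρ g q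
  real : q.im = 0 → ∀ ε g, contourIntegral ε (glue γ₁ γ₂) H g = 0 → u.RealCond lam ε ρ g q

lemma exists_isNodeContour (hc : u.IsPosImag) (hKS : u.IsKlausShaw) (hneg : ∀ x, u.onReal x < 0)
    (hlam : 0 < lam) (hsimple : ∀ w : ℂ, 0 < w.im → u.IsCritical lam w → deriv u.toFun w ≠ 0)
    (hreal : ∀ x : ℝ, u.IsCritical lam (x : ℂ) → deriv u.toFun (x : ℂ) = 0 →
      iteratedDeriv 2 u.toFun (x : ℂ) ≠ 0) (h : u.IsFarRadius lam ρ) (hρ : -ρ ≤ u.leftAbscissa)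
    {q : ℂ} (hq : u.IsNode lam q) : ∃ γ₁ γ₂ H, u.IsNodeContour lam ρ q γ₁ γ₂ H := by
  have key : ∀ {M₁ M₂ γ₁ γ₂}, u.Half M₁ q γ₁ → u.Half M₂ q γ₂ → M₁ ⊆ u.below lam q →
      M₂ ⊆ u.below lam q → ∃ H, u.IsBranchAlong lam (glue γ₁ γ₂) H := fun h₁ h₂ s₁ s₂ =>
    exists_isBranchAlong ((h₁.mono s₁).continuous_glue (h₂.mono s₂))
      ((h₁.mono s₁).isContour_glue (h₂.mono s₂) (fun w hw => hw.1) hq.isCritical.1).avoids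
  rcases hq with ⟨him, hcr⟩ | ⟨x, hx, rfl⟩
  · have s : u.region lam (u.R lam q) ρ ⊆ u.below lam q := fun w hw => ⟨hw.1, hw.2.1, hw.2.2.1⟩
    obtain ⟨γ₁, γ₂, h₁, h₂, hs⟩ := hc.exists_halves_upper hlam h hρ him hcr (hsimple q him hcr)
    obtain ⟨H, hH⟩ := key h₁ h₂ s s
    exact ⟨γ₁, γ₂, H, h₁.mono s, h₂.mono s, hH, fun _ ε g h0 => ⟨γ₁, γ₂, H, h₁, h₂, hs, hH, h0⟩,
      fun h0 => absurd h0 him.ne'⟩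
  · have s₁ : u.region lam 0 ρ ⊆ u.below lam x := fun w hw =>
      ⟨hw.1, hw.2.1, hw.2.2.1.trans_eq (hc.R_ofReal lam x).symm⟩
    have s₂ : u.lowRegion lam ρ ⊆ u.below lam x := fun w hw =>
      ⟨hw.1, hw.2.1, hw.2.2.1.trans_eq (hc.R_ofReal lam x).symm⟩
    obtain ⟨k, r, hk, hL⟩ := exists_realSign hKS hneg hreal hx.1
    obtain ⟨γ₁, γ₂, h₁, h₂⟩ := hc.exists_halves_real hlam h hρ hx hk hL
    obtain ⟨H, hH⟩ := key h₁ h₂ s₁ s₂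
    exact ⟨γ₁, γ₂, H, h₁.mono s₁, h₂.mono s₂, hH, fun h0 => absurd h0 (by simp),
      fun _ ε g h0 => ⟨γ₁, γ₂, H, h₁, h₂, hH, h0⟩⟩

/-- If the integrals over all the contours vanish, then so do the loop integrals. -/
lemma loop_eq_zero_of_contourIntegral (hc : u.IsPosImag) (hKS : u.IsKlausShaw)
    (hneg : ∀ x, u.onReal x < 0) (hlam : 0 < lam) (hε : 0 < ε)
    (hreal : ∀ x : ℝ, u.IsCritical lam (x : ℂ) → deriv u.toFun (x : ℂ) = 0 →
      iteratedDeriv 2 u.toFun (x : ℂ) ≠ 0) (h : u.IsFarRadius lam ρ) (hρ : -ρ ≤ u.leftAbscissa)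
    (hρ' : u.leftAbscissa + 1 ≤ ρ) (hg : u.IsTest g)
    (hint : ∀ q, u.IsNode lam q → ∃ γ₁ γ₂ H, u.IsNodeContour lam ρ q γ₁ γ₂ H ∧
      contourIntegral ε (glue γ₁ γ₂) H g = 0) (m : Fin P) : u.loop ε lam m g = 0 := by
  obtain ⟨yi, hyi⟩ := hc.exists_isRecessive hg hlam hε h hρ'
  have hS : u.Setting lam ε ρ g yi := ⟨hc, hg, hlam, hε, h, hρ, hyi⟩
  -- In the upper half-plane every logarithmic term of `R` is at most `0`, so `R ≤ lam Im w`; the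
  -- level `lam * height + 1` covers the whole strip containing the upper parts of the loops.
  obtain ⟨y, hy⟩ := hS.exists_isSol hKS hneg hreal
    (fun q him hcr => by
      obtain ⟨γ₁, γ₂, H, h1, h2⟩ := hint q (Or.inl ⟨him, hcr⟩)
      exact h1.upper him ε g h2)
    (fun q hq => by
      obtain ⟨γ₁, γ₂, H, h1, h2⟩ := hint q (Or.inr ⟨q, hq, rfl⟩)
      exact h1.real (by simp) ε g h2) (lam * u.height + 1)
  have hpos : 0 < lam * u.height + 1 := by have := height_pos (u := u); positivity
  refine loop_eq_zero hc hlam hε hg (Y := ext y yi) (fun w h1 h2 => ?_) (fun w h1 h2 => ?_) ?_ m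
  · refine hy.solAt_ext_of_mem hc hyi hpos ?_
    rcases h1.eq_or_lt with h1 | h1
    · exact Or.inr ⟨h1.ge, Or.inl fun p => by rw [← h1, abs_zero]; exact u.z_im_pos p⟩
    · refine Or.inl ⟨h1, or_iff_not_imp_left.2 fun hp => ?_⟩
      rw [hc.R_eq]
      have h3 : ∑ p, u.gam p * (Real.log ‖w - u.z p‖ - Real.log ‖w - conj (u.z p)‖) ≤ 0 := by
        refine Finset.sum_nonpos fun p _ => mul_nonpos_of_nonneg_of_nonpos (hc.gam_pos p).le
          (sub_nonpos.2 (Real.log_le_log (norm_pos_iff.2 (sub_ne_zero_of_not_isPole hp p).1) ?_))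
        rw [← abs_of_nonneg (norm_nonneg (w - u.z p)), ← abs_of_nonneg (norm_nonneg (w - conj (u.z p))),
          ← sq_le_sq, Complex.sq_norm, Complex.sq_norm, Complex.normSq_apply, Complex.normSq_apply]
        simp only [Complex.sub_re, Complex.sub_im, Complex.conj_re, Complex.conj_im]
        nlinarith [mul_pos h1 (u.z_im_pos p)]
      have h4 := mul_le_mul_of_nonneg_left h2 hlam.le
      linarith
  · exact hy.solAt_ext_of_mem hc hyi hpos (Or.inr ⟨h1, Or.inr (Or.inl (by linarith))⟩)
  · refine squeeze_zero_norm' ?_ (hyi.tendsto u.corner corner_re.le)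
    filter_upwards [eventually_ge_atTop u.height] with t ht
    have h1 : ¬ 0 < (u.corner - t * Complex.I).im := by simp [corner_im, ht]
    rw [norm_mul, hc.norm_expP, ext, if_neg h1]

end BenjaminOno.RationalPotential

/-! ### Change of basis and conclusion -/

namespace BenjaminOno

/-- If `e = Aℓ`, a row vector annihilating `A` gives a relation among the `eₘ`, hence is zero; so
the square matrix `A` is invertible and `N = A⁻¹`. -/
lemma exists_isUnit_det_smul_eq {V n : Type*} [AddCommGroup V] [Module ℂ V] [Fintype n]
    [DecidableEq n] {e ℓ : n → V} (he : LinearIndependent ℂ e)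
    (h : ∀ m, e m ∈ Submodule.span ℂ (Set.range ℓ)) :
    ∃ N : Matrix n n ℂ, IsUnit N.det ∧ ∀ m, ℓ m = ∑ k, N m k • e k := by
  have h1 : ∀ m, ∃ a : n → ℂ, ∑ j, a j • ℓ j = e m := fun m =>
    (Submodule.mem_span_range_iff_exists_fun ℂ).1 (h m)
  choose A hA using h1
  have hu : IsUnit (Matrix.of A) := by
    rw [← Matrix.vecMul_injective_iff_isUnit]
    refine (injective_iff_map_eq_zero (Matrix.vecMulLinear (Matrix.of A))).2 fun v hv => ?_
    refine funext (Fintype.linearIndependent_iff.1 he v ?_)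
    simp only [← hA, Finset.smul_sum, smul_smul]
    rw [Finset.sum_comm]
    refine Finset.sum_eq_zero fun j _ => ?_
    rw [← Finset.sum_smul]
    have : ∑ i, v i * A i j = 0 := congrFun hv j
    rw [this, zero_smul]
  have hdet := (Matrix.isUnit_iff_isUnit_det _).1 hu
  refine ⟨(Matrix.of A)⁻¹, Matrix.isUnit_nonsing_inv_det _ hdet, fun m => ?_⟩
  simp only [← hA, Finset.smul_sum, smul_smul]
  rw [Finset.sum_comm]
  simp only [← Finset.sum_smul]
  have h2 : ∀ j, ∑ i, (Matrix.of A)⁻¹ m i * A i j = (1 : Matrix n n ℂ) m j := fun j =>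
    congrFun (congrFun (Matrix.nonsing_inv_mul _ hdet) m) j
  simp [h2, Matrix.one_apply]

lemma IsUpperBoundaryValue.neg_mul {F : ℝ → ℂ} {lam : ℝ} {a : ℂ} (h : IsUpperBoundaryValue F lam a) :
    IsUpperBoundaryValue (fun μ => -μ * F μ) lam (-lam * a) := by
  obtain ⟨G, h1, h2, h3⟩ := h
  refine ⟨fun μ => -μ * G μ, differentiableOn_id.neg.mul h1, fun μ hμ => by simp only [h2 μ hμ], ?_⟩
  exact ((continuous_neg.tendsto (lam : ℂ)).mono_left nhdsWithin_le_nhds).mul h3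

end BenjaminOno

namespace BenjaminOno.RationalPotential

variable {P : ℕ} {u : RationalPotential P} {lam ε ρ : ℝ}

lemma IsNodeContour.integrable (hc : u.IsPosImag) (hlam : 0 < lam) (hε : 0 < ε) {q : ℂ}
    (hq : u.IsNode lam q) {γ₁ γ₂ H : ℝ → ℂ} (h : u.IsNodeContour lam ρ q γ₁ γ₂ H) {g : ℂ → ℂ}
    (hg : u.IsTest g) :
    Integrable fun t => g (glue γ₁ γ₂ t) * expAlong ε H t * deriv (glue γ₁ γ₂) t :=
  (integrable_glue hc hlam hε hg h.half₁ h.half₂ hq.isCritical.1 (fun _ hw => hw.1)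
    (fun _ hw => hw.1) h.branch).1

lemma integrandA_eq (ε : ℝ) (W H : ℝ → ℂ) (p : Fin P) : u.integrandA ε W H p =
    fun t => 1 / (W t - u.z p) * expAlong ε H t * deriv W t := by
  funext t
  rw [integrandA, expAlong, one_div_mul_eq_div]

lemma integrandB_eq (ε : ℝ) (W H : ℝ → ℂ) :
    integrandB ε W H = fun t => 1 * expAlong ε H t * deriv W t := by
  funext t
  rw [integrandB, expAlong, one_mul]

lemma isJostSystem_loop (hc : u.IsPosImag) (hlam : 0 < lam) (hε : 0 < ε) :
    u.IsJostSystem ε lam (Matrix.of fun m p => u.loop ε lam m fun w => 1 / (w - u.z p))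
      (fun m => -lam * u.loop ε lam m fun _ => 1) := by
  refine ⟨fun m p => ?_, fun m => ?_⟩
  · have h := isUpperBoundaryValue_loop hc hlam hε (isOuterTest_inv p) m
    simp only [← exp_h_eq, one_div_mul_eq_div] at h
    exact h
  · have h := isUpperBoundaryValue_loop hc hlam hε isOuterTest_one m
    simp only [← exp_h_eq, one_mul] at h
    exact h.neg_mul

open scoped Classical in
/-- The contours number `P`, and the integrals over them are related to the loop integrals by an
invertible matrix. -/
lemma exists_isUnit_contourIntegral_eq (hc : u.IsPosImag) (hKS : u.IsKlausShaw)
    (hneg : ∀ x, u.onReal x < 0) (hlam : 0 < lam)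
    (hreal : ∀ x : ℝ, u.IsCritical lam (x : ℂ) → deriv u.toFun (x : ℂ) = 0 →
      iteratedDeriv 2 u.toFun (x : ℂ) ≠ 0) (h : u.IsFarRadius lam ρ) (hρ : -ρ ≤ u.leftAbscissa)
    (hρ' : u.leftAbscissa + 1 ≤ ρ) {γ₁ γ₂ H : {q // u.IsNode lam q} → ℝ → ℂ}
    (hγ : ∀ q : {q // u.IsNode lam q}, u.IsNodeContour lam ρ q (γ₁ q) (γ₂ q) (H q)) :
    ∃ σ : Fin P ≃ {q // u.IsNode lam q}, ∀ ε : ℝ, 0 < ε →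
      ∃ N : Matrix (Fin P) (Fin P) ℂ, IsUnit N.det ∧ ∀ m g, u.IsTest g →
        ∑ k, N m k * u.loop ε lam k g =
          contourIntegral ε (glue (γ₁ (σ m)) (γ₂ (σ m))) (H (σ m)) g := by
  have : Finite {q // u.IsNode lam q} := finite_isNode hlam
  have : Fintype {q // u.IsNode lam q} := Fintype.ofFinite _
  have hcard : Fintype.card {q // u.IsNode lam q} ≤ P := by
    rw [← Nat.card_eq_fintype_card]
    exact (Nat.card_eq_card_finite_toFinset (finite_isNode (u := u) hlam)).trans_le
      (card_isNode_le hlam)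
  let ℓ : ∀ ε : ℝ, 0 < ε → {q // u.IsNode lam q} → u.testSpace →ₗ[ℂ] ℂ := fun ε hε q =>
    contourLinear hc hlam hε (hγ q).half₁ (hγ q).half₂ q.2.isCritical.1 (fun _ hw => hw.1)
      (fun _ hw => hw.1) (hγ q).branch
  have hspan : ∀ ε (hε : 0 < ε) m,
      loopLinear hc hlam hε m ∈ Submodule.span ℂ (Set.range (ℓ ε hε)) := by
    intro ε hε m
    -- Duality: membership in the span of finitely many functionals is inclusion of the common
    -- kernel.
    refine mem_span_of_iInf_ker_le_ker fun g hg => ?_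
    rw [Submodule.mem_iInf] at hg
    exact loop_eq_zero_of_contourIntegral hc hKS hneg hlam hε hreal h hρ hρ' g.2
      (fun q hq => ⟨_, _, _, hγ ⟨q, hq⟩, hg ⟨q, hq⟩⟩) m
  have hcard' : P ≤ Fintype.card {q // u.IsNode lam q} := by
    -- The set of nodes does not involve `ε`, so they may be counted with `ε = 1`; the numbering `σ`
    -- is thereby fixed before `ε`.
    have h1 := linearIndependent_le_span_aux' _ (linearIndependent_loop (u := u) hc hlam one_pos)
      (Set.range (ℓ 1 one_pos)) (by rintro _ ⟨m, rfl⟩; exact hspan 1 one_pos m)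
    rw [Fintype.card_fin] at h1
    exact h1.trans (Fintype.card_range_le _)
  let σ : Fin P ≃ {q // u.IsNode lam q} :=
    Fintype.equivOfCardEq (by rw [Fintype.card_fin]; exact hcard'.antisymm hcard)
  refine ⟨σ, fun ε hε => ?_⟩
  obtain ⟨N, hN, hN'⟩ := exists_isUnit_det_smul_eq (linearIndependent_loop hc hlam hε)
    (ℓ := fun m => ℓ ε hε (σ m)) fun m => by
      have h1 := hspan ε hε m
      rwa [← σ.surjective.range_comp] at h1
  refine ⟨N, hN, fun m g hg => ?_⟩
  have h1 := LinearMap.congr_fun (hN' m) ⟨g, hg⟩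
  simp only [LinearMap.coe_sum, Finset.sum_apply, LinearMap.smul_apply, smul_eq_mul] at h1
  exact h1.symm

end BenjaminOno.RationalPotential

open BenjaminOno BenjaminOno.RationalPotential in
theorem mainTheorem9 {P : ℕ} (u : BenjaminOno.RationalPotential P)
    (hKS : u.IsKlausShaw) (hneg : ∀ x : ℝ, u.onReal x < 0)
    (hc : ∀ p, (u.c p).re = 0 ∧ 0 < (u.c p).im)
    (lam : ℝ) (hlam : 0 < lam)
    (hsimple : ∀ w : ℂ, 0 < w.im → u.IsCritical lam w → deriv u.toFun w ≠ 0)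
    (hnonzero : ∀ w : ℂ, 0 < w.im → u.IsCritical lam w → u.R lam w ≠ 0)
    (hdistinct : ∀ w w' : ℂ, 0 < w.im → 0 < w'.im → u.IsCritical lam w → u.IsCritical lam w' →
      u.R lam w = u.R lam w' → w = w')
    (hreal : ∀ x : ℝ, u.IsCritical lam (x : ℂ) → deriv u.toFun (x : ℂ) = 0 →
      iteratedDeriv 2 u.toFun (x : ℂ) ≠ 0) :
    ∃ (W H : Fin P → ℝ → ℂ) (N : ℝ → Matrix (Fin P) (Fin P) ℂ), u.IsSuitable lam N W H := by
  have hc' : u.IsPosImag := hc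
  obtain ⟨ρ₀, hρ₀⟩ := exists_isFarRadius (u := u) hlam
  obtain ⟨ρ, h1, h2, h3⟩ : ∃ ρ, ρ₀ ≤ ρ ∧ -ρ ≤ u.leftAbscissa ∧ u.leftAbscissa + 1 ≤ ρ :=
    ⟨max ρ₀ (|u.leftAbscissa| + 1), le_max_left _ _,
      by linarith [le_max_right ρ₀ (|u.leftAbscissa| + 1), neg_abs_le u.leftAbscissa],
      by linarith [le_max_right ρ₀ (|u.leftAbscissa| + 1), le_abs_self u.leftAbscissa]⟩
  have hρ := hρ₀.mono h1
  have hex := fun q : {q // u.IsNode lam q} =>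
    exists_isNodeContour hc' hKS hneg hlam hsimple hreal hρ h2 q.2
  choose γ₁ γ₂ H hγ using hex
  obtain ⟨σ, hσ⟩ := exists_isUnit_contourIntegral_eq hc' hKS hneg hlam hreal hρ h2 h3 hγ
  choose! N hN using hσ
  refine ⟨fun m => glue (γ₁ (σ m)) (γ₂ (σ m)), fun m => H (σ m), N, fun m => ?_, fun m => ?_,
    fun ε hε => ?_, ?_, fun ε hε => (hN ε hε).1⟩
  · exact (hγ _).half₁.isContour_glue (hγ _).half₂ (fun _ hw => hw.1) (σ m).2.isCritical.1
  · exact (hγ _).branch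
  · refine ⟨_, _, isJostSystem_loop hc' hlam hε, fun m p => ⟨?_, ?_⟩, fun m => ⟨?_, ?_⟩⟩
    · rw [integrandA_eq]
      exact (hγ (σ m)).integrable (g := fun w => 1 / (w - u.z p)) hc' hlam hε (σ m).2
        (isOuterTest_inv p).test
    · rw [integrandA_eq, Matrix.mul_apply]
      exact (hN ε hε).2 m (fun w => 1 / (w - u.z p)) (isOuterTest_inv p).test
    · rw [integrandB_eq]
      exact (hγ (σ m)).integrable (g := fun _ => 1) hc' hlam hε (σ m).2 isOuterTest_one.test
    · rw [integrandB_eq, Matrix.mulVec, dotProduct]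
      -- The factor `-lam` is common to all rows, so it passes through `N`.
      refine (Finset.sum_congr rfl fun k _ => mul_left_comm _ _ _).trans ?_
      rw [← Finset.mul_sum]
      exact congrArg (-(lam : ℂ) * ·) ((hN ε hε).2 m (fun _ => 1) isOuterTest_one.test)
  · exact ⟨fun m => σ m, Subtype.val_injective.comp σ.injective, fun m =>
      (hγ _).half₁.passesMaximally_glue (hγ _).half₂ (fun _ hw => hw.2) (σ m).2.isCritical⟩
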